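/- Let $n\ge 1$, $\alpha>0$, $b_1>b_2>0$, and let $f(u)=f_1(u)+f_2(u)$ with $f_1(u)=\pm|u|^{b_1}u$ and $f_2(u)=\pm|u|^{b_2}u$, the two signs being arbitrary. Consider real- or complex-valued solutions of $$u_t+(-\Delta)^\alpha u=f_1(u)+f_2(u),\qquad u(0)=\varphi ,\qquad (t,x)\in[0,\infty)\times\mathbb R^n .$$ Let $S_\alpha(t)=e^{-t(-\Delta)^\alpha}$, that is, $S_\alpha(0)=\mathrm{Id}$ and, for $t>0$, $S_\alpha(t)g=K_t*g$ with $K_t(x)=(2\pi)^{-n}\int_{\mathbb R^n}e^{ix\cdot\eta}e^{-t|\eta|^{2\alpha}}\,d\eta$. Put $r_0=\frac{nb_1}{2\alpha}$, and assume $r\ge r_0>1$. Let $(q,p,r)$ be an admissible triplet: $\frac1q=\frac n{2\alpha}\left(\frac1r-\frac1p\right)$, where $1<r\le p<\frac{nr}{n-2\alpha}$ if $n>2\alpha$ and $1<r\le p<\infty$ if $n\le 2\alpha$ (so $q=\infty$ if $p=r$). For $0\le T\le\infty$ let $$X([0,T))=C([0,T);L^r(\mathbb R^n))\cap L^q([0,T);L^p(\mathbb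 R^n)).$$ A mild solution on $[0,T)$ is a function $u$ with $$u(t)=S_\alpha(t)\varphi+\int_0^tS_\alpha(t-\tau)f(u(\tau))\,d\tau\quad\text{a.e. on }\mathbb R^n,\ \text{for every }t\in[0,T),$$ the integrals (those over $\tau$ and those in the convolutions) being absolutely convergent. (i) For every $\varphi\in L^r(\mathbb R^n)$ there are $T>0$ and a mild solution $u\in X([0,T))$; if $p>b_1+1$, it is the only mild solution in $X([0,T))$ with initial value $\varphi$. If $r>r_0$, then $T$ can be chosen to depend on $\varphi$ only through the norm: for every $M$ there is one $T>0$ that serves all $\varphi$ with $\|\varphi\|_{L^r}\le M$. (ii) Let $r>r_0$ and $p>b_1+1$. For every $\varphi\in L^r(\mathbb R^n)$ there is a unique maximal solution: there are a unique $T^*\in(0,\infty]$ and a mild solution $u$ on $[0,T^*)$, unique there, such that $u\in X([0,T))$ for every $T<T^*$, while no mild solution with initial value $\varphi$ belongs to $X([0,T))$ for some $T>T^*$. For every $T_0<\infty$ there is a constant $C>0$, independent of $\varphi$, such that whenever $T^*\le T_0$, $$\|u(s)\|_{L^r}\ge\frac{C}{(T^*-s)^{\frac1{b_1}-\frac n{2r\alpha}}}\qquad\text{for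 all }0\le s<T^* .$$ Consequently, if $T^*<\infty$, then $\lim_{t\uparrow T^*}\|u(t)\|_{L^r}=\infty$. -/

import Mathlib

open MeasureTheory Filter Topology Set
open scoped ENNReal FourierTransform

noncomputable section

namespace FracHeat

/-- Admissible triplets `(q, p, r)` for the fractional heat operator `∂ₜ + (-Δ)^α` on `ℝⁿ`:
`1/q = n/(2α) (1/r - 1/p)` and `1 < r ≤ p < nr/(n - 2α)` if `n > 2α`, `1 < r ≤ p < ∞` if `n ≤ 2α`.
The exponent `p` is a real number, hence finite; `q = ∞` exactly when `p = r`. -/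
structure IsAdmissible (n : ℕ) (α : ℝ) (q : ℝ≥0∞) (p r : ℝ) : Prop where
  one_lt : 1 < r
  le : r ≤ p
  lt : 2 * α < n → p < n * r / (n - 2 * α)
  scaling : q⁻¹ = ENNReal.ofReal (n / (2 * α) * (1 / r - 1 / p))

/-- The kernel `K_t(x) = (2π)⁻ⁿ ∫ e^{i x·η} e^{-t|η|^{2α}} dη` of the operator `e^{-t(-Δ)^α}`, for
`t > 0`. It is written with the normalisation `∫ e^{2πi x·ξ} g(ξ) dξ` of the inverse Fourier
transform, i.e. after the substitution `η = 2πξ`. The symbol is even, so that the inverse Fourier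
transform is real, and taking the real part only changes its type. -/
def kernel (n : ℕ) (α t : ℝ) (x : EuclideanSpace ℝ (Fin n)) : ℝ :=
  (𝓕⁻ (fun ξ : EuclideanSpace ℝ (Fin n) =>
    ((Real.exp (-(t * (2 * Real.pi * ‖ξ‖) ^ (2 * α))) : ℝ) : ℂ)) x).re

/-- The semigroup `S_α(t) = e^{-t(-Δ)^α}`, `t ≥ 0`, acting on a function `g`: the identity for
`t = 0`, the convolution `K_t * g` for `t > 0`. -/
def semigroup {𝕜 : Type*} [RCLike 𝕜] {n : ℕ} (α t : ℝ) (g : EuclideanSpace ℝ (Fin n) → 𝕜)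
    (x : EuclideanSpace ℝ (Fin n)) : 𝕜 :=
  if t = 0 then g x else ∫ y, kernel n α t (x - y) • g y

/-- The nonlinearity `f₁(z) + f₂(z) = ε₁ |z|^{b₁} z + ε₂ |z|^{b₂} z`. -/
def source {𝕜 : Type*} [RCLike 𝕜] (ε₁ ε₂ b₁ b₂ : ℝ) (z : 𝕜) : 𝕜 :=
  (ε₁ * ‖z‖ ^ b₁) • z + (ε₂ * ‖z‖ ^ b₂) • z

/-- The time interval `[0, T)`, with `0 ≤ T ≤ ∞`. -/
def timeInterval (T : ℝ≥0∞) : Set ℝ := {t | 0 ≤ t ∧ ENNReal.ofReal t < T}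

/-- The space `L^r(ℝⁿ)`. -/
abbrev LSpace (𝕜 : Type*) [RCLike 𝕜] (n : ℕ) (r : ℝ) : Type _ :=
  Lp 𝕜 (ENNReal.ofReal r) (volume : Measure (EuclideanSpace ℝ (Fin n)))

/-- Membership of a curve `u` in `X([0,T)) = C([0,T); L^r(ℝⁿ)) ∩ L^q([0,T); L^p(ℝⁿ))`. For a curve
that is continuous into `L^r`, the map `t ↦ ‖u(t)‖_{L^p} ∈ [0, ∞]` is lower semicontinuous, so that
the mixed norm needs no separate measurability requirement. -/
def MemX {𝕜 : Type*} [RCLike 𝕜] {n : ℕ} {r : ℝ} [Fact (1 ≤ ENNReal.ofReal r)]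
    (q : ℝ≥0∞) (p : ℝ) (T : ℝ≥0∞) (u : ℝ → LSpace 𝕜 n r) : Prop :=
  ContinuousOn u (timeInterval T) ∧
    eLpNorm (fun t => eLpNorm (u t) (ENNReal.ofReal p) volume) q
      (volume.restrict (timeInterval T)) < ∞

/-- `u` satisfies `u(t) = S_α(t)φ + ∫₀ᵗ S_α(t-τ) f(u(τ)) dτ` almost everywhere on `ℝⁿ`, for every
`t ∈ [0,T)`; that the integrals on the right-hand side converge absolutely is part of the
definition. -/
def IsMildSolution {𝕜 : Type*} [RCLike 𝕜] {n : ℕ} {r : ℝ} (α : ℝ) (f : 𝕜 → 𝕜)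
    (φ : LSpace 𝕜 n r) (T : ℝ≥0∞) (u : ℝ → LSpace 𝕜 n r) : Prop :=
  ∀ t ∈ timeInterval T, ∀ᵐ x : EuclideanSpace ℝ (Fin n),
    (∀ᵐ τ ∂(volume.restrict (Ioo 0 t)),
      Integrable (fun y => kernel n α (t - τ) (x - y) • f (u τ y))) ∧
    IntegrableOn (fun τ => semigroup α (t - τ) (fun y => f (u τ y)) x) (Ioo 0 t) ∧
    u t x = semigroup α t φ x + ∫ τ in Ioo 0 t, semigroup α (t - τ) (fun y => f (u τ y)) x

/-- `u` is a mild solution on `[0,T)` with initial value `φ` that belongs to `X([0,T))`. -/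
def IsSolutionX {𝕜 : Type*} [RCLike 𝕜] {n : ℕ} {r : ℝ} [Fact (1 ≤ ENNReal.ofReal r)]
    (α : ℝ) (q : ℝ≥0∞) (p : ℝ) (f : 𝕜 → 𝕜) (φ : LSpace 𝕜 n r) (T : ℝ≥0∞)
    (u : ℝ → LSpace 𝕜 n r) : Prop :=
  MemX q p T u ∧ IsMildSolution α f φ T u

/-- `[0,Tmax)` is the maximal existence interval of the solution `u` with initial value `φ`: `u` is
a mild solution that belongs to `X([0,T))` for every `T < Tmax`, and no mild solution with initial
value `φ` belongs to `X([0,T))` for some `T > Tmax`. -/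
structure IsMaximalSolution {𝕜 : Type*} [RCLike 𝕜] {n : ℕ} {r : ℝ} [Fact (1 ≤ ENNReal.ofReal r)]
    (α : ℝ) (q : ℝ≥0∞) (p : ℝ) (f : 𝕜 → 𝕜) (φ : LSpace 𝕜 n r) (Tmax : ℝ≥0∞)
    (u : ℝ → LSpace 𝕜 n r) : Prop where
  pos : 0 < Tmax
  solution : ∀ T < Tmax, IsSolutionX α q p f φ T u
  maximal : ∀ (T : ℝ≥0∞) (v : ℝ → LSpace 𝕜 n r), IsSolutionX α q p f φ T v → T ≤ Tmax

end FracHeat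

end

open scoped NNReal

/-! Put m = n/(2α). The linear theory rests on one fact: the kernel K_1 is bounded and integrable.
Scaling and Young's inequality then show that convolution with |K_t| maps L^s to L^p with norm at
most C t^{-m(1/s-1/p)}. The symbol is in general not smooth at the origin, so integrability comes
from a dyadic decomposition: rescaled to the unit annulus, the piece at frequency 2^{±j} is 2^{-2αj}
times a member of a smooth, compactly supported family, and the L^1 norms sum geometrically
(`integrable_fourierInv_symbol_one`).

Existence. The fixed point is sought not in L^q_t L^p_x but in the norm sup t^γ ‖u(t)‖_s, where γ =
m(1/r - 1/s), for an auxiliary s with b₁+1 ≤ s and r < s < r(b₁+1). The lower power is absorbed by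
|u|^{b₂} ≤ ε + C|u|^{b₁}. The Duhamel term of a difference is dominated by t^{-γ} ∫₀¹ W(θ) h(tθ) dθ
with ∫W ≤ 1/2, once T^{1-mb₁/r} A^{b₁} is small, A being the size of the linear flow
(`exists_duhamel_contraction`). If r > r₀, the smallness comes from T, with A ≤ C‖φ‖. If r = r₀, the
power of T is zero and the smallness comes from t^γ‖S(t)φ‖_s → 0 (`tendsto_lnorm_heatMaj`). Dilation
averages are bounded on L^q(dt/t) too (`lnorm_mellin_le`), so the space-time integrability of the
linear flow (`lnorm_time_heatMaj_ne_top`, a hand-made real interpolation) passes to the solution,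
and from there to L^q_t L^p_x.

Uniqueness. The difference w of two solutions satisfies a linear inequality whose potential is built
from |u|^{b_i} + |v|^{b_i}. If p = r, continuity in L^r splits the potential into a part small in
L^{r/b₁} and a part bounded in L^{r/b₂}. If p > r, interpolation puts u and v into L^Q_t L^s_x, and
the potential is small in L^{Q/b₁} of a short time interval. At the critical exponent the direct
estimate fails, because it leads to ∫ dσ/σ. It is rescued in the weak space (L^{s₁},
L^{s₂})_{1/2,∞}: decomposing at the level σ^k gives σ^{-1+k} in one endpoint space and σ^{-1-k} in
the other, integrable at 0 and at ∞ respectively (`WeakBound.lintegral`). Each application halves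
the weak norm, so w = 0. A continuity argument extends this to the whole interval
(`IsSolutionX.eqOn`).

Blow-up. By uniqueness, local solutions fit together to a maximal one. Restarting at time s gives a
solution of length T whenever T^{1-mb₁/r}‖u(s)‖^{b₁} ≤ c. The glued solution (`IsSolutionX.glue`)
cannot pass T^*, so T = T^*-s must violate this condition, which is the lower bound; its exponent is
(1-mb₁/r)/b₁. -/

namespace FracHeat

/-! ### Integrability of the kernel by dyadic decomposition of the symbol. -/

section KernelBounds

open scoped ContDiff

/-- Euclidean space of dimension `n`. -/
abbrev Sp (n : ℕ) : Type := EuclideanSpace ℝ (Fin n)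

section FourierBound

variable {n : ℕ}

/-- The slice is a translate of F composed with the inclusion of E, whose norm is at most one.
Bounds for derivatives of the joint function thus become bounds uniform in the parameter. -/
theorem norm_iteratedFDeriv_slice_le {E : Type*} [NormedAddCommGroup E] [NormedSpace ℝ E]
    {F : ℝ × E → ℂ} (hF : ContDiff ℝ ∞ F) (j : ℕ) (l : ℝ) (ξ : E) :
    ‖iteratedFDeriv ℝ j (fun η => F (l, η)) ξ‖ ≤ ‖iteratedFDeriv ℝ j F (l, ξ)‖ := by
  have h1 : (fun η => F (l, η)) = (fun z => F (z + (l, 0))) ∘ (ContinuousLinearMap.inr ℝ ℝ E) := by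
    funext ξ; simp
  have h2 : ContDiff ℝ ∞ (fun z => F (z + (l, 0))) := hF.comp (contDiff_id.add contDiff_const)
  rw [h1, ContinuousLinearMap.iteratedFDeriv_comp_right _ h2 ξ (i := j) (by exact_mod_cast le_top)]
  refine (ContinuousMultilinearMap.norm_compContinuousLinearMap_le _ _).trans ?_
  rw [iteratedFDeriv_comp_add_right]
  have h3 : ‖ContinuousLinearMap.inr ℝ ℝ E‖ ≤ 1 := ContinuousLinearMap.norm_inr_le_one ℝ ℝ E
  have h4 : (∏ _i : Fin j, ‖ContinuousLinearMap.inr ℝ ℝ E‖) ≤ 1 := by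
    rw [Finset.prod_const]
    exact pow_le_one₀ (norm_nonneg _) h3
  have h5 : (ContinuousLinearMap.inr ℝ ℝ E) ξ + (l, 0) = (l, ξ) := by simp
  rw [h5]
  exact mul_le_of_le_one_right (norm_nonneg _) h4

/-- A smooth one-parameter family of functions with supports in a fixed ball has inverse Fourier
transforms that are bounded in `L¹`. -/
theorem exists_lintegral_fourierInv_le (H : ℝ → Sp n → ℂ)
    (hH : ContDiff ℝ ∞ (fun z : ℝ × Sp n => H z.1 z.2)) (hs : ∀ l ξ, 2 < ‖ξ‖ → H l ξ = 0) :
    ∃ C : ℝ≥0, ∀ l ∈ Icc (0 : ℝ) 1, ∫⁻ x, ‖𝓕⁻ (H l) x‖ₑ ≤ C := by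
  have hsm : ∀ l, ContDiff ℝ ∞ (H l) := fun l => hH.comp (contDiff_const.prodMk contDiff_id)
  have hts : ∀ l, tsupport (H l) ⊆ Metric.closedBall 0 2 := by
    intro l
    refine closure_minimal ?_ Metric.isClosed_closedBall
    intro ξ hξ
    by_contra h
    exact hξ (hs l ξ (by simpa using h))
  have hcs : ∀ l, HasCompactSupport (H l) := fun l =>
    (isCompact_closedBall (0 : Sp n) 2).of_isClosed_subset (isClosed_tsupport _) (hts l)
  -- Uniformity in l: the derivatives of the slices are bounded by those of the joint function on
  -- the compact set [0,1] × ball, and vanish off the ball.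
  have hbd : ∀ j : ℕ, ∃ B : ℝ, 0 ≤ B ∧ ∀ l ∈ Icc (0 : ℝ) 1,
      ∫ v, ‖v‖ ^ 0 * ‖iteratedFDeriv ℝ j (H l) v‖ ≤ B := by
    intro j
    obtain ⟨B, hB⟩ := ((isCompact_Icc (a := (0 : ℝ)) (b := 1)).prod
      (isCompact_closedBall (0 : Sp n) 2)).exists_bound_of_continuousOn
      (hH.continuous_iteratedFDeriv (m := j) (by exact_mod_cast le_top)).continuousOn
    refine ⟨|B| * volume.real (Metric.closedBall (0 : Sp n) 2), by positivity, fun l hl => ?_⟩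
    have hzero : ∀ v, v ∉ Metric.closedBall (0 : Sp n) 2 → iteratedFDeriv ℝ j (H l) v = 0 := by
      intro v hv
      by_contra h
      exact hv (hts l (support_iteratedFDeriv_subset j h))
    rw [← setIntegral_eq_integral_of_forall_compl_eq_zero (s := Metric.closedBall (0 : Sp n) 2)
      (fun v hv => by simp [hzero v hv])]
    refine (le_abs_self _).trans ?_
    rw [← Real.norm_eq_abs]
    refine norm_setIntegral_le_of_norm_le_const
      (isCompact_closedBall (0 : Sp n) 2).measure_lt_top (fun v hv => ?_)
    simp only [pow_zero, one_mul, norm_norm]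
    exact (norm_iteratedFDeriv_slice_le hH j l v).trans ((hB (l, v) ⟨hl, hv⟩).trans (le_abs_self _))
  have hint : ∀ l (k j : ℕ), Integrable (fun v => ‖v‖ ^ k * ‖iteratedFDeriv ℝ j (H l) v‖) := by
    intro l k j
    refine Continuous.integrable_of_hasCompactSupport ?_ ?_
    · exact (continuous_norm.pow k).mul
        ((hsm l).continuous_iteratedFDeriv (m := j) (by exact_mod_cast le_top)).norm
    · exact (((hcs l).iteratedFDeriv (𝕜 := ℝ) j).norm).mul_left
  choose B hB0 hB using hbd
  -- Integration by parts: L^1 bounds on the derivatives up to order N give decay of order N of the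
  -- transform.
  have hpow : ∀ N : ℕ, ∃ D : ℝ, 0 ≤ D ∧ ∀ l ∈ Icc (0 : ℝ) 1, ∀ w : Sp n,
      ‖w‖ ^ N * ‖𝓕 (H l) w‖ ≤ D := by
    intro N
    refine ⟨(2 * Real.pi) ^ 0 * (2 * (0 : ℕ) + 2) ^ N *
      ∑ p ∈ Finset.range (0 + 1) ×ˢ Finset.range (N + 1), B p.2, ?_, ?_⟩
    · have := fun p : ℕ × ℕ => hB0 p.2
      have h := Finset.sum_nonneg (s := Finset.range (0 + 1) ×ˢ Finset.range (N + 1))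
        (f := fun p => B p.2) (fun p _ => this p)
      positivity
    · intro l hl w
      have h := Real.pow_mul_norm_iteratedFDeriv_fourier_le (f := H l) (K := 0) (N := ⊤)
        (hsm l) (fun k j _ _ => hint l k j) (k := 0) (n := N) (by simp) (by exact_mod_cast le_top) w
      simp only [norm_iteratedFDeriv_zero] at h
      refine h.trans ?_
      gcongr with p hp
      have : p.1 = 0 := by
        have := (Finset.mem_product.1 hp).1
        simpa using this
      rw [this]
      exact hB p.2 l hl
  obtain ⟨D0, hD0, h0⟩ := hpow 0
  obtain ⟨D1, hD1, h1⟩ := hpow (n + 1)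
  -- Decay of orders 0 and n+1 combines to (1+‖w‖)^{-(n+1)}, which is integrable in dimension n; the
  -- factor comes from (1+x)^{n+1} ≤ 2^{n+1}(1+x^{n+1}).
  set D : ℝ := 2 ^ (n + 1) * (D0 + D1) with hD
  have hw : Integrable (fun x : Sp n => D * (1 + ‖x‖) ^ (-((n : ℝ) + 1))) :=
    (integrable_one_add_norm (by simp)).const_mul _
  refine ⟨(∫⁻ x : Sp n, ‖D * (1 + ‖x‖) ^ (-((n : ℝ) + 1))‖ₑ).toNNReal, fun l hl => ?_⟩
  rw [ENNReal.coe_toNNReal hw.2.ne]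
  have hneg : ∫⁻ x, ‖𝓕⁻ (H l) x‖ₑ = ∫⁻ x, ‖𝓕 (H l) x‖ₑ := by
    simp_rw [Real.fourierInv_eq_fourier_neg]
    exact lintegral_neg_eq_self (fun x => ‖𝓕 (H l) x‖ₑ)
  rw [hneg]
  refine lintegral_mono fun w => ?_
  rw [enorm_le_iff_norm_le]
  refine le_trans ?_ (le_abs_self _)
  have hpos : (0 : ℝ) < 1 + ‖w‖ := by positivity
  have hr : (1 + ‖w‖) ^ (-((n : ℝ) + 1)) = ((1 + ‖w‖) ^ (n + 1))⁻¹ := by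
    rw [Real.rpow_neg hpos.le]
    congr 1
    exact_mod_cast Real.rpow_natCast (1 + ‖w‖) (n + 1)
  change _ ≤ D * (1 + ‖w‖) ^ (-((n : ℝ) + 1))
  rw [hr, ← div_eq_mul_inv, le_div_iff₀ (by positivity)]
  have h2 : (1 + ‖w‖) ^ (n + 1) ≤ 2 ^ (n + 1) * (1 + ‖w‖ ^ (n + 1)) := by
    rcases le_total ‖w‖ 1 with h | h
    · calc (1 + ‖w‖) ^ (n + 1) ≤ 2 ^ (n + 1) := by gcongr; linarith
        _ ≤ 2 ^ (n + 1) * (1 + ‖w‖ ^ (n + 1)) := by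
          have : (0 : ℝ) ≤ ‖w‖ ^ (n + 1) := by positivity
          nlinarith [show (0 : ℝ) < 2 ^ (n + 1) by positivity]
    · calc (1 + ‖w‖) ^ (n + 1) ≤ (2 * ‖w‖) ^ (n + 1) := by gcongr; linarith
        _ = 2 ^ (n + 1) * ‖w‖ ^ (n + 1) := mul_pow _ _ _
        _ ≤ _ := by gcongr; linarith
  have h3 := h0 l hl w
  have h4 := h1 l hl w
  simp only [pow_zero, one_mul] at h3
  calc ‖𝓕 (H l) w‖ * (1 + ‖w‖) ^ (n + 1)
      ≤ ‖𝓕 (H l) w‖ * (2 ^ (n + 1) * (1 + ‖w‖ ^ (n + 1))) := by gcongr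
    _ = 2 ^ (n + 1) * (‖𝓕 (H l) w‖ + ‖w‖ ^ (n + 1) * ‖𝓕 (H l) w‖) := by ring
    _ ≤ D := by rw [hD]; gcongr

end FourierBound

section CutOff

variable {n : ℕ}

/-- A smooth radial cut-off function, equal to `1` on the unit ball. -/
noncomputable def cutOff (ξ : Sp n) : ℝ := Real.smoothTransition (2 - ‖ξ‖ ^ 2)

/-- A smooth radial bump supported in an annulus; its dyadic dilates sum up to `1`. -/
noncomputable def annulus (ξ : Sp n) : ℝ := cutOff ξ - cutOff ((2 : ℝ) • ξ)

theorem cutOff_nonneg (ξ : Sp n) : 0 ≤ cutOff ξ := Real.smoothTransition.nonneg _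

theorem cutOff_le_one (ξ : Sp n) : cutOff ξ ≤ 1 := Real.smoothTransition.le_one _

theorem cutOff_eq_one {ξ : Sp n} (h : ‖ξ‖ ≤ 1) : cutOff ξ = 1 := by
  apply Real.smoothTransition.one_of_one_le
  nlinarith [norm_nonneg ξ]

theorem cutOff_eq_zero {ξ : Sp n} (h : 3 / 2 ≤ ‖ξ‖) : cutOff ξ = 0 := by
  apply Real.smoothTransition.zero_of_nonpos
  nlinarith [norm_nonneg ξ]

theorem contDiff_cutOff : ContDiff ℝ ∞ (cutOff (n := n)) :=
  Real.smoothTransition.contDiff.comp (contDiff_const.sub (contDiff_norm_sq ℝ))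

theorem contDiff_annulus : ContDiff ℝ ∞ (annulus (n := n)) :=
  contDiff_cutOff.sub (contDiff_cutOff.comp (contDiff_const_smul 2))

theorem annulus_eq_zero_of_small {ξ : Sp n} (h : ‖ξ‖ ≤ 1 / 2) : annulus ξ = 0 := by
  rw [annulus, cutOff_eq_one (by linarith), cutOff_eq_one (by rw [norm_smul]; norm_num; linarith),
    sub_self]

theorem annulus_eq_zero_of_large {ξ : Sp n} (h : 3 / 2 ≤ ‖ξ‖) : annulus ξ = 0 := by
  rw [annulus, cutOff_eq_zero h, cutOff_eq_zero (by rw [norm_smul]; norm_num; linarith), sub_self]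

/-- The bump vanishes near the origin, the only place where Φ may fail to be smooth. -/
theorem contDiff_annulus_smul {Φ : ℝ → Sp n → ℂ}
    (hΦ : ∀ l ξ, ξ ≠ 0 → ContDiffAt ℝ ∞ (fun z : ℝ × Sp n => Φ z.1 z.2) (l, ξ)) :
    ContDiff ℝ ∞ (fun z : ℝ × Sp n => (annulus z.2 : ℂ) * Φ z.1 z.2) := by
  rw [contDiff_iff_contDiffAt]
  rintro ⟨l, ξ⟩
  by_cases h : ξ = 0
  · refine (contDiffAt_const (c := (0 : ℂ))).congr_of_eventuallyEq ?_
    have : ∀ᶠ z : ℝ × Sp n in 𝓝 (l, ξ), ‖z.2‖ < 1 / 2 := by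
      refine (continuous_snd.norm.continuousAt (x := (l, ξ))).eventually_lt
        continuousAt_const ?_
      simp [h]
    filter_upwards [this] with z hz
    simp [annulus_eq_zero_of_small hz.le]
  · refine ContDiffAt.mul ?_ (hΦ l ξ h)
    exact (Complex.ofRealCLM.contDiff.comp (contDiff_annulus.comp contDiff_snd)).contDiffAt

end CutOff

section Dilation

variable {n : ℕ}

theorem lintegral_comp_smul (f : Sp n → ℝ≥0∞) {c : ℝ} (hc : 0 < c) :
    ∫⁻ x, f (c • x) = ENNReal.ofReal ((c ^ n)⁻¹) * ∫⁻ x, f x := by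
  have h := Measure.map_addHaar_smul (volume : Measure (Sp n)) hc.ne'
  have h2 : ∫⁻ x, f (c • x) = ∫⁻ x, f x ∂(Measure.map (c • ·) volume) :=
    ((Homeomorph.smulOfNeZero c hc.ne').measurableEmbedding.lintegral_map f).symm
  rw [h2, h, lintegral_smul_measure, abs_of_pos (by positivity)]
  simp

theorem fourierInv_comp_smul (f : Sp n → ℂ) {c : ℝ} (hc : 0 < c) (x : Sp n) :
    𝓕⁻ (fun ξ => f (c • ξ)) x = ((c ^ n)⁻¹ : ℝ) • 𝓕⁻ f (c⁻¹ • x) := by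
  have h := Measure.integral_comp_smul (volume : Measure (Sp n))
    (fun v => (Real.fourierChar (inner ℝ v (c⁻¹ • x))) • f v) c
  rw [Real.fourierInv_eq, Real.fourierInv_eq]
  rw [abs_of_pos (by positivity)] at h
  rw [show Module.finrank ℝ (Sp n) = n by simp] at h
  rw [← h]
  congr 1
  funext v
  rw [inner_smul_left, inner_smul_right]
  simp [hc.ne']

/-- The factor c^{-n} of the transform cancels the Jacobian. Hence every dyadic piece can be
estimated at unit frequency. -/
theorem lintegral_fourierInv_comp_smul (f : Sp n → ℂ) {c : ℝ} (hc : 0 < c) :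
    ∫⁻ x, ‖𝓕⁻ (fun ξ => f (c • ξ)) x‖ₑ = ∫⁻ x, ‖𝓕⁻ f x‖ₑ := by
  simp_rw [fourierInv_comp_smul f hc, enorm_smul]
  rw [lintegral_const_mul' _ _ enorm_ne_top,
    lintegral_comp_smul (fun x => ‖𝓕⁻ f x‖ₑ) (inv_pos.2 hc), ← mul_assoc]
  rw [Real.enorm_of_nonneg (by positivity), ← ENNReal.ofReal_mul (by positivity)]
  rw [inv_pow, inv_inv, inv_mul_cancel₀ (by positivity)]
  simp

theorem integrable_fourierChar_smul {f : Sp n → ℂ} (hf : Integrable f) (x : Sp n) :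
    Integrable (fun v => Real.fourierChar (inner ℝ v x) • f v) := by
  have := (Real.fourierIntegral_convergent_iff (V := Sp n) (f := f) (μ := volume) (-x)).2 hf
  simpa using this

theorem fourierInv_add_apply {f g : Sp n → ℂ} (hf : Integrable f) (hg : Integrable g) (x : Sp n) :
    𝓕⁻ (fun ξ => f ξ + g ξ) x = 𝓕⁻ f x + 𝓕⁻ g x := by
  simp_rw [Real.fourierInv_eq, smul_add]
  exact integral_add (integrable_fourierChar_smul hf x) (integrable_fourierChar_smul hg x)

theorem continuous_fourierInv {f : Sp n → ℂ} (hf : Integrable f) : Continuous (𝓕⁻ f) := by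
  have h : 𝓕⁻ f = fun x => 𝓕 f (-x) := funext fun x => Real.fourierInv_eq_fourier_neg f x
  rw [h]
  exact (VectorFourier.fourierIntegral_continuous Real.continuous_fourierChar
    continuous_inner hf).comp continuous_neg

theorem lintegral_fourierInv_add_le {f g : Sp n → ℂ} (hf : Integrable f) (hg : Integrable g) :
    ∫⁻ x, ‖𝓕⁻ (fun ξ => f ξ + g ξ) x‖ₑ ≤ (∫⁻ x, ‖𝓕⁻ f x‖ₑ) + ∫⁻ x, ‖𝓕⁻ g x‖ₑ := by
  simp_rw [fourierInv_add_apply hf hg]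
  have hm : Measurable (fun x : Sp n => ‖𝓕⁻ f x‖ₑ) := (continuous_fourierInv hf).enorm.measurable
  have h := lintegral_add_left (μ := (volume : Measure (Sp n))) hm (fun x => ‖𝓕⁻ g x‖ₑ)
  rw [← h]
  exact lintegral_mono fun x => enorm_add_le _ _

theorem lintegral_fourierInv_const_mul (f : Sp n → ℂ) (c : ℝ) :
    ∫⁻ x, ‖𝓕⁻ (fun ξ => (c : ℂ) * f ξ) x‖ₑ = ‖c‖ₑ * ∫⁻ x, ‖𝓕⁻ f x‖ₑ := by
  rw [← lintegral_const_mul' _ _ enorm_ne_top]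
  congr 1
  funext x
  rw [Real.fourierInv_eq, Real.fourierInv_eq]
  have : ∀ v, Real.fourierChar (inner ℝ v x) • ((c : ℂ) * f v) =
      (c : ℂ) • (Real.fourierChar (inner ℝ v x) • f v) := fun v => by
    rw [smul_comm, smul_eq_mul]
  simp_rw [this]
  rw [integral_smul, enorm_smul]
  congr 1
  simp [enorm_eq_nnnorm]

end Dilation

section Symbol

variable {n : ℕ}

/-- The symbol of `(-Δ)^α`, in the normalisation of the Fourier transform. -/
noncomputable def phase (α : ℝ) (ξ : Sp n) : ℝ := (2 * Real.pi * ‖ξ‖) ^ (2 * α)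

/-- The symbol of `e^{-t(-Δ)^α}`. -/
noncomputable def symbol (α t : ℝ) (ξ : Sp n) : ℂ :=
  ((Real.exp (-(t * (2 * Real.pi * ‖ξ‖) ^ (2 * α))) : ℝ) : ℂ)

theorem phase_nonneg (α : ℝ) (ξ : Sp n) : 0 ≤ phase α ξ := by
  unfold phase; positivity

theorem phase_pos (α : ℝ) {ξ : Sp n} (h : ξ ≠ 0) : 0 < phase α ξ := by
  have : 0 < ‖ξ‖ := norm_pos_iff.2 h
  have := Real.pi_pos
  unfold phase; positivity

theorem phase_smul (α : ℝ) {c : ℝ} (hc : 0 ≤ c) (ξ : Sp n) :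
    phase α (c • ξ) = c ^ (2 * α) * phase α ξ := by
  have := Real.pi_pos
  rw [phase, phase, norm_smul, Real.norm_of_nonneg hc, ← Real.mul_rpow hc (by positivity)]
  ring_nf

theorem contDiffAt_phase (α : ℝ) {ξ : Sp n} (h : ξ ≠ 0) : ContDiffAt ℝ ∞ (phase α) ξ := by
  have h1 : 0 < ‖ξ‖ := norm_pos_iff.2 h
  have h2 : 2 * Real.pi * ‖ξ‖ ≠ 0 := by have := Real.pi_pos; positivity
  exact (contDiffAt_const.mul (contDiffAt_norm ℝ h)).rpow_const_of_ne h2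

theorem continuous_phase {α : ℝ} (hα : 0 < α) : Continuous (phase (n := n) α) :=
  (continuous_const.mul continuous_norm).rpow_const fun _ => Or.inr (by positivity)

theorem continuous_symbol {α : ℝ} (hα : 0 < α) (t : ℝ) : Continuous (symbol (n := n) α t) :=
  Complex.continuous_ofReal.comp
    (Real.continuous_exp.comp (continuous_const.mul (continuous_phase hα)).neg)

theorem integrable_symbol {α t : ℝ} (hα : 0 < α) (ht : 0 < t) :
    Integrable (symbol (n := n) α t) := by
  refine Integrable.ofReal ?_
  rcases Nat.eq_zero_or_pos n with rfl | hn
  · exact Integrable.of_finite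
  · have : Nonempty (Fin n) := ⟨⟨0, hn⟩⟩
    have : Nontrivial (Sp n) := inferInstance
    have h := (integrable_fun_norm_addHaar (volume : Measure (Sp n))
      (f := fun s : ℝ => Real.exp (-(t * (2 * Real.pi * s) ^ (2 * α))))).2 ?_
    · exact h
    · have hpi := Real.pi_pos
      have := integrableOn_rpow_mul_exp_neg_mul_rpow (p := 2 * α) (s := ((n - 1 : ℕ) : ℝ))
        (b := t * (2 * Real.pi) ^ (2 * α))
        (by have : (0 : ℝ) ≤ ((n - 1 : ℕ) : ℝ) := by positivity
            linarith) (by positivity) (by positivity)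
      refine this.congr_fun (fun s hs => ?_) measurableSet_Ioi
      have hs' : (0 : ℝ) < s := hs
      simp only [finrank_euclideanSpace, Fintype.card_fin, Real.rpow_natCast, smul_eq_mul]
      rw [Real.mul_rpow (by positivity) hs'.le]
      ring_nf

end Symbol

section Pieces

variable {n : ℕ}

/-- The low frequency pieces of the symbol. -/
noncomputable def lowPiece (α l : ℝ) (ξ : Sp n) : ℂ :=
  (annulus ξ : ℂ) * ((-phase α ξ : ℝ) * dslope Complex.exp 0 ((-(l * phase α ξ) : ℝ) : ℂ))

/-- The high frequency pieces of the symbol. -/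
noncomputable def highPiece (α l : ℝ) (ξ : Sp n) : ℂ :=
  (annulus ξ : ℂ) * (((phase α ξ)⁻¹ * ((l * (phase α ξ)⁻¹)⁻¹ *
    expNegInvGlue (l * (phase α ξ)⁻¹)) : ℝ) : ℂ)

/-- The entire function (e^z-1)/z makes the quotient (e^{-lφ}-1)/l smooth across l = 0; thus l may
range over the compact interval [0,1]. -/
theorem contDiff_lowPiece (α : ℝ) :
    ContDiff ℝ ∞ (fun z : ℝ × Sp n => lowPiece α z.1 z.2) := by
  refine contDiff_annulus_smul (Φ := fun l ξ => ((-phase α ξ : ℝ) : ℂ) *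
    dslope Complex.exp 0 ((-(l * phase α ξ) : ℝ) : ℂ)) (fun l ξ h => ?_)
  have hp : ContDiffAt ℝ ∞ (fun z : ℝ × Sp n => phase α z.2) (l, ξ) :=
    (contDiffAt_phase α h).comp (l, ξ) contDiffAt_snd
  have hE : ContDiff ℝ ∞ (dslope Complex.exp 0) := by
    have : Differentiable ℂ (dslope Complex.exp 0) := by
      rw [← differentiableOn_univ, Complex.differentiableOn_dslope Filter.univ_mem]
      exact Complex.differentiable_exp.differentiableOn
    exact this.contDiff.restrict_scalars ℝ
  refine ContDiffAt.mul ?_ ?_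
  · exact Complex.ofRealCLM.contDiff.contDiffAt.comp _ hp.neg
  · exact hE.contDiffAt.comp _
      (Complex.ofRealCLM.contDiff.contDiffAt.comp _ (contDiffAt_fst.mul hp).neg)

/-- With x = l/φ, the quotient e^{-φ/l}/l equals φ^{-1} x^{-1} e^{-1/x}, and the flat function
e^{-1/x}, extended by 0, absorbs the factor x^{-1} smoothly at 0. -/
theorem contDiff_highPiece (α : ℝ) :
    ContDiff ℝ ∞ (fun z : ℝ × Sp n => highPiece α z.1 z.2) := by
  refine contDiff_annulus_smul (Φ := fun l ξ => (((phase α ξ)⁻¹ * ((l * (phase α ξ)⁻¹)⁻¹ *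
    expNegInvGlue (l * (phase α ξ)⁻¹)) : ℝ) : ℂ)) (fun l ξ h => ?_)
  have hp : ContDiffAt ℝ ∞ (fun z : ℝ × Sp n => (phase α z.2)⁻¹) (l, ξ) :=
    ContDiffAt.inv (f := fun z : ℝ × Sp n => phase α z.2)
      ((contDiffAt_phase α h).comp (l, ξ) contDiffAt_snd) (phase_pos α h).ne'
  have hQ : ContDiff ℝ ∞ (fun x : ℝ => x⁻¹ * expNegInvGlue x) := by
    simpa using expNegInvGlue.contDiff_polynomial_eval_inv_mul (n := ⊤) Polynomial.X
  exact Complex.ofRealCLM.contDiff.contDiffAt.comp _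
    (hp.mul (hQ.contDiffAt.comp _ (contDiffAt_fst.mul hp)))

theorem lowPiece_eq_zero {α l : ℝ} {ξ : Sp n} (h : 2 < ‖ξ‖) : lowPiece α l ξ = 0 := by
  rw [lowPiece, annulus_eq_zero_of_large (by linarith)]; simp

theorem highPiece_eq_zero {α l : ℝ} {ξ : Sp n} (h : 2 < ‖ξ‖) : highPiece α l ξ = 0 := by
  rw [highPiece, annulus_eq_zero_of_large (by linarith)]; simp

theorem mul_lowPiece (α l : ℝ) (ξ : Sp n) :
    (l : ℂ) * lowPiece α l ξ =
      ((annulus ξ * (Real.exp (-(l * phase α ξ)) - 1) : ℝ) : ℂ) := by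
  have h := sub_smul_dslope Complex.exp 0 ((-(l * phase α ξ) : ℝ) : ℂ)
  rw [lowPiece]
  simp only [sub_zero, smul_eq_mul, Complex.exp_zero] at h
  push_cast at h ⊢
  rw [← h]
  ring

theorem mul_highPiece (α : ℝ) {l : ℝ} (hl : 0 < l) (ξ : Sp n) :
    (l : ℂ) * highPiece α l ξ = ((annulus ξ * Real.exp (-(phase α ξ / l)) : ℝ) : ℂ) := by
  rcases eq_or_ne ξ 0 with rfl | h
  · simp [highPiece, annulus_eq_zero_of_small (n := n) (ξ := 0) (by simp)]
  · have hp := phase_pos α h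
    rw [highPiece, expNegInvGlue, if_neg (by push Not; positivity)]
    rw [← Complex.ofReal_mul, ← Complex.ofReal_mul]
    congr 1
    have : (l * (phase α ξ)⁻¹)⁻¹ = phase α ξ / l := by field_simp
    rw [this]
    field_simp

theorem integrable_comp_smul_of_contDiff {H : ℝ → Sp n → ℂ}
    (hH : ContDiff ℝ ∞ (fun z : ℝ × Sp n => H z.1 z.2)) (hs : ∀ l ξ, 2 < ‖ξ‖ → H l ξ = 0)
    (l : ℝ) {c : ℝ} (hc : 0 < c) : Integrable (fun ξ => H l (c • ξ)) := by
  have h1 : Continuous (H l) := hH.continuous.comp (Continuous.prodMk_right l)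
  have h2 : Integrable (H l) := by
    refine h1.integrable_of_hasCompactSupport ?_
    refine HasCompactSupport.of_support_subset_isCompact (isCompact_closedBall (0 : Sp n) 2) ?_
    intro ξ hξ
    by_contra h
    exact hξ (hs l ξ (by simpa using h))
  exact h2.comp_smul hc.ne'

end Pieces

section Integrability

variable {n : ℕ}

theorem cutOff_smul_le {c : ℝ} (hc : 1 ≤ c) (ξ : Sp n) : cutOff (c • ξ) ≤ cutOff ξ := by
  refine Real.smoothTransition.monotone ?_
  rw [norm_smul, Real.norm_of_nonneg (by linarith)]
  have : ‖ξ‖ ≤ c * ‖ξ‖ := le_mul_of_one_le_left (norm_nonneg _) hc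
  have := norm_nonneg ξ
  nlinarith

theorem sum_annulus_low (J : ℕ) (ξ : Sp n) :
    ∑ j ∈ Finset.range J, annulus ((2 : ℝ) ^ j • ξ) = cutOff ξ - cutOff ((2 : ℝ) ^ J • ξ) := by
  induction J with
  | zero => simp
  | succ J ih => rw [Finset.sum_range_succ, ih, annulus, smul_smul, ← pow_succ']; ring

theorem sum_annulus_high (J : ℕ) (ξ : Sp n) :
    ∑ j ∈ Finset.range J, annulus (((2 : ℝ)⁻¹) ^ (j + 1) • ξ) =
      cutOff (((2 : ℝ)⁻¹) ^ J • ξ) - cutOff ξ := by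
  induction J with
  | zero => simp
  | succ J ih =>
    rw [Finset.sum_range_succ, ih, annulus, smul_smul, pow_succ' _ J, ← mul_assoc,
      mul_inv_cancel₀ two_ne_zero, one_mul]
    ring

/-- Dyadic approximations of the symbol of `e^{-(-Δ)^α}`. -/
noncomputable def approxSymbol (α : ℝ) (J : ℕ) (ξ : Sp n) : ℂ :=
  cutOff ξ + ∑ j ∈ Finset.range J,
    (((((2 : ℝ)⁻¹ ^ (2 * α)) ^ j : ℝ) : ℂ) * lowPiece α (((2 : ℝ)⁻¹ ^ (2 * α)) ^ j) ((2 : ℝ) ^ j • ξ)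
    + ((((2 : ℝ)⁻¹ ^ (2 * α)) ^ (j + 1) : ℝ) : ℂ) *
      highPiece α (((2 : ℝ)⁻¹ ^ (2 * α)) ^ (j + 1)) (((2 : ℝ)⁻¹) ^ (j + 1) • ξ))

/-- By homogeneity of the phase, dilating the jth piece back turns its parameter l into the original
exponential, and the annuli telescope to differences of cut-offs. -/
theorem approxSymbol_eq (α : ℝ) (J : ℕ) (ξ : Sp n) :
    approxSymbol α J ξ = ((cutOff ξ
      + (Real.exp (-phase α ξ) - 1) * (cutOff ξ - cutOff ((2 : ℝ) ^ J • ξ))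
      + Real.exp (-phase α ξ) * (cutOff (((2 : ℝ)⁻¹) ^ J • ξ) - cutOff ξ) : ℝ) : ℂ) := by
  rw [← sum_annulus_low, ← sum_annulus_high, Finset.mul_sum, Finset.mul_sum, add_assoc,
    ← Finset.sum_add_distrib, approxSymbol]
  push_cast
  congr 1
  refine Finset.sum_congr rfl fun j _ => ?_
  have hc : ∀ j : ℕ, ((2 : ℝ)⁻¹ ^ (2 * α)) ^ j = ((2 : ℝ)⁻¹ ^ j) ^ (2 * α) := fun j => by
    rw [← Real.rpow_natCast, ← Real.rpow_natCast, ← Real.rpow_mul (by positivity),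
      ← Real.rpow_mul (by positivity), mul_comm]
  have hl := mul_lowPiece α (((2 : ℝ)⁻¹ ^ (2 * α)) ^ j) ((2 : ℝ) ^ j • ξ)
  have hh := mul_highPiece α (l := ((2 : ℝ)⁻¹ ^ (2 * α)) ^ (j + 1)) (by positivity)
    (((2 : ℝ)⁻¹) ^ (j + 1) • ξ)
  rw [phase_smul α (by positivity)] at hl hh
  push_cast at hl hh ⊢
  rw [hl, hh]
  have e1 : ((2 : ℝ)⁻¹ ^ (2 * α)) ^ j * (((2 : ℝ) ^ j) ^ (2 * α) * phase α ξ) = phase α ξ := by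
    rw [hc, ← mul_assoc, ← Real.mul_rpow (by positivity) (by positivity), ← mul_pow]
    simp
  have e2 : ((2 : ℝ)⁻¹ ^ (j + 1)) ^ (2 * α) * phase α ξ / ((2 : ℝ)⁻¹ ^ (2 * α)) ^ (j + 1) =
      phase α ξ := by
    rw [hc]; field_simp
  have e1' := congrArg (fun s : ℝ => Complex.exp (-(s : ℂ))) e1
  have e2' := congrArg (fun s : ℝ => Complex.exp (-(s : ℂ))) e2
  push_cast at e1' e2'
  rw [e1', e2']
  ring

/-- An integrable majorant independent of J, for dominated convergence of the inverse transforms. -/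
theorem norm_approxSymbol_le (α : ℝ) (J : ℕ) (ξ : Sp n) :
    ‖approxSymbol α J ξ‖ ≤ 2 * cutOff ξ + Real.exp (-phase α ξ) := by
  rw [approxSymbol_eq, Complex.norm_real, Real.norm_eq_abs]
  have h1 : Real.exp (-phase α ξ) ≤ 1 := Real.exp_le_one_iff.2 (by
    have := phase_nonneg α ξ; linarith)
  have h1' : 0 < Real.exp (-phase α ξ) := Real.exp_pos _
  have h2 : cutOff ((2 : ℝ) ^ J • ξ) ≤ cutOff ξ := cutOff_smul_le (one_le_pow₀ (by norm_num)) ξ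
  have h3 : cutOff ξ ≤ cutOff (((2 : ℝ)⁻¹) ^ J • ξ) := by
    have := cutOff_smul_le (c := (2 : ℝ) ^ J) (one_le_pow₀ (by norm_num)) (((2 : ℝ)⁻¹) ^ J • ξ)
    rwa [smul_smul, ← mul_pow, mul_inv_cancel₀ two_ne_zero, one_pow, one_smul] at this
  have h4 := cutOff_nonneg ((2 : ℝ) ^ J • ξ)
  have h5 := cutOff_le_one (((2 : ℝ)⁻¹) ^ J • ξ)
  have h6 := cutOff_nonneg ξ
  rw [abs_le]
  constructor
  · nlinarith [mul_nonneg (sub_nonneg.2 h1) (sub_nonneg.2 h2), mul_nonneg h1'.le (sub_nonneg.2 h3),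
      mul_nonneg h1'.le (sub_nonneg.2 h2)]
  · nlinarith [mul_nonneg (sub_nonneg.2 h1) (sub_nonneg.2 h2), mul_nonneg h1'.le (sub_nonneg.2 h3),
      mul_nonneg h1'.le (sub_nonneg.2 h5), mul_nonneg h1'.le h6]

/-- At each nonzero frequency the approximations are eventually equal to the symbol. -/
theorem tendsto_approxSymbol (α : ℝ) {ξ : Sp n} (h : ξ ≠ 0) :
    Tendsto (fun J => approxSymbol α J ξ) atTop (𝓝 (symbol α 1 ξ)) := by
  have hξ : 0 < ‖ξ‖ := norm_pos_iff.2 h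
  have e1 : ∀ᶠ J : ℕ in atTop, cutOff ((2 : ℝ) ^ J • ξ) = 0 := by
    have := (tendsto_pow_atTop_atTop_of_one_lt (r := (2 : ℝ)) (by norm_num)).eventually_ge_atTop
      (3 / 2 / ‖ξ‖)
    filter_upwards [this] with J hJ
    refine cutOff_eq_zero ?_
    rw [norm_smul, norm_pow, Real.norm_two]
    rwa [div_le_iff₀ hξ] at hJ
  have e2 : ∀ᶠ J : ℕ in atTop, cutOff (((2 : ℝ)⁻¹) ^ J • ξ) = 1 := by
    have := (tendsto_pow_atTop_nhds_zero_of_lt_one (r := (2 : ℝ)⁻¹) (by norm_num)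
      (by norm_num)).eventually_le_const (u := ‖ξ‖⁻¹) (by positivity)
    filter_upwards [this] with J hJ
    refine cutOff_eq_one ?_
    rw [norm_smul, norm_pow, norm_inv, Real.norm_two]
    calc (2 : ℝ)⁻¹ ^ J * ‖ξ‖ ≤ ‖ξ‖⁻¹ * ‖ξ‖ := by gcongr
      _ = 1 := inv_mul_cancel₀ hξ.ne'
  refine tendsto_const_nhds.congr' ?_
  filter_upwards [e1, e2] with J h1 h2
  rw [approxSymbol_eq, h1, h2, symbol, phase]
  congr 1
  ring_nf

theorem integrable_cutOff : Integrable (fun ξ : Sp n => (cutOff ξ : ℂ)) := by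
  have hH : ContDiff ℝ ∞ (fun z : ℝ × Sp n => (cutOff z.2 : ℂ)) :=
    Complex.ofRealCLM.contDiff.comp (contDiff_cutOff.comp contDiff_snd)
  have := integrable_comp_smul_of_contDiff (H := fun _ ξ => (cutOff ξ : ℂ)) hH
    (fun l ξ h => by simp [cutOff_eq_zero (ξ := ξ) (by linarith)]) 0 one_pos
  simpa using this

/-- The jth pair of pieces contributes at most ρ^j C₁ + ρ^{j+1} C₂ with ρ = 2^{-2α} < 1; the series
is geometric. -/
theorem exists_lintegral_fourierInv_approxSymbol_le {α : ℝ} (hα : 0 < α) :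
    ∃ C : ℝ≥0, ∀ J, Continuous (approxSymbol (n := n) α J) ∧
      ∫⁻ x : Sp n, ‖𝓕⁻ (approxSymbol (n := n) α J) x‖ₑ ≤ C := by
  have hH : ContDiff ℝ ∞ (fun z : ℝ × Sp n => (cutOff z.2 : ℂ)) :=
    Complex.ofRealCLM.contDiff.comp (contDiff_cutOff.comp contDiff_snd)
  obtain ⟨C0, h0⟩ := exists_lintegral_fourierInv_le (fun _ (ξ : Sp n) => (cutOff ξ : ℂ)) hH
    (fun l ξ h => by simp [cutOff_eq_zero (ξ := ξ) (by linarith)])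
  obtain ⟨C1, h1⟩ := exists_lintegral_fourierInv_le (n := n) (lowPiece α) (contDiff_lowPiece α)
    (fun l ξ h => lowPiece_eq_zero h)
  obtain ⟨C2, h2⟩ := exists_lintegral_fourierInv_le (n := n) (highPiece α) (contDiff_highPiece α)
    (fun l ξ h => highPiece_eq_zero h)
  set ρ : ℝ := (2 : ℝ)⁻¹ ^ (2 * α) with hρ
  have hρ0 : 0 < ρ := by positivity
  have hρ1 : ρ < 1 := Real.rpow_lt_one (by norm_num) (by norm_num) (by positivity)
  set σ : ℝ≥0 := ⟨ρ, hρ0.le⟩ with hσ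
  have hσ1 : σ < 1 := by rw [← NNReal.coe_lt_coe]; exact hρ1
  have hmem : ∀ j, ρ ^ j ∈ Icc (0 : ℝ) 1 := fun j => ⟨by positivity, pow_le_one₀ hρ0.le hρ1.le⟩
  have henorm : ∀ j, ‖ρ ^ j‖ₑ = ((σ ^ j : ℝ≥0) : ℝ≥0∞) := fun j => by
    rw [enorm_pow, ENNReal.coe_pow, hσ]
    congr 1
    rw [Real.enorm_of_nonneg hρ0.le, ENNReal.ofReal, Real.toNNReal_of_nonneg hρ0.le]
    rfl
  have key : ∀ J, Continuous (approxSymbol (n := n) α J) ∧ Integrable (approxSymbol (n := n) α J) ∧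
      ∫⁻ x : Sp n, ‖𝓕⁻ (approxSymbol (n := n) α J) x‖ₑ ≤
        ((C0 + ∑ j ∈ Finset.range J, (σ ^ j * C1 + σ ^ (j + 1) * C2) : ℝ≥0) : ℝ≥0∞) := by
    intro J
    induction J with
    | zero =>
      have : approxSymbol (n := n) α 0 = fun ξ => (cutOff ξ : ℂ) := by
        funext ξ; simp [approxSymbol]
      rw [this]
      refine ⟨Complex.continuous_ofReal.comp contDiff_cutOff.continuous, integrable_cutOff, ?_⟩
      simpa using h0 0 (by simp)
    | succ J ih =>
      obtain ⟨ihc, ihi, ihb⟩ := ih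
      have hlowI : Integrable (fun ξ : Sp n => ((ρ ^ J : ℝ) : ℂ) *
          lowPiece α (ρ ^ J) ((2 : ℝ) ^ J • ξ)) :=
        (integrable_comp_smul_of_contDiff (contDiff_lowPiece α)
          (fun l ξ h => lowPiece_eq_zero h) _ (by positivity)).const_mul _
      have hhighI : Integrable (fun ξ : Sp n => ((ρ ^ (J + 1) : ℝ) : ℂ) *
          highPiece α (ρ ^ (J + 1)) ((2 : ℝ)⁻¹ ^ (J + 1) • ξ)) :=
        (integrable_comp_smul_of_contDiff (contDiff_highPiece α)
          (fun l ξ h => highPiece_eq_zero h) _ (by positivity)).const_mul _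
      have hlowC : Continuous (fun ξ : Sp n => lowPiece α (ρ ^ J) ((2 : ℝ) ^ J • ξ)) :=
        ((contDiff_lowPiece α).continuous.comp (Continuous.prodMk_right _)).comp
          (continuous_const_smul _)
      have hhighC : Continuous (fun ξ : Sp n =>
          highPiece α (ρ ^ (J + 1)) ((2 : ℝ)⁻¹ ^ (J + 1) • ξ)) :=
        ((contDiff_highPiece α).continuous.comp (Continuous.prodMk_right _)).comp
          (continuous_const_smul _)
      have e : approxSymbol (n := n) α (J + 1) = fun ξ => approxSymbol α J ξ +
          (((ρ ^ J : ℝ) : ℂ) * lowPiece α (ρ ^ J) ((2 : ℝ) ^ J • ξ) +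
          ((ρ ^ (J + 1) : ℝ) : ℂ) * highPiece α (ρ ^ (J + 1)) ((2 : ℝ)⁻¹ ^ (J + 1) • ξ)) := by
        funext ξ
        rw [approxSymbol, Finset.sum_range_succ, ← add_assoc, approxSymbol]
      rw [e]
      refine ⟨ihc.add ((continuous_const.mul hlowC).add (continuous_const.mul hhighC)),
        ihi.add (hlowI.add hhighI), ?_⟩
      refine (lintegral_fourierInv_add_le ihi (hlowI.add hhighI)).trans ?_
      rw [Finset.sum_range_succ, ← add_assoc, ENNReal.coe_add]
      refine add_le_add ihb ((lintegral_fourierInv_add_le hlowI hhighI).trans ?_)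
      rw [ENNReal.coe_add, ENNReal.coe_mul, ENNReal.coe_mul,
        lintegral_fourierInv_const_mul, lintegral_fourierInv_const_mul,
        lintegral_fourierInv_comp_smul (lowPiece α (ρ ^ J)) (by positivity),
        lintegral_fourierInv_comp_smul (highPiece α (ρ ^ (J + 1))) (by positivity),
        henorm, henorm]
      gcongr
      · exact h1 _ (hmem _)
      · exact h2 _ (hmem _)
  have hsum : Summable (fun j : ℕ => σ ^ j * C1 + σ ^ (j + 1) * C2) := by
    have := NNReal.summable_geometric hσ1
    refine (this.mul_right C1).add ?_
    simp_rw [pow_succ, mul_assoc]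
    exact this.mul_right _
  refine ⟨C0 + ∑' j, (σ ^ j * C1 + σ ^ (j + 1) * C2), fun J => ⟨(key J).1, (key J).2.2.trans ?_⟩⟩
  have := hsum.sum_le_tsum (Finset.range J) (fun _ _ => by positivity)
  exact_mod_cast add_le_add le_rfl this

theorem tendsto_fourierInv_approxSymbol {α : ℝ} (hα : 0 < α) (hn : 0 < n) (x : Sp n) :
    Tendsto (fun J => 𝓕⁻ (approxSymbol (n := n) α J) x) atTop (𝓝 (𝓕⁻ (symbol (n := n) α 1) x)) := by
  have : Nonempty (Fin n) := ⟨⟨0, hn⟩⟩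
  have : Nontrivial (Sp n) := inferInstance
  simp_rw [Real.fourierInv_eq]
  obtain ⟨C, hC⟩ := exists_lintegral_fourierInv_approxSymbol_le (n := n) hα
  refine tendsto_integral_of_dominated_convergence
    (fun ξ => 2 * cutOff ξ + Real.exp (-phase α ξ)) (fun J => ?_) ?_ (fun J => ?_) ?_
  · have h := (hC J).1
    have hch : Continuous (fun v : Sp n => Real.fourierChar (inner ℝ v x)) :=
      Real.continuous_fourierChar.comp (continuous_id.inner continuous_const)
    exact (hch.smul h).aestronglyMeasurable
  · have h1 : Integrable (fun ξ : Sp n => cutOff ξ) := by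
      simpa using (integrable_cutOff (n := n)).re
    have h2 : Integrable (fun ξ : Sp n => Real.exp (-phase α ξ)) := by
      have := (integrable_symbol (n := n) hα one_pos).re
      simpa only [symbol, phase, RCLike.re_to_complex, Complex.ofReal_re, one_mul] using this
    exact (h1.const_mul 2).add h2
  · refine ae_of_all _ fun ξ => ?_
    rw [Circle.norm_smul]
    exact norm_approxSymbol_le α J ξ
  · have h0 : ∀ᵐ ξ : Sp n, ξ ≠ 0 := by
      simp [ae_iff]
    filter_upwards [h0] with ξ hξ
    exact (tendsto_approxSymbol α hξ).const_smul _

/-- The kernel of `e^{-(-Δ)^α}` is integrable. -/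
theorem integrable_fourierInv_symbol_one {α : ℝ} (hα : 0 < α) (hn : 0 < n) :
    Integrable (𝓕⁻ (symbol (n := n) α 1)) := by
  refine ⟨(continuous_fourierInv (integrable_symbol hα one_pos)).aestronglyMeasurable, ?_⟩
  obtain ⟨C, hC⟩ := exists_lintegral_fourierInv_approxSymbol_le (n := n) hα
  -- Fatou's lemma carries the uniform L^1 bound to the pointwise limit.
  have hlim : ∀ x : Sp n, ‖𝓕⁻ (symbol (n := n) α 1) x‖ₑ =
      liminf (fun J => ‖𝓕⁻ (approxSymbol (n := n) α J) x‖ₑ) atTop := fun x =>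
    ((tendsto_fourierInv_approxSymbol hα hn x).enorm.liminf_eq).symm
  have hI : ∀ J, Integrable (approxSymbol (n := n) α J) := fun J => by
    have h1 : Integrable (fun ξ : Sp n => cutOff ξ) := by
      simpa using (integrable_cutOff (n := n)).re
    have h2 : Integrable (fun ξ : Sp n => Real.exp (-phase α ξ)) := by
      have := (integrable_symbol (n := n) hα one_pos).re
      simpa only [symbol, phase, RCLike.re_to_complex, Complex.ofReal_re, one_mul] using this
    exact ((h1.const_mul 2).add h2).mono' (hC J).1.aestronglyMeasurable
      (ae_of_all _ fun ξ => norm_approxSymbol_le α J ξ)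
  rw [HasFiniteIntegral]
  simp_rw [hlim]
  refine (lintegral_liminf_le fun J => (continuous_fourierInv (hI J)).enorm.measurable).trans_lt ?_
  refine lt_of_le_of_lt ?_ (ENNReal.coe_lt_top (r := C))
  refine (liminf_le_liminf (Eventually.of_forall fun J => (hC J).2)).trans ?_
  simp

end Integrability

/-! ### Scaling, total mass and semigroup law of the kernel. -/

section Kernel

variable {n : ℕ} {α : ℝ}

/-- The symbol is real and even, so its inverse transform is its own conjugate; taking the real part
loses nothing. -/
theorem ofReal_kernel (t : ℝ) (x : Sp n) :
    ((kernel n α t x : ℝ) : ℂ) = 𝓕⁻ (symbol (n := n) α t) x := by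
  have h : (starRingEnd ℂ) (𝓕⁻ (symbol (n := n) α t) x) = 𝓕⁻ (symbol (n := n) α t) x := by
    rw [Real.fourierInv_eq', ← integral_conj]
    rw [← integral_neg_eq_self]
    congr 1
    funext v
    rw [smul_eq_mul, smul_eq_mul, map_mul, ← Complex.exp_conj, map_mul, Complex.conj_ofReal,
      Complex.conj_I, symbol, symbol, Complex.conj_ofReal, norm_neg, inner_neg_left, mul_neg,
      mul_neg, Complex.ofReal_neg, neg_mul, neg_neg]
  exact Complex.conj_eq_iff_re.1 h

theorem symbol_eq_symbol_one (hα : 0 < α) {t : ℝ} (ht : 0 < t) (ξ : Sp n) :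
    symbol α t ξ = symbol α 1 (t ^ (1 / (2 * α)) • ξ) := by
  have h := phase_smul α (c := t ^ (1 / (2 * α))) (by positivity) ξ
  rw [← Real.rpow_mul ht.le, one_div_mul_cancel (by positivity), Real.rpow_one] at h
  rw [phase, phase] at h
  rw [symbol, symbol, h, one_mul]

theorem kernel_eq (hα : 0 < α) {t : ℝ} (ht : 0 < t) (x : Sp n) :
    kernel n α t x =
      ((t ^ (1 / (2 * α))) ^ n)⁻¹ * kernel n α 1 ((t ^ (1 / (2 * α)))⁻¹ • x) := by
  have h : ((kernel n α t x : ℝ) : ℂ) =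
      (((t ^ (1 / (2 * α))) ^ n)⁻¹ * kernel n α 1 ((t ^ (1 / (2 * α)))⁻¹ • x) : ℝ) := by
    rw [Complex.ofReal_mul, ofReal_kernel, ofReal_kernel,
      show symbol (n := n) α t = fun ξ => symbol α 1 (t ^ (1 / (2 * α)) • ξ) from
        funext fun ξ => symbol_eq_symbol_one hα ht ξ,
      fourierInv_comp_smul _ (by positivity), Complex.real_smul]
  exact_mod_cast h

theorem continuous_kernel (hα : 0 < α) {t : ℝ} (ht : 0 < t) : Continuous (kernel n α t) :=
  Complex.continuous_re.comp (continuous_fourierInv (integrable_symbol hα ht))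

theorem integrable_kernel_one (hα : 0 < α) (hn : 0 < n) : Integrable (kernel n α 1) :=
  (integrable_fourierInv_symbol_one hα hn).re

theorem integrable_kernel (hα : 0 < α) (hn : 0 < n) {t : ℝ} (ht : 0 < t) :
    Integrable (kernel n α t) := by
  rw [show kernel n α t = fun x => ((t ^ (1 / (2 * α))) ^ n)⁻¹ *
    kernel n α 1 ((t ^ (1 / (2 * α)))⁻¹ • x) from funext fun x => kernel_eq hα ht x]
  exact ((integrable_kernel_one hα hn).comp_smul (by positivity)).const_mul _

theorem exists_norm_kernel_le (α t : ℝ) :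
    ∃ C : ℝ, 0 ≤ C ∧ ∀ x, ‖kernel n α t x‖ ≤ C := by
  refine ⟨∫ ξ, ‖symbol (n := n) α t ξ‖, by positivity, fun x => ?_⟩
  refine (Complex.abs_re_le_norm _).trans ?_
  rw [Real.fourierInv_eq_fourier_neg]
  exact VectorFourier.norm_fourierIntegral_le_integral_norm _ _ _ _ _

theorem integrable_fourierInv_symbol (hα : 0 < α) (hn : 0 < n) {t : ℝ} (ht : 0 < t) :
    Integrable (𝓕⁻ (symbol (n := n) α t)) := by
  have := Complex.ofRealCLM.integrable_comp (integrable_kernel hα hn ht)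
  simp only [Complex.ofRealCLM_apply] at this
  rwa [show (fun x => ((kernel n α t x : ℝ) : ℂ)) = 𝓕⁻ (symbol (n := n) α t) from
    funext fun x => ofReal_kernel t x] at this

theorem integrable_fourier_of_inv {f : Sp n → ℂ} (h : Integrable (𝓕⁻ f)) : Integrable (𝓕 f) := by
  have : 𝓕 f = fun x => 𝓕⁻ f (-x) := by
    funext x; rw [Real.fourierInv_eq_fourier_neg, neg_neg]
  rw [this]; exact h.comp_neg

theorem fourier_kernel (hα : 0 < α) (hn : 0 < n) {t : ℝ} (ht : 0 < t) :
    𝓕 (fun x => ((kernel n α t x : ℝ) : ℂ)) = symbol (n := n) α t := by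
  rw [show (fun x => ((kernel n α t x : ℝ) : ℂ)) = 𝓕⁻ (symbol (n := n) α t) from
    funext fun x => ofReal_kernel t x]
  exact (continuous_symbol hα t).fourier_fourierInv_eq (integrable_symbol hα ht)
    (integrable_fourier_of_inv (integrable_fourierInv_symbol hα hn ht))

/-- The mass is the value of the symbol at the frequency zero. -/
theorem integral_kernel (hα : 0 < α) (hn : 0 < n) {t : ℝ} (ht : 0 < t) :
    ∫ x, kernel n α t x = 1 := by
  have h := congrFun (fourier_kernel hα hn ht) (0 : Sp n)
  rw [Real.fourier_eq] at h
  simp only [inner_zero_right, neg_zero, AddChar.map_zero_eq_one, one_smul, symbol, norm_zero,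
    mul_zero] at h
  rw [Real.zero_rpow (by positivity), mul_zero, neg_zero, Real.exp_zero, integral_complex_ofReal] at h
  exact_mod_cast h

/-- The semigroup property, on the level of kernels. -/
theorem integral_kernel_mul_kernel (hα : 0 < α) (hn : 0 < n) {t s : ℝ} (ht : 0 < t) (hs : 0 < s)
    (x : Sp n) : ∫ y, kernel n α t (x - y) * kernel n α s y = kernel n α (t + s) x := by
  set kt : Sp n → ℂ := fun x => ((kernel n α t x : ℝ) : ℂ) with hkt
  set ks : Sp n → ℂ := fun x => ((kernel n α s x : ℝ) : ℂ) with hks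
  have hti : Integrable kt := (integrable_kernel hα hn ht).ofReal
  have hsi : Integrable ks := (integrable_kernel hα hn hs).ofReal
  have htc : Continuous kt := Complex.continuous_ofReal.comp (continuous_kernel hα ht)
  have hsc : Continuous ks := Complex.continuous_ofReal.comp (continuous_kernel hα hs)
  set L := ContinuousLinearMap.mul ℂ ℂ
  -- On the Fourier side the symbols multiply. The convolution is continuous, so inversion yields
  -- the identity at every point and not only almost everywhere.
  have hconv : convolution ks kt L volume = 𝓕⁻ (symbol (n := n) α (t + s)) := by
    have hF : 𝓕 (convolution ks kt L volume) = symbol (n := n) α (t + s) := by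
      funext ξ
      rw [Real.fourier_mul_convolution_eq hsi hti, fourier_kernel hα hn ht,
        fourier_kernel hα hn hs, symbol, symbol, symbol, ← Complex.ofReal_mul, ← Real.exp_add]
      congr 2
      ring
    have hC : Continuous (convolution ks kt L volume) := by
      refine BddAbove.continuous_convolution_right_of_integrable L ?_ hsi htc
      obtain ⟨C, -, hC⟩ := exists_norm_kernel_le (n := n) α t
      refine ⟨C, ?_⟩
      rintro _ ⟨y, rfl⟩
      simpa [hkt] using hC y
    have hI : Integrable (convolution ks kt L volume) := hsi.integrable_convolution L hti
    rw [← hF]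
    refine (hC.fourierInv_fourier_eq hI ?_).symm
    rw [hF]
    exact integrable_symbol hα (by positivity)
  have h := congrFun hconv x
  rw [← ofReal_kernel, convolution_def] at h
  have h2 : ∫ y, L (ks y) (kt (x - y)) = ((∫ y, kernel n α t (x - y) * kernel n α s y : ℝ) : ℂ) := by
    rw [← integral_complex_ofReal]
    congr 1
    funext y
    simp [L, hkt, hks, mul_comm]
  rw [h2] at h
  exact_mod_cast h

end Kernel

end KernelBounds

/-! ### Lebesgue norms of functions with values in [0, ∞]: Hölder, Minkowski, Fatou. -/

section LNorm

variable {X Y : Type*} [MeasurableSpace X] [MeasurableSpace Y] {μ : Measure X} {ν : Measure Y}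

/-- The `L^p` norm, `0 < p < ∞`, of a function with values in `[0, ∞]`. -/
noncomputable def lnorm (p : ℝ) (μ : Measure X) (g : X → ℝ≥0∞) : ℝ≥0∞ :=
  (∫⁻ x, g x ^ p ∂μ) ^ (1 / p)

theorem lnorm_mono_ae {p : ℝ} (hp : 0 < p) {f g : X → ℝ≥0∞} (h : ∀ᵐ x ∂μ, f x ≤ g x) :
    lnorm p μ f ≤ lnorm p μ g := by
  refine ENNReal.rpow_le_rpow (lintegral_mono_ae ?_) (by positivity)
  filter_upwards [h] with x hx using ENNReal.rpow_le_rpow hx hp.le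

theorem lnorm_mono {p : ℝ} (hp : 0 < p) {f g : X → ℝ≥0∞} (h : ∀ x, f x ≤ g x) :
    lnorm p μ f ≤ lnorm p μ g := lnorm_mono_ae hp (ae_of_all _ h)

theorem lnorm_congr_ae (p : ℝ) {f g : X → ℝ≥0∞} (h : ∀ᵐ x ∂μ, f x = g x) :
    lnorm p μ f = lnorm p μ g := by
  unfold lnorm
  congr 1
  refine lintegral_congr_ae ?_
  filter_upwards [h] with x hx
  rw [hx]

theorem lnorm_rpow_self {p : ℝ} (hp : 0 < p) (g : X → ℝ≥0∞) :
    lnorm p μ g ^ p = ∫⁻ x, g x ^ p ∂μ := by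
  rw [lnorm, ← ENNReal.rpow_mul, one_div_mul_cancel hp.ne', ENNReal.rpow_one]

theorem lnorm_zero {p : ℝ} (hp : 0 < p) : lnorm p μ (fun _ => 0) = 0 := by
  simp [lnorm, hp]

theorem lnorm_add_le {p : ℝ} (hp : 1 ≤ p) {f g : X → ℝ≥0∞} (hf : AEMeasurable f μ)
    (hg : AEMeasurable g μ) : lnorm p μ (fun x => f x + g x) ≤ lnorm p μ f + lnorm p μ g :=
  ENNReal.lintegral_Lp_add_le hf hg hp

theorem lnorm_const_mul {p : ℝ} (hp : 0 < p) {c : ℝ≥0∞} (hc : c ≠ ∞) (g : X → ℝ≥0∞) :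
    lnorm p μ (fun x => c * g x) = c * lnorm p μ g := by
  unfold lnorm
  simp_rw [ENNReal.mul_rpow_of_nonneg _ _ hp.le]
  rw [lintegral_const_mul' _ _ (ENNReal.rpow_ne_top_of_nonneg hp.le hc),
    ENNReal.mul_rpow_of_nonneg _ _ (by positivity), ← ENNReal.rpow_mul,
    mul_one_div_cancel hp.ne', ENNReal.rpow_one]

theorem lnorm_rpow {p b : ℝ} (hp : 0 < p) (hb : 0 < b) (g : X → ℝ≥0∞) :
    lnorm p μ (fun x => g x ^ b) = lnorm (p * b) μ g ^ b := by
  unfold lnorm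
  simp_rw [← ENNReal.rpow_mul]
  congr 2
  · simp_rw [mul_comm]
  · field_simp

theorem lnorm_mul_le {p q s : ℝ} (hq : 0 < q) (hs : 0 < s) (h : 1 / p = 1 / q + 1 / s)
    {f g : X → ℝ≥0∞} (hf : AEMeasurable f μ) (hg : AEMeasurable g μ) :
    lnorm p μ (fun x => f x * g x) ≤ lnorm q μ f * lnorm s μ g := by
  have h1 : 0 < 1 / q := by positivity
  have h2 : 0 < 1 / s := by positivity
  have hp : 0 < p := one_div_pos.1 (by linarith)
  have hpq : p < q := (one_div_lt_one_div hq hp).1 (by linarith)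
  exact ENNReal.lintegral_Lp_mul_le_Lq_mul_Lr hp hpq h μ hf hg

/-- Interpolation of Lebesgue norms. -/
theorem lnorm_interpolate {p q s θ : ℝ} (hq : 0 < q) (hs : 0 < s) (h0 : 0 < θ)
    (h1 : θ < 1) (h : 1 / p = (1 - θ) / q + θ / s) {g : X → ℝ≥0∞} (hg : AEMeasurable g μ) :
    lnorm p μ g ≤ lnorm q μ g ^ (1 - θ) * lnorm s μ g ^ θ := by
  have h2 : 0 < 1 - θ := by linarith
  have e : ∀ x, g x = g x ^ (1 - θ) * g x ^ θ := fun x => by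
    rw [← ENNReal.rpow_add_of_nonneg _ _ h2.le h0.le, sub_add_cancel, ENNReal.rpow_one]
  have := lnorm_mul_le (μ := μ) (p := p) (q := q / (1 - θ)) (s := s / θ) (by positivity)
    (by positivity) (by rw [h]; simp) (hg.pow_const (1 - θ)) (hg.pow_const θ)
  rw [lnorm_rpow (by positivity) h2, lnorm_rpow (by positivity) h0, div_mul_cancel₀ _ h2.ne',
    div_mul_cancel₀ _ h0.ne'] at this
  simpa [← e] using this

/-- The cancellation at the end of the duality proof of Minkowski's inequality; it is legitimate
only for finite H. -/
theorem le_of_le_mul_rpow {H A : ℝ≥0∞} {p : ℝ} (hp : 1 ≤ p) (hH : H ≠ ∞)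
    (h : H ≤ A * H ^ (1 - 1 / p)) : H ^ (1 / p) ≤ A := by
  have hp0 : 0 < p := by linarith
  rcases eq_or_ne H 0 with rfl | h0
  · rw [ENNReal.zero_rpow_of_pos (by positivity)]; exact zero_le
  have h1 : H ^ (1 / p) * H ^ (1 - 1 / p) = H := by
    rw [← ENNReal.rpow_add _ _ h0 hH]; simp
  have hne : H ^ (1 - 1 / p) ≠ 0 := by
    intro hh
    rw [hh, mul_zero] at h1
    exact h0 h1.symm
  have hnt : H ^ (1 - 1 / p) ≠ ∞ := ENNReal.rpow_ne_top_of_ne_zero h0 hH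
  rw [← h1] at h
  rw [h1] at h
  have h3 : H ^ (1 / p) * H ^ (1 - 1 / p) ≤ A * H ^ (1 - 1 / p) := by rw [h1]; exact h
  exact (ENNReal.mul_le_mul_iff_left hne hnt).1 h3

/-- Minkowski's integral inequality. -/
theorem lnorm_lintegral_le [SigmaFinite μ] [SFinite ν] {p : ℝ} (hp : 1 ≤ p) {F : X → Y → ℝ≥0∞}
    (hF : Measurable (Function.uncurry F)) :
    lnorm p μ (fun x => ∫⁻ y, F x y ∂ν) ≤ ∫⁻ y, lnorm p μ (fun x => F x y) ∂ν := by
  have hp0 : 0 < p := by linarith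
  set A := ∫⁻ y, lnorm p μ (fun x => F x y) ∂ν with hA
  set I : X → ℝ≥0∞ := fun x => ∫⁻ y, F x y ∂ν with hI
  have hIm : Measurable I := hF.lintegral_prod_right
  have hinv : 0 ≤ 1 - 1 / p := by
    rw [sub_nonneg, div_le_one hp0]; exact hp
  -- For a minorant h of I with finite norm, bound ∫ h^p by ∫ I h^{p-1}, exchange the integrals and
  -- use Hölder in x; then cancel.
  have key : ∀ h : X → ℝ≥0∞, Measurable h → (∀ x, h x ≤ I x) → ∫⁻ x, h x ^ p ∂μ ≠ ∞ →
      (∫⁻ x, h x ^ p ∂μ) ^ (1 / p) ≤ A := by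
    intro h hm hle hfin
    refine le_of_le_mul_rpow hp hfin ?_
    have e : ∀ x, (h x ^ p) ^ (1 - 1 / p) = h x ^ (p - 1) := fun x => by
      rw [← ENNReal.rpow_mul]; congr 1; field_simp
    calc ∫⁻ x, h x ^ p ∂μ = ∫⁻ x, h x * h x ^ (p - 1) ∂μ := by
          refine lintegral_congr fun x => ?_
          conv_rhs => rw [← ENNReal.rpow_one (h x), ← ENNReal.rpow_mul, one_mul]
          rw [← ENNReal.rpow_add_of_nonneg _ _ zero_le_one (by linarith)]
          congr 1; ring
      _ ≤ ∫⁻ x, I x * h x ^ (p - 1) ∂μ := by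
          refine lintegral_mono fun x => ?_
          gcongr
          exact hle x
      _ = ∫⁻ x, ∫⁻ y, F x y * h x ^ (p - 1) ∂ν ∂μ := by
          refine lintegral_congr fun x => ?_
          exact (lintegral_mul_const _ (hF.comp measurable_prodMk_left)).symm
      _ = ∫⁻ y, ∫⁻ x, F x y * h x ^ (p - 1) ∂μ ∂ν := by
          refine lintegral_lintegral_swap ?_
          exact (hF.mul ((hm.comp measurable_fst).pow_const _)).aemeasurable
      _ ≤ ∫⁻ y, lnorm p μ (fun x => F x y) * (∫⁻ x, h x ^ p ∂μ) ^ (1 - 1 / p) ∂ν := by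
          refine lintegral_mono fun y => ?_
          have := ENNReal.lintegral_mul_norm_pow_le (μ := μ) (f := fun x => F x y ^ p)
            (g := fun x => h x ^ p) (p := 1 / p) (q := 1 - 1 / p)
            ((hF.comp measurable_prodMk_right).pow_const p).aemeasurable
            (hm.pow_const p).aemeasurable (by positivity) hinv (by ring)
          refine le_trans (le_of_eq ?_) this
          refine lintegral_congr fun x => ?_
          rw [e, ← ENNReal.rpow_mul, mul_one_div_cancel hp0.ne', ENNReal.rpow_one]
      _ = A * (∫⁻ x, h x ^ p ∂μ) ^ (1 - 1 / p) := by
          rw [lintegral_mul_const' _ _ (ENNReal.rpow_ne_top_of_nonneg hinv hfin)]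
  -- Finiteness of the norm is enforced by truncating I at height k on a set of finite measure;
  -- monotone convergence removes the truncation.
  let S := spanningSets μ
  let h : ℕ → X → ℝ≥0∞ := fun k => (S k).indicator (fun x => min (I x) k)
  have hhm : ∀ k, Measurable (h k) := fun k =>
    (hIm.min measurable_const).indicator (measurableSet_spanningSets μ k)
  have hmono : Monotone h := by
    intro k l hkl x
    simp only [h]
    by_cases hx : x ∈ S k
    · rw [indicator_of_mem hx, indicator_of_mem (monotone_spanningSets μ hkl hx)]
      exact min_le_min le_rfl (by exact_mod_cast hkl)
    · rw [indicator_of_notMem hx]; exact zero_le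
  have hle : ∀ k x, h k x ≤ I x := by
    intro k x
    simp only [h]
    by_cases hx : x ∈ S k
    · rw [indicator_of_mem hx]; exact min_le_left _ _
    · rw [indicator_of_notMem hx]; exact zero_le
  have hsup : ∀ x, I x = ⨆ k, h k x := by
    intro x
    apply le_antisymm
    · refine le_of_forall_lt fun c hc => ?_
      obtain ⟨k, hk⟩ : ∃ k, x ∈ S k := by
        have := iUnion_spanningSets μ
        have hx : x ∈ ⋃ i, spanningSets μ i := by rw [this]; trivial
        exact mem_iUnion.1 hx
      obtain ⟨l, hl⟩ := ENNReal.exists_nat_gt (lt_top_of_lt hc).ne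
      refine lt_of_lt_of_le ?_ (le_iSup (fun k => h k x) (max k l))
      simp only [h]
      rw [indicator_of_mem (monotone_spanningSets μ (le_max_left k l) hk)]
      refine lt_min hc (hl.trans_le ?_)
      exact_mod_cast le_max_right k l
    · exact iSup_le fun k => hle k x
  have hfin : ∀ k, ∫⁻ x, h k x ^ p ∂μ ≠ ∞ := by
    intro k
    refine (lt_of_le_of_lt (b := ∫⁻ x, (S k).indicator (fun _ => (k : ℝ≥0∞) ^ p) x ∂μ)
      (lintegral_mono fun x => ?_) ?_).ne
    · simp only [h]
      by_cases hx : x ∈ S k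
      · rw [indicator_of_mem hx, indicator_of_mem hx]
        exact ENNReal.rpow_le_rpow (min_le_right _ _) hp0.le
      · rw [indicator_of_notMem hx, indicator_of_notMem hx, ENNReal.zero_rpow_of_pos hp0]
    · rw [lintegral_indicator_const (measurableSet_spanningSets μ k)]
      exact ENNReal.mul_lt_top
        (ENNReal.rpow_lt_top_of_nonneg hp0.le (ENNReal.natCast_ne_top k))
        (measure_spanningSets_lt_top μ k)
  have hlim : ∫⁻ x, I x ^ p ∂μ = ⨆ k, ∫⁻ x, h k x ^ p ∂μ := by
    rw [← lintegral_iSup (fun k => (hhm k).pow_const p)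
      (fun k l hkl x => ENNReal.rpow_le_rpow (hmono hkl x) hp0.le)]
    refine lintegral_congr fun x => ?_
    rw [hsup x]
    exact (ENNReal.orderIsoRpow p hp0).map_iSup _
  rw [lnorm, one_div, ENNReal.rpow_inv_le_iff hp0, hlim]
  refine iSup_le fun k => ?_
  rw [← ENNReal.rpow_inv_le_iff hp0, ← one_div]
  exact key (h k) (hhm k) (hle k) (hfin k)

theorem lnorm_liminf_le {p : ℝ} (hp : 0 < p) {f : ℕ → X → ℝ≥0∞} (hf : ∀ k, Measurable (f k)) :
    lnorm p μ (fun x => liminf (fun k => f k x) atTop) ≤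
      liminf (fun k => lnorm p μ (f k)) atTop := by
  have h1 : ∀ x, (liminf (fun k => f k x) atTop) ^ p = liminf (fun k => f k x ^ p) atTop := by
    intro x
    exact (ENNReal.orderIsoRpow p hp).liminf_apply
  have h2 : ∀ a : ℕ → ℝ≥0∞, (liminf a atTop) ^ (1 / p) = liminf (fun k => a k ^ (1 / p)) atTop := by
    intro a
    exact (ENNReal.orderIsoRpow (1 / p) (by positivity)).liminf_apply
  unfold lnorm
  simp_rw [h1]
  rw [← h2]
  exact ENNReal.rpow_le_rpow (lintegral_liminf_le fun k => (hf k).pow_const p) (by positivity)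

end LNorm

/-! ### Young's convolution inequality. -/

section Young

variable {E : Type*} [NormedAddCommGroup E] [InnerProductSpace ℝ E] [FiniteDimensional ℝ E]
  [MeasurableSpace E] [BorelSpace E]

/-- Young's inequality for convolutions. -/
theorem lnorm_conv_le {p a s : ℝ} (ha : 1 ≤ a) (hs : 1 ≤ s) (hp : 0 < p)
    (h : 1 + 1 / p = 1 / a + 1 / s) {f g : E → ℝ≥0∞} (hf : Measurable f) (hg : Measurable g) :
    lnorm p volume (fun x => ∫⁻ y, f (x - y) * g y) ≤ lnorm a volume f * lnorm s volume g := by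
  have ha0 : 0 < a := by linarith
  have hs0 : 0 < s := by linarith
  have h1 : 1 / a ≤ 1 := by rw [div_le_one ha0]; exact ha
  have h2 : 1 / s ≤ 1 := by rw [div_le_one hs0]; exact hs
  have hw2 : 0 ≤ 1 / a - 1 / p := by linarith
  have hw3 : 0 ≤ 1 / s - 1 / p := by linarith
  have hw1 : 0 ≤ 1 / p := by positivity
  have hsub : ∀ x : E, Measurable fun y => f (x - y) := fun x =>
    hf.comp (measurable_const.sub measurable_id)
  set Fa := ∫⁻ x, f x ^ a with hFa
  set Gs := ∫⁻ x, g x ^ s with hGs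
  -- Hölder with three factors: fg = (f^a g^s)^{1/p} · (f^a)^{1/a-1/p} · (g^s)^{1/s-1/p}. The
  -- exponents add up to 1 by the hypothesis.
  have point : ∀ x, ∫⁻ y, f (x - y) * g y ≤
      (∫⁻ y, f (x - y) ^ a * g y ^ s) ^ (1 / p) *
        (Fa ^ (1 / a - 1 / p) * Gs ^ (1 / s - 1 / p)) := by
    intro x
    have := ENNReal.lintegral_prod_norm_pow_le (μ := (volume : Measure (E))) Finset.univ
      (f := ![fun y => f (x - y) ^ a * g y ^ s, fun y => f (x - y) ^ a, fun y => g y ^ s])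
      (p := ![1 / p, 1 / a - 1 / p, 1 / s - 1 / p])
      (by
        intro i _
        fin_cases i
        · exact (((hsub x).pow_const a).mul (hg.pow_const s)).aemeasurable
        · exact ((hsub x).pow_const a).aemeasurable
        · exact (hg.pow_const s).aemeasurable)
      (by simp only [Fin.sum_univ_three, Matrix.cons_val]
          linarith)
      (by
        intro i _
        fin_cases i
        · exact hw1
        · exact hw2
        · exact hw3)
    simp only [Fin.prod_univ_three, Matrix.cons_val_zero, Matrix.cons_val_one,
      Matrix.cons_val] at this
    have e1 : ∫⁻ y, f (x - y) ^ a = Fa := lintegral_sub_left_eq_self (fun y => f y ^ a) x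
    rw [e1, mul_assoc] at this
    refine le_trans (le_of_eq (lintegral_congr fun y => ?_)) this
    rw [ENNReal.mul_rpow_of_nonneg _ _ hw1, ← ENNReal.rpow_mul, ← ENNReal.rpow_mul,
      ← ENNReal.rpow_mul, ← ENNReal.rpow_mul]
    have e2 : f (x - y) ^ (a * (1 / p)) * f (x - y) ^ (a * (1 / a - 1 / p)) = f (x - y) := by
      rw [← ENNReal.rpow_add_of_nonneg _ _ (by positivity) (by positivity)]
      rw [← mul_add, add_sub_cancel, mul_one_div_cancel ha0.ne', ENNReal.rpow_one]
    have e3 : g y ^ (s * (1 / p)) * g y ^ (s * (1 / s - 1 / p)) = g y := by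
      rw [← ENNReal.rpow_add_of_nonneg _ _ (by positivity) (by positivity)]
      rw [← mul_add, add_sub_cancel, mul_one_div_cancel hs0.ne', ENNReal.rpow_one]
    conv_lhs => rw [← e2, ← e3]
    ring
  have hm : Measurable fun z : E × E => f (z.1 - z.2) ^ a * g z.2 ^ s :=
    ((hf.comp (measurable_fst.sub measurable_snd)).pow_const a).mul
      ((hg.comp measurable_snd).pow_const s)
  have htot : ∫⁻ x, ∫⁻ y, f (x - y) ^ a * g y ^ s = Fa * Gs := by
    rw [lintegral_lintegral_swap hm.aemeasurable, ← lintegral_const_mul _ (hg.pow_const s)]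
    refine lintegral_congr fun y => ?_
    have h1 : Measurable fun x => f (x - y) ^ a :=
      (hf.comp (measurable_id.sub measurable_const)).pow_const a
    rw [lintegral_mul_const _ h1]
    congr 1
    exact lintegral_sub_right_eq_self (fun x => f x ^ a) y
  set D := Fa ^ (1 / a - 1 / p) * Gs ^ (1 / s - 1 / p) with hD
  calc lnorm p volume (fun x => ∫⁻ y, f (x - y) * g y)
      ≤ lnorm p volume (fun x => (∫⁻ y, f (x - y) ^ a * g y ^ s) ^ (1 / p) * D) :=
        lnorm_mono hp point
    _ = (∫⁻ x, (∫⁻ y, f (x - y) ^ a * g y ^ s) * D ^ p) ^ (1 / p) := by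
        unfold lnorm
        congr 1
        refine lintegral_congr fun x => ?_
        rw [ENNReal.mul_rpow_of_nonneg _ _ hp.le, ← ENNReal.rpow_mul,
          one_div_mul_cancel hp.ne', ENNReal.rpow_one]
    _ = (Fa * Gs * D ^ p) ^ (1 / p) := by
        rw [lintegral_mul_const _ hm.lintegral_prod_right', htot]
    _ = (Fa ^ (1 / p) * Fa ^ (1 / a - 1 / p)) * (Gs ^ (1 / p) * Gs ^ (1 / s - 1 / p)) := by
        rw [ENNReal.mul_rpow_of_nonneg _ _ hw1, ENNReal.mul_rpow_of_nonneg _ _ hw1,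
          ← ENNReal.rpow_mul, mul_one_div_cancel hp.ne', ENNReal.rpow_one, hD]
        ring
    _ = lnorm a volume f * lnorm s volume g := by
        rw [← ENNReal.rpow_add_of_nonneg _ _ hw1 hw2, ← ENNReal.rpow_add_of_nonneg _ _ hw1 hw3,
          add_sub_cancel, add_sub_cancel]
        rfl

end Young

/-! ### Smoothing estimates and strong continuity of the semigroup. -/

section Smoothing

variable {n : ℕ} {α : ℝ}

theorem measurable_kernel (n : ℕ) (α : ℝ) :
    Measurable (fun z : ℝ × Sp n => kernel n α z.1 z.2) := by
  refine Complex.measurable_re.comp ?_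
  simp_rw [Real.fourierInv_eq']
  refine StronglyMeasurable.measurable ?_
  refine StronglyMeasurable.integral_prod_right
    (f := fun (z : ℝ × Sp n) (v : Sp n) =>
      Complex.exp ((2 * Real.pi * inner ℝ v z.2 : ℝ) * Complex.I) •
      ((Real.exp (-(z.1 * (2 * Real.pi * ‖v‖) ^ (2 * α))) : ℝ) : ℂ)) ?_
  refine Measurable.stronglyMeasurable ?_
  unfold Function.uncurry
  fun_prop

/-- The positive operator `g ↦ |K_t| * g`, which dominates the semigroup. -/
noncomputable def heatMaj (n : ℕ) (α t : ℝ) (g : Sp n → ℝ≥0∞) (x : Sp n) : ℝ≥0∞ :=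
  ∫⁻ y, ‖kernel n α t (x - y)‖ₑ * g y

theorem measurable_enorm_kernel (n : ℕ) (α t : ℝ) :
    Measurable (fun x : Sp n => ‖kernel n α t x‖ₑ) :=
  ((measurable_kernel n α).comp measurable_prodMk_left).enorm

theorem heatMaj_mono_ae {t : ℝ} {f g : Sp n → ℝ≥0∞} (h : ∀ᵐ y, f y ≤ g y) (x : Sp n) :
    heatMaj n α t f x ≤ heatMaj n α t g x := by
  refine lintegral_mono_ae ?_
  filter_upwards [h] with y hy
  gcongr

theorem heatMaj_add {t : ℝ} {f g : Sp n → ℝ≥0∞} (hf : Measurable f) (x : Sp n) :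
    heatMaj n α t (fun y => f y + g y) x = heatMaj n α t f x + heatMaj n α t g x := by
  unfold heatMaj
  simp_rw [mul_add]
  exact lintegral_add_left (((measurable_enorm_kernel n α t).comp
    (measurable_const.sub measurable_id)).mul hf) _

theorem heatMaj_const_mul {t : ℝ} {c : ℝ≥0∞} (hc : c ≠ ∞) (g : Sp n → ℝ≥0∞) (x : Sp n) :
    heatMaj n α t (fun y => c * g y) x = c * heatMaj n α t g x := by
  unfold heatMaj
  rw [← lintegral_const_mul' _ _ hc]
  refine lintegral_congr fun y => ?_
  ring

theorem measurable_heatMaj {n : ℕ} {α t : ℝ} {g : Sp n → ℝ≥0∞} (hg : Measurable g) :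
    Measurable (heatMaj n α t g) := by
  refine Measurable.lintegral_prod_right' (f := fun z : Sp n × Sp n =>
    ‖kernel n α t (z.1 - z.2)‖ₑ * g z.2) ?_
  exact ((measurable_enorm_kernel n α t).comp (measurable_fst.sub measurable_snd)).mul
    (hg.comp measurable_snd)

theorem measurable_heatMaj_uncurry {n : ℕ} {α : ℝ} {g : ℝ × Sp n → ℝ≥0∞} (hg : Measurable g) :
    Measurable (fun z : (ℝ × ℝ) × Sp n => heatMaj n α (z.1.1 - z.1.2) (fun y => g (z.1.2, y)) z.2) := by
  refine Measurable.lintegral_prod_right' (f := fun w : ((ℝ × ℝ) × Sp n) × Sp n =>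
    ‖kernel n α (w.1.1.1 - w.1.1.2) (w.1.2 - w.2)‖ₑ * g (w.1.1.2, w.2)) ?_
  refine Measurable.mul ?_ ?_
  · refine ((measurable_kernel n α).comp (?_ : Measurable fun w : ((ℝ × ℝ) × Sp n) × Sp n =>
      (w.1.1.1 - w.1.1.2, w.1.2 - w.2))).enorm
    fun_prop
  · refine hg.comp (?_ : Measurable fun w : ((ℝ × ℝ) × Sp n) × Sp n => (w.1.1.2, w.2))
    fun_prop

/-- Bounded and integrable functions lie in every L^a with a ≥ 1. -/
theorem lnorm_kernel_one_ne_top (hα : 0 < α) (hn : 0 < n) {a : ℝ} (ha : 1 ≤ a) :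
    lnorm a volume (fun x : Sp n => ‖kernel n α 1 x‖ₑ) ≠ ∞ := by
  obtain ⟨C, hC0, hC⟩ := exists_norm_kernel_le (n := n) α 1
  refine ENNReal.rpow_ne_top_of_nonneg (by positivity) ?_
  have h1 := (integrable_kernel_one (n := n) hα hn).2
  have h2 : ∀ x : Sp n, ‖kernel n α 1 x‖ₑ ^ a ≤ ENNReal.ofReal C ^ (a - 1) * ‖kernel n α 1 x‖ₑ := by
    intro x
    have e : ‖kernel n α 1 x‖ₑ ^ a = ‖kernel n α 1 x‖ₑ ^ (a - 1) * ‖kernel n α 1 x‖ₑ := by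
      conv_rhs => rw [← ENNReal.rpow_one (‖kernel n α 1 x‖ₑ), ← ENNReal.rpow_mul, one_mul]
      rw [← ENNReal.rpow_add_of_nonneg _ _ (by linarith) zero_le_one, sub_add_cancel]
    rw [e]
    gcongr
    rw [← ofReal_norm]
    exact ENNReal.ofReal_le_ofReal (hC x)
  refine ((lintegral_mono h2).trans_lt ?_).ne
  rw [lintegral_const_mul' _ _ (ENNReal.rpow_ne_top_of_nonneg (by linarith) ENNReal.ofReal_ne_top)]
  exact ENNReal.mul_lt_top (ENNReal.rpow_lt_top_of_nonneg (by linarith) ENNReal.ofReal_ne_top) h1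

theorem lnorm_kernel (hα : 0 < α) {t : ℝ} (ht : 0 < t) {a : ℝ} (ha : 1 ≤ a) :
    lnorm a volume (fun x : Sp n => ‖kernel n α t x‖ₑ) =
      ENNReal.ofReal (t ^ (-(n / (2 * α) * (1 - 1 / a)))) *
        lnorm a volume (fun x : Sp n => ‖kernel n α 1 x‖ₑ) := by
  have ha0 : 0 < a := by linarith
  set s := t ^ (1 / (2 * α)) with hs
  have hs0 : 0 < s := by positivity
  have e : ∀ x : Sp n, ‖kernel n α t x‖ₑ = ENNReal.ofReal ((s ^ n)⁻¹) * ‖kernel n α 1 (s⁻¹ • x)‖ₑ := by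
    intro x
    rw [kernel_eq hα ht, enorm_mul, Real.enorm_of_nonneg (by positivity)]
  simp_rw [e]
  rw [lnorm_const_mul ha0 ENNReal.ofReal_ne_top]
  unfold lnorm
  rw [lintegral_comp_smul (fun x => ‖kernel n α 1 x‖ₑ ^ a) (inv_pos.2 hs0),
    ENNReal.mul_rpow_of_nonneg _ _ (by positivity), ← mul_assoc,
    ENNReal.ofReal_rpow_of_pos (by positivity), ← ENNReal.ofReal_mul (by positivity)]
  congr 2
  rw [inv_pow, inv_inv, ← Real.rpow_natCast, ← Real.rpow_neg hs0.le, ← Real.rpow_mul hs0.le,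
    ← Real.rpow_add hs0, hs, ← Real.rpow_mul ht.le]
  congr 1
  field_simp
  ring

/-- The smoothing estimate `‖|K_t| * g‖_p ≤ C t^{-n/(2α)(1/s-1/p)} ‖g‖_s`. -/
theorem exists_lnorm_heatMaj_le (hα : 0 < α) (hn : 0 < n) {s p : ℝ} (hs : 1 ≤ s) (hsp : s ≤ p) :
    ∃ C : ℝ≥0, ∀ t : ℝ, 0 < t → ∀ g : Sp n → ℝ≥0∞, Measurable g →
      lnorm p volume (heatMaj n α t g) ≤
        C * ENNReal.ofReal (t ^ (-(n / (2 * α) * (1 / s - 1 / p)))) * lnorm s volume g := by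
  have hs0 : 0 < s := by linarith
  have hp0 : 0 < p := by linarith
  have h1 : 1 / s ≤ 1 := by rw [div_le_one hs0]; exact hs
  have h2 : 1 / p ≤ 1 / s := one_div_le_one_div_of_le hs0 hsp
  have h3 : 0 < 1 / p := by positivity
  have hw : 0 < 1 + 1 / p - 1 / s := by linarith
  -- The kernel exponent in Young's inequality; a ≥ 1 because s ≤ p.
  set a := 1 / (1 + 1 / p - 1 / s) with ha
  have ha1 : 1 ≤ a := by rw [ha, le_div_iff₀ hw]; linarith
  have hainv : 1 / a = 1 + 1 / p - 1 / s := by rw [ha, one_div_one_div]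
  refine ⟨(lnorm a volume (fun x : Sp n => ‖kernel n α 1 x‖ₑ)).toNNReal, fun t ht g hg => ?_⟩
  rw [ENNReal.coe_toNNReal (lnorm_kernel_one_ne_top hα hn ha1)]
  have := lnorm_conv_le ha1 hs hp0 (by rw [hainv]; ring) (measurable_enorm_kernel n α t) hg
  refine this.trans (le_of_eq ?_)
  rw [lnorm_kernel hα ht ha1, hainv]
  ring_nf

end Smoothing

section Semigroup

variable {n : ℕ} {α : ℝ} {𝕜 : Type*} [RCLike 𝕜]

theorem eLpNorm_eq_lnorm {p : ℝ} (hp : 0 < p) (f : Sp n → 𝕜) :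
    eLpNorm f (ENNReal.ofReal p) volume = lnorm p volume (fun x => ‖f x‖ₑ) := by
  rw [eLpNorm_eq_lintegral_rpow_enorm_toReal (by simpa using hp) ENNReal.ofReal_ne_top,
    ENNReal.toReal_ofReal hp.le]
  rfl

theorem semigroup_of_pos {t : ℝ} (ht : 0 < t) (g : Sp n → 𝕜) (x : Sp n) :
    semigroup α t g x = ∫ y, kernel n α t (x - y) • g y := by
  rw [semigroup, if_neg ht.ne']

theorem enorm_semigroup_le {t : ℝ} (ht : 0 < t) (g : Sp n → 𝕜) (x : Sp n) :
    ‖semigroup α t g x‖ₑ ≤ heatMaj n α t (fun y => ‖g y‖ₑ) x := by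
  rw [semigroup_of_pos ht]
  refine (enorm_integral_le_lintegral_enorm _).trans (le_of_eq ?_)
  simp_rw [enorm_smul]
  rfl

theorem semigroup_congr_ae {t : ℝ} (ht : 0 < t) {f g : Sp n → 𝕜} (h : ∀ᵐ y, f y = g y) (x : Sp n) :
    semigroup α t f x = semigroup α t g x := by
  rw [semigroup_of_pos ht, semigroup_of_pos ht]
  refine integral_congr_ae ?_
  filter_upwards [h] with y hy
  rw [hy]

theorem integrable_kernel_smul {t : ℝ} {g : Sp n → 𝕜} (hg : Measurable g) {x : Sp n}
    (h : heatMaj n α t (fun y => ‖g y‖ₑ) x < ∞) :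
    Integrable (fun y => kernel n α t (x - y) • g y) := by
  refine ⟨Measurable.aestronglyMeasurable ?_, ?_⟩
  · exact ((((measurable_kernel n α).comp measurable_prodMk_left).comp
      (measurable_const.sub measurable_id)).smul hg)
  · rw [HasFiniteIntegral]
    simp_rw [enorm_smul]
    exact h

theorem ae_lt_top_of_lnorm {X : Type*} [MeasurableSpace X] {μ : Measure X} {p : ℝ} (hp : 0 < p)
    {g : X → ℝ≥0∞} (hg : Measurable g) (h : lnorm p μ g ≠ ∞) : ∀ᵐ x ∂μ, g x < ∞ := by
  have h1 : ∫⁻ x, g x ^ p ∂μ ≠ ∞ := by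
    rw [← lnorm_rpow_self hp]
    exact ENNReal.rpow_ne_top_of_nonneg hp.le h
  filter_upwards [ae_lt_top (hg.pow_const p) h1] with x hx
  by_contra hc
  rw [not_lt, top_le_iff] at hc
  simp [hc, hp] at hx

/-- Continuity of translations in `L^r`. -/
theorem tendsto_lnorm_translate {r : ℝ} (hr : 1 ≤ r) {φ : Sp n → 𝕜} (hφ : Measurable φ)
    (hφr : lnorm r volume (fun x => ‖φ x‖ₑ) ≠ ∞) :
    Tendsto (fun y => lnorm r volume (fun x => ‖φ (x - y) - φ x‖ₑ)) (𝓝 0) (𝓝 0) := by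
  have hr0 : 0 < r := by linarith
  have : Fact (1 ≤ ENNReal.ofReal r) := ⟨by simpa using hr⟩
  have hmem : MemLp φ (ENNReal.ofReal r) volume :=
    ⟨hφ.aestronglyMeasurable, by rw [eLpNorm_eq_lnorm hr0]; exact hφr.lt_top⟩
  set f := hmem.toLp φ with hf
  let g : C(Sp n, C(Sp n, Sp n)) := (ContinuousMap.mk (fun z : Sp n × Sp n => z.2 - z.1)
    (continuous_snd.sub continuous_fst)).curry
  have hgm : ∀ y, MeasurePreserving (g y) (volume : Measure (Sp n)) volume :=
    fun y => measurePreserving_sub_right volume y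
  have hcont : Continuous fun y => Lp.compMeasurePreserving (g y) (hgm y) f :=
    continuous_const.compMeasurePreservingLp g.continuous hgm ENNReal.ofReal_ne_top
  have h0 : Lp.compMeasurePreserving (g 0) (hgm 0) f = f := by
    refine Lp.ext ?_
    filter_upwards [Lp.coeFn_compMeasurePreserving f (hgm 0)] with x hx
    rw [hx]
    simp [g]
  have h1 := hcont.tendsto 0
  rw [h0, tendsto_iff_edist_tendsto_0] at h1
  refine h1.congr fun y => ?_
  rw [Lp.edist_def, eLpNorm_eq_lnorm hr0]
  refine lnorm_congr_ae r ?_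
  have h2 := (hgm y).quasiMeasurePreserving.ae (hmem.coeFn_toLp)
  filter_upwards [Lp.coeFn_compMeasurePreserving f (hgm y), h2, hmem.coeFn_toLp] with x hx h3 h4
  simp only [Pi.sub_apply]
  rw [hx, Function.comp_apply, hf, h3, h4]
  simp [g]

/-- Strong continuity of the semigroup at `t = 0`. -/
theorem tendsto_lnorm_semigroup_sub (hα : 0 < α) (hn : 0 < n) {r : ℝ} (hr : 1 ≤ r)
    {φ : Sp n → 𝕜} (hφ : Measurable φ) (hφr : lnorm r volume (fun x => ‖φ x‖ₑ) ≠ ∞) :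
    Tendsto (fun t => lnorm r volume (fun x => ‖semigroup α t φ x - φ x‖ₑ)) (𝓝[>] 0) (𝓝 0) := by
  have hr0 : 0 < r := by linarith
  set ω : Sp n → ℝ≥0∞ := fun y => lnorm r volume (fun x => ‖φ (x - y) - φ x‖ₑ) with hω
  have hjm : Measurable fun z : Sp n × Sp n => ‖φ (z.1 - z.2) - φ z.1‖ₑ :=
    ((hφ.comp (measurable_fst.sub measurable_snd)).sub (hφ.comp measurable_fst)).enorm
  have hωm : Measurable ω := by
    have : Measurable fun z : Sp n × Sp n => ‖φ (z.2 - z.1) - φ z.2‖ₑ ^ r :=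
      (hjm.comp measurable_swap).pow_const r
    exact (this.lintegral_prod_right').pow_const _
  set N := lnorm r volume (fun x => ‖φ x‖ₑ) with hN
  have hωle : ∀ y, ω y ≤ N + N := by
    intro y
    have h1 : Measurable fun x => ‖φ (x - y)‖ₑ :=
      (hφ.comp (measurable_id.sub measurable_const)).enorm
    calc ω y ≤ lnorm r volume (fun x => ‖φ (x - y)‖ₑ + ‖φ x‖ₑ) :=
          lnorm_mono hr0 fun x => enorm_sub_le
      _ ≤ lnorm r volume (fun x => ‖φ (x - y)‖ₑ) + N :=
          lnorm_add_le hr h1.aemeasurable hφ.enorm.aemeasurable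
      _ = N + N := by
          congr 1
          unfold N lnorm
          congr 1
          exact lintegral_sub_right_eq_self (fun x => ‖φ x‖ₑ ^ r) y
  have hω0 : Tendsto ω (𝓝 0) (𝓝 0) := tendsto_lnorm_translate hr hφ hφr
  -- As K_t has mass one, S(t)φ - φ is the average of φ(·-y) - φ against K_t(y). Minkowski and
  -- rescaling of y turn its norm into an integral against the fixed kernel K_1.
  have hbound : ∀ t : ℝ, 0 < t → lnorm r volume (fun x => ‖semigroup α t φ x - φ x‖ₑ) ≤
      ∫⁻ z, ‖kernel n α 1 z‖ₑ * ω (t ^ (1 / (2 * α)) • z) := by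
    intro t ht
    set s := t ^ (1 / (2 * α)) with hs
    have hs0 : 0 < s := by positivity
    have hfin : ∀ᵐ x, heatMaj n α t (fun y => ‖φ y‖ₑ) x < ∞ := by
      refine ae_lt_top_of_lnorm hr0 (measurable_heatMaj hφ.enorm) ?_
      obtain ⟨C, hC⟩ := exists_lnorm_heatMaj_le hα hn hr le_rfl
      exact ((hC t ht _ hφ.enorm).trans_lt (ENNReal.mul_lt_top
        (ENNReal.mul_lt_top ENNReal.coe_lt_top ENNReal.ofReal_lt_top) hφr.lt_top)).ne
    have hpt : ∀ᵐ x, ‖semigroup α t φ x - φ x‖ₑ ≤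
        ∫⁻ y, ‖kernel n α t y‖ₑ * ‖φ (x - y) - φ x‖ₑ := by
      filter_upwards [hfin] with x hx
      have hi := integrable_kernel_smul hφ hx
      have hi2 : Integrable fun y => kernel n α t y • φ (x - y) := by
        have := hi.comp_sub_left x
        simpa using this
      have e : semigroup α t φ x - φ x = ∫ y, kernel n α t y • (φ (x - y) - φ x) := by
        rw [semigroup_of_pos ht]
        have e1 : ∫ y, kernel n α t (x - y) • φ y = ∫ y, kernel n α t y • φ (x - y) := by
          rw [← integral_sub_left_eq_self (fun y => kernel n α t (x - y) • φ y) volume x]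
          simp
        simp_rw [smul_sub]
        rw [integral_sub hi2 ((integrable_kernel hα hn ht).smul_const _), integral_smul_const,
          integral_kernel hα hn ht, one_smul, e1]
      rw [e]
      refine (enorm_integral_le_lintegral_enorm _).trans (le_of_eq ?_)
      simp_rw [enorm_smul]
    calc lnorm r volume (fun x => ‖semigroup α t φ x - φ x‖ₑ)
        ≤ lnorm r volume (fun x => ∫⁻ y, ‖kernel n α t y‖ₑ * ‖φ (x - y) - φ x‖ₑ) :=
          lnorm_mono_ae hr0 hpt
      _ ≤ ∫⁻ y, lnorm r volume (fun x => ‖kernel n α t y‖ₑ * ‖φ (x - y) - φ x‖ₑ) := by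
          refine lnorm_lintegral_le hr ?_
          exact ((measurable_enorm_kernel n α t).comp measurable_snd).mul hjm
      _ = ∫⁻ y, ‖kernel n α t y‖ₑ * ω y := by
          refine lintegral_congr fun y => ?_
          rw [lnorm_const_mul hr0 enorm_ne_top]
      _ = ∫⁻ y, ENNReal.ofReal ((s ^ n)⁻¹) *
            (‖kernel n α 1 (s⁻¹ • y)‖ₑ * ω (s • (s⁻¹ • y))) := by
          refine lintegral_congr fun y => ?_
          rw [kernel_eq hα ht, enorm_mul, Real.enorm_of_nonneg (by positivity), smul_smul,
            mul_inv_cancel₀ hs0.ne', one_smul, mul_assoc]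
      _ = ∫⁻ z, ‖kernel n α 1 z‖ₑ * ω (s • z) := by
          rw [lintegral_const_mul' _ _ ENNReal.ofReal_ne_top,
            lintegral_comp_smul (fun z => ‖kernel n α 1 z‖ₑ * ω (s • z)) (inv_pos.2 hs0),
            ← mul_assoc, ← ENNReal.ofReal_mul (by positivity), inv_pow, inv_inv,
            inv_mul_cancel₀ (by positivity), ENNReal.ofReal_one, one_mul]
  have hlim : Tendsto (fun t : ℝ => ∫⁻ z, ‖kernel n α 1 z‖ₑ * ω (t ^ (1 / (2 * α)) • z))
      (𝓝[>] 0) (𝓝 (∫⁻ _z : Sp n, 0)) := by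
    refine tendsto_lintegral_filter_of_dominated_convergence
      (fun z => ‖kernel n α 1 z‖ₑ * (N + N)) (Eventually.of_forall fun t => ?_)
      (Eventually.of_forall fun t => ae_of_all _ fun z => ?_) ?_ (ae_of_all _ fun z => ?_)
    · exact (measurable_enorm_kernel n α 1).mul (hωm.comp (measurable_const_smul _))
    · gcongr
      exact hωle _
    · rw [lintegral_mul_const _ (measurable_enorm_kernel n α 1)]
      exact ENNReal.mul_ne_top (integrable_kernel_one hα hn).2.ne
        (ENNReal.add_ne_top.2 ⟨hφr, hφr⟩)
    · have h1 : Tendsto (fun t : ℝ => t ^ (1 / (2 * α)) • z) (𝓝[>] 0) (𝓝 0) := by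
        have : Tendsto (fun t : ℝ => t ^ (1 / (2 * α))) (𝓝 0) (𝓝 0) := by
          have h := (Real.continuous_rpow_const (q := 1 / (2 * α)) (by positivity)).tendsto 0
          rwa [Real.zero_rpow (by positivity)] at h
        have h2 := (this.smul_const z).mono_left (nhdsWithin_le_nhds (s := Ioi 0))
        rwa [zero_smul] at h2
      have h3 := (ENNReal.Tendsto.const_mul (a := ‖kernel n α 1 z‖ₑ) (hω0.comp h1)
        (Or.inr enorm_ne_top))
      rwa [mul_zero] at h3
  rw [lintegral_zero] at hlim
  exact tendsto_of_tendsto_of_tendsto_of_le_of_le' tendsto_const_nhds hlim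
    (Eventually.of_forall fun _ => zero_le)
    (eventually_nhdsWithin_of_forall fun t ht => hbound t ht)

end Semigroup

attribute [local irreducible] kernel

/-! ### The semigroup law, for functions and for the positive majorants. -/

section Composition

variable {n : ℕ} {α : ℝ} {𝕜 : Type*} [RCLike 𝕜]

theorem integral_kernel_mul_kernel_sub (hα : 0 < α) (hn : 0 < n) {t s : ℝ} (ht : 0 < t) (hs : 0 < s)
    (x y : Sp n) : ∫ z, kernel n α t (x - z) * kernel n α s (z - y) = kernel n α (t + s) (x - y) := by
  rw [← integral_kernel_mul_kernel hα hn ht hs,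
    ← integral_add_right_eq_self (fun z => kernel n α t (x - z) * kernel n α s (z - y)) y]
  congr 1
  funext z
  congr 2
  · abel
  · abel

theorem heatMaj_heatMaj {t s : ℝ} {g : Sp n → ℝ≥0∞} (hg : Measurable g) (x : Sp n) :
    heatMaj n α t (heatMaj n α s g) x =
      ∫⁻ y, (∫⁻ z, ‖kernel n α t (x - z)‖ₑ * ‖kernel n α s (z - y)‖ₑ) * g y := by
  unfold heatMaj
  have hm : Measurable fun w : Sp n × Sp n =>
      ‖kernel n α t (x - w.1)‖ₑ * (‖kernel n α s (w.1 - w.2)‖ₑ * g w.2) :=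
    ((measurable_enorm_kernel n α t).comp (measurable_const.sub measurable_fst)).mul
      (((measurable_enorm_kernel n α s).comp (measurable_fst.sub measurable_snd)).mul
        (hg.comp measurable_snd))
  have h1 : ∀ z, ‖kernel n α t (x - z)‖ₑ * ∫⁻ y, ‖kernel n α s (z - y)‖ₑ * g y =
      ∫⁻ y, ‖kernel n α t (x - z)‖ₑ * (‖kernel n α s (z - y)‖ₑ * g y) := fun z =>
    (lintegral_const_mul' _ _ enorm_ne_top).symm
  simp_rw [h1]
  rw [lintegral_lintegral_swap hm.aemeasurable]
  refine lintegral_congr fun y => ?_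
  have h2 : Measurable fun z => ‖kernel n α t (x - z)‖ₑ * ‖kernel n α s (z - y)‖ₑ :=
    ((measurable_enorm_kernel n α t).comp (measurable_const.sub measurable_id)).mul
      ((measurable_enorm_kernel n α s).comp (measurable_id.sub measurable_const))
  rw [← lintegral_mul_const _ h2]
  refine lintegral_congr fun z => ?_
  ring

/-- The kernels may change sign, so for absolute values only the inequality |K_{t+s}| ≤ |K_t| *
|K_s| survives. -/
theorem heatMaj_add_time_le (hα : 0 < α) (hn : 0 < n) {t s : ℝ} (ht : 0 < t) (hs : 0 < s)
    {g : Sp n → ℝ≥0∞} (hg : Measurable g) (x : Sp n) :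
    heatMaj n α (t + s) g x ≤ heatMaj n α t (heatMaj n α s g) x := by
  rw [heatMaj_heatMaj hg]
  refine lintegral_mono fun y => ?_
  gcongr
  rw [← integral_kernel_mul_kernel_sub hα hn ht hs]
  refine (enorm_integral_le_lintegral_enorm _).trans (le_of_eq ?_)
  simp_rw [enorm_mul]

/-- The semigroup property. -/
theorem semigroup_semigroup (hα : 0 < α) (hn : 0 < n) {t s : ℝ} (ht : 0 < t) (hs : 0 < s)
    {g : Sp n → 𝕜} (hg : Measurable g) {x : Sp n}
    (h : heatMaj n α t (heatMaj n α s (fun y => ‖g y‖ₑ)) x < ∞) :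
    semigroup α t (semigroup α s g) x = semigroup α (t + s) g x := by
  rw [semigroup_of_pos ht, semigroup_of_pos (by positivity)]
  have hm : Measurable fun w : Sp n × Sp n =>
      kernel n α t (x - w.1) • (kernel n α s (w.1 - w.2) • g w.2) := by
    have hk : ∀ t, Measurable (kernel n α t) := fun t =>
      (measurable_kernel n α).comp measurable_prodMk_left
    exact ((hk t).comp (measurable_const.sub measurable_fst)).smul
      (((hk s).comp (measurable_fst.sub measurable_snd)).smul (hg.comp measurable_snd))
  have hi : Integrable (Function.uncurry fun z y : Sp n =>
      kernel n α t (x - z) • (kernel n α s (z - y) • g y)) (volume.prod volume) := by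
    refine ⟨hm.aestronglyMeasurable, ?_⟩
    refine lt_of_le_of_lt (le_of_eq ((lintegral_prod _ hm.enorm.aemeasurable).trans ?_)) h
    refine lintegral_congr fun z => ?_
    simp only [enorm_smul]
    exact lintegral_const_mul' _ _ enorm_ne_top
  have e1 : ∀ z, kernel n α t (x - z) • semigroup α s g z =
      ∫ y, kernel n α t (x - z) • (kernel n α s (z - y) • g y) := fun z => by
    rw [semigroup_of_pos hs, integral_smul]
  simp_rw [e1]
  rw [integral_integral_swap hi]
  congr 1
  funext y
  simp_rw [smul_smul]
  rw [integral_smul_const, integral_kernel_mul_kernel_sub hα hn ht hs]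

end Composition

/-! ### The Duhamel integral: measurability, absolute convergence, norm bound. -/

section Duhamel

variable {n : ℕ} {α : ℝ} {𝕜 : Type*} [RCLike 𝕜]

/-- The Duhamel integral with absolute values inside. -/
noncomputable def duhMaj (n : ℕ) (α t : ℝ) (g : ℝ × Sp n → ℝ≥0∞) (x : Sp n) : ℝ≥0∞ :=
  ∫⁻ τ in Ioo 0 t, heatMaj n α (t - τ) (fun y => g (τ, y)) x

/-- The Duhamel integral `∫₀ᵗ S(t-τ) G(τ) dτ`. -/
noncomputable def duhamel (n : ℕ) (α t : ℝ) (G : ℝ × Sp n → 𝕜) (x : Sp n) : 𝕜 :=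
  ∫ τ in Ioo 0 t, semigroup α (t - τ) (fun y => G (τ, y)) x

theorem measurable_heatMaj_slice {g : ℝ × Sp n → ℝ≥0∞} (hg : Measurable g) (t : ℝ) :
    Measurable fun w : Sp n × ℝ => heatMaj n α (t - w.2) (fun y => g (w.2, y)) w.1 := by
  have hmap : Measurable fun w : Sp n × ℝ => (((t, w.2) : ℝ × ℝ), w.1) :=
    (measurable_const.prodMk measurable_snd).prodMk measurable_fst
  have h := measurable_heatMaj_uncurry (α := α) hg
  exact h.comp hmap

theorem measurable_duhMaj {g : ℝ × Sp n → ℝ≥0∞} (hg : Measurable g) (t : ℝ) :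
    Measurable (duhMaj n α t g) :=
  (measurable_heatMaj_slice hg t).lintegral_prod_right'

theorem duhMaj_mono_ae {t : ℝ} {f g : ℝ × Sp n → ℝ≥0∞}
    (h : ∀ τ ∈ Ioo 0 t, ∀ᵐ y, f (τ, y) ≤ g (τ, y)) (x : Sp n) :
    duhMaj n α t f x ≤ duhMaj n α t g x :=
  setLIntegral_mono' measurableSet_Ioo fun τ hτ => heatMaj_mono_ae (h τ hτ) x

theorem duhMaj_add {t : ℝ} {f g : ℝ × Sp n → ℝ≥0∞} (hf : Measurable f) (x : Sp n) :
    duhMaj n α t (fun z => f z + g z) x = duhMaj n α t f x + duhMaj n α t g x := by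
  unfold duhMaj
  rw [← lintegral_add_left]
  · refine lintegral_congr fun τ => heatMaj_add (hf.comp measurable_prodMk_left) x
  · exact (measurable_heatMaj_slice hf t).comp measurable_prodMk_left

theorem duhMaj_const_mul {t : ℝ} {c : ℝ≥0∞} (hc : c ≠ ∞) (g : ℝ × Sp n → ℝ≥0∞) (x : Sp n) :
    duhMaj n α t (fun z => c * g z) x = c * duhMaj n α t g x := by
  unfold duhMaj
  rw [← lintegral_const_mul' _ _ hc]
  exact lintegral_congr fun τ => heatMaj_const_mul hc _ x

theorem measurable_semigroup_uncurry {G : ℝ × Sp n → 𝕜} (hG : Measurable G) :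
    Measurable fun z : (ℝ × ℝ) × Sp n =>
      ∫ y, kernel n α (z.1.1 - z.1.2) (z.2 - y) • G (z.1.2, y) := by
  refine StronglyMeasurable.measurable ?_
  refine StronglyMeasurable.integral_prod_right'
    (f := fun w : ((ℝ × ℝ) × Sp n) × Sp n =>
      kernel n α (w.1.1.1 - w.1.1.2) (w.1.2 - w.2) • G (w.1.1.2, w.2)) ?_
  refine Measurable.stronglyMeasurable (Measurable.smul ?_ ?_)
  · exact (measurable_kernel n α).comp (by fun_prop : Measurable
      fun w : ((ℝ × ℝ) × Sp n) × Sp n => (w.1.1.1 - w.1.1.2, w.1.2 - w.2))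
  · exact hG.comp (by fun_prop : Measurable fun w : ((ℝ × ℝ) × Sp n) × Sp n => (w.1.1.2, w.2))

theorem measurable_duhamel {G : ℝ × Sp n → 𝕜} (hG : Measurable G) :
    Measurable fun z : ℝ × Sp n => duhamel n α z.1 G z.2 := by
  have e : (fun z : ℝ × Sp n => duhamel n α z.1 G z.2) = fun z => ∫ τ,
      {w : (ℝ × Sp n) × ℝ | w.2 ∈ Ioo 0 w.1.1}.indicator
        (fun w => ∫ y, kernel n α (w.1.1 - w.2) (w.1.2 - y) • G (w.2, y)) (z, τ) := by
    funext z
    rw [duhamel, ← integral_indicator measurableSet_Ioo]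
    congr 1
    funext τ
    by_cases h : τ ∈ Ioo 0 z.1
    · rw [indicator_of_mem h, indicator_of_mem (show (z, τ) ∈ _ from h),
        semigroup_of_pos (sub_pos.2 h.2)]
    · rw [indicator_of_notMem h, indicator_of_notMem (show (z, τ) ∉ _ from h)]
  rw [e]
  refine StronglyMeasurable.measurable (StronglyMeasurable.integral_prod_right' ?_)
  refine Measurable.stronglyMeasurable (Measurable.indicator ?_ ?_)
  · exact (measurable_semigroup_uncurry hG).comp (by fun_prop : Measurable
      fun w : (ℝ × Sp n) × ℝ => (((w.1.1, w.2) : ℝ × ℝ), w.1.2))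
  · exact (measurableSet_lt measurable_const measurable_snd).inter
      (measurableSet_lt measurable_snd (measurable_fst.comp measurable_fst))

theorem enorm_duhamel_le {t : ℝ} (G : ℝ × Sp n → 𝕜) (x : Sp n) :
    ‖duhamel n α t G x‖ₑ ≤ duhMaj n α t (fun z => ‖G z‖ₑ) x := by
  refine (enorm_integral_le_lintegral_enorm _).trans ?_
  exact setLIntegral_mono' measurableSet_Ioo fun τ hτ =>
    enorm_semigroup_le (sub_pos.2 hτ.2) _ x

theorem ae_integrable_of_duhMaj {t : ℝ} {G : ℝ × Sp n → 𝕜} (hG : Measurable G) {x : Sp n}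
    (h : duhMaj n α t (fun z => ‖G z‖ₑ) x < ∞) :
    ∀ᵐ τ ∂(volume.restrict (Ioo 0 t)),
      Integrable (fun y => kernel n α (t - τ) (x - y) • G (τ, y)) := by
  have hm := (measurable_heatMaj_slice (α := α) hG.enorm t).comp (measurable_prodMk_left (x := x))
  filter_upwards [ae_lt_top hm h.ne] with τ hτ
  exact integrable_kernel_smul (hG.comp measurable_prodMk_left) hτ

theorem integrableOn_semigroup_of_duhMaj {t : ℝ} {G : ℝ × Sp n → 𝕜} (hG : Measurable G) {x : Sp n}
    (h : duhMaj n α t (fun z => ‖G z‖ₑ) x < ∞) :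
    IntegrableOn (fun τ => semigroup α (t - τ) (fun y => G (τ, y)) x) (Ioo 0 t) := by
  refine ⟨?_, ?_⟩
  · have h1 := (measurable_semigroup_uncurry (α := α) hG).comp
      (by fun_prop : Measurable fun τ : ℝ => (((t, τ) : ℝ × ℝ), x))
    refine h1.aestronglyMeasurable.congr ?_
    filter_upwards [ae_restrict_mem measurableSet_Ioo] with τ hτ
    rw [semigroup_of_pos (sub_pos.2 hτ.2)]
    rfl
  · refine lt_of_le_of_lt ?_ h
    exact setLIntegral_mono' measurableSet_Ioo fun τ hτ =>
      enorm_semigroup_le (sub_pos.2 hτ.2) _ x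

theorem duhamel_sub {t : ℝ} {F G : ℝ × Sp n → 𝕜} (hF : Measurable F) (hG : Measurable G) {x : Sp n}
    (h : duhMaj n α t (fun z => ‖F z‖ₑ) x < ∞) (h' : duhMaj n α t (fun z => ‖G z‖ₑ) x < ∞) :
    duhamel n α t F x - duhamel n α t G x = duhamel n α t (fun z => F z - G z) x := by
  unfold duhamel
  rw [← integral_sub (integrableOn_semigroup_of_duhMaj hF h) (integrableOn_semigroup_of_duhMaj hG h')]
  refine integral_congr_ae ?_
  filter_upwards [ae_integrable_of_duhMaj hF h, ae_integrable_of_duhMaj hG h',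
    ae_restrict_mem measurableSet_Ioo] with τ h1 h2 hτ
  rw [semigroup_of_pos (sub_pos.2 hτ.2), semigroup_of_pos (sub_pos.2 hτ.2),
    semigroup_of_pos (sub_pos.2 hτ.2), ← integral_sub h1 h2]
  simp_rw [smul_sub]

theorem measurable_lnorm_slice {p : ℝ} {g : ℝ × Sp n → ℝ≥0∞} (hg : Measurable g) :
    Measurable fun τ => lnorm p volume (fun y => g (τ, y)) :=
  ((hg.pow_const p).lintegral_prod_right').pow_const _

/-- The Lebesgue norm of the Duhamel integral. -/
theorem exists_lnorm_duhMaj_le (hα : 0 < α) (hn : 0 < n) {s p : ℝ} (hs : 1 ≤ s) (hsp : s ≤ p) :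
    ∃ C : ℝ≥0, ∀ t : ℝ, ∀ g : ℝ × Sp n → ℝ≥0∞, Measurable g →
      lnorm p volume (duhMaj n α t g) ≤
        C * ∫⁻ τ in Ioo 0 t, ENNReal.ofReal ((t - τ) ^ (-(n / (2 * α) * (1 / s - 1 / p)))) *
          lnorm s volume (fun y => g (τ, y)) := by
  obtain ⟨C, hC⟩ := exists_lnorm_heatMaj_le (n := n) hα hn hs hsp
  refine ⟨C, fun t g hg => ?_⟩
  refine (lnorm_lintegral_le (hs.trans hsp) (measurable_heatMaj_slice hg t)).trans ?_
  rw [← lintegral_const_mul' _ _ ENNReal.coe_ne_top]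
  refine setLIntegral_mono' measurableSet_Ioo fun τ hτ => ?_
  rw [← mul_assoc]
  exact hC _ (sub_pos.2 hτ.2) _ (hg.comp measurable_prodMk_left)

end Duhamel

/-! ### Weakly singular time integrals and dilation averages. -/

section Beta

theorem lintegral_Ioo_scale (f : ℝ → ℝ≥0∞) {t : ℝ} (ht : 0 < t) :
    ∫⁻ τ in Ioo 0 t, f τ = ENNReal.ofReal t * ∫⁻ θ in Ioo (0 : ℝ) 1, f (t * θ) := by
  have h1 : ∫⁻ θ in Ioo (0 : ℝ) 1, f (t * θ) = ∫⁻ θ, (Ioo 0 t).indicator f (t * θ) := by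
    rw [← lintegral_indicator measurableSet_Ioo]
    refine lintegral_congr fun θ => ?_
    have : θ ∈ Ioo (0 : ℝ) 1 ↔ t * θ ∈ Ioo 0 t := by
      rw [mem_Ioo, mem_Ioo, mul_pos_iff_of_pos_left ht, mul_lt_iff_lt_one_right ht]
    by_cases h : θ ∈ Ioo (0 : ℝ) 1
    · rw [indicator_of_mem h, indicator_of_mem (this.1 h)]
    · rw [indicator_of_notMem h, indicator_of_notMem (fun h' => h (this.2 h'))]
  have h2 : ∫⁻ θ, (Ioo 0 t).indicator f (t * θ) =
      ∫⁻ x, (Ioo 0 t).indicator f x ∂(Measure.map (t * ·) volume) :=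
    ((Homeomorph.mulLeft₀ t ht.ne').measurableEmbedding.lintegral_map _).symm
  rw [h1, h2, Real.map_volume_mul_left ht.ne', lintegral_smul_measure,
    lintegral_indicator measurableSet_Ioo, smul_eq_mul, ← mul_assoc, abs_of_pos (by positivity),
    ← ENNReal.ofReal_mul ht.le, mul_inv_cancel₀ ht.ne', ENNReal.ofReal_one, one_mul]

/-- The weight of the Beta integral. -/
noncomputable def betaWeight (A B θ : ℝ) : ℝ≥0∞ :=
  ENNReal.ofReal ((1 - θ) ^ (-A)) * ENNReal.ofReal (θ ^ (-B))

theorem measurable_betaWeight (A B : ℝ) : Measurable (betaWeight A B) := by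
  unfold betaWeight; fun_prop

/-- Convergence of Euler's Beta integral with the parameters 1-B and 1-A. -/
theorem lintegral_betaWeight_ne_top {A B : ℝ} (hA : A < 1) (hB : B < 1) :
    ∫⁻ θ in Ioo (0 : ℝ) 1, betaWeight A B θ ≠ ∞ := by
  have h := Complex.betaIntegral_convergent (u := ((1 - B : ℝ) : ℂ)) (v := ((1 - A : ℝ) : ℂ))
    (by simpa using hB) (by simpa using hA)
  rw [intervalIntegrable_iff_integrableOn_Ioo_of_le zero_le_one] at h
  refine ne_of_lt (lt_of_le_of_lt (le_of_eq ?_) h.2)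
  refine setLIntegral_congr_fun measurableSet_Ioo fun θ hθ => ?_
  have h1 : 0 < θ := hθ.1
  have h2 : 0 < 1 - θ := sub_pos.2 hθ.2
  have e1 : (θ : ℂ) ^ (((1 - B : ℝ) : ℂ) - 1) = ((θ ^ (-B) : ℝ) : ℂ) := by
    rw [Complex.ofReal_cpow h1.le]; congr 1; push_cast; ring
  have e2 : (1 - θ : ℂ) ^ (((1 - A : ℝ) : ℂ) - 1) = (((1 - θ) ^ (-A) : ℝ) : ℂ) := by
    rw [Complex.ofReal_cpow h2.le]; congr 1 <;> push_cast <;> ring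
  simp only [betaWeight]
  rw [e1, e2, enorm_mul, ← ofReal_norm, ← ofReal_norm, Complex.norm_real, Complex.norm_real,
    Real.norm_of_nonneg (by positivity), Real.norm_of_nonneg (by positivity), mul_comm]

/-- Scaling of a weakly singular time integral. -/
theorem lintegral_singular_eq {A B t : ℝ} (ht : 0 < t) (k : ℝ → ℝ≥0∞) :
    ∫⁻ τ in Ioo 0 t, ENNReal.ofReal ((t - τ) ^ (-A)) * (ENNReal.ofReal (τ ^ (-B)) * k τ) =
      ENNReal.ofReal (t ^ (1 - A - B)) * ∫⁻ θ in Ioo (0 : ℝ) 1, betaWeight A B θ * k (t * θ) := by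
  rw [lintegral_Ioo_scale _ ht, ← lintegral_const_mul' _ _ ENNReal.ofReal_ne_top,
    ← lintegral_const_mul' _ _ ENNReal.ofReal_ne_top]
  refine setLIntegral_congr_fun measurableSet_Ioo fun θ hθ => ?_
  have h1 : 0 < θ := hθ.1
  have h2 : 0 < 1 - θ := sub_pos.2 hθ.2
  simp only [betaWeight]
  rw [show t - t * θ = t * (1 - θ) by ring, Real.mul_rpow ht.le h2.le, Real.mul_rpow ht.le h1.le,
    show 1 - A - B = 1 + -A + -B by ring, Real.rpow_add ht, Real.rpow_add ht, Real.rpow_one,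
    ENNReal.ofReal_mul (by positivity), ENNReal.ofReal_mul (by positivity),
    ENNReal.ofReal_mul (by positivity), ENNReal.ofReal_mul (by positivity)]
  ring

/-- Dilation invariant averages are bounded on `L^q((0,T); dt/t)`. -/
theorem lnorm_mellin_le {q T : ℝ} (hq : 1 ≤ q) {w k : ℝ → ℝ≥0∞} (hw : Measurable w)
    (hk : Measurable k) :
    lnorm q (volume.restrict (Ioo 0 T))
      (fun t => ENNReal.ofReal (t ^ (-(1 / q))) * ∫⁻ θ in Ioo (0 : ℝ) 1, w θ * k (t * θ)) ≤
    (∫⁻ θ in Ioo (0 : ℝ) 1, w θ) *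
      lnorm q (volume.restrict (Ioo 0 T)) (fun t => ENNReal.ofReal (t ^ (-(1 / q))) * k t) := by
  have hq0 : 0 < q := by linarith
  set L := lnorm q (volume.restrict (Ioo 0 T)) (fun t => ENNReal.ofReal (t ^ (-(1 / q))) * k t)
    with hL
  have hm : Measurable (Function.uncurry fun t θ : ℝ =>
      w θ * (ENNReal.ofReal (t ^ (-(1 / q))) * k (t * θ))) := by
    unfold Function.uncurry; fun_prop
  have h1 : ∀ t, ENNReal.ofReal (t ^ (-(1 / q))) * ∫⁻ θ in Ioo (0 : ℝ) 1, w θ * k (t * θ) =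
      ∫⁻ θ in Ioo (0 : ℝ) 1, w θ * (ENNReal.ofReal (t ^ (-(1 / q))) * k (t * θ)) := fun t => by
    rw [← lintegral_const_mul' _ _ ENNReal.ofReal_ne_top]
    refine lintegral_congr fun θ => ?_
    ring
  simp_rw [h1]
  refine (lnorm_lintegral_le hq hm).trans ?_
  rw [← lintegral_mul_const _ hw]
  refine setLIntegral_mono' measurableSet_Ioo fun θ hθ => ?_
  have hθ0 : 0 < θ := hθ.1
  have hθ1 : θ ≤ 1 := hθ.2.le
  rcases le_or_gt T 0 with hT | hT
  · simp [lnorm, Ioo_eq_empty (not_lt.2 hT), hq0]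
  have hmono : lnorm q (volume.restrict (Ioo 0 T))
      (fun t => w θ * (ENNReal.ofReal (t ^ (-(1 / q))) * k (t * θ))) =
      w θ * lnorm q (volume.restrict (Ioo 0 T))
        (fun t => ENNReal.ofReal (t ^ (-(1 / q))) * k (t * θ)) := by
    unfold lnorm
    simp_rw [ENNReal.mul_rpow_of_nonneg _ _ hq0.le]
    rw [lintegral_const_mul _ (by fun_prop), ENNReal.mul_rpow_of_nonneg _ _ (by positivity),
      ← ENNReal.rpow_mul, mul_one_div_cancel hq0.ne', ENNReal.rpow_one]
  rw [hmono]
  gcongr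
  unfold L lnorm
  refine ENNReal.rpow_le_rpow ?_ (by positivity)
  set F : ℝ → ℝ≥0∞ := fun t => (ENNReal.ofReal (t ^ (-(1 / q))) * k t) ^ q with hF
  -- The weight t^{-1/q}, raised to the power q, is t^{-1}; its dilation produces exactly the
  -- Jacobian θ. Since θ ≤ 1, the dilated interval stays inside (0,T).
  have e : ∫⁻ t in Ioo 0 T, (ENNReal.ofReal (t ^ (-(1 / q))) * k (t * θ)) ^ q =
      ∫⁻ t in Ioo 0 T, ENNReal.ofReal θ * F (θ * t) := by
    refine setLIntegral_congr_fun measurableSet_Ioo fun t ht => ?_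
    have ht0 : 0 < t := ht.1
    simp only [hF]
    rw [ENNReal.mul_rpow_of_nonneg _ _ hq0.le, ENNReal.mul_rpow_of_nonneg _ _ hq0.le,
      ENNReal.ofReal_rpow_of_pos (by positivity), ENNReal.ofReal_rpow_of_pos (by positivity),
      ← Real.rpow_mul ht0.le, ← Real.rpow_mul (by positivity), ← mul_assoc,
      ← ENNReal.ofReal_mul hθ0.le, mul_comm t θ]
    congr 2
    rw [neg_mul, one_div_mul_cancel hq0.ne', Real.rpow_neg_one, Real.rpow_neg_one]
    field_simp
  rw [e, lintegral_const_mul' _ _ ENNReal.ofReal_ne_top]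
  have h2 : ENNReal.ofReal θ * ∫⁻ t in Ioo 0 T, F (θ * t) = ∫⁻ t in Ioo 0 (θ * T), F t := by
    rw [lintegral_Ioo_scale F (t := θ * T) (by positivity), lintegral_Ioo_scale _ hT, ← mul_assoc,
      ← ENNReal.ofReal_mul hθ0.le]
    simp_rw [mul_assoc]
  rw [h2]
  exact lintegral_mono_set (Ioo_subset_Ioo_right (by nlinarith))

end Beta

/-! ### Cutting a function at a given height. -/

section Truncation

variable {X : Type*}

theorem indicator_lt_add_indicator_ge (L : ℝ) (g : X → ℝ≥0∞) (x : X) :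
    {x | ENNReal.ofReal L < g x}.indicator g x + {x | g x ≤ ENNReal.ofReal L}.indicator g x =
      g x := by
  by_cases h : ENNReal.ofReal L < g x
  · rw [indicator_of_mem (show x ∈ {x | ENNReal.ofReal L < g x} from h),
      indicator_of_notMem (show x ∉ {x | g x ≤ ENNReal.ofReal L} from not_le.2 h), add_zero]
  · rw [indicator_of_notMem (show x ∉ {x | ENNReal.ofReal L < g x} from h),
      indicator_of_mem (show x ∈ {x | g x ≤ ENNReal.ofReal L} from not_lt.1 h), zero_add]

/-- Where g > L one has g^{ρ-r} ≤ L^{ρ-r}, because ρ - r ≤ 0. The value ∞ must be treated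
separately. -/
theorem indicator_rpow_le_of_lt {ρ r : ℝ} (hρ : 0 < ρ) (hρr : ρ ≤ r) {L : ℝ} (hL : 0 < L)
    (g : X → ℝ≥0∞) (x : X) :
    ({x | ENNReal.ofReal L < g x}.indicator g x) ^ ρ ≤ ENNReal.ofReal (L ^ (ρ - r)) * g x ^ r := by
  by_cases h : ENNReal.ofReal L < g x
  · rw [indicator_of_mem (show x ∈ {x | ENNReal.ofReal L < g x} from h)]
    have h0 : g x ≠ 0 := (lt_of_le_of_lt zero_le h).ne'
    rcases eq_or_ne (g x) ∞ with ht | ht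
    · rw [ht, ENNReal.top_rpow_of_pos (by linarith : 0 < r), ENNReal.mul_top]
      · exact le_top
      · simp only [ne_eq, ENNReal.ofReal_eq_zero, not_le]; positivity
    · have e : g x ^ ρ = g x ^ (ρ - r) * g x ^ r := by rw [← ENNReal.rpow_add _ _ h0 ht]; simp
      rw [e, ← ENNReal.ofReal_rpow_of_pos hL]
      gcongr ?_ * _
      rw [← neg_sub r ρ, ENNReal.rpow_neg, ENNReal.rpow_neg]
      exact ENNReal.inv_le_inv.2 (ENNReal.rpow_le_rpow h.le (by linarith))
  · rw [indicator_of_notMem (show x ∉ {x | ENNReal.ofReal L < g x} from h),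
      ENNReal.zero_rpow_of_pos hρ]
    exact zero_le

theorem indicator_rpow_le_of_ge {ρ r : ℝ} (hr : 0 < r) (hρr : r ≤ ρ) {L : ℝ} (hL : 0 < L)
    (g : X → ℝ≥0∞) (x : X) :
    ({x | g x ≤ ENNReal.ofReal L}.indicator g x) ^ ρ ≤ ENNReal.ofReal (L ^ (ρ - r)) * g x ^ r := by
  by_cases h : g x ≤ ENNReal.ofReal L
  · rw [indicator_of_mem (show x ∈ {x | g x ≤ ENNReal.ofReal L} from h)]
    have e : g x ^ ρ = g x ^ (ρ - r) * g x ^ r := by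
      rw [← ENNReal.rpow_add_of_nonneg _ _ (by linarith) hr.le]; simp
    rw [e, ← ENNReal.ofReal_rpow_of_pos hL]
    gcongr ?_ * _
    exact ENNReal.rpow_le_rpow h (by linarith)
  · rw [indicator_of_notMem (show x ∉ {x | g x ≤ ENNReal.ofReal L} from h),
      ENNReal.zero_rpow_of_pos (by linarith)]
    exact zero_le

variable [MeasurableSpace X] {μ : Measure X}

theorem lnorm_le_of_rpow_le {ρ r L : ℝ} (hρ : 0 < ρ) (hr : 0 < r) (hL : 0 < L)
    {f g : X → ℝ≥0∞} (h : ∀ x, f x ^ ρ ≤ ENNReal.ofReal (L ^ (ρ - r)) * g x ^ r) :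
    lnorm ρ μ f ≤ ENNReal.ofReal (L ^ (1 - r / ρ)) * lnorm r μ g ^ (r / ρ) := by
  unfold lnorm
  calc (∫⁻ x, f x ^ ρ ∂μ) ^ (1 / ρ)
      ≤ (∫⁻ x, ENNReal.ofReal (L ^ (ρ - r)) * g x ^ r ∂μ) ^ (1 / ρ) :=
        ENNReal.rpow_le_rpow (lintegral_mono h) (by positivity)
    _ = _ := by
        rw [lintegral_const_mul' _ _ ENNReal.ofReal_ne_top,
          ENNReal.mul_rpow_of_nonneg _ _ (by positivity), ENNReal.ofReal_rpow_of_pos (by positivity),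
          ← Real.rpow_mul hL.le, ← ENNReal.rpow_mul]
        congr 3 <;> field_simp

theorem lnorm_indicator_lt_le {ρ r L : ℝ} (hρ : 0 < ρ) (hρr : ρ ≤ r) (hL : 0 < L)
    (g : X → ℝ≥0∞) :
    lnorm ρ μ ({x | ENNReal.ofReal L < g x}.indicator g) ≤
      ENNReal.ofReal (L ^ (1 - r / ρ)) * lnorm r μ g ^ (r / ρ) :=
  lnorm_le_of_rpow_le hρ (by linarith) hL (indicator_rpow_le_of_lt hρ hρr hL g)

theorem lnorm_indicator_ge_le {ρ r L : ℝ} (hr : 0 < r) (hρr : r ≤ ρ) (hL : 0 < L)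
    (g : X → ℝ≥0∞) :
    lnorm ρ μ ({x | g x ≤ ENNReal.ofReal L}.indicator g) ≤
      ENNReal.ofReal (L ^ (1 - r / ρ)) * lnorm r μ g ^ (r / ρ) :=
  lnorm_le_of_rpow_le (by linarith) hr hL (indicator_rpow_le_of_ge hr hρr hL g)

/-- The tails of a function with finite norm are small. -/
theorem tendsto_lnorm_indicator_lt {r : ℝ} (hr : 0 < r) {g : X → ℝ≥0∞} (hg : Measurable g)
    (h : lnorm r μ g ≠ ∞) :
    Tendsto (fun L : ℝ => lnorm r μ ({x | ENNReal.ofReal L < g x}.indicator g)) atTop (𝓝 0) := by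
  have hfin : ∫⁻ x, g x ^ r ∂μ ≠ ∞ := by
    rw [← lnorm_rpow_self hr]; exact ENNReal.rpow_ne_top_of_nonneg hr.le h
  have h1 : Tendsto (fun L : ℝ => ∫⁻ x, ({x | ENNReal.ofReal L < g x}.indicator g x) ^ r ∂μ)
      atTop (𝓝 (∫⁻ _, 0 ∂μ)) := by
    refine tendsto_lintegral_filter_of_dominated_convergence (fun x => g x ^ r) ?_ ?_ hfin ?_
    · exact Eventually.of_forall fun L =>
        (hg.indicator (measurableSet_lt measurable_const hg)).pow_const r
    · exact Eventually.of_forall fun L => ae_of_all _ fun x =>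
        ENNReal.rpow_le_rpow (indicator_le_self _ _ x) hr.le
    · filter_upwards [ae_lt_top (hg.pow_const r) hfin] with x hx
      have hx' : g x ≠ ∞ := by
        intro hc; simp [hc, hr] at hx
      refine tendsto_const_nhds.congr' ?_
      filter_upwards [eventually_ge_atTop (g x).toReal] with L hL
      rw [indicator_of_notMem, ENNReal.zero_rpow_of_pos hr]
      simp only [mem_ofPred_eq, not_lt]
      rw [← ENNReal.ofReal_toReal hx']
      exact ENNReal.ofReal_le_ofReal hL
  rw [lintegral_zero] at h1
  have h2 := (ENNReal.continuous_rpow_const (y := 1 / r)).tendsto 0 |>.comp h1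
  rw [ENNReal.zero_rpow_of_pos (by positivity)] at h2
  exact h2

end Truncation

/-! ### Power integrals in time and the small-time behaviour of the flow. -/

section PowerIntegrals

theorem lintegral_Ioi_rpow {β c : ℝ} (hβ : 0 < β) (hc : 0 < c) :
    ∫⁻ t in Ioi c, ENNReal.ofReal (t ^ (-1 - β)) = ENNReal.ofReal (c ^ (-β) / β) := by
  rw [← ofReal_integral_eq_lintegral_ofReal (integrableOn_Ioi_rpow_of_lt (by linarith) hc),
    integral_Ioi_rpow_of_lt (by linarith) hc]
  · congr 1
    rw [show -1 - β + 1 = -β by ring]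
    field_simp
  · filter_upwards [ae_restrict_mem measurableSet_Ioi] with t ht
    have : 0 < t := hc.trans ht
    show 0 ≤ t ^ (-1 - β)
    positivity

theorem lintegral_Ioo_rpow {β c : ℝ} (hβ : 0 < β) (hc : 0 < c) :
    ∫⁻ t in Ioo 0 c, ENNReal.ofReal (t ^ (-1 + β)) = ENNReal.ofReal (c ^ β / β) := by
  rw [setLIntegral_congr Ioo_ae_eq_Ioc]
  have h := intervalIntegral.intervalIntegrable_rpow' (a := 0) (b := c) (r := -1 + β) (by linarith)
  rw [intervalIntegrable_iff_integrableOn_Ioc_of_le hc.le] at h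
  rw [← ofReal_integral_eq_lintegral_ofReal h, ← intervalIntegral.integral_of_le hc.le,
    integral_rpow (Or.inl (by linarith))]
  · congr 1
    rw [show -1 + β + 1 = β by ring, Real.zero_rpow hβ.ne', sub_zero]
  · filter_upwards [ae_restrict_mem measurableSet_Ioc] with t ht
    have : 0 < t := ht.1
    show 0 ≤ t ^ (-1 + β)
    positivity

end PowerIntegrals

section SmallTime

variable {n : ℕ} {α : ℝ}

/-- The smoothing estimate improves to `o(t^{-γ})` as `t → 0`. -/
theorem tendsto_lnorm_heatMaj (hα : 0 < α) (hn : 0 < n) {r s : ℝ} (hr : 1 ≤ r) (hrs : r < s)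
    {g : Sp n → ℝ≥0∞} (hg : Measurable g) (hgr : lnorm r volume g ≠ ∞) :
    Tendsto (fun t => ENNReal.ofReal (t ^ (n / (2 * α) * (1 / r - 1 / s))) *
      lnorm s volume (heatMaj n α t g)) (𝓝[>] 0) (𝓝 0) := by
  have hs : 1 ≤ s := by linarith
  have hr0 : 0 < r := by linarith
  have hs0 : 0 < s := by linarith
  obtain ⟨C₁, hC₁⟩ := exists_lnorm_heatMaj_le (n := n) hα hn hr hrs.le
  obtain ⟨C₂, hC₂⟩ := exists_lnorm_heatMaj_le (n := n) hα hn hs le_rfl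
  set γ := n / (2 * α) * (1 / r - 1 / s) with hγ
  have hγ0 : 0 < γ := by
    have : 1 / s < 1 / r := one_div_lt_one_div_of_lt hr0 hrs
    have hn' : (0 : ℝ) < n := by exact_mod_cast hn
    have : 0 < 1 / r - 1 / s := by linarith
    positivity
  rw [ENNReal.tendsto_nhds_zero]
  intro ε hε
  have hε2 : 0 < ε / 2 := ENNReal.half_pos hε.ne'
  have h1 : Tendsto (fun L : ℝ => C₁ * lnorm r volume ({x | ENNReal.ofReal L < g x}.indicator g))
      atTop (𝓝 0) := by
    have := ENNReal.Tendsto.const_mul (a := (C₁ : ℝ≥0∞)) (tendsto_lnorm_indicator_lt hr0 hg hgr)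
      (Or.inr ENNReal.coe_ne_top)
    rwa [mul_zero] at this
  -- Cut g at a height L for which the upper part is small in L^r, uniformly in t. The lower part
  -- lies in L^s, where the flow is bounded, and t^γ makes it small.
  obtain ⟨L, hL, hL0⟩ := (((ENNReal.tendsto_nhds_zero.1 h1) _ hε2).and
    (eventually_gt_atTop 0)).exists
  set g₁ := {x | ENNReal.ofReal L < g x}.indicator g with hg₁
  set g₂ := {x | g x ≤ ENNReal.ofReal L}.indicator g with hg₂
  have hm₁ : Measurable g₁ := hg.indicator (measurableSet_lt measurable_const hg)
  have hm₂ : Measurable g₂ := hg.indicator (measurableSet_le hg measurable_const)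
  set B := C₂ * lnorm s volume g₂ with hB
  have hBt : B ≠ ∞ := by
    refine ENNReal.mul_ne_top ENNReal.coe_ne_top
      (ne_top_of_le_ne_top ?_ (lnorm_indicator_ge_le hr0 hrs.le hL0 g))
    exact ENNReal.mul_ne_top ENNReal.ofReal_ne_top (ENNReal.rpow_ne_top_of_nonneg (by positivity) hgr)
  have h2 : Tendsto (fun t : ℝ => ENNReal.ofReal (t ^ γ) * B) (𝓝[>] 0) (𝓝 0) := by
    have h3 : Tendsto (fun t : ℝ => t ^ γ) (𝓝[>] 0) (𝓝 0) := by
      have := (Real.continuousAt_rpow_const 0 γ (Or.inr hγ0.le)).tendsto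
      rw [Real.zero_rpow hγ0.ne'] at this
      exact this.mono_left nhdsWithin_le_nhds
    have h4 := ENNReal.Tendsto.mul_const (b := B) (ENNReal.tendsto_ofReal h3) (Or.inr hBt)
    simpa using h4
  filter_upwards [(ENNReal.tendsto_nhds_zero.1 h2) _ hε2, self_mem_nhdsWithin] with t ht ht0
  have ht0 : 0 < t := ht0
  have hle : lnorm s volume (heatMaj n α t g) ≤
      lnorm s volume (heatMaj n α t g₁) + lnorm s volume (heatMaj n α t g₂) := by
    refine le_trans (lnorm_mono hs0 fun x => ?_)
      (lnorm_add_le hs (measurable_heatMaj hm₁).aemeasurable (measurable_heatMaj hm₂).aemeasurable)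
    rw [← heatMaj_add hm₁]
    exact heatMaj_mono_ae (ae_of_all _ fun y => (indicator_lt_add_indicator_ge L g y).ge) x
  have k1 := hC₁ t ht0 g₁ hm₁
  have k2 := hC₂ t ht0 g₂ hm₂
  rw [sub_self, mul_zero, neg_zero, Real.rpow_zero, ENNReal.ofReal_one, mul_one] at k2
  calc _ ≤ ENNReal.ofReal (t ^ γ) * (C₁ * ENNReal.ofReal (t ^ (-γ)) * lnorm r volume g₁ + B) := by
        gcongr
        exact hle.trans (add_le_add k1 k2)
    _ = (ENNReal.ofReal (t ^ γ) * ENNReal.ofReal (t ^ (-γ))) * (C₁ * lnorm r volume g₁) +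
        ENNReal.ofReal (t ^ γ) * B := by ring
    _ = C₁ * lnorm r volume g₁ + ENNReal.ofReal (t ^ γ) * B := by
        rw [← ENNReal.ofReal_mul (by positivity), ← Real.rpow_add ht0]; simp
    _ ≤ ε / 2 + ε / 2 := add_le_add hL ht
    _ = ε := ENNReal.add_halves ε

end SmallTime

/-! ### Space-time integrability of the linear flow, by time-dependent truncation. -/

section MixedNorm

variable {X : Type*} [MeasurableSpace X] {μ : Measure X} [SigmaFinite μ]

/-- Minkowski in L^{q/ρ} of time, allowed since ρ ≤ q, moves the x-integral outside. A time integral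
for each fixed x then suffices, provided that it is of size g(x)^r. -/
theorem lnorm_mixed_ne_top {q ρ r e : ℝ} (hρ : 0 < ρ) (hρq : ρ ≤ q) (hr : 0 < r)
    {g : X → ℝ≥0∞} (hg : Measurable g) (hgr : lnorm r μ g ≠ ∞) {S : ℝ → Set X}
    (hS : MeasurableSet {z : ℝ × X | z.2 ∈ S z.1}) {K : ℝ≥0∞} (hK : K ≠ ∞)
    (h : ∀ x, lnorm (q / ρ) (volume.restrict (Ioi 0))
      (fun t => ENNReal.ofReal (t ^ (ρ * e)) * (S t).indicator g x ^ ρ) ≤ K * g x ^ r) :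
    lnorm q (volume.restrict (Ioi 0))
      (fun t => ENNReal.ofReal (t ^ e) * lnorm ρ μ ((S t).indicator g)) ≠ ∞ := by
  have hm : Measurable (Function.uncurry fun (t : ℝ) (x : X) =>
      ENNReal.ofReal (t ^ (ρ * e)) * (S t).indicator g x ^ ρ) := by
    have h1 : Measurable fun z : ℝ × X => (S z.1).indicator g z.2 := by
      have : (fun z : ℝ × X => (S z.1).indicator g z.2) =
          {z : ℝ × X | z.2 ∈ S z.1}.indicator (fun z => g z.2) := by
        funext z
        by_cases hz : z.2 ∈ S z.1
        · rw [indicator_of_mem hz, indicator_of_mem (show z ∈ {z : ℝ × X | z.2 ∈ S z.1} from hz)]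
        · rw [indicator_of_notMem hz,
            indicator_of_notMem (show z ∉ {z : ℝ × X | z.2 ∈ S z.1} from hz)]
      rw [this]
      exact (hg.comp measurable_snd).indicator hS
    exact (by fun_prop : Measurable fun z : ℝ × X => ENNReal.ofReal (z.1 ^ (ρ * e))).mul
      (h1.pow_const ρ)
  have e1 : ∀ t ∈ Ioi (0 : ℝ), ENNReal.ofReal (t ^ e) * lnorm ρ μ ((S t).indicator g) =
      (∫⁻ x, ENNReal.ofReal (t ^ (ρ * e)) * (S t).indicator g x ^ ρ ∂μ) ^ (1 / ρ) := by
    intro t ht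
    have ht0 : 0 < t := ht
    rw [lintegral_const_mul' _ _ ENNReal.ofReal_ne_top, ENNReal.mul_rpow_of_nonneg _ _ (by positivity),
      ENNReal.ofReal_rpow_of_pos (by positivity), ← Real.rpow_mul ht0.le]
    unfold lnorm
    congr 4
    field_simp
  rw [lnorm_congr_ae q (by
    filter_upwards [ae_restrict_mem measurableSet_Ioi] with t ht using e1 t ht),
    lnorm_rpow (by linarith) (by positivity)]
  refine ENNReal.rpow_ne_top_of_nonneg (by positivity) ?_
  rw [mul_one_div]
  refine ne_top_of_le_ne_top ?_
    (lnorm_lintegral_le (μ := volume.restrict (Ioi (0 : ℝ))) (ν := μ) (p := q / ρ)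
      (by rwa [one_le_div hρ]) hm)
  refine ne_top_of_le_ne_top ?_ (lintegral_mono h)
  rw [lintegral_const_mul' _ _ hK]
  refine ENNReal.mul_ne_top hK ?_
  rw [← lnorm_rpow_self hr]
  exact ENNReal.rpow_ne_top_of_nonneg hr.le hgr

/-- For fixed x only the value Y = g(x) enters. The time set I is an interval cut off at a power of
Y, and `hcY` records that all powers of Y combine to Y^r. -/
theorem lnorm_mixed_pointwise {q ρ r β c Y : ℝ} (hρ : 0 < ρ) (hq : 0 < q)
    (hY : 0 < Y) (hβ : 0 < β) {I : Set ℝ} (hI : MeasurableSet I) (hI0 : I ⊆ Ioi 0)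
    {e : ℝ} (hint : ∫⁻ t in I, ENNReal.ofReal (t ^ (q * e)) = ENNReal.ofReal (c / β)) (hc : 0 < c)
    (hcY : (Y ^ q * c) ^ (ρ / q) = Y ^ r) :
    lnorm (q / ρ) (volume.restrict (Ioi 0)) (fun t => ENNReal.ofReal (t ^ (ρ * e)) *
      I.indicator (fun _ => ENNReal.ofReal Y ^ ρ) t) ≤
        ENNReal.ofReal ((1 / β) ^ (ρ / q)) * ENNReal.ofReal Y ^ r := by
  unfold lnorm
  have e1 : ∀ t ∈ Ioi (0 : ℝ), (ENNReal.ofReal (t ^ (ρ * e)) *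
      I.indicator (fun _ => ENNReal.ofReal Y ^ ρ) t) ^ (q / ρ) =
      I.indicator (fun t => ENNReal.ofReal (Y ^ q) * ENNReal.ofReal (t ^ (q * e))) t := by
    intro t ht
    have ht0 : 0 < t := ht
    by_cases h : t ∈ I
    · rw [indicator_of_mem h, indicator_of_mem h, ENNReal.mul_rpow_of_nonneg _ _ (by positivity),
        ENNReal.ofReal_rpow_of_pos (by positivity), ENNReal.ofReal_rpow_of_pos hY,
        ENNReal.ofReal_rpow_of_pos (by positivity), ← Real.rpow_mul ht0.le, ← Real.rpow_mul hY.le,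
        mul_comm]
      congr 3 <;> field_simp
    · rw [indicator_of_notMem h, indicator_of_notMem h, mul_zero,
        ENNReal.zero_rpow_of_pos (by positivity)]
  rw [setLIntegral_congr_fun measurableSet_Ioi e1, lintegral_indicator hI,
    Measure.restrict_restrict hI, inter_eq_left.2 hI0,
    lintegral_const_mul' _ _ ENNReal.ofReal_ne_top, hint, ← ENNReal.ofReal_mul (by positivity),
    ENNReal.ofReal_rpow_of_pos (by positivity), ENNReal.ofReal_rpow_of_pos hY,
    ← ENNReal.ofReal_mul (by positivity), one_div_div]
  refine ENNReal.ofReal_le_ofReal (le_of_eq ?_)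
  rw [← hcY, ← Real.mul_rpow (by positivity) (by positivity)]
  congr 1
  field_simp

theorem mixed_rpow_identity {q ρ r m Y : ℝ} (hρ : 0 < ρ) (hq : 0 < q) (hr : 0 < r) (hm : 0 < m)
    (hY : 0 < Y) : (Y ^ q * (Y ^ (-(r / m))) ^ (-(q * (m / ρ - m / r)))) ^ (ρ / q) = Y ^ r := by
  rw [← Real.rpow_mul hY.le, ← Real.rpow_add hY, ← Real.rpow_mul hY.le]
  congr 1
  field_simp
  ring

theorem rpow_neg_lt_iff {m r t Y : ℝ} (hm : 0 < m) (hr : 0 < r) (ht : 0 < t) (hY : 0 < Y) :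
    t ^ (-(m / r)) < Y ↔ Y ^ (-(r / m)) < t := by
  rw [← Real.rpow_lt_rpow_iff (by positivity) hY.le (by positivity : 0 < r / m),
    ← Real.rpow_mul ht.le, show -(m / r) * (r / m) = -1 by field_simp, Real.rpow_neg_one,
    Real.rpow_neg hY.le, inv_lt_comm₀ ht (by positivity)]

/-- At a point where g = Y the truncation is active for t > Y^{-r/m}; there the time weight is
t^{-1-β}, with β > 0 because ρ < r. -/
theorem lnorm_mixed_high {q ρ r m : ℝ} (hρ : 0 < ρ) (hρr : ρ < r) (hρq : ρ ≤ q) (hm : 0 < m)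
    {g : X → ℝ≥0∞} (hg : Measurable g) (hgr : lnorm r μ g ≠ ∞) :
    lnorm q (volume.restrict (Ioi 0)) (fun t => ENNReal.ofReal (t ^ (-(1 / q) + (m / r - m / ρ))) *
      lnorm ρ μ ({x | ENNReal.ofReal (t ^ (-(m / r))) < g x}.indicator g)) ≠ ∞ := by
  have hr : 0 < r := hρ.trans hρr
  have hq : 0 < q := by linarith
  have hβ : 0 < q * (m / ρ - m / r) := by
    have := div_lt_div_of_pos_left hm hρ hρr
    have : 0 < m / ρ - m / r := by linarith
    positivity
  set β := q * (m / ρ - m / r) with hβd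
  refine lnorm_mixed_ne_top (K := ENNReal.ofReal ((1 / β) ^ (ρ / q))) hρ hρq hr hg hgr
    (S := fun t => {x | ENNReal.ofReal (t ^ (-(m / r))) < g x}) ?_ ENNReal.ofReal_ne_top ?_
  · exact measurableSet_lt (by fun_prop) (hg.comp measurable_snd)
  intro x
  rcases eq_or_ne (g x) 0 with h0 | h0
  · refine le_of_eq_of_le ?_ zero_le
    rw [← lnorm_zero (μ := volume.restrict (Ioi (0 : ℝ))) (by positivity : 0 < q / ρ)]
    congr 1
    funext t
    simp [indicator, h0, hρ]
  rcases eq_or_ne (g x) ∞ with ht | ht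
  · rw [ht, ENNReal.top_rpow_of_pos hr, ENNReal.mul_top]
    · exact le_top
    · simp only [ne_eq, ENNReal.ofReal_eq_zero, not_le]; positivity
  have hY : 0 < (g x).toReal := ENNReal.toReal_pos h0 ht
  have hgY : g x = ENNReal.ofReal (g x).toReal := (ENNReal.ofReal_toReal ht).symm
  set Y := (g x).toReal with hYd
  have key := lnorm_mixed_pointwise (r := r) hρ hq hY hβ (I := Ioi (Y ^ (-(r / m))))
    measurableSet_Ioi (Ioi_subset_Ioi (by positivity)) (e := -(1 / q) + (m / r - m / ρ))
    (c := (Y ^ (-(r / m))) ^ (-β)) (by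
      rw [← lintegral_Ioi_rpow hβ (by positivity)]
      congr 1
      funext t
      congr 2
      rw [hβd]; field_simp; ring) (by positivity) (mixed_rpow_identity hρ hq hr hm hY)
  rw [hgY]
  refine le_of_eq_of_le (lnorm_congr_ae _ ?_) key
  filter_upwards [ae_restrict_mem measurableSet_Ioi] with t ht0
  have ht0 : 0 < t := ht0
  congr 1
  have hiff : x ∈ {x | ENNReal.ofReal (t ^ (-(m / r))) < g x} ↔ t ∈ Ioi (Y ^ (-(r / m))) := by
    rw [mem_ofPred_eq, hgY, ENNReal.ofReal_lt_ofReal_iff hY, rpow_neg_lt_iff hm hr ht0 hY]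
    rfl
  by_cases h : t ∈ Ioi (Y ^ (-(r / m)))
  · rw [indicator_of_mem h, indicator_of_mem (hiff.2 h), ← hgY]
  · rw [indicator_of_notMem h, indicator_of_notMem (fun h' => h (hiff.1 h')),
      ENNReal.zero_rpow_of_pos hρ]

/-- At a point where g = Y the truncation is active for t up to Y^{-r/m}; there the time weight is
t^{-1+β}, with β > 0 because ρ > r. -/
theorem lnorm_mixed_low {q ρ r m : ℝ} (hr : 0 < r) (hρr : r < ρ) (hρq : ρ ≤ q) (hm : 0 < m)
    {g : X → ℝ≥0∞} (hg : Measurable g) (hgr : lnorm r μ g ≠ ∞) :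
    lnorm q (volume.restrict (Ioi 0)) (fun t => ENNReal.ofReal (t ^ (-(1 / q) + (m / r - m / ρ))) *
      lnorm ρ μ ({x | g x ≤ ENNReal.ofReal (t ^ (-(m / r)))}.indicator g)) ≠ ∞ := by
  have hρ : 0 < ρ := hr.trans hρr
  have hq : 0 < q := by linarith
  have hβ : 0 < q * (m / r - m / ρ) := by
    have := div_lt_div_of_pos_left hm hr hρr
    have : 0 < m / r - m / ρ := by linarith
    positivity
  set β := q * (m / r - m / ρ) with hβd
  refine lnorm_mixed_ne_top (K := ENNReal.ofReal ((1 / β) ^ (ρ / q))) hρ hρq hr hg hgr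
    (S := fun t => {x | g x ≤ ENNReal.ofReal (t ^ (-(m / r)))}) ?_ ENNReal.ofReal_ne_top ?_
  · exact measurableSet_le (hg.comp measurable_snd) (by fun_prop)
  intro x
  rcases eq_or_ne (g x) 0 with h0 | h0
  · refine le_of_eq_of_le ?_ zero_le
    rw [← lnorm_zero (μ := volume.restrict (Ioi (0 : ℝ))) (by positivity : 0 < q / ρ)]
    congr 1
    funext t
    simp [indicator, h0, hρ]
  rcases eq_or_ne (g x) ∞ with ht | ht
  · rw [ht, ENNReal.top_rpow_of_pos hr, ENNReal.mul_top]
    · exact le_top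
    · simp only [ne_eq, ENNReal.ofReal_eq_zero, not_le]; positivity
  have hY : 0 < (g x).toReal := ENNReal.toReal_pos h0 ht
  have hgY : g x = ENNReal.ofReal (g x).toReal := (ENNReal.ofReal_toReal ht).symm
  set Y := (g x).toReal with hYd
  have key := lnorm_mixed_pointwise (r := r) hρ hq hY hβ (I := Ioo 0 (Y ^ (-(r / m))))
    measurableSet_Ioo (fun t ht => ht.1) (e := -(1 / q) + (m / r - m / ρ))
    (c := (Y ^ (-(r / m))) ^ β) (by
      rw [← lintegral_Ioo_rpow hβ (by positivity)]
      congr 1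
      funext t
      congr 2
      rw [hβd]; field_simp) (by positivity) (by
      rw [← mixed_rpow_identity hρ hq hr hm hY, hβd]
      congr 3
      ring)
  rw [hgY]
  refine le_of_eq_of_le (lnorm_congr_ae _ ?_) key
  -- The endpoint belongs to the truncation set but not to the open interval; it is a null set of
  -- times.
  have hne : ∀ᵐ t : ℝ ∂(volume.restrict (Ioi 0)), t ≠ Y ^ (-(r / m)) :=
    ae_restrict_of_ae (Measure.ae_ne volume _)
  filter_upwards [ae_restrict_mem measurableSet_Ioi, hne] with t ht0 hne
  have ht0 : 0 < t := ht0
  congr 1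
  have hiff : x ∈ {x | g x ≤ ENNReal.ofReal (t ^ (-(m / r)))} ↔ t ∈ Ioo 0 (Y ^ (-(r / m))) := by
    rw [mem_ofPred_eq, hgY, ← not_lt, ENNReal.ofReal_lt_ofReal_iff hY, rpow_neg_lt_iff hm hr ht0 hY,
      not_lt, mem_Ioo]
    exact ⟨fun h => ⟨ht0, lt_of_le_of_ne h hne⟩, fun h => h.2.le⟩
  by_cases h : t ∈ Ioo 0 (Y ^ (-(r / m)))
  · rw [indicator_of_mem h, indicator_of_mem (hiff.2 h), ← hgY]
  · rw [indicator_of_notMem h, indicator_of_notMem (fun h' => h (hiff.1 h')),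
      ENNReal.zero_rpow_of_pos hρ]

end MixedNorm

section MixedHeat

variable {n : ℕ} {α : ℝ}

/-- The space-time integrability of the heat flow of an `L^r` function. -/
theorem lnorm_time_heatMaj_ne_top (hα : 0 < α) (hn : 0 < n) {r s q : ℝ} (hr : 1 < r) (hrs : r < s)
    (hrq : r < q) {g : Sp n → ℝ≥0∞} (hg : Measurable g) (hgr : lnorm r volume g ≠ ∞) :
    lnorm q (volume.restrict (Ioi 0)) (fun t => ENNReal.ofReal (t ^ (-(1 / q))) *
      (ENNReal.ofReal (t ^ (n / (2 * α) * (1 / r - 1 / s))) *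
        lnorm s volume (heatMaj n α t g))) ≠ ∞ := by
  -- An exponent above r for the lower part; ρ ≤ s is needed for smoothing, ρ ≤ q for Minkowski in
  -- time.
  obtain ⟨ρ, hρr, hρ⟩ : ∃ ρ, r < ρ ∧ ρ ≤ min s q := ⟨min s q, lt_min hrs hrq, le_rfl⟩
  have hρs := hρ.trans (min_le_left _ _)
  have hρq := hρ.trans (min_le_right _ _)
  have hs0 : 0 < s := by linarith
  have hq0 : 0 < q := by linarith
  have hn' : (0 : ℝ) < n := by exact_mod_cast hn
  set m : ℝ := n / (2 * α) with hm
  have hm0 : 0 < m := by positivity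
  obtain ⟨C₁, hC₁⟩ := exists_lnorm_heatMaj_le (n := n) hα hn le_rfl (by linarith : 1 ≤ s)
  obtain ⟨C₂, hC₂⟩ := exists_lnorm_heatMaj_le (n := n) hα hn (by linarith : 1 ≤ ρ) hρs
  -- Cut at the height t^{-m/r} dictated by scaling. The upper part is measured in L^1 and the lower
  -- one in L^ρ, so that r lies strictly between the two exponents.
  set H : ℝ → Sp n → ℝ≥0∞ := fun t => {x | ENNReal.ofReal (t ^ (-(m / r))) < g x}.indicator g
  set L : ℝ → Sp n → ℝ≥0∞ := fun t => {x | g x ≤ ENNReal.ofReal (t ^ (-(m / r)))}.indicator g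
  have hH := lnorm_mixed_high (μ := (volume : Measure (Sp n))) one_pos hr
    (by linarith : 1 ≤ q) hm0 hg hgr
  have hL := lnorm_mixed_low (μ := (volume : Measure (Sp n))) (by linarith) hρr hρq hm0 hg hgr
  set FH : ℝ → ℝ≥0∞ := fun t => ENNReal.ofReal (t ^ (-(1 / q) + (m / r - m / 1))) *
      lnorm 1 volume (H t) with hFH
  set FL : ℝ → ℝ≥0∞ := fun t => ENNReal.ofReal (t ^ (-(1 / q) + (m / r - m / ρ))) *
      lnorm ρ volume (L t) with hFL
  have hmH : Measurable fun z : ℝ × Sp n => H z.1 z.2 := by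
    have : (fun z : ℝ × Sp n => H z.1 z.2) =
        {z : ℝ × Sp n | ENNReal.ofReal (z.1 ^ (-(m / r))) < g z.2}.indicator (fun z => g z.2) := rfl
    rw [this]
    exact (hg.comp measurable_snd).indicator
      (measurableSet_lt (by fun_prop) (hg.comp measurable_snd))
  have hmL : Measurable fun z : ℝ × Sp n => L z.1 z.2 := by
    have : (fun z : ℝ × Sp n => L z.1 z.2) =
        {z : ℝ × Sp n | g z.2 ≤ ENNReal.ofReal (z.1 ^ (-(m / r)))}.indicator (fun z => g z.2) := rfl
    rw [this]
    exact (hg.comp measurable_snd).indicator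
      (measurableSet_le (hg.comp measurable_snd) (by fun_prop))
  have hmFH : Measurable FH :=
    (by fun_prop : Measurable fun t : ℝ => ENNReal.ofReal (t ^ (-(1 / q) + (m / r - m / 1)))).mul
      (measurable_lnorm_slice hmH)
  have hmFL : Measurable FL :=
    (by fun_prop : Measurable fun t : ℝ => ENNReal.ofReal (t ^ (-(1 / q) + (m / r - m / ρ)))).mul
      (measurable_lnorm_slice hmL)
  have hbound : ∀ t ∈ Ioi (0 : ℝ), ENNReal.ofReal (t ^ (-(1 / q))) *
      (ENNReal.ofReal (t ^ (m * (1 / r - 1 / s))) * lnorm s volume (heatMaj n α t g)) ≤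
      C₁ * FH t + C₂ * FL t := by
    intro t ht
    have ht0 : 0 < t := ht
    have hm₁ : Measurable (H t) := hg.indicator (measurableSet_lt measurable_const hg)
    have hm₂ : Measurable (L t) := hg.indicator (measurableSet_le hg measurable_const)
    have hle : lnorm s volume (heatMaj n α t g) ≤
        lnorm s volume (heatMaj n α t (H t)) + lnorm s volume (heatMaj n α t (L t)) := by
      refine le_trans (lnorm_mono hs0 fun x => ?_) (lnorm_add_le (by linarith)
        (measurable_heatMaj hm₁).aemeasurable (measurable_heatMaj hm₂).aemeasurable)
      rw [← heatMaj_add hm₁]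
      exact heatMaj_mono_ae (ae_of_all _ fun y => (indicator_lt_add_indicator_ge _ g y).ge) x
    have k1 := hC₁ t ht0 _ hm₁
    have k2 := hC₂ t ht0 _ hm₂
    have aux : ∀ (C : ℝ≥0) (ρ : ℝ) (N : ℝ≥0∞), ENNReal.ofReal (t ^ (-(1 / q))) *
        (ENNReal.ofReal (t ^ (m * (1 / r - 1 / s))) *
          (C * ENNReal.ofReal (t ^ (-(m * (1 / ρ - 1 / s)))) * N)) =
        C * (ENNReal.ofReal (t ^ (-(1 / q) + (m / r - m / ρ))) * N) := by
      intro C ρ N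
      have : t ^ (-(1 / q) + (m / r - m / ρ)) =
          t ^ (-(1 / q)) * (t ^ (m * (1 / r - 1 / s)) * t ^ (-(m * (1 / ρ - 1 / s)))) := by
        rw [← Real.rpow_add ht0, ← Real.rpow_add ht0]
        congr 1
        ring
      rw [this, ENNReal.ofReal_mul (by positivity), ENNReal.ofReal_mul (by positivity)]
      ring
    calc _ ≤ ENNReal.ofReal (t ^ (-(1 / q))) * (ENNReal.ofReal (t ^ (m * (1 / r - 1 / s))) *
          (C₁ * ENNReal.ofReal (t ^ (-(m * (1 / 1 - 1 / s)))) * lnorm 1 volume (H t) +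
          C₂ * ENNReal.ofReal (t ^ (-(m * (1 / ρ - 1 / s)))) * lnorm ρ volume (L t))) := by
          gcongr
          exact hle.trans (add_le_add k1 k2)
      _ = C₁ * FH t + C₂ * FL t := by
          rw [mul_add, mul_add, aux, aux]
  refine ne_top_of_le_ne_top ?_ (lnorm_mono_ae hq0 (g := fun t => C₁ * FH t + C₂ * FL t) (by
    filter_upwards [ae_restrict_mem measurableSet_Ioi] with t ht using hbound t ht))
  refine ne_top_of_le_ne_top ?_ (lnorm_add_le (by linarith)
    (hmFH.const_mul _).aemeasurable (hmFL.const_mul _).aemeasurable)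
  rw [lnorm_const_mul hq0 ENNReal.coe_ne_top, lnorm_const_mul hq0 ENNReal.coe_ne_top]
  exact ENNReal.add_ne_top.2 ⟨ENNReal.mul_ne_top ENNReal.coe_ne_top hH,
    ENNReal.mul_ne_top ENNReal.coe_ne_top hL⟩

end MixedHeat

/-! ### Series of functions, and jointly measurable representatives of curves. -/

section Series

variable {X : Type*} [MeasurableSpace X] {μ : Measure X} [SigmaFinite μ]

/-- Minkowski's integral inequality for the counting measure. -/
theorem lnorm_tsum_le {p : ℝ} (hp : 1 ≤ p) {g : ℕ → X → ℝ≥0∞} (hg : ∀ k, Measurable (g k)) :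
    lnorm p μ (fun x => ∑' k, g k x) ≤ ∑' k, lnorm p μ (g k) := by
  have hm : Measurable (Function.uncurry fun (x : X) (k : ℕ) => g k x) :=
    measurable_from_prod_countable_left hg
  have := lnorm_lintegral_le (μ := μ) (ν := Measure.count) hp hm
  simpa only [lintegral_count] using this

theorem ae_tsum_lt_top {p : ℝ} (hp : 1 ≤ p) {g : ℕ → X → ℝ≥0∞} (hg : ∀ k, Measurable (g k))
    (h : ∑' k, lnorm p μ (g k) ≠ ∞) : ∀ᵐ x ∂μ, ∑' k, g k x < ∞ :=
  ae_lt_top_of_lnorm (by linarith) (Measurable.tsum hg)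
    (ne_top_of_le_ne_top h (lnorm_tsum_le hp hg))

end Series

section Representative

variable {𝕜 : Type*} [RCLike 𝕜] {n : ℕ} {r : ℝ}

theorem edist_LSpace (hr : 0 < r) (u v : LSpace 𝕜 n r) :
    edist u v = lnorm r volume (fun x => ‖u x - v x‖ₑ) := by
  rw [Lp.edist_def, eLpNorm_eq_lnorm hr]
  rfl

theorem enorm_LSpace (hr : 0 < r) (u : LSpace 𝕜 n r) :
    ‖u‖ₑ = lnorm r volume (fun x => ‖u x‖ₑ) := by
  rw [Lp.enorm_def, eLpNorm_eq_lnorm hr]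

theorem measurable_LSpace (u : LSpace 𝕜 n r) : Measurable (u : Sp n → 𝕜) :=
  (Lp.stronglyMeasurable u).measurable

theorem lnorm_LSpace_ne_top (hr : 0 < r) (u : LSpace 𝕜 n r) :
    lnorm r volume (fun x => ‖u x‖ₑ) ≠ ∞ := by
  rw [← eLpNorm_eq_lnorm hr]
  exact Lp.eLpNorm_ne_top u

theorem memLp_of_lnorm (hr : 0 < r) {f : Sp n → 𝕜} (hf : Measurable f)
    (h : lnorm r volume (fun x => ‖f x‖ₑ) ≠ ∞) : MemLp f (ENNReal.ofReal r) volume :=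
  ⟨hf.aestronglyMeasurable, by rw [eLpNorm_eq_lnorm hr]; exact h.lt_top⟩

/-- A continuous curve in `L^r` is represented by a jointly measurable function. -/
theorem exists_measurable_representative [hr1 : Fact (1 ≤ ENNReal.ofReal r)] {I : Set ℝ}
    (hI : MeasurableSet I) {u : ℝ → LSpace 𝕜 n r} (hu : ContinuousOn u I) :
    ∃ U : ℝ × Sp n → 𝕜, Measurable U ∧ ∀ t ∈ I, ∀ᵐ x, u t x = U (t, x) := by
  classical
  have hr : 1 ≤ r := by simpa using hr1.out
  have hr0 : 0 < r := by linarith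
  have : Fact (ENNReal.ofReal r ≠ ∞) := ⟨ENNReal.ofReal_ne_top⟩
  obtain ⟨d, hd⟩ : ∃ d : ℕ → LSpace 𝕜 n r, DenseRange d :=
    ⟨_, TopologicalSpace.denseRange_denseSeq _⟩
  set h : ℕ → ℝ → ℝ≥0∞ := fun j => I.piecewise (fun t => edist (u t) (d j)) (fun _ => 0) with hh
  have hm : ∀ j, Measurable (h j) := fun j =>
    ContinuousOn.measurable_piecewise
      ((continuous_id.edist continuous_const).comp_continuousOn hu) continuousOn_const hI
  have hex : ∀ (k : ℕ) (t : ℝ), ∃ j, h j t < (2⁻¹ : ℝ≥0∞) ^ k := by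
    intro k t
    have hpos : (0 : ℝ≥0∞) < 2⁻¹ ^ k := ENNReal.pow_pos (by simp) k
    by_cases ht : t ∈ I
    · obtain ⟨y, ⟨j, hj⟩, hy⟩ := EMetric.mem_closure_iff.1 (hd (u t)) _ hpos
      refine ⟨j, ?_⟩
      simp only [hh, piecewise_eq_of_mem _ _ _ ht]
      rwa [hj]
    · refine ⟨0, ?_⟩
      simp only [hh, piecewise_eq_of_notMem _ _ _ ht]
      exact hpos
  -- The first member of a dense sequence within 2^{-k} of u(t) is a measurable choice, since each
  -- distance is measurable in t. Outside I the distance is set to zero, so that the choice is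
  -- always possible.
  obtain ⟨idx, hidx, hspec⟩ : ∃ idx : ℕ → ℝ → ℕ, (∀ k, Measurable (idx k)) ∧
      ∀ k t, h (idx k t) t < (2⁻¹ : ℝ≥0∞) ^ k :=
    ⟨fun k t => Nat.find (hex k t), fun k =>
      measurable_find (hex k) fun j => measurableSet_lt (hm j) measurable_const,
      fun k t => Nat.find_spec (hex k t)⟩
  set F : ℕ → ℝ × Sp n → 𝕜 := fun k z => d (idx k z.1) z.2 with hF
  have hFm : ∀ k, Measurable (F k) := by
    intro k
    have h1 : Measurable fun w : ℕ × Sp n => d w.1 w.2 :=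
      measurable_from_prod_countable_right fun j => measurable_LSpace (d j)
    exact h1.comp (((hidx k).comp measurable_fst).prodMk measurable_snd)
  refine ⟨fun z => limUnder atTop fun k => F k z,
    (StronglyMeasurable.limUnder fun k => (hFm k).stronglyMeasurable).measurable, fun t ht => ?_⟩
  set g : ℕ → Sp n → ℝ≥0∞ := fun k x => ‖F k (t, x) - u t x‖ₑ with hg
  have hgm : ∀ k, Measurable (g k) := fun k =>
    Measurable.enorm (Measurable.sub (measurable_LSpace (d (idx k t)))
      (measurable_LSpace (u t)))
  have hgk : ∀ k, lnorm r volume (g k) ≤ (2⁻¹ : ℝ≥0∞) ^ k := by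
    intro k
    have h2 : ∀ j, h j t = edist (u t) (d j) := fun j => piecewise_eq_of_mem _ _ _ ht
    have h3 := edist_LSpace hr0 (d (idx k t)) (u t)
    rw [edist_comm, ← h2] at h3
    exact h3.symm.trans_le (hspec k t).le
  -- The errors 2^{-k} are summable, which turns convergence in norm into convergence at almost
  -- every x, for each t in I.
  have hsum : ∑' k, lnorm r volume (g k) ≠ ∞ := by
    refine ne_top_of_le_ne_top ?_ (ENNReal.tsum_le_tsum hgk)
    rw [ENNReal.tsum_geometric]
    simp
  filter_upwards [ae_tsum_lt_top hr hgm hsum] with x hx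
  have h0 : Tendsto (fun k => g k x) atTop (𝓝 0) := ENNReal.tendsto_atTop_zero_of_tsum_ne_top hx.ne
  have h1 : Tendsto (fun k => F k (t, x)) atTop (𝓝 (u t x)) := by
    rw [tendsto_iff_edist_tendsto_0]
    simpa only [edist_eq_enorm_sub] using h0
  exact h1.limUnder_eq.symm

end Representative

/-! ### Continuity of the linear orbits at every time. -/

section SemigroupContinuity

variable {𝕜 : Type*} [RCLike 𝕜] {n : ℕ} {α : ℝ}

theorem measurable_semigroup (t : ℝ) {g : Sp n → 𝕜} (hg : Measurable g) :
    Measurable (semigroup α t g) := by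
  by_cases ht : t = 0
  · have : semigroup α t g = g := by funext x; rw [semigroup, if_pos ht]
    rwa [this]
  · have h := measurable_semigroup_uncurry (α := α) (hg.comp (measurable_snd (α := ℝ)))
    have hmap : Measurable fun x : Sp n => (((t, 0) : ℝ × ℝ), x) := measurable_prodMk_left
    have h2 := h.comp hmap
    have : semigroup α t g = fun x => ∫ y, kernel n α (t - 0) (x - y) • g y := by
      funext x; rw [semigroup, if_neg ht, sub_zero]
    rw [this]
    exact h2

theorem semigroup_zero (g : Sp n → 𝕜) : semigroup α 0 g = g := by
  funext x; rw [semigroup, if_pos rfl]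

theorem semigroup_sub {t : ℝ} (ht : 0 < t) {f g : Sp n → 𝕜} (hf : Measurable f) (hg : Measurable g)
    {x : Sp n} (h : heatMaj n α t (fun y => ‖f y‖ₑ) x < ∞)
    (h' : heatMaj n α t (fun y => ‖g y‖ₑ) x < ∞) :
    semigroup α t f x - semigroup α t g x = semigroup α t (fun y => f y - g y) x := by
  rw [semigroup_of_pos ht, semigroup_of_pos ht, semigroup_of_pos ht,
    ← integral_sub (integrable_kernel_smul hf h) (integrable_kernel_smul hg h')]
  simp_rw [smul_sub]

theorem lnorm_heatMaj_ne_top (hα : 0 < α) (hn : 0 < n) {s p : ℝ} (hs : 1 ≤ s) (hsp : s ≤ p) {t : ℝ}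
    (ht : 0 < t) {g : Sp n → ℝ≥0∞} (hg : Measurable g) (h : lnorm s volume g ≠ ∞) :
    lnorm p volume (heatMaj n α t g) ≠ ∞ := by
  obtain ⟨C, hC⟩ := exists_lnorm_heatMaj_le (n := n) hα hn hs hsp
  exact ne_top_of_le_ne_top (ENNReal.mul_ne_top (ENNReal.mul_ne_top ENNReal.coe_ne_top
    ENNReal.ofReal_ne_top) h) (hC t ht g hg)

theorem ae_heatMaj_lt_top (hα : 0 < α) (hn : 0 < n) {s : ℝ} (hs : 1 ≤ s) {t : ℝ}
    (ht : 0 < t) {g : Sp n → ℝ≥0∞} (hg : Measurable g) (h : lnorm s volume g ≠ ∞) :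
    ∀ᵐ x, heatMaj n α t g x < ∞ :=
  ae_lt_top_of_lnorm (by linarith) (measurable_heatMaj hg)
    (lnorm_heatMaj_ne_top hα hn hs le_rfl ht hg h)

/-- The semigroup has a uniform modulus of continuity along each orbit. -/
theorem exists_lnorm_semigroup_sub_le (hα : 0 < α) (hn : 0 < n) {r : ℝ} (hr : 1 ≤ r)
    {φ : Sp n → 𝕜} (hφ : Measurable φ) (hφr : lnorm r volume (fun x => ‖φ x‖ₑ) ≠ ∞) :
    ∃ C : ℝ≥0, ∀ a b : ℝ, 0 ≤ a → a < b →
      lnorm r volume (fun x => ‖semigroup α b φ x - semigroup α a φ x‖ₑ) ≤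
        C * lnorm r volume (fun x => ‖semigroup α (b - a) φ x - φ x‖ₑ) := by
  have hr0 : 0 < r := by linarith
  obtain ⟨C, hC⟩ := exists_lnorm_heatMaj_le (n := n) hα hn hr le_rfl
  -- The 1 covers a = 0, where the semigroup is the identity and the smoothing bound does not apply.
  refine ⟨max C 1, fun a b ha hab => ?_⟩
  have hb : 0 < b - a := sub_pos.2 hab
  rcases ha.eq_or_lt with rfl | ha
  · rw [sub_zero, semigroup_zero]
    refine le_mul_of_one_le_left zero_le ?_
    exact_mod_cast le_max_right _ _
  have hn1 : lnorm r volume (heatMaj n α (b - a) fun y => ‖φ y‖ₑ) ≠ ∞ :=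
    lnorm_heatMaj_ne_top hα hn hr le_rfl hb hφ.enorm hφr
  have hfin := ae_heatMaj_lt_top hα hn hr ha (measurable_heatMaj hφ.enorm) hn1
  have hfin' := ae_heatMaj_lt_top hα hn hr ha hφ.enorm hφr
  -- The semigroup law gives S(b)φ - S(a)φ = S(a)w, and S(a) is bounded on L^r uniformly in a.
  set w : Sp n → 𝕜 := fun x => semigroup α (b - a) φ x - φ x with hw
  have hwm : Measurable w := (measurable_semigroup _ hφ).sub hφ
  have hpt : ∀ᵐ x, ‖semigroup α b φ x - semigroup α a φ x‖ₑ ≤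
      heatMaj n α a (fun y => ‖w y‖ₑ) x := by
    filter_upwards [hfin, hfin'] with x hx hx'
    have e1 := semigroup_semigroup hα hn ha hb hφ hx
    rw [add_sub_cancel] at e1
    have hx2 : heatMaj n α a (fun y => ‖semigroup α (b - a) φ y‖ₑ) x < ∞ :=
      lt_of_le_of_lt (heatMaj_mono_ae (ae_of_all _ fun y => enorm_semigroup_le hb φ y) x) hx
    rw [← e1, semigroup_sub ha (measurable_semigroup _ hφ) hφ hx2 hx']
    exact enorm_semigroup_le ha _ x
  refine (lnorm_mono_ae hr0 hpt).trans ?_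
  have := hC a ha _ hwm.enorm
  rw [sub_self, mul_zero, neg_zero, Real.rpow_zero, ENNReal.ofReal_one, mul_one] at this
  refine this.trans ?_
  gcongr
  exact_mod_cast le_max_left _ _

theorem tendsto_lnorm_semigroup_sub_semigroup (hα : 0 < α) (hn : 0 < n) {r : ℝ} (hr : 1 ≤ r)
    {φ : Sp n → 𝕜} (hφ : Measurable φ) (hφr : lnorm r volume (fun x => ‖φ x‖ₑ) ≠ ∞) {t₀ : ℝ}
    (ht₀ : 0 ≤ t₀) :
    Tendsto (fun t => lnorm r volume (fun x => ‖semigroup α t φ x - semigroup α t₀ φ x‖ₑ))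
      (𝓝[Ici 0] t₀) (𝓝 0) := by
  have hr0 : 0 < r := by linarith
  obtain ⟨C, hC⟩ := exists_lnorm_semigroup_sub_le (n := n) hα hn hr hφ hφr
  have h0 := ENNReal.Tendsto.const_mul (a := (C : ℝ≥0∞))
    (tendsto_lnorm_semigroup_sub (n := n) hα hn hr hφ hφr) (Or.inr ENNReal.coe_ne_top)
  rw [mul_zero] at h0
  rw [ENNReal.tendsto_nhds_zero] at h0 ⊢
  intro ε hε
  obtain ⟨δ, hδ, hδ'⟩ := mem_nhdsGT_iff_exists_Ioo_subset.1 (h0 ε hε)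
  have hδ : 0 < δ := hδ
  filter_upwards [self_mem_nhdsWithin, mem_nhdsWithin_of_mem_nhds (Metric.ball_mem_nhds t₀ hδ)]
    with t ht hball
  rw [Metric.mem_ball, Real.dist_eq, abs_lt] at hball
  rcases lt_trichotomy t t₀ with h | h | h
  · refine le_trans (le_of_eq ?_) ((hC t t₀ ht h).trans
      (hδ' ⟨sub_pos.2 h, by linarith⟩ : _ ≤ ε))
    congr 1
    funext x
    rw [← enorm_neg, neg_sub]
  · simp [h, lnorm_zero hr0]
  · exact (hC t₀ t ht₀ h).trans (hδ' ⟨sub_pos.2 h, by linarith⟩ : _ ≤ ε)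

end SemigroupContinuity

/-! ### Restarting the Duhamel integral at an intermediate time. -/

section Restart

variable {n : ℕ} {α : ℝ} {𝕜 : Type*} [RCLike 𝕜]

theorem lintegral_Ioo_shift (f : ℝ → ℝ≥0∞) (s h : ℝ) :
    ∫⁻ τ in Ioo s (s + h), f τ = ∫⁻ τ in Ioo 0 h, f (s + τ) := by
  have e := (measurePreserving_add_left volume s).setLIntegral_comp_preimage_emb
    (measurableEmbedding_addLeft s) f (Ioo s (s + h))
  rw [← e]
  congr 2
  ext τ
  simp

theorem integral_Ioo_shift {E : Type*} [NormedAddCommGroup E] [NormedSpace ℝ E] (f : ℝ → E)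
    (s h : ℝ) : ∫ τ in Ioo s (s + h), f τ = ∫ τ in Ioo 0 h, f (s + τ) := by
  have e := (measurePreserving_add_left volume s).setIntegral_preimage_emb
    (measurableEmbedding_addLeft s) f (Ioo s (s + h))
  rw [← e]
  congr 2
  ext τ
  simp

theorem heatMaj_duhMaj {h s : ℝ} {g : ℝ × Sp n → ℝ≥0∞} (hg : Measurable g) (x : Sp n) :
    heatMaj n α h (duhMaj n α s g) x =
      ∫⁻ τ in Ioo 0 s, heatMaj n α h (heatMaj n α (s - τ) fun y => g (τ, y)) x := by
  have hk : Measurable fun y : Sp n => ‖kernel n α h (x - y)‖ₑ :=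
    (measurable_enorm_kernel n α h).comp (measurable_const.sub measurable_id)
  have hm : Measurable fun w : Sp n × ℝ =>
      ‖kernel n α h (x - w.1)‖ₑ * heatMaj n α (s - w.2) (fun y => g (w.2, y)) w.1 :=
    (hk.comp measurable_fst).mul (measurable_heatMaj_slice hg s)
  have e1 : ∀ y, ‖kernel n α h (x - y)‖ₑ * duhMaj n α s g y = ∫⁻ τ in Ioo 0 s,
      ‖kernel n α h (x - y)‖ₑ * heatMaj n α (s - τ) (fun y => g (τ, y)) y := fun y =>
    (lintegral_const_mul' _ _ enorm_ne_top).symm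
  calc heatMaj n α h (duhMaj n α s g) x = ∫⁻ y, ∫⁻ τ in Ioo 0 s,
      ‖kernel n α h (x - y)‖ₑ * heatMaj n α (s - τ) (fun y => g (τ, y)) y := lintegral_congr e1
    _ = _ := lintegral_lintegral_swap hm.aemeasurable

/-- Fubini, justified by the finiteness of the majorant, moves S(h) under the time integral, where
the semigroup law applies. -/
theorem semigroup_duhamel (hα : 0 < α) (hn : 0 < n) {h s : ℝ} (hh : 0 < h)
    {G : ℝ × Sp n → 𝕜} (hG : Measurable G) {x : Sp n}
    (hfin : heatMaj n α h (duhMaj n α s fun z => ‖G z‖ₑ) x < ∞) :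
    semigroup α h (duhamel n α s G) x =
      ∫ τ in Ioo 0 s, semigroup α (s + h - τ) (fun y => G (τ, y)) x := by
  rw [heatMaj_duhMaj hG.enorm] at hfin
  have hk : Measurable fun y : Sp n => kernel n α h (x - y) := by
    have h1 : Measurable fun y : Sp n => (h, x - y) :=
      measurable_const.prodMk (measurable_const.sub measurable_id)
    exact (measurable_kernel n α).comp h1
  have hsl : Measurable fun w : Sp n × ℝ =>
      ∫ y, kernel n α (s - w.2) (w.1 - y) • G (w.2, y) := by
    have hmap : Measurable fun w : Sp n × ℝ => (((s, w.2) : ℝ × ℝ), w.1) :=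
      (measurable_const.prodMk measurable_snd).prodMk measurable_fst
    exact (measurable_semigroup_uncurry (α := α) hG).comp hmap
  set F : Sp n → ℝ → 𝕜 := fun y τ =>
    kernel n α h (x - y) • ∫ z, kernel n α (s - τ) (y - z) • G (τ, z) with hF
  have hFm : Measurable (Function.uncurry F) := (hk.comp measurable_fst).smul hsl
  have hint : Integrable (Function.uncurry F) (volume.prod (volume.restrict (Ioo 0 s))) := by
    refine ⟨hFm.aestronglyMeasurable, lt_of_le_of_lt ?_ hfin⟩
    rw [lintegral_prod_symm' _ hFm.enorm]
    refine setLIntegral_mono' measurableSet_Ioo fun τ hτ => ?_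
    refine lintegral_mono fun y => ?_
    simp only [Function.uncurry_apply_pair, hF, enorm_smul]
    gcongr
    rw [← semigroup_of_pos (sub_pos.2 hτ.2)]
    exact enorm_semigroup_le (sub_pos.2 hτ.2) _ y
  have e1 : semigroup α h (duhamel n α s G) x = ∫ y, ∫ τ in Ioo 0 s, F y τ := by
    rw [semigroup_of_pos hh]
    congr 1
    funext y
    rw [duhamel, integral_smul]
    congr 1
    refine setIntegral_congr_fun measurableSet_Ioo fun τ hτ => ?_
    exact semigroup_of_pos (sub_pos.2 hτ.2) _ _
  rw [e1, integral_integral_swap hint]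
  have hmm : Measurable fun τ => heatMaj n α h (heatMaj n α (s - τ) fun y => ‖G (τ, y)‖ₑ) x := by
    have hm : Measurable fun w : Sp n × ℝ =>
        ‖kernel n α h (x - w.1)‖ₑ * heatMaj n α (s - w.2) (fun y => ‖G (w.2, y)‖ₑ) w.1 :=
      (hk.enorm.comp measurable_fst).mul (measurable_heatMaj_slice hG.enorm s)
    exact hm.lintegral_prod_left'
  refine integral_congr_ae ?_
  filter_upwards [ae_lt_top hmm hfin.ne, ae_restrict_mem measurableSet_Ioo] with τ hτ hτs
  have hs : 0 < s - τ := sub_pos.2 hτs.2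
  have hGτ : Measurable fun y => G (τ, y) := hG.comp measurable_prodMk_left
  rw [show s + h - τ = h + (s - τ) by ring, ← semigroup_semigroup hα hn hh hs hGτ hτ,
    semigroup_of_pos hh]
  congr 1
  funext y
  rw [semigroup_of_pos hs]

theorem duhMaj_restart_le (hα : 0 < α) (hn : 0 < n) {s h : ℝ} (hh : 0 < h)
    {g : ℝ × Sp n → ℝ≥0∞} (hg : Measurable g) (x : Sp n) :
    duhMaj n α (s + h) g x ≤
      heatMaj n α h (duhMaj n α s g) x + duhMaj n α h (fun z => g (s + z.1, z.2)) x := by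
  have hsplit : Ioo 0 (s + h) ⊆ Ioo 0 s ∪ ({s} ∪ Ioo s (s + h)) := by
    intro τ hτ
    rcases lt_trichotomy τ s with h | h | h
    · exact Or.inl ⟨hτ.1, h⟩
    · exact Or.inr (Or.inl h)
    · exact Or.inr (Or.inr ⟨h, hτ.2⟩)
  rw [heatMaj_duhMaj hg]
  unfold duhMaj
  refine (lintegral_mono_set hsplit).trans ((lintegral_union_le _ _ _).trans ?_)
  refine add_le_add ?_ ?_
  · refine setLIntegral_mono' measurableSet_Ioo fun τ hτ => ?_
    rw [show s + h - τ = h + (s - τ) by ring]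
    exact heatMaj_add_time_le hα hn hh (sub_pos.2 hτ.2) (hg.comp measurable_prodMk_left) x
  · refine (lintegral_union_le _ _ _).trans ?_
    rw [setLIntegral_measure_zero _ _ (by simp), zero_add, lintegral_Ioo_shift]
    refine le_of_eq (lintegral_congr fun τ => ?_)
    rw [show s + h - (s + τ) = h - τ by ring]

/-- Splitting the Duhamel integral at an intermediate time. -/
theorem duhamel_restart (hα : 0 < α) (hn : 0 < n) {s h : ℝ} (hs : 0 ≤ s) (hh : 0 < h)
    {G : ℝ × Sp n → 𝕜} (hG : Measurable G) {x : Sp n}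
    (h1 : heatMaj n α h (duhMaj n α s fun z => ‖G z‖ₑ) x < ∞)
    (h2 : duhMaj n α h (fun z => ‖G (s + z.1, z.2)‖ₑ) x < ∞) :
    duhamel n α (s + h) G x =
      semigroup α h (duhamel n α s G) x + duhamel n α h (fun z => G (s + z.1, z.2)) x := by
  have hfin : duhMaj n α (s + h) (fun z => ‖G z‖ₑ) x < ∞ :=
    lt_of_le_of_lt (duhMaj_restart_le hα hn hh hG.enorm x) (ENNReal.add_lt_top.2 ⟨h1, h2⟩)
  have hint := integrableOn_semigroup_of_duhMaj hG hfin
  rw [semigroup_duhamel hα hn hh hG h1]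
  have hsplit : Ioo 0 (s + h) = Ioo 0 (s + h) \ Ioo s (s + h) ∪ Ioo s (s + h) :=
    (sdiff_union_of_subset (Ioo_subset_Ioo_left hs)).symm
  unfold duhamel
  rw [hsplit, setIntegral_union disjoint_sdiff_left measurableSet_Ioo
    (hint.mono_set sdiff_subset) (hint.mono_set (Ioo_subset_Ioo_left hs))]
  congr 1
  · refine setIntegral_congr_set ?_
    have hne : ∀ᵐ τ : ℝ, τ ≠ s := Measure.ae_ne volume s
    filter_upwards [hne] with τ hτ
    refine propext ⟨fun h' => ⟨h'.1.1, ?_⟩, fun h' => ⟨⟨h'.1, ?_⟩, fun h'' => ?_⟩⟩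
    · by_contra hc
      exact h'.2 ⟨lt_of_le_of_ne (not_lt.1 hc) hτ.symm, h'.1.2⟩
    · linarith [h'.2]
    · linarith [h'.2, h''.1]
  · rw [integral_Ioo_shift]
    congr 1
    funext τ
    rw [show s + h - (s + τ) = h - τ by ring]

end Restart

/-! ### Estimates of the nonlinear Duhamel term. -/

section Estimates

variable {n : ℕ} {α : ℝ}

/-- The Duhamel integral of a source with a power singularity at time zero. -/
theorem exists_lnorm_duhMaj_le_beta (hα : 0 < α) (hn : 0 < n) {σ ρ : ℝ} (hσ : 1 ≤ σ)
    (hσρ : σ ≤ ρ) : ∃ C : ℝ≥0, ∀ t : ℝ, 0 < t → ∀ (B : ℝ) (g : ℝ × Sp n → ℝ≥0∞) (k : ℝ → ℝ≥0∞),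
      Measurable g →
      (∀ τ ∈ Ioo 0 t, lnorm σ volume (fun y => g (τ, y)) ≤ ENNReal.ofReal (τ ^ (-B)) * k τ) →
      lnorm ρ volume (duhMaj n α t g) ≤
        C * (ENNReal.ofReal (t ^ (1 - n / (2 * α) * (1 / σ - 1 / ρ) - B)) *
          ∫⁻ θ in Ioo (0 : ℝ) 1, betaWeight (n / (2 * α) * (1 / σ - 1 / ρ)) B θ * k (t * θ)) := by
  obtain ⟨C, hC⟩ := exists_lnorm_duhMaj_le (n := n) hα hn hσ hσρ
  refine ⟨C, fun t ht B g k hg hk => (hC t g hg).trans ?_⟩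
  gcongr
  rw [← lintegral_singular_eq ht]
  exact setLIntegral_mono' measurableSet_Ioo fun τ hτ => by gcongr; exact hk τ hτ

theorem lnorm_power_mul_le {X : Type*} [MeasurableSpace X] {μ : Measure X} {b s : ℝ} (hb : 0 < b)
    (hs : b ≤ s) {u v w : X → ℝ≥0∞} (hu : Measurable u) (hv : Measurable v) (hw : Measurable w) :
    lnorm (s / (b + 1)) μ (fun x => (u x ^ b + v x ^ b) * w x) ≤
      (lnorm s μ u ^ b + lnorm s μ v ^ b) * lnorm s μ w := by
  have hs0 : 0 < s := by linarith
  refine (lnorm_mul_le (q := s / b) (s := s) (by positivity) hs0 (by field_simp)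
    ((hu.pow_const b).add (hv.pow_const b)).aemeasurable hw.aemeasurable).trans ?_
  gcongr
  refine (lnorm_add_le (by rwa [one_le_div hb]) (hu.pow_const b).aemeasurable
    (hv.pow_const b).aemeasurable).trans ?_
  rw [lnorm_rpow (by positivity) hb, lnorm_rpow (by positivity) hb, div_mul_cancel₀ _ hb.ne']

/-- The Duhamel integral of a superlinear source. -/
theorem exists_lnorm_duhMaj_power_le (hα : 0 < α) (hn : 0 < n) {b s ρ : ℝ} (hb : 0 < b)
    (hs : b + 1 ≤ s) (hρ : s ≤ ρ * (b + 1)) : ∃ C : ℝ≥0, ∀ t : ℝ, 0 < t →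
      ∀ (γ : ℝ) (a : ℝ≥0∞) (u v w : ℝ × Sp n → ℝ≥0∞) (h : ℝ → ℝ≥0∞), Measurable u → Measurable v →
      Measurable w → Measurable h →
      (∀ τ ∈ Ioo 0 t, lnorm s volume (fun y => u (τ, y)) ≤ ENNReal.ofReal (τ ^ (-γ)) * a) →
      (∀ τ ∈ Ioo 0 t, lnorm s volume (fun y => v (τ, y)) ≤ ENNReal.ofReal (τ ^ (-γ)) * a) →
      (∀ τ ∈ Ioo 0 t, lnorm s volume (fun y => w (τ, y)) ≤ ENNReal.ofReal (τ ^ (-γ)) * h τ) →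
      lnorm ρ volume (duhMaj n α t (fun z => (u z ^ b + v z ^ b) * w z)) ≤
        C * (a ^ b * (ENNReal.ofReal (t ^ (1 - n / (2 * α) * ((b + 1) / s - 1 / ρ) - γ * (b + 1))) *
          ∫⁻ θ in Ioo (0 : ℝ) 1,
            betaWeight (n / (2 * α) * ((b + 1) / s - 1 / ρ)) (γ * (b + 1)) θ * h (t * θ))) := by
  have hb1 : 0 < b + 1 := by linarith
  obtain ⟨C, hC⟩ := exists_lnorm_duhMaj_le_beta (n := n) hα hn (σ := s / (b + 1)) (ρ := ρ)
    (by rwa [one_le_div hb1]) (by rwa [div_le_iff₀ hb1])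
  -- The factor 2 arises because u and v both contribute the bound a^b.
  refine ⟨2 * C, fun t ht γ a u v w h hu hv hw hh h1 h2 h3 => ?_⟩
  have key := hC t ht (γ * (b + 1)) (fun z => (u z ^ b + v z ^ b) * w z)
    (fun τ => 2 * a ^ b * h τ) (((hu.pow_const b).add (hv.pow_const b)).mul hw) (fun τ hτ => by
      have hτ0 : 0 < τ := hτ.1
      refine (lnorm_power_mul_le hb (by linarith) (hu.comp measurable_prodMk_left)
        (hv.comp measurable_prodMk_left) (hw.comp measurable_prodMk_left)).trans ?_
      have e : ENNReal.ofReal (τ ^ (-(γ * (b + 1)))) =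
          ENNReal.ofReal (τ ^ (-γ)) ^ b * ENNReal.ofReal (τ ^ (-γ)) := by
        rw [ENNReal.ofReal_rpow_of_pos (by positivity), ← ENNReal.ofReal_mul (by positivity),
          ← Real.rpow_mul hτ0.le, ← Real.rpow_add hτ0]
        congr 2
        ring
      calc _ ≤ ((ENNReal.ofReal (τ ^ (-γ)) * a) ^ b + (ENNReal.ofReal (τ ^ (-γ)) * a) ^ b) *
            (ENNReal.ofReal (τ ^ (-γ)) * h τ) :=
          mul_le_mul' (add_le_add (ENNReal.rpow_le_rpow (h1 τ hτ) hb.le)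
            (ENNReal.rpow_le_rpow (h2 τ hτ) hb.le)) (h3 τ hτ)
        _ = _ := by
          rw [ENNReal.mul_rpow_of_nonneg _ _ hb.le, e]
          ring)
  refine key.trans (le_of_eq ?_)
  rw [one_div_div]
  have hmeas : Measurable fun θ => betaWeight (n / (2 * α) * ((b + 1) / s - 1 / ρ)) (γ * (b + 1)) θ *
      h (t * θ) := (measurable_betaWeight _ _).mul (hh.comp (measurable_const_mul t))
  have e : ∀ θ, betaWeight (n / (2 * α) * ((b + 1) / s - 1 / ρ)) (γ * (b + 1)) θ *
      (2 * a ^ b * h (t * θ)) = (2 * a ^ b) *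
      (betaWeight (n / (2 * α) * ((b + 1) / s - 1 / ρ)) (γ * (b + 1)) θ * h (t * θ)) := fun θ => by
    ring
  simp_rw [e]
  rw [lintegral_const_mul _ hmeas]
  push_cast
  ring

end Estimates

/-- Nonlinearities of growth `b + 1` with small Lipschitz constant at lower order. -/
structure IsPowerSource {𝕜 : Type*} [RCLike 𝕜] (b : ℝ) (f : 𝕜 → 𝕜) : Prop where
  measurable : Measurable f
  map_zero : f 0 = 0
  lipschitz : ∀ ε : ℝ≥0, 0 < ε → ∃ C : ℝ≥0, ∀ u v : 𝕜,
    ‖f u - f v‖ₑ ≤ (ε + C * (‖u‖ₑ ^ b + ‖v‖ₑ ^ b)) * ‖u - v‖ₑ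

theorem exists_coe_of_ne_top {x : ℝ≥0∞} (h : x ≠ ∞) : ∃ y : ℝ≥0, (y : ℝ≥0∞) = x :=
  ⟨_, ENNReal.coe_toNNReal h⟩

section Source

variable {n : ℕ} {α : ℝ} {𝕜 : Type*} [RCLike 𝕜] {b : ℝ} {f : 𝕜 → 𝕜}

/-- The Lipschitz bound has a linear part with a coefficient at one's disposal, estimated from
L^{ρ₀}, and a power part, estimated by Hölder from L^{s/(b+1)}. The price of a small η is a large K.
-/
theorem exists_lnorm_duhMaj_source_le (hα : 0 < α) (hn : 0 < n) (hf : IsPowerSource b f)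
    {s ρ ρ₀ : ℝ} (hb : 0 < b) (hs : b + 1 ≤ s) (hρ : s ≤ ρ * (b + 1)) (hρ₀ : 1 ≤ ρ₀)
    (hρ₀ρ : ρ₀ ≤ ρ) {η : ℝ≥0} (hη : 0 < η) : ∃ K : ℝ≥0, ∀ t : ℝ, 0 < t →
      ∀ (γ B : ℝ) (a : ℝ≥0∞) (U V : ℝ × Sp n → 𝕜) (h k : ℝ → ℝ≥0∞), Measurable U → Measurable V →
      Measurable h →
      (∀ τ ∈ Ioo 0 t, lnorm s volume (fun y => ‖U (τ, y)‖ₑ) ≤ ENNReal.ofReal (τ ^ (-γ)) * a) →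
      (∀ τ ∈ Ioo 0 t, lnorm s volume (fun y => ‖V (τ, y)‖ₑ) ≤ ENNReal.ofReal (τ ^ (-γ)) * a) →
      (∀ τ ∈ Ioo 0 t, lnorm s volume (fun y => ‖U (τ, y) - V (τ, y)‖ₑ) ≤
        ENNReal.ofReal (τ ^ (-γ)) * h τ) →
      (∀ τ ∈ Ioo 0 t, lnorm ρ₀ volume (fun y => ‖U (τ, y) - V (τ, y)‖ₑ) ≤
        ENNReal.ofReal (τ ^ (-B)) * k τ) →
      lnorm ρ volume (duhMaj n α t (fun z => ‖f (U z) - f (V z)‖ₑ)) ≤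
        η * (ENNReal.ofReal (t ^ (1 - n / (2 * α) * (1 / ρ₀ - 1 / ρ) - B)) *
          ∫⁻ θ in Ioo (0 : ℝ) 1, betaWeight (n / (2 * α) * (1 / ρ₀ - 1 / ρ)) B θ * k (t * θ)) +
        K * (a ^ b * (ENNReal.ofReal (t ^ (1 - n / (2 * α) * ((b + 1) / s - 1 / ρ) - γ * (b + 1))) *
          ∫⁻ θ in Ioo (0 : ℝ) 1,
            betaWeight (n / (2 * α) * ((b + 1) / s - 1 / ρ)) (γ * (b + 1)) θ * h (t * θ))) := by
  have hρ1 : 1 ≤ ρ := hρ₀.trans hρ₀ρ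
  have hρ0 : 0 < ρ := by linarith
  obtain ⟨C₁, hC₁⟩ := exists_lnorm_duhMaj_le_beta (n := n) hα hn hρ₀ hρ₀ρ
  obtain ⟨C₂, hC₂⟩ := exists_lnorm_duhMaj_power_le (n := n) hα hn hb hs hρ
  -- The division absorbs the smoothing constant, so that the final linear coefficient is η itself.
  have hε : 0 < η / (C₁ + 1) := by positivity
  obtain ⟨C, hC⟩ := hf.lipschitz _ hε
  refine ⟨C * C₂, fun t ht γ B a U V h k hU hV hh h1 h2 h3 h4 => ?_⟩
  set w : ℝ × Sp n → ℝ≥0∞ := fun z => ‖U z - V z‖ₑ with hw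
  set G : ℝ × Sp n → ℝ≥0∞ := fun z => (‖U z‖ₑ ^ b + ‖V z‖ₑ ^ b) * w z with hG
  have hwm : Measurable w := (hU.sub hV).enorm
  have hGm : Measurable G := ((hU.enorm.pow_const b).add (hV.enorm.pow_const b)).mul hwm
  have hle : lnorm ρ volume (duhMaj n α t (fun z => ‖f (U z) - f (V z)‖ₑ)) ≤
      (η / (C₁ + 1) : ℝ≥0) * lnorm ρ volume (duhMaj n α t w) +
        C * lnorm ρ volume (duhMaj n α t G) := by
    rw [← lnorm_const_mul hρ0 ENNReal.coe_ne_top, ← lnorm_const_mul hρ0 ENNReal.coe_ne_top]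
    refine le_trans ?_ (lnorm_add_le hρ1 ((measurable_duhMaj hwm t).const_mul _).aemeasurable
      ((measurable_duhMaj hGm t).const_mul _).aemeasurable)
    refine lnorm_mono hρ0 fun x => ?_
    rw [← duhMaj_const_mul ENNReal.coe_ne_top, ← duhMaj_const_mul ENNReal.coe_ne_top,
      ← duhMaj_add (hwm.const_mul _)]
    refine duhMaj_mono_ae (fun τ _ => ae_of_all _ fun y => (hC _ _).trans (le_of_eq ?_)) x
    simp only [hG, hw]
    ring
  refine hle.trans (add_le_add ?_ ?_)
  · refine (mul_le_mul_right (hC₁ t ht B w k hwm h4) _).trans ?_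
    rw [← mul_assoc]
    gcongr
    rw [← ENNReal.coe_mul, ENNReal.coe_le_coe, div_mul_eq_mul_div, div_le_iff₀ (by positivity)]
    gcongr
    exact le_add_of_nonneg_right zero_le_one
  · refine (mul_le_mul_right (hC₂ t ht γ a _ _ w h hU.enorm hV.enorm hwm hh h1 h2 h3) _).trans
      (le_of_eq ?_)
    push_cast
    ring

/-- In the weighted norm `sup t^γ ‖·‖_s`, `γ = n/(2α) (1/r - 1/s)`, the Duhamel term is dominated by
a dilation average of small mass. -/
theorem exists_duhamel_contraction (hα : 0 < α) (hn : 0 < n) (hf : IsPowerSource b f)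
    {s r : ℝ} (hb : 0 < b) (hs : b + 1 ≤ s) (hr : 1 < r) (hbr : n / (2 * α) * b ≤ r) (hrs : r < s)
    (hsr : s < r * (b + 1)) (T₀ : ℝ) : ∃ c : ℝ≥0∞, 0 < c ∧ ∀ T : ℝ, 0 < T → T ≤ T₀ →
      ∀ A : ℝ≥0∞, ENNReal.ofReal (T ^ (1 - n / (2 * α) * b / r)) * A ^ b ≤ c →
      ∃ W : ℝ → ℝ≥0∞, Measurable W ∧ ∫⁻ θ in Ioo (0 : ℝ) 1, W θ ≤ 2⁻¹ ∧
        ∀ (U V : ℝ × Sp n → 𝕜) (h : ℝ → ℝ≥0∞) (t : ℝ), Measurable U → Measurable V → Measurable h →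
        t ∈ Ioo 0 T →
        (∀ τ ∈ Ioo 0 t, lnorm s volume (fun y => ‖U (τ, y)‖ₑ) ≤
          ENNReal.ofReal (τ ^ (-(n / (2 * α) * (1 / r - 1 / s)))) * (2 * A)) →
        (∀ τ ∈ Ioo 0 t, lnorm s volume (fun y => ‖V (τ, y)‖ₑ) ≤
          ENNReal.ofReal (τ ^ (-(n / (2 * α) * (1 / r - 1 / s)))) * (2 * A)) →
        (∀ τ ∈ Ioo 0 t, lnorm s volume (fun y => ‖U (τ, y) - V (τ, y)‖ₑ) ≤
          ENNReal.ofReal (τ ^ (-(n / (2 * α) * (1 / r - 1 / s)))) * h τ) →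
        lnorm s volume (duhMaj n α t (fun z => ‖f (U z) - f (V z)‖ₑ)) ≤
          ENNReal.ofReal (t ^ (-(n / (2 * α) * (1 / r - 1 / s)))) *
            ∫⁻ θ in Ioo (0 : ℝ) 1, W θ * h (t * θ) := by
  have hr0 : 0 < r := by linarith
  have hs0 : 0 < s := by linarith
  have hb1 : 0 < b + 1 := by linarith
  have hn' : (0 : ℝ) < n := by exact_mod_cast hn
  set m : ℝ := n / (2 * α) with hm
  have hm0 : 0 < m := by positivity
  set γ := m * (1 / r - 1 / s) with hγ
  set δ := 1 - m * b / r with hδ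
  have hδ0 : 0 ≤ δ := by
    rw [hδ, sub_nonneg, div_le_one hr0]; exact hbr
  set A₂ := m * ((b + 1) / s - 1 / s) with hA₂
  -- Integrability of the two singularities: at τ = t because mb ≤ r < s, and at τ = 0 because s <
  -- r(b+1) and mb ≤ r.
  have hA₂1 : A₂ < 1 := by
    have : A₂ = m * b / s := by rw [hA₂]; field_simp; ring
    rw [this, div_lt_one hs0]; linarith
  have hB1 : γ * (b + 1) < 1 := by
    have h1 : 1 / r - 1 / s < 1 / r - 1 / (r * (b + 1)) := by
      have := one_div_lt_one_div_of_lt hs0 hsr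
      linarith
    have h2 : γ * (b + 1) < m * (1 / r - 1 / (r * (b + 1))) * (b + 1) := by
      rw [hγ]; gcongr
    refine h2.trans_le ?_
    have h3 : m * (1 / r - 1 / (r * (b + 1))) * (b + 1) = m * b / r := by field_simp; ring
    rw [h3, div_le_one hr0]; exact hbr
  have hγ0 : 0 ≤ γ := by
    have := one_div_lt_one_div_of_lt hr0 hrs
    have : 0 < 1 / r - 1 / s := by linarith
    positivity
  have hγ1 : γ < 1 := lt_of_le_of_lt (le_mul_of_one_le_right hγ0 (by linarith)) hB1
  obtain ⟨β₁, hβ₁⟩ := exists_coe_of_ne_top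
    (lintegral_betaWeight_ne_top (A := 0) (B := γ) (by norm_num) hγ1)
  obtain ⟨β₂, hβ₂⟩ := exists_coe_of_ne_top
    (lintegral_betaWeight_ne_top (A := A₂) (B := γ * (b + 1)) hA₂1 hB1)
  -- With this choice the linear part of W has mass at most 1/4 for every T ≤ T₀.
  set η : ℝ≥0 := 1 / (4 * (T₀.toNNReal * β₁ + 1)) with hη
  have hη0 : 0 < η := by positivity
  obtain ⟨K, hK⟩ := exists_lnorm_duhMaj_source_le (n := n) hα hn hf (s := s) (ρ := s) (ρ₀ := s) hb hs
    (by nlinarith) (by linarith) le_rfl hη0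
  -- Q dominates the mass of the power part of W per unit of T^δ A^b, so the threshold c = 1/(4Q)
  -- leaves that part at most 1/4.
  set Q : ℝ≥0∞ := (K : ℝ≥0∞) * 2 ^ b * β₂ + 1 with hQ
  have hQt : Q ≠ ∞ := by
    rw [hQ]; finiteness
  refine ⟨4⁻¹ / Q, ENNReal.div_pos (by simp) hQt, fun T hT hTT A hA => ?_⟩
  set D : ℝ≥0∞ := K * (2 * A) ^ b * ENNReal.ofReal (T ^ δ) with hD
  refine ⟨fun θ => η * ENNReal.ofReal T * betaWeight 0 γ θ + D * betaWeight A₂ (γ * (b + 1)) θ,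
    ((measurable_betaWeight _ _).const_mul _).add ((measurable_betaWeight _ _).const_mul _), ?_, ?_⟩
  · rw [lintegral_add_left ((measurable_betaWeight _ _).const_mul _),
      lintegral_const_mul _ (measurable_betaWeight _ _),
      lintegral_const_mul _ (measurable_betaWeight _ _), ← hβ₁, ← hβ₂]
    have h1 : η * ENNReal.ofReal T * β₁ ≤ 4⁻¹ := by
      have hle : η * T.toNNReal * β₁ ≤ (4 : ℝ≥0)⁻¹ := by
        have h0 : T.toNNReal * β₁ ≤ T₀.toNNReal * β₁ := by
          gcongr
        calc η * T.toNNReal * β₁ = η * (T.toNNReal * β₁) := by ring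
          _ ≤ η * (T₀.toNNReal * β₁ + 1) := by
            gcongr
            exact h0.trans (le_add_of_nonneg_right zero_le_one)
          _ = 4⁻¹ := by rw [hη]; field_simp
      have := ENNReal.coe_le_coe.2 hle
      rwa [ENNReal.coe_inv (by norm_num), ENNReal.coe_mul, ENNReal.coe_mul] at this
    have h2 : D * β₂ ≤ 4⁻¹ := by
      have e : D * β₂ = (K * 2 ^ b * β₂) * (ENNReal.ofReal (T ^ δ) * A ^ b) := by
        rw [hD, ENNReal.mul_rpow_of_nonneg _ _ hb.le]; ring
      rw [e]
      calc (K * 2 ^ b * β₂) * (ENNReal.ofReal (T ^ δ) * A ^ b) ≤ Q * (4⁻¹ / Q) := by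
            gcongr
            exact le_self_add
        _ ≤ 4⁻¹ := ENNReal.mul_div_le
    refine (add_le_add h1 h2).trans (le_of_eq ?_)
    rw [← two_mul, show (4 : ℝ≥0∞) = 2 * 2 by norm_num,
      ENNReal.mul_inv (Or.inl (by norm_num)) (Or.inl (by norm_num)), ← mul_assoc,
      ENNReal.mul_inv_cancel (by norm_num) (by norm_num), one_mul]
  intro U V h t hU hV hh ht h1 h2 h3
  have ht0 : 0 < t := ht.1
  have key := hK t ht0 γ γ (2 * A) U V h h hU hV hh h1 h2 h3 h3
  refine key.trans ?_
  have e0 : m * (1 / s - 1 / s) = 0 := by ring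
  rw [e0]
  have e1 : ENNReal.ofReal (t ^ (1 - 0 - γ)) = ENNReal.ofReal (t ^ (-γ)) * ENNReal.ofReal t := by
    rw [← ENNReal.ofReal_mul (by positivity), ← Real.rpow_add_one ht0.ne']
    congr 2; ring
  -- Scaling: after the weight t^{-γ} has been split off, the remaining power of t is δ = 1 - mb/r ≥
  -- 0, which vanishes exactly in the critical case.
  have e2 : ENNReal.ofReal (t ^ (1 - A₂ - γ * (b + 1))) =
      ENNReal.ofReal (t ^ (-γ)) * ENNReal.ofReal (t ^ δ) := by
    rw [← ENNReal.ofReal_mul (by positivity), ← Real.rpow_add ht0]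
    congr 2
    rw [hA₂, hγ, hδ]; field_simp; ring
  have hm1 : Measurable fun θ => betaWeight 0 γ θ * h (t * θ) :=
    (measurable_betaWeight _ _).mul (hh.comp (measurable_const_mul t))
  have hm2 : Measurable fun θ => betaWeight A₂ (γ * (b + 1)) θ * h (t * θ) :=
    (measurable_betaWeight _ _).mul (hh.comp (measurable_const_mul t))
  rw [e1, e2]
  simp_rw [add_mul, mul_assoc _ (betaWeight _ _ _) _]
  rw [lintegral_add_left (hm1.const_mul _), lintegral_const_mul _ hm1, lintegral_const_mul _ hm2,
    mul_add (ENNReal.ofReal (t ^ (-γ)))]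
  refine add_le_add ?_ ?_
  · calc _ = ENNReal.ofReal (t ^ (-γ)) * (η * ENNReal.ofReal t *
          ∫⁻ θ in Ioo (0 : ℝ) 1, betaWeight 0 γ θ * h (t * θ)) := by ring
      _ ≤ _ := by
        gcongr
        exact ht.2.le
  · calc _ = ENNReal.ofReal (t ^ (-γ)) * (K * (2 * A) ^ b * ENNReal.ofReal (t ^ δ) *
          ∫⁻ θ in Ioo (0 : ℝ) 1, betaWeight A₂ (γ * (b + 1)) θ * h (t * θ)) := by ring
      _ ≤ _ := by
        rw [hD]
        gcongr
        exact ht.2.le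

/-- The Duhamel term of a function that is bounded in `L^r` and in the weighted `L^s` norm. -/
theorem exists_lnorm_duhamel_le (hα : 0 < α) (hn : 0 < n) (hf : IsPowerSource b f)
    {s r ρ : ℝ} (hb : 0 < b) (hs : b + 1 ≤ s) (hr : 1 < r) (hrρ : r ≤ ρ)
    (hsr : s < r * (b + 1)) {η : ℝ≥0} (hη : 0 < η) : ∃ K : ℝ≥0, ∀ t : ℝ, 0 < t →
      ∀ (a M : ℝ≥0∞) (U : ℝ × Sp n → 𝕜) (h : ℝ → ℝ≥0∞), Measurable U → Measurable h →
      (∀ τ ∈ Ioo 0 t, lnorm s volume (fun y => ‖U (τ, y)‖ₑ) ≤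
        ENNReal.ofReal (τ ^ (-(n / (2 * α) * (1 / r - 1 / s)))) * a) →
      (∀ τ ∈ Ioo 0 t, lnorm s volume (fun y => ‖U (τ, y)‖ₑ) ≤
        ENNReal.ofReal (τ ^ (-(n / (2 * α) * (1 / r - 1 / s)))) * h τ) →
      (∀ τ ∈ Ioo 0 t, lnorm r volume (fun y => ‖U (τ, y)‖ₑ) ≤ M) →
      lnorm ρ volume (duhMaj n α t (fun z => ‖f (U z)‖ₑ)) ≤
        ENNReal.ofReal (t ^ (-(n / (2 * α) * (1 / r - 1 / ρ)))) * (η * ENNReal.ofReal t *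
          ((∫⁻ θ in Ioo (0 : ℝ) 1, betaWeight (n / (2 * α) * (1 / r - 1 / ρ)) 0 θ) * M) +
        K * a ^ b * ENNReal.ofReal (t ^ (1 - n / (2 * α) * b / r)) *
          ∫⁻ θ in Ioo (0 : ℝ) 1, betaWeight (n / (2 * α) * ((b + 1) / s - 1 / ρ))
            (n / (2 * α) * (1 / r - 1 / s) * (b + 1)) θ * h (t * θ)) := by
  have hr0 : 0 < r := by linarith
  have hs0 : 0 < s := by linarith
  have hρ0 : 0 < ρ := by linarith
  have hb1 : 0 < b + 1 := by linarith
  obtain ⟨K, hK⟩ := exists_lnorm_duhMaj_source_le (n := n) hα hn hf (s := s) (ρ := ρ) (ρ₀ := r) hb hs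
    (by nlinarith) hr.le hrρ hη
  refine ⟨K, fun t ht a M U h hU hh h1 h2 h3 => ?_⟩
  set m : ℝ := n / (2 * α) with hm
  have hz : ∀ τ, lnorm s volume (fun y : Sp n => ‖(0 : 𝕜)‖ₑ) ≤
      ENNReal.ofReal (τ ^ (-(m * (1 / r - 1 / s)))) * a := fun τ => by
    simp [lnorm_zero hs0]
  have key := hK t ht (m * (1 / r - 1 / s)) 0 a U (fun _ => 0) h (fun _ => M) hU measurable_const hh
    h1 (fun τ _ => hz τ) (fun τ hτ => by simpa only [sub_zero] using h2 τ hτ)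
    (fun τ hτ => by simpa using h3 τ hτ)
  simp only [hf.map_zero, sub_zero] at key
  refine key.trans (le_of_eq ?_)
  rw [lintegral_mul_const _ (measurable_betaWeight _ _)]
  have e1 : ENNReal.ofReal (t ^ (1 - m * (1 / r - 1 / ρ))) =
      ENNReal.ofReal (t ^ (-(m * (1 / r - 1 / ρ)))) * ENNReal.ofReal t := by
    rw [← ENNReal.ofReal_mul (by positivity), ← Real.rpow_add_one ht.ne']
    congr 2; ring
  have e2 : ENNReal.ofReal (t ^ (1 - m * ((b + 1) / s - 1 / ρ) - m * (1 / r - 1 / s) * (b + 1))) =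
      ENNReal.ofReal (t ^ (-(m * (1 / r - 1 / ρ)))) * ENNReal.ofReal (t ^ (1 - m * b / r)) := by
    rw [← ENNReal.ofReal_mul (by positivity), ← Real.rpow_add ht]
    congr 2
    field_simp; ring
  rw [e1, e2]
  ring

end Source

/-- The exponents of the weighted norm `sup t^γ ‖·‖_s`, `γ = n/(2α) (1/r - 1/s)`, in which the
fixed point problem for a nonlinearity of growth `b + 1` and data in `L^r` is solved. -/
structure IsWeightedExponent (n : ℕ) (α b r s : ℝ) : Prop where
  pos_order : 0 < α
  pos_dim : 0 < n
  pos_power : 0 < b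
  add_one_le : b + 1 ≤ s
  one_lt : 1 < r
  scaling : n / (2 * α) * b ≤ r
  lt : r < s
  lt_mul : s < r * (b + 1)

/-- This makes the weight τ^{-γ(b+1)} of the source integrable at time zero; it follows from s <
r(b+1) and the scaling condition. -/
theorem IsWeightedExponent.weight_lt_one {n : ℕ} {α b r s : ℝ} (he : IsWeightedExponent n α b r s) :
    n / (2 * α) * (1 / r - 1 / s) * (b + 1) < 1 := by
  obtain ⟨hα, hn, hb, hs, hr, hbr, hrs, hsr⟩ := he
  have hr0 : 0 < r := by linarith
  have hs0 : 0 < s := by linarith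
  have hb1 : 0 < b + 1 := by linarith
  have hn' : (0 : ℝ) < n := by exact_mod_cast hn
  have h1 : 1 / r - 1 / s < 1 / r - 1 / (r * (b + 1)) := by
    have := one_div_lt_one_div_of_lt hs0 hsr
    linarith
  have h2 : n / (2 * α) * (1 / r - 1 / s) * (b + 1) <
      n / (2 * α) * (1 / r - 1 / (r * (b + 1))) * (b + 1) := by
    gcongr
  refine h2.trans_le ?_
  have h3 : n / (2 * α) * (1 / r - 1 / (r * (b + 1))) * (b + 1) = n / (2 * α) * b / r := by
    field_simp; ring
  rw [h3, div_le_one hr0]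
  exact hbr

theorem lintegral_betaWeight_zero : ∫⁻ θ in Ioo (0 : ℝ) 1, betaWeight 0 0 θ = 1 := by
  simp [betaWeight]

/-! ### Picard iteration in the weighted norm. -/

section Picard

variable {n : ℕ} {α : ℝ} {𝕜 : Type*} [RCLike 𝕜] {b r s : ℝ} {f : 𝕜 → 𝕜} {φ : Sp n → 𝕜}

/-- The linear evolution as a function on space-time, for positive times. -/
noncomputable def linPart (α : ℝ) (φ : Sp n → 𝕜) (z : ℝ × Sp n) : 𝕜 :=
  ∫ y, kernel n α z.1 (z.2 - y) • φ y

theorem linPart_of_pos {t : ℝ} (ht : 0 < t) (x : Sp n) :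
    linPart α φ (t, x) = semigroup α t φ x := (semigroup_of_pos ht φ x).symm

theorem measurable_linPart (hφ : Measurable φ) : Measurable (linPart (n := n) α φ) := by
  have h := measurable_semigroup_uncurry (α := α) (hφ.comp (measurable_snd (α := ℝ)))
  have hmap : Measurable fun z : ℝ × Sp n => (((z.1, 0) : ℝ × ℝ), z.2) :=
    (measurable_fst.prodMk measurable_const).prodMk measurable_snd
  have h2 := h.comp hmap
  have : linPart (n := n) α φ = fun z => ∫ y, kernel n α (z.1 - 0) (z.2 - y) • φ y := by
    funext z; rw [linPart, sub_zero]
  rw [this]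
  exact h2

theorem enorm_linPart_le {t : ℝ} (ht : 0 < t) (x : Sp n) :
    ‖linPart α φ (t, x)‖ₑ ≤ heatMaj n α t (fun y => ‖φ y‖ₑ) x := by
  rw [linPart_of_pos ht]
  exact enorm_semigroup_le ht φ x

/-- The Picard iterates. -/
noncomputable def picard (α : ℝ) (f : 𝕜 → 𝕜) (φ : Sp n → 𝕜) : ℕ → ℝ × Sp n → 𝕜
  | 0 => fun _ => 0
  | k + 1 => fun z => linPart α φ z + duhamel n α z.1 (fun w => f (picard α f φ k w)) z.2

theorem measurable_picard (hf : Measurable f) (hφ : Measurable φ) (k : ℕ) :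
    Measurable (picard (n := n) α f φ k) := by
  induction k with
  | zero => exact measurable_const
  | succ k ih => exact (measurable_linPart hφ).add (measurable_duhamel (hf.comp ih))

theorem lnorm_picard_succ_le {t ρ : ℝ} (ht : 0 < t) (hρ : 1 ≤ ρ) (hf : Measurable f)
    (hφ : Measurable φ) (k : ℕ) :
    lnorm ρ volume (fun x => ‖picard (n := n) α f φ (k + 1) (t, x)‖ₑ) ≤
      lnorm ρ volume (heatMaj n α t fun y => ‖φ y‖ₑ) +
        lnorm ρ volume (duhMaj n α t fun z => ‖f (picard α f φ k z)‖ₑ) := by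
  refine le_trans (lnorm_mono (by linarith) fun x => ?_) (lnorm_add_le hρ
    (measurable_heatMaj hφ.enorm).aemeasurable
    (measurable_duhMaj (hf.comp (measurable_picard hf hφ k)).enorm t).aemeasurable)
  exact (enorm_add_le _ _).trans (add_le_add (enorm_linPart_le ht x) (enorm_duhamel_le _ x))

theorem ae_lnorm_lt_top_of_le {ρ : ℝ} {X : Type*} [MeasurableSpace X] {μ : Measure X}
    (hρ : 0 < ρ) {g : X → ℝ≥0∞} (hg : Measurable g) {c : ℝ≥0∞} (hc : c ≠ ∞)
    (h : lnorm ρ μ g ≤ c) : ∀ᵐ x ∂μ, g x < ∞ :=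
  ae_lt_top_of_lnorm hρ hg (ne_top_of_le_ne_top hc h)

/-- Local existence, with bounds, in terms of the size `A` of the linear evolution in the weighted
norm. -/
theorem exists_integral_solution (he : IsWeightedExponent n α b r s) (hf : IsPowerSource b f)
    (T₀ : ℝ) : ∃ c : ℝ≥0∞, 0 < c ∧ ∀ T : ℝ, 0 < T → T ≤ T₀ → ∀ φ : Sp n → 𝕜, Measurable φ →
      lnorm r volume (fun x => ‖φ x‖ₑ) ≠ ∞ → ∀ A : ℝ≥0∞, A ≠ ∞ →
      (∀ t ∈ Ioo 0 T, lnorm s volume (heatMaj n α t fun y => ‖φ y‖ₑ) ≤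
        ENNReal.ofReal (t ^ (-(n / (2 * α) * (1 / r - 1 / s)))) * A) →
      ENNReal.ofReal (T ^ (1 - n / (2 * α) * b / r)) * A ^ b ≤ c →
      ∃ U : ℝ × Sp n → 𝕜, Measurable U ∧
        (∀ t ∈ Ioo 0 T, ∀ᵐ x, U (t, x) = semigroup α t φ x + duhamel n α t (fun z => f (U z)) x) ∧
        (∀ t ∈ Ioo 0 T, ∀ a : ℝ≥0∞, (∀ τ ∈ Ioc 0 t, lnorm s volume (heatMaj n α τ fun y => ‖φ y‖ₑ) ≤
          ENNReal.ofReal (τ ^ (-(n / (2 * α) * (1 / r - 1 / s)))) * a) →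
          lnorm s volume (fun x => ‖U (t, x)‖ₑ) ≤
            ENNReal.ofReal (t ^ (-(n / (2 * α) * (1 / r - 1 / s)))) * (2 * a)) ∧
        (∃ M : ℝ≥0∞, M ≠ ∞ ∧ ∀ t ∈ Ioo 0 T, lnorm r volume (fun x => ‖U (t, x)‖ₑ) ≤ M) ∧
        ∀ q : ℝ, 1 ≤ q → lnorm q (volume.restrict (Ioo 0 T)) (fun t => ENNReal.ofReal (t ^ (-(1 / q))) *
          (ENNReal.ofReal (t ^ (n / (2 * α) * (1 / r - 1 / s))) *
            lnorm s volume (fun x => ‖U (t, x)‖ₑ))) ≤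
          2 * lnorm q (volume.restrict (Ioo 0 T)) (fun t => ENNReal.ofReal (t ^ (-(1 / q))) *
          (ENNReal.ofReal (t ^ (n / (2 * α) * (1 / r - 1 / s))) *
            lnorm s volume (heatMaj n α t fun y => ‖φ y‖ₑ))) := by
  have hB1 := he.weight_lt_one
  obtain ⟨hα, hn, hb, hs, hr, hbr, hrs, hsr⟩ := he
  have hr0 : 0 < r := by linarith
  have hs0 : 0 < s := by linarith
  have hs1 : 1 ≤ s := by linarith
  have hn' : (0 : ℝ) < n := by exact_mod_cast hn
  obtain ⟨c, hc0, hc⟩ := exists_duhamel_contraction (n := n) hα hn hf hb hs hr hbr hrs hsr T₀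
  refine ⟨c, hc0, fun T hT hTT φ hφ hφr A hAt hA hAc => ?_⟩
  obtain ⟨W, hWm, hW, hcon⟩ := hc T hT hTT A hAc
  set m : ℝ := n / (2 * α) with hm
  set γ := m * (1 / r - 1 / s) with hγ
  set P := picard (n := n) α f φ with hP
  have hPm : ∀ k, Measurable (P k) := measurable_picard hf.measurable hφ
  have hfP : ∀ k, Measurable fun z => f (P k z) := fun k => hf.measurable.comp (hPm k)
  have hmap : ∀ t : ℝ, Measurable fun y : Sp n => (t, y) := fun t => measurable_prodMk_left
  have mulcancel : ∀ t : ℝ, 0 < t → ∀ x : ℝ≥0∞,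
      ENNReal.ofReal (t ^ (-γ)) * (ENNReal.ofReal (t ^ γ) * x) = x := by
    intro t ht x
    rw [← mul_assoc, ← ENNReal.ofReal_mul (by positivity), ← Real.rpow_add ht]
    simp
  have mulcancel' : ∀ t : ℝ, 0 < t → ∀ x : ℝ≥0∞,
      ENNReal.ofReal (t ^ γ) * (ENNReal.ofReal (t ^ (-γ)) * x) = x := by
    intro t ht x
    rw [← mul_assoc, ← ENNReal.ofReal_mul (by positivity), ← Real.rpow_add ht]
    simp
  have hWc : ∀ x : ℝ≥0∞, ∫⁻ θ in Ioo (0 : ℝ) 1, W θ * x ≤ 2⁻¹ * x := fun x => by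
    rw [lintegral_mul_const _ hWm]; gcongr
  -- the weighted bound for the iterates
  have I1 : ∀ k, ∀ t ∈ Ioo 0 T, ∀ a : ℝ≥0∞, a ≤ A →
      (∀ τ ∈ Ioc 0 t, lnorm s volume (heatMaj n α τ fun y => ‖φ y‖ₑ) ≤
        ENNReal.ofReal (τ ^ (-γ)) * a) →
      lnorm s volume (fun x => ‖P k (t, x)‖ₑ) ≤ ENNReal.ofReal (t ^ (-γ)) * (2 * a) := by
    intro k
    induction k with
    | zero =>
      intro t ht a _ _
      simp [hP, picard, lnorm_zero hs0]
    | succ k ih =>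
      intro t ht a haA ha
      have hbd : ∀ τ ∈ Ioo 0 t, lnorm s volume (fun y => ‖P k (τ, y)‖ₑ) ≤
          ENNReal.ofReal (τ ^ (-γ)) * (2 * a) := fun τ hτ =>
        ih τ ⟨hτ.1, hτ.2.trans ht.2⟩ a haA fun τ' hτ' => ha τ' ⟨hτ'.1, hτ'.2.trans hτ.2.le⟩
      have hbd' : ∀ τ ∈ Ioo 0 t, lnorm s volume (fun y => ‖P k (τ, y)‖ₑ) ≤
          ENNReal.ofReal (τ ^ (-γ)) * (2 * A) := fun τ hτ => (hbd τ hτ).trans (by gcongr)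
      have key := hcon (P k) (fun _ => 0) (fun _ => 2 * a) t (hPm k) measurable_const
        measurable_const ht hbd' (fun τ _ => by simp [lnorm_zero hs0])
        (fun τ hτ => by simpa only [sub_zero] using hbd τ hτ)
      simp only [hf.map_zero, sub_zero] at key
      refine (lnorm_picard_succ_le ht.1 hs1 hf.measurable hφ k).trans ?_
      calc _ ≤ ENNReal.ofReal (t ^ (-γ)) * a + ENNReal.ofReal (t ^ (-γ)) * (2⁻¹ * (2 * a)) :=
            add_le_add (ha t ⟨ht.1, le_rfl⟩) (key.trans (by gcongr; exact hWc _))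
        _ = ENNReal.ofReal (t ^ (-γ)) * (2 * a) := by
            rw [← mul_assoc 2⁻¹, ENNReal.inv_mul_cancel (by norm_num) (by norm_num)]
            ring
  have I1A : ∀ k, ∀ t ∈ Ioo 0 T, lnorm s volume (fun x => ‖P k (t, x)‖ₑ) ≤
      ENNReal.ofReal (t ^ (-γ)) * (2 * A) := fun k t ht =>
    I1 k t ht A le_rfl fun τ hτ => hA τ ⟨hτ.1, hτ.2.trans_lt ht.2⟩
  have hfin : ∀ k, ∀ t ∈ Ioo 0 T, ∀ᵐ x, duhMaj n α t (fun z => ‖f (P k z)‖ₑ) x < ∞ := by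
    intro k t ht
    have key := hcon (P k) (fun _ => 0) (fun _ => 2 * A) t (hPm k) measurable_const
      measurable_const ht (fun τ hτ => I1A k τ ⟨hτ.1, hτ.2.trans ht.2⟩)
      (fun τ _ => by simp [lnorm_zero hs0])
      (fun τ hτ => by simpa only [sub_zero] using I1A k τ ⟨hτ.1, hτ.2.trans ht.2⟩)
    simp only [hf.map_zero, sub_zero] at key
    refine ae_lnorm_lt_top_of_le hs0 (measurable_duhMaj (hfP k).enorm t) ?_
      (key.trans (mul_le_mul_right (hWc _) _))
    finiteness
  -- convergence
  set w : ℕ → ℝ → Sp n → ℝ≥0∞ := fun k t x => ‖P (k + 1) (t, x) - P k (t, x)‖ₑ with hw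
  have hwm : ∀ k t, Measurable (w k t) := fun k t =>
    (((hPm (k + 1)).comp (hmap t)).sub ((hPm k).comp (hmap t))).enorm
  -- The mass 1/2 of W halves the increment at each step. The first increment is the first iterate
  -- itself, as the iteration starts at 0.
  have I2 : ∀ k, ∀ t ∈ Ioo 0 T,
      lnorm s volume (w k t) ≤ ENNReal.ofReal (t ^ (-γ)) * (2⁻¹ ^ k * (2 * A)) := by
    intro k
    induction k with
    | zero =>
      intro t ht
      have := I1A 1 t ht
      simpa [hw, hP, picard] using this
    | succ k ih =>
      intro t ht
      have key := hcon (P (k + 1)) (P k) (fun _ => 2⁻¹ ^ k * (2 * A)) t (hPm _) (hPm _)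
        measurable_const ht (fun τ hτ => I1A _ τ ⟨hτ.1, hτ.2.trans ht.2⟩)
        (fun τ hτ => I1A _ τ ⟨hτ.1, hτ.2.trans ht.2⟩) (fun τ hτ => ih τ ⟨hτ.1, hτ.2.trans ht.2⟩)
      have hpt : ∀ᵐ x, w (k + 1) t x ≤
          duhMaj n α t (fun z => ‖f (P (k + 1) z) - f (P k z)‖ₑ) x := by
        filter_upwards [hfin (k + 1) t ht, hfin k t ht] with x hx hx'
        have e : P (k + 1 + 1) (t, x) - P (k + 1) (t, x) =
            duhamel n α t (fun z => f (P (k + 1) z) - f (P k z)) x := by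
          rw [← duhamel_sub (hfP _) (hfP _) hx hx']
          exact add_sub_add_left_eq_sub _ _ _
        simp only [hw]
        rw [e]
        exact enorm_duhamel_le _ x
      refine (lnorm_mono_ae hs0 hpt).trans (key.trans ?_)
      refine (mul_le_mul_right (hWc _) _).trans (le_of_eq ?_)
      rw [pow_succ]
      ring
  have hsum : ∀ t ∈ Ioo 0 T, ∀ N, ∑' k, lnorm s volume (w (k + N) t) ≤
      ENNReal.ofReal (t ^ (-γ)) * (2⁻¹ ^ N * (4 * A)) := by
    intro t ht N
    refine (ENNReal.tsum_le_tsum fun k => I2 (k + N) t ht).trans (le_of_eq ?_)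
    have : ∀ k : ℕ, ENNReal.ofReal (t ^ (-γ)) * (2⁻¹ ^ (k + N) * (2 * A)) =
        2⁻¹ ^ k * (ENNReal.ofReal (t ^ (-γ)) * (2⁻¹ ^ N * (2 * A))) := fun k => by
      rw [pow_add]; ring
    simp_rw [this]
    rw [ENNReal.tsum_mul_right, ENNReal.tsum_geometric, ENNReal.one_sub_inv_two, inv_inv]
    ring
  set U : ℝ × Sp n → 𝕜 := fun z => limUnder atTop fun k => P k z with hU
  have hUm : Measurable U :=
    (StronglyMeasurable.limUnder fun k => (hPm k).stronglyMeasurable).measurable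
  have hlim : ∀ t ∈ Ioo 0 T, ∀ᵐ x, Tendsto (fun k => P k (t, x)) atTop (𝓝 (U (t, x))) := by
    intro t ht
    have h0 := hsum t ht 0
    simp only [add_zero, pow_zero, one_mul] at h0
    filter_upwards [ae_tsum_lt_top hs1 (fun k => hwm k t)
      (ne_top_of_le_ne_top (by finiteness) h0)] with x hx
    have hC : CauchySeq fun k => P k (t, x) :=
      cauchySeq_of_edist_le_of_tsum_ne_top (fun k => w k t x)
        (fun k => by rw [edist_comm, edist_eq_enorm_sub]) hx.ne
    exact hC.tendsto_limUnder
  have hlimN : ∀ t ∈ Ioo 0 T, ∀ N, lnorm s volume (fun x => ‖U (t, x) - P N (t, x)‖ₑ) ≤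
      ENNReal.ofReal (t ^ (-γ)) * (2⁻¹ ^ N * (4 * A)) := by
    intro t ht N
    refine le_trans (lnorm_mono_ae hs0 (g := fun x => ∑' k, w (k + N) t x) ?_)
      ((lnorm_tsum_le hs1 fun k => hwm (k + N) t).trans (hsum t ht N))
    filter_upwards [hlim t ht] with x hx
    have := edist_le_tsum_of_edist_le_of_tendsto (f := fun k => P k (t, x)) (fun k => w k t x)
      (fun k => by rw [edist_comm, edist_eq_enorm_sub]) hx N
    rw [edist_comm, edist_eq_enorm_sub] at this
    simpa only [add_comm N] using this
  have hfatou : ∀ ρ, 0 < ρ → ∀ t ∈ Ioo 0 T, lnorm ρ volume (fun x => ‖U (t, x)‖ₑ) ≤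
      liminf (fun k => lnorm ρ volume fun x => ‖P k (t, x)‖ₑ) atTop := by
    intro ρ hρ t ht
    refine le_trans (le_of_eq (lnorm_congr_ae _ ?_))
      (lnorm_liminf_le hρ fun k => ((hPm k).comp (hmap t)).enorm)
    filter_upwards [hlim t ht] with x hx
    exact hx.enorm.liminf_eq.symm
  have hliminf : ∀ (g : ℕ → ℝ≥0∞) (C : ℝ≥0∞), (∀ k, g k ≤ C) → liminf g atTop ≤ C :=
    fun g C h => (liminf_le_liminf (Eventually.of_forall h)).trans (by simp)
  have hUA : ∀ t ∈ Ioo 0 T, lnorm s volume (fun x => ‖U (t, x)‖ₑ) ≤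
      ENNReal.ofReal (t ^ (-γ)) * (2 * A) := fun t ht =>
    (hfatou s hs0 t ht).trans (hliminf _ _ fun k => I1A k t ht)
  refine ⟨U, hUm, ?_, ?_, ?_, ?_⟩
  · intro t ht
    have hfU : Measurable fun z => f (U z) := hf.measurable.comp hUm
    have hUfin : ∀ᵐ x, duhMaj n α t (fun z => ‖f (U z)‖ₑ) x < ∞ := by
      have key := hcon U (fun _ => 0) (fun _ => 2 * A) t hUm measurable_const
        measurable_const ht (fun τ hτ => hUA τ ⟨hτ.1, hτ.2.trans ht.2⟩)
        (fun τ _ => by simp [lnorm_zero hs0])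
        (fun τ hτ => by simpa only [sub_zero] using hUA τ ⟨hτ.1, hτ.2.trans ht.2⟩)
      simp only [hf.map_zero, sub_zero] at key
      refine ae_lnorm_lt_top_of_le hs0 (measurable_duhMaj hfU.enorm t) ?_
        (key.trans (mul_le_mul_right (hWc _) _))
      finiteness
    -- The defect of the limit in the equation. Comparing with the iterates N and N+1 bounds it by a
    -- geometric sequence, hence it vanishes.
    set D : Sp n → ℝ≥0∞ := fun x =>
      ‖U (t, x) - (semigroup α t φ x + duhamel n α t (fun z => f (U z)) x)‖ₑ with hD
    have hDle : ∀ N, lnorm s volume D ≤ ENNReal.ofReal (t ^ (-γ)) * (2⁻¹ ^ N * (4 * A)) := by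
      intro N
      have key := hcon (P N) U (fun _ => 2⁻¹ ^ N * (4 * A)) t (hPm _) hUm
        measurable_const ht (fun τ hτ => I1A _ τ ⟨hτ.1, hτ.2.trans ht.2⟩)
        (fun τ hτ => hUA τ ⟨hτ.1, hτ.2.trans ht.2⟩) (fun τ hτ => by
          simp_rw [enorm_sub_rev (P N _)]
          exact hlimN τ ⟨hτ.1, hτ.2.trans ht.2⟩ N)
      have hpt : ∀ᵐ x, D x ≤ ‖U (t, x) - P (N + 1) (t, x)‖ₑ +
          duhMaj n α t (fun z => ‖f (P N z) - f (U z)‖ₑ) x := by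
        filter_upwards [hfin N t ht, hUfin] with x hx hx'
        have e : P (N + 1) (t, x) - (semigroup α t φ x + duhamel n α t (fun z => f (U z)) x) =
            duhamel n α t (fun z => f (P N z) - f (U z)) x := by
          rw [← duhamel_sub (hfP _) hfU hx hx', ← linPart_of_pos ht.1]
          exact add_sub_add_left_eq_sub _ _ _
        calc D x = ‖(U (t, x) - P (N + 1) (t, x)) + (P (N + 1) (t, x) -
              (semigroup α t φ x + duhamel n α t (fun z => f (U z)) x))‖ₑ := by
              simp only [hD]; congr 1; ring
          _ ≤ _ := (enorm_add_le _ _).trans (by rw [e]; gcongr; exact enorm_duhamel_le _ x)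
      have hm1 : Measurable fun x => ‖U (t, x) - P (N + 1) (t, x)‖ₑ :=
        Measurable.enorm (Measurable.sub (hUm.comp (hmap t)) ((hPm (N + 1)).comp (hmap t)))
      have hm2 : Measurable (duhMaj n α t (fun z => ‖f (P N z) - f (U z)‖ₑ)) :=
        measurable_duhMaj ((hfP N).sub hfU).enorm t
      refine (lnorm_mono_ae hs0 hpt).trans ((lnorm_add_le hs1 hm1.aemeasurable
        hm2.aemeasurable).trans ?_)
      calc _ ≤ ENNReal.ofReal (t ^ (-γ)) * (2⁻¹ ^ (N + 1) * (4 * A)) +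
            ENNReal.ofReal (t ^ (-γ)) * (2⁻¹ * (2⁻¹ ^ N * (4 * A))) :=
            add_le_add (hlimN t ht (N + 1)) (key.trans (mul_le_mul_right (hWc _) _))
        _ = ENNReal.ofReal (t ^ (-γ)) * ((2⁻¹ + 2⁻¹) * 2⁻¹ ^ N * (4 * A)) := by
            rw [pow_succ]; ring
        _ = _ := by rw [ENNReal.inv_two_add_inv_two, one_mul]
    have hz : lnorm s volume D = 0 := by
      have h1 : Tendsto (fun N : ℕ => ENNReal.ofReal (t ^ (-γ)) * ((2⁻¹ : ℝ≥0∞) ^ N * (4 * A)))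
          atTop (𝓝 0) := by
        have h2 : Tendsto (fun N : ℕ => (2⁻¹ : ℝ≥0∞) ^ N) atTop (𝓝 0) :=
          ENNReal.tendsto_pow_atTop_nhds_zero_of_lt_one (by simp)
        have h3 := ENNReal.Tendsto.mul_const (b := 4 * A) h2 (Or.inr (by finiteness))
        have h4 := ENNReal.Tendsto.const_mul (a := ENNReal.ofReal (t ^ (-γ))) h3
          (Or.inr ENNReal.ofReal_ne_top)
        simpa using h4
      exact le_antisymm (ge_of_tendsto' h1 hDle) zero_le
    have hDm : Measurable D :=
      ((hUm.comp (hmap t)).sub ((measurable_semigroup t hφ).add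
        ((measurable_duhamel hfU).comp (hmap t)))).enorm
    have hz2 : ∫⁻ x, D x ^ s = 0 := by
      rw [← lnorm_rpow_self hs0, hz, ENNReal.zero_rpow_of_pos hs0]
    filter_upwards [(lintegral_eq_zero_iff (hDm.pow_const s)).1 hz2] with x hx
    have hx0 : D x = 0 := by simpa [hs0.not_gt, hs0] using hx
    exact sub_eq_zero.1 (enorm_eq_zero.1 hx0)
  · intro t ht a ha
    -- The iterates were bounded only for constants not exceeding A; the minimum removes this
    -- restriction. A bound local in time, with a small a, is what later gives continuity at t = 0.
    have h1 : lnorm s volume (fun x => ‖U (t, x)‖ₑ) ≤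
        ENNReal.ofReal (t ^ (-γ)) * (2 * min a A) :=
      (hfatou s hs0 t ht).trans (hliminf _ _ fun k => I1 k t ht _ (min_le_right _ _) fun τ hτ => by
        rcases le_total a A with h | h
        · rw [min_eq_left h]; exact ha τ hτ
        · rw [min_eq_right h]; exact hA τ ⟨hτ.1, hτ.2.trans_lt ht.2⟩)
    exact h1.trans (by gcongr; exact min_le_left _ _)
  -- Here the linear coefficient is chosen so that η t ≤ 1/2 on the whole interval.
  · set η : ℝ≥0 := 1 / (2 * (T₀.toNNReal + 1)) with hη
    obtain ⟨K, hK⟩ := exists_lnorm_duhamel_le (n := n) hα hn hf (ρ := r) hb hs hr le_rfl hsr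
      (η := η) (by positivity)
    obtain ⟨C, hC⟩ := exists_lnorm_heatMaj_le (n := n) hα hn hr.le le_rfl
    have hβ : ∫⁻ θ in Ioo (0 : ℝ) 1, betaWeight (m * ((b + 1) / s - 1 / r)) (γ * (b + 1)) θ ≠ ∞ := by
      refine lintegral_betaWeight_ne_top ?_ hB1
      have h1 : (b + 1) / s < (b + 1) / r := div_lt_div_of_pos_left (by linarith) hr0 hrs
      have h2 : m * ((b + 1) / s - 1 / r) < m * ((b + 1) / r - 1 / r) := by gcongr
      refine h2.trans_le ?_
      have h3 : m * ((b + 1) / r - 1 / r) = m * b / r := by field_simp; ring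
      rw [h3, div_le_one hr0]; exact hbr
    set E : ℝ≥0∞ := K * (2 * A) ^ b * ENNReal.ofReal (T ^ (1 - m * b / r)) *
      ((∫⁻ θ in Ioo (0 : ℝ) 1, betaWeight (m * ((b + 1) / s - 1 / r)) (γ * (b + 1)) θ) * (2 * A))
      with hE
    set N := lnorm r volume (fun x => ‖φ x‖ₑ) with hN
    have hM : 2 * (C * N + E) ≠ ∞ := by
      rw [hE]
      finiteness
    have hδ : 0 ≤ 1 - m * b / r := by rw [sub_nonneg, div_le_one hr0]; exact hbr
    -- The bound is the fixed point of x ↦ CN + x/2 + E, hence it reproduces itself along the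
    -- iteration.
    refine ⟨2 * (C * N + E), hM, fun t ht => (hfatou r hr0 t ht).trans (hliminf _ _ fun k => ?_)⟩
    induction k generalizing t with
    | zero => simp [hP, picard, lnorm_zero hr0]
    | succ k ih =>
      refine (lnorm_picard_succ_le ht.1 hr.le hf.measurable hφ k).trans ?_
      have k1 := hC t ht.1 _ hφ.enorm
      have k2 := hK t ht.1 (2 * A) (2 * (C * N + E)) (P k) (fun _ => 2 * A) (hPm k) measurable_const
        (fun τ hτ => I1A k τ ⟨hτ.1, hτ.2.trans ht.2⟩) (fun τ hτ => I1A k τ ⟨hτ.1, hτ.2.trans ht.2⟩)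
        (fun τ hτ => ih τ ⟨hτ.1, hτ.2.trans ht.2⟩)
      rw [sub_self, mul_zero, neg_zero, Real.rpow_zero, ENNReal.ofReal_one, mul_one] at k1
      rw [sub_self, mul_zero, neg_zero, Real.rpow_zero, ENNReal.ofReal_one, one_mul,
        lintegral_betaWeight_zero, one_mul, lintegral_mul_const _ (measurable_betaWeight _ _)] at k2
      have hηt : (η : ℝ≥0∞) * ENNReal.ofReal t ≤ 2⁻¹ := by
        have h1 : η * t.toNNReal ≤ 2⁻¹ := by
          calc η * t.toNNReal ≤ η * (T₀.toNNReal + 1) := by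
                gcongr
                exact (Real.toNNReal_le_toNNReal (ht.2.le.trans hTT)).trans
                  (le_add_of_nonneg_right zero_le_one)
            _ = 2⁻¹ := by rw [hη]; field_simp
        have := ENNReal.coe_le_coe.2 h1
        rwa [ENNReal.coe_inv (by norm_num), ENNReal.coe_mul] at this
      have hEt : K * (2 * A) ^ b * ENNReal.ofReal (t ^ (1 - m * b / r)) *
          ((∫⁻ θ in Ioo (0 : ℝ) 1, betaWeight (m * ((b + 1) / s - 1 / r)) (γ * (b + 1)) θ) *
            (2 * A)) ≤ E := by
        rw [hE]
        have := ht.1.le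
        gcongr
        exact ht.2.le
      calc _ ≤ C * N + (2⁻¹ * (2 * (C * N + E)) + E) :=
            add_le_add k1 (k2.trans (add_le_add (mul_le_mul_left hηt _) hEt))
        _ = 2 * (C * N + E) := by
            rw [← mul_assoc 2⁻¹, ENNReal.inv_mul_cancel (by norm_num) (by norm_num)]
            ring
  · intro q hq
    have hq0 : 0 < q := by linarith
    set H : ℕ → ℝ → ℝ≥0∞ := fun k t => ENNReal.ofReal (t ^ γ) *
      lnorm s volume (fun x => ‖P k (t, x)‖ₑ) with hH
    set Hl : ℝ → ℝ≥0∞ := fun t => ENNReal.ofReal (t ^ γ) *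
      lnorm s volume (heatMaj n α t fun y => ‖φ y‖ₑ) with hHl
    set L := lnorm q (volume.restrict (Ioo 0 T)) (fun t => ENNReal.ofReal (t ^ (-(1 / q))) * Hl t)
      with hL
    have hHm : ∀ k, Measurable (H k) := fun k =>
      (by fun_prop : Measurable fun t : ℝ => ENNReal.ofReal (t ^ γ)).mul
        (measurable_lnorm_slice (hPm k).enorm)
    have hpw : Measurable fun t : ℝ => ENNReal.ofReal (t ^ (-(1 / q))) := by fun_prop
    -- Dilation averages are bounded on L^q(dt/t) by the mass of W, so the induction closes with L +
    -- (1/2)(2L) = 2L.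
    have hHk : ∀ k, lnorm q (volume.restrict (Ioo 0 T))
        (fun t => ENNReal.ofReal (t ^ (-(1 / q))) * H k t) ≤ 2 * L := by
      intro k
      induction k with
      | zero => simp [hH, hP, picard, lnorm_zero hs0, lnorm_zero hq0]
      | succ k ih =>
        have hstep : ∀ t ∈ Ioo 0 T, H (k + 1) t ≤ Hl t + ∫⁻ θ in Ioo (0 : ℝ) 1, W θ * H k (t * θ) := by
          intro t ht
          have key := hcon (P k) (fun _ => 0) (H k) t (hPm k) measurable_const (hHm k) ht
            (fun τ hτ => I1A k τ ⟨hτ.1, hτ.2.trans ht.2⟩) (fun τ _ => by simp [lnorm_zero hs0])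
            (fun τ hτ => by simp only [sub_zero]; exact (mulcancel τ hτ.1 _).ge)
          simp only [hf.map_zero, sub_zero] at key
          calc H (k + 1) t ≤ ENNReal.ofReal (t ^ γ) *
                (lnorm s volume (heatMaj n α t fun y => ‖φ y‖ₑ) + ENNReal.ofReal (t ^ (-γ)) *
                  ∫⁻ θ in Ioo (0 : ℝ) 1, W θ * H k (t * θ)) := by
                simp only [hH]
                gcongr
                exact (lnorm_picard_succ_le ht.1 hs1 hf.measurable hφ k).trans (by gcongr)
            _ = _ := by rw [mul_add, mulcancel' t ht.1]
        have hWint : Measurable fun t : ℝ => ∫⁻ θ in Ioo (0 : ℝ) 1, W θ * H k (t * θ) := by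
          refine Measurable.lintegral_prod_right' (f := fun z : ℝ × ℝ => W z.2 * H k (z.1 * z.2)) ?_
          exact (hWm.comp measurable_snd).mul ((hHm k).comp (measurable_fst.mul measurable_snd))
        have hHlm : Measurable Hl :=
          (by fun_prop : Measurable fun t : ℝ => ENNReal.ofReal (t ^ γ)).mul (by
            have h1 := measurable_heatMaj_uncurry (α := α) (hφ.enorm.comp (measurable_snd (α := ℝ)))
            have h2 : Measurable fun z : ℝ × Sp n => (((z.1, 0) : ℝ × ℝ), z.2) :=
              (measurable_fst.prodMk measurable_const).prodMk measurable_snd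
            have h3 := measurable_lnorm_slice (p := s) (h1.comp h2)
            simpa using h3)
        calc _ ≤ lnorm q (volume.restrict (Ioo 0 T)) (fun t =>
              ENNReal.ofReal (t ^ (-(1 / q))) * Hl t + ENNReal.ofReal (t ^ (-(1 / q))) *
                ∫⁻ θ in Ioo (0 : ℝ) 1, W θ * H k (t * θ)) := by
              refine lnorm_mono_ae hq0 ?_
              filter_upwards [ae_restrict_mem measurableSet_Ioo] with t ht
              rw [← mul_add]
              gcongr
              exact hstep t ht
          _ ≤ L + 2⁻¹ * (2 * L) := by
              refine (lnorm_add_le hq (hpw.mul hHlm).aemeasurable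
                (hpw.mul hWint).aemeasurable).trans ?_
              refine add_le_add le_rfl ((lnorm_mellin_le hq hWm (hHm k)).trans ?_)
              gcongr
          _ = 2 * L := by
              rw [← mul_assoc 2⁻¹, ENNReal.inv_mul_cancel (by norm_num) (by norm_num)]
              ring
    refine le_trans (lnorm_mono_ae hq0 (g := fun t => liminf (fun k =>
      ENNReal.ofReal (t ^ (-(1 / q))) * H k t) atTop) ?_)
      ((lnorm_liminf_le hq0 fun k => hpw.mul (hHm k)).trans (hliminf _ _ hHk))
    filter_upwards [ae_restrict_mem measurableSet_Ioo] with t ht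
    simp only [hH]
    rw [ENNReal.liminf_const_mul_of_ne_top ENNReal.ofReal_ne_top,
      ENNReal.liminf_const_mul_of_ne_top ENNReal.ofReal_ne_top]
    gcongr
    exact hfatou s hs0 t ht

end Picard

/-! ### Time intervals, and passage from measurable representatives to curves. -/

section TimeInterval

theorem mem_timeInterval_ofReal {T t : ℝ} : t ∈ timeInterval (ENNReal.ofReal T) ↔ 0 ≤ t ∧ t < T := by
  refine ⟨fun h => ⟨h.1, ?_⟩, fun h => ⟨h.1, ?_⟩⟩
  · exact (ENNReal.ofReal_lt_ofReal_iff_of_nonneg h.1).1 h.2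
  · exact (ENNReal.ofReal_lt_ofReal_iff_of_nonneg h.1).2 h.2

theorem timeInterval_ofReal (T : ℝ) : timeInterval (ENNReal.ofReal T) = Ico 0 T :=
  Set.ext fun _ => mem_timeInterval_ofReal

theorem measurableSet_timeInterval (T : ℝ≥0∞) : MeasurableSet (timeInterval T) :=
  measurableSet_Ici.inter (measurableSet_lt ENNReal.measurable_ofReal measurable_const)

theorem timeInterval_mono {S T : ℝ≥0∞} (h : S ≤ T) : timeInterval S ⊆ timeInterval T :=
  fun _ ht => ⟨ht.1, ht.2.trans_le h⟩

end TimeInterval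

section MildFromRepresentative

variable {n : ℕ} {α r : ℝ} {𝕜 : Type*} [RCLike 𝕜] {f : 𝕜 → 𝕜}

theorem mild_of_representative (hf : Measurable f) {t : ℝ} {u : ℝ → LSpace 𝕜 n r}
    {U : ℝ × Sp n → 𝕜} (hU : Measurable U) (hu : ∀ τ ∈ Ioo 0 t, ∀ᵐ y, u τ y = U (τ, y)) {x : Sp n}
    (hfin : duhMaj n α t (fun z => ‖f (U z)‖ₑ) x < ∞) :
    (∀ᵐ τ ∂(volume.restrict (Ioo 0 t)),
      Integrable (fun y => kernel n α (t - τ) (x - y) • f (u τ y))) ∧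
    IntegrableOn (fun τ => semigroup α (t - τ) (fun y => f (u τ y)) x) (Ioo 0 t) := by
  have hfU : Measurable fun z => f (U z) := hf.comp hU
  refine ⟨?_, ?_⟩
  · filter_upwards [ae_integrable_of_duhMaj hfU hfin, ae_restrict_mem measurableSet_Ioo] with τ h hτ
    refine h.congr ?_
    filter_upwards [hu τ hτ] with y hy
    rw [hy]
  · refine (integrableOn_semigroup_of_duhMaj hfU hfin).congr_fun (fun τ hτ => ?_) measurableSet_Ioo
    refine semigroup_congr_ae (sub_pos.2 hτ.2) ?_ x
    filter_upwards [hu τ hτ] with y hy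
    rw [hy]

theorem integral_eq_duhamel {t : ℝ} {u : ℝ → LSpace 𝕜 n r}
    {U : ℝ × Sp n → 𝕜} (hu : ∀ τ ∈ Ioo 0 t, ∀ᵐ y, u τ y = U (τ, y)) (x : Sp n) :
    ∫ τ in Ioo 0 t, semigroup α (t - τ) (fun y => f (u τ y)) x =
      duhamel n α t (fun z => f (U z)) x := by
  refine setIntegral_congr_fun measurableSet_Ioo fun τ hτ => ?_
  refine semigroup_congr_ae (sub_pos.2 hτ.2) ?_ x
  filter_upwards [hu τ hτ] with y hy
  rw [hy]

end MildFromRepresentative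

/-! ### Continuity in L^r at positive times. -/

section Continuity

variable {n : ℕ} {α : ℝ} {𝕜 : Type*} [RCLike 𝕜] {b r s : ℝ} {f : 𝕜 → 𝕜}

theorem tendsto_ofReal_rpow_mul {κ : ℝ} (hκ : 0 < κ) {B : ℝ≥0∞} (hB : B ≠ ∞) :
    Tendsto (fun h : ℝ => ENNReal.ofReal (h ^ κ) * B) (𝓝[>] 0) (𝓝 0) := by
  have h3 : Tendsto (fun t : ℝ => t ^ κ) (𝓝[>] 0) (𝓝 0) := by
    have := (Real.continuousAt_rpow_const 0 κ (Or.inr hκ.le)).tendsto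
    rw [Real.zero_rpow hκ.ne'] at this
    exact this.mono_left nhdsWithin_le_nhds
  have h4 := ENNReal.Tendsto.mul_const (b := B) (ENNReal.tendsto_ofReal h3) (Or.inr hB)
  simpa using h4

/-- Integrability at τ = t of the smoothing of the source from L^{s/(b+1)} to L^r; the strict
inequality uses r < s. -/
theorem IsWeightedExponent.source_exponent_lt (he : IsWeightedExponent n α b r s) :
    n / (2 * α) * ((b + 1) / s - 1 / r) < 1 := by
  obtain ⟨hα, hn, hb, hs, hr, hbr, hrs, hsr⟩ := he
  have hr0 : 0 < r := by linarith
  have hn' : (0 : ℝ) < n := by exact_mod_cast hn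
  have h1 : (b + 1) / s < (b + 1) / r := div_lt_div_of_pos_left (by linarith) hr0 hrs
  have h2 : n / (2 * α) * ((b + 1) / s - 1 / r) < n / (2 * α) * ((b + 1) / r - 1 / r) := by gcongr
  refine h2.trans_le ?_
  have h3 : n / (2 * α) * ((b + 1) / r - 1 / r) = n / (2 * α) * b / r := by field_simp; ring
  rw [h3, div_le_one hr0]
  exact hbr

/-- The Duhamel integral over a short time, of a function bounded in `L^r` and in `L^s`. -/
theorem exists_lnorm_duhMaj_short (he : IsWeightedExponent n α b r s) (hf : IsPowerSource b f)
    {M a : ℝ≥0∞} (hM : M ≠ ∞) (ha : a ≠ ∞) : ∃ ψ : ℝ → ℝ≥0∞, Tendsto ψ (𝓝[>] 0) (𝓝 0) ∧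
      (∀ h, ψ h ≠ ∞) ∧ ∀ (h : ℝ) (U : ℝ × Sp n → 𝕜), 0 < h → Measurable U →
        (∀ τ ∈ Ioo 0 h, lnorm r volume (fun y => ‖U (τ, y)‖ₑ) ≤ M) →
        (∀ τ ∈ Ioo 0 h, lnorm s volume (fun y => ‖U (τ, y)‖ₑ) ≤ a) →
        lnorm r volume (duhMaj n α h (fun z => ‖f (U z)‖ₑ)) ≤ ψ h := by
  have hA := he.source_exponent_lt
  obtain ⟨hα, hn, hb, hs, hr, hbr, hrs, hsr⟩ := he
  have hr0 : 0 < r := by linarith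
  have hs0 : 0 < s := by linarith
  obtain ⟨K, hK⟩ := exists_lnorm_duhMaj_source_le (n := n) hα hn hf (s := s) (ρ := r) (ρ₀ := r) hb hs
    hsr.le hr.le le_rfl one_pos
  set m : ℝ := n / (2 * α) with hm
  set A := m * ((b + 1) / s - 1 / r) with hAdef
  have hβ := lintegral_betaWeight_ne_top hA (B := 0) (by norm_num)
  set β := ∫⁻ θ in Ioo (0 : ℝ) 1, betaWeight A 0 θ with hβdef
  refine ⟨fun h => ENNReal.ofReal (h ^ (1 : ℝ)) * M + ENNReal.ofReal (h ^ (1 - A)) *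
    (K * (a ^ b * (β * a))), ?_, ?_, ?_⟩
  · have h1 := (tendsto_ofReal_rpow_mul one_pos hM).add
      (tendsto_ofReal_rpow_mul (sub_pos.2 hA) (B := K * (a ^ b * (β * a))) (by finiteness))
    rwa [add_zero] at h1
  · intro h
    finiteness
  · intro h U hh hU h1 h2
    have e0 : ENNReal.ofReal (0 : ℝ) = 0 := by simp
    have hz : lnorm s volume (fun y : Sp n => ‖(0 : 𝕜)‖ₑ) = 0 := by simp [lnorm_zero hs0]
    have key := hK h hh 0 0 a U (fun _ => 0) (fun _ => a) (fun _ => M) hU measurable_const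
      measurable_const (fun τ hτ => by simpa using h2 τ hτ)
      (fun τ hτ => by rw [hz]; exact zero_le) (fun τ hτ => by simpa using h2 τ hτ)
      (fun τ hτ => by simpa using h1 τ hτ)
    simp only [hf.map_zero, sub_zero, zero_mul] at key
    rw [lintegral_mul_const _ (measurable_betaWeight _ _),
      lintegral_mul_const _ (measurable_betaWeight _ _), sub_self, mul_zero,
      lintegral_betaWeight_zero, sub_zero, one_mul, ENNReal.coe_one, one_mul] at key
    refine key.trans (le_of_eq ?_)
    ring

theorem lnorm_sub_le_of_sub_le {X : Type*} [MeasurableSpace X] {μ : Measure X} {r : ℝ} (hr : 1 ≤ r)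
    {f g h k : X → 𝕜} (hf : Measurable f) (hg : Measurable g) (hh : Measurable h)
    (hk : Measurable k) :
    lnorm r μ (fun x => ‖f x - g x‖ₑ) ≤ lnorm r μ (fun x => ‖f x - h x‖ₑ) +
      (lnorm r μ (fun x => ‖h x - k x‖ₑ) + lnorm r μ (fun x => ‖g x - k x‖ₑ)) := by
  have hr0 : 0 < r := by linarith
  refine le_trans (lnorm_mono hr0 (g := fun x => ‖f x - h x‖ₑ + (‖h x - k x‖ₑ + ‖g x - k x‖ₑ))
    fun x => ?_) ?_
  · rw [enorm_sub_rev (g x)]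
    calc ‖f x - g x‖ₑ = ‖(f x - h x) + ((h x - k x) + (k x - g x))‖ₑ := by congr 1; ring
      _ ≤ _ := (enorm_add_le _ _).trans (by gcongr; exact enorm_add_le _ _)
  · have h1 : Measurable fun x => ‖f x - h x‖ₑ := (hf.sub hh).enorm
    have h2 : Measurable fun x => ‖h x - k x‖ₑ := (hh.sub hk).enorm
    have h3 : Measurable fun x => ‖g x - k x‖ₑ := (hg.sub hk).enorm
    exact (lnorm_add_le hr h1.aemeasurable (h2.add h3).aemeasurable).trans
      (add_le_add le_rfl (lnorm_add_le hr h2.aemeasurable h3.aemeasurable))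

/-- Continuity in `L^r`, at a positive time, of a solution of the integral equation. -/
theorem tendsto_lnorm_sub_of_integral_eq (he : IsWeightedExponent n α b r s)
    (hf : IsPowerSource b f) {T : ℝ} {φ : Sp n → 𝕜} (hφ : Measurable φ)
    (hφr : lnorm r volume (fun x => ‖φ x‖ₑ) ≠ ∞) {U : ℝ × Sp n → 𝕜} (hU : Measurable U)
    (hint : ∀ t ∈ Ioo 0 T, ∀ᵐ x, U (t, x) = semigroup α t φ x + duhamel n α t (fun z => f (U z)) x)
    (hfin : ∀ t ∈ Ioo 0 T, lnorm r volume (duhMaj n α t fun z => ‖f (U z)‖ₑ) ≠ ∞)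
    {M : ℝ≥0∞} (hM : M ≠ ∞) (hUM : ∀ t ∈ Ioo 0 T, lnorm r volume (fun x => ‖U (t, x)‖ₑ) ≤ M)
    (hUs : ∀ t₁, 0 < t₁ → ∃ a : ℝ≥0∞, a ≠ ∞ ∧ ∀ t ∈ Ioo t₁ T,
      lnorm s volume (fun x => ‖U (t, x)‖ₑ) ≤ a) {t₀ : ℝ} (ht₀ : t₀ ∈ Ioo 0 T) :
    Tendsto (fun t => lnorm r volume (fun x => ‖U (t, x) - U (t₀, x)‖ₑ)) (𝓝 t₀) (𝓝 0) := by
  have he' := he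
  obtain ⟨hα, hn, hb, hs, hr, hbr, hrs, hsr⟩ := he'
  have hr0 : 0 < r := by linarith
  have hmap : ∀ t : ℝ, Measurable fun y : Sp n => (t, y) := fun t => measurable_prodMk_left
  have hUt : ∀ t, Measurable fun x => U (t, x) := fun t => hU.comp (hmap t)
  have hfU : Measurable fun z => f (U z) := hf.measurable.comp hU
  obtain ⟨a, ha, hUa⟩ := hUs (t₀ / 2) (by linarith [ht₀.1])
  obtain ⟨ψ, hψ, hψfin, hψU⟩ := exists_lnorm_duhMaj_short (n := n) (𝕜 := 𝕜) he hf hM ha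
  -- the restart estimate
  have hre : ∀ t₁ ∈ Ico (t₀ / 2) T, ∀ t ∈ Ioo t₁ T,
      lnorm r volume (fun x => ‖U (t, x) - semigroup α (t - t₁) (fun y => U (t₁, y)) x‖ₑ) ≤
        ψ (t - t₁) := by
    intro t₁ ht₁ t ht
    have h1pos : 0 < t₁ := by linarith [ht₁.1, ht₀.1]
    have hh : 0 < t - t₁ := sub_pos.2 ht.1
    have ht₁T : t₁ ∈ Ioo 0 T := ⟨h1pos, ht₁.2⟩
    have hshift : Measurable fun z : ℝ × Sp n => U (t₁ + z.1, z.2) :=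
      hU.comp ((measurable_const.add measurable_fst).prodMk measurable_snd)
    have hbd := hψU (t - t₁) (fun z => U (t₁ + z.1, z.2)) hh hshift
      (fun τ hτ => hUM (t₁ + τ) ⟨by linarith [hτ.1], by linarith [hτ.2, ht.2]⟩)
      (fun τ hτ => hUa (t₁ + τ) ⟨by linarith [hτ.1, ht₁.1], by linarith [hτ.2, ht.2]⟩)
    refine le_trans (lnorm_mono_ae hr0 ?_) hbd
    have hm1 : Measurable (duhMaj n α t₁ fun z => ‖f (U z)‖ₑ) := measurable_duhMaj hfU.enorm t₁
    have f1 := ae_heatMaj_lt_top hα hn hr.le hh hm1 (hfin t₁ ht₁T)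
    have f2 := ae_heatMaj_lt_top hα hn hr.le hh hφ.enorm hφr
    have f2' := ae_heatMaj_lt_top hα hn hr.le hh (measurable_heatMaj hφ.enorm)
      (lnorm_heatMaj_ne_top hα hn hr.le le_rfl h1pos hφ.enorm hφr)
    have f3 : ∀ᵐ x, duhMaj n α (t - t₁) (fun z => ‖f (U (t₁ + z.1, z.2))‖ₑ) x < ∞ :=
      ae_lt_top_of_lnorm hr0 (measurable_duhMaj (hf.measurable.comp hshift).enorm _)
        (ne_top_of_le_ne_top (hψfin _) hbd)
    filter_upwards [f1, f2', f3, hint t ⟨h1pos.trans ht.1, ht.2⟩] with x h1 h2 h3 h4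
    have e1 : semigroup α (t - t₁) (fun y => U (t₁, y)) x =
        semigroup α (t - t₁) (fun y => semigroup α t₁ φ y + duhamel n α t₁ (fun z => f (U z)) y) x :=
      semigroup_congr_ae hh (hint t₁ ht₁T) x
    have hms : Measurable (semigroup α t₁ φ) := measurable_semigroup t₁ hφ
    have hmd : Measurable (duhamel n α t₁ fun z => f (U z)) := (measurable_duhamel hfU).comp (hmap t₁)
    have g1 : heatMaj n α (t - t₁) (fun y => ‖semigroup α t₁ φ y‖ₑ) x < ∞ :=
      lt_of_le_of_lt (heatMaj_mono_ae (ae_of_all _ fun y => enorm_semigroup_le h1pos φ y) x) h2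
    have g2 : heatMaj n α (t - t₁) (fun y => ‖duhamel n α t₁ (fun z => f (U z)) y‖ₑ) x < ∞ :=
      lt_of_le_of_lt (heatMaj_mono_ae (ae_of_all _ fun y => enorm_duhamel_le _ y) x) h1
    have e2 : semigroup α (t - t₁) (fun y => semigroup α t₁ φ y +
        duhamel n α t₁ (fun z => f (U z)) y) x = semigroup α (t - t₁) (semigroup α t₁ φ) x +
        semigroup α (t - t₁) (duhamel n α t₁ fun z => f (U z)) x := by
      rw [semigroup_of_pos hh, semigroup_of_pos hh, semigroup_of_pos hh,
        ← integral_add (integrable_kernel_smul hms g1) (integrable_kernel_smul hmd g2)]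
      simp_rw [smul_add]
    have e3 := duhamel_restart hα hn h1pos.le hh hfU h1 h3
    have e4 := semigroup_semigroup hα hn hh h1pos hφ h2
    rw [add_sub_cancel] at e3
    rw [sub_add_cancel] at e4
    have e5 : U (t, x) - semigroup α (t - t₁) (fun y => U (t₁, y)) x =
        duhamel n α (t - t₁) (fun z => f (U (t₁ + z.1, z.2))) x := by
      rw [h4, e1, e2, e3, e4]
      ring
    rw [e5]
    exact enorm_duhamel_le _ x
  rw [ENNReal.tendsto_nhds_zero] at hψ ⊢
  intro ε hε
  have hε3 : 0 < ε / 3 := ENNReal.div_pos hε.ne' (by norm_num)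
  obtain ⟨δ, hδ, hδ'⟩ := mem_nhdsGT_iff_exists_Ioo_subset.1 (hψ _ hε3)
  have hδ : 0 < δ := hδ
  have hδ' : ∀ h ∈ Ioo 0 δ, ψ h ≤ ε / 3 := fun h hh => hδ' hh
  -- Restart at t₁ = t₀ - d: the Duhamel parts up to t and up to t₀ are short, hence small, and
  -- continuity of the linear orbit of U(t₁) handles the rest. Starting before t₀ covers both sides
  -- of t₀.
  set d := min (δ / 2) (t₀ / 2) with hd
  have ht₀0 := ht₀.1
  have hd0 : 0 < d := lt_min (by linarith) (by linarith)
  have hd1 : d ≤ δ / 2 := min_le_left _ _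
  have hd2 : d ≤ t₀ / 2 := min_le_right _ _
  set t₁ := t₀ - d with ht₁
  have hg : Measurable fun y => U (t₁, y) := hUt t₁
  have ht₁T : t₁ ∈ Ioo 0 T := ⟨by linarith, by linarith [ht₀.2]⟩
  have hcont := tendsto_lnorm_semigroup_sub_semigroup (n := n) hα hn hr.le hg
    (ne_top_of_le_ne_top hM (hUM t₁ ht₁T)) hd0.le
  rw [ENNReal.tendsto_nhds_zero] at hcont
  have hev := hcont _ hε3
  rw [eventually_nhdsWithin_iff] at hev
  have hshift : Tendsto (fun t => t - t₁) (𝓝 t₀) (𝓝 d) := by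
    have h0 : Tendsto (fun t => t - t₁) (𝓝 t₀) (𝓝 (t₀ - t₁)) := tendsto_id.sub tendsto_const_nhds
    rwa [ht₁, sub_sub_cancel] at h0
  filter_upwards [hshift.eventually hev, Ioo_mem_nhds (show t₁ < t₀ by linarith) ht₀.2,
    Iio_mem_nhds (show t₀ < t₁ + δ by linarith)] with t h1 h2 h3
  have h3 : t < t₁ + δ := h3
  have k1 := hre t₁ ⟨by linarith, ht₁T.2⟩ t h2
  have k2 := hre t₁ ⟨by linarith, ht₁T.2⟩ t₀ ⟨by linarith, ht₀.2⟩
  have k3 := h1 (show 0 ≤ t - t₁ by linarith [h2.1])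
  have e : t₀ - t₁ = d := by rw [ht₁]; ring
  rw [e] at k2
  calc _ ≤ _ := lnorm_sub_le_of_sub_le hr.le (hUt t) (hUt t₀)
        (measurable_semigroup (α := α) (t - t₁) hg) (measurable_semigroup (α := α) d hg)
    _ ≤ ε / 3 + (ε / 3 + ε / 3) := by
        refine add_le_add (k1.trans (hδ' _ ⟨by linarith [h2.1], by linarith⟩))
          (add_le_add k3 (k2.trans (hδ' _ ⟨hd0, by linarith⟩)))
    _ = ε := by rw [← add_assoc, ENNReal.add_thirds]

end Continuity

/-! ### Arithmetic of admissible triplets. -/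

section Admissible

variable {n : ℕ} {α p r : ℝ} {q : ℝ≥0∞}

/-- This is the upper bound on p in another form; it says that the time exponent exceeds r. -/
theorem IsAdmissible.scaling_lt (h : IsAdmissible n α q p r) (hα : 0 < α) :
    n / (2 * α) * (1 / r - 1 / p) < 1 / r := by
  have hr0 : 0 < r := by linarith [h.one_lt]
  have hp0 : 0 < p := by linarith [h.le]
  have key : p * (n - 2 * α) < n * r := by
    rcases le_or_gt (n : ℝ) (2 * α) with h1 | h1
    · rcases Nat.eq_zero_or_pos n with h0 | h0
      · subst h0
        simp only [CharP.cast_eq_zero, zero_sub, zero_mul]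
        nlinarith
      · have : (0 : ℝ) < n := by exact_mod_cast h0
        nlinarith
    · have := h.lt h1
      rwa [lt_div_iff₀ (by linarith)] at this
  have e : n / (2 * α) * (1 / r - 1 / p) = n * (p - r) / (2 * α * (r * p)) := by
    field_simp
  rw [e, div_lt_div_iff₀ (by positivity) hr0, one_mul]
  nlinarith

/-- The time exponent of an admissible triplet. -/
theorem IsAdmissible.exponent (h : IsAdmissible n α q p r) (hα : 0 < α) (hn : 0 < n) :
    (p = r ∧ q = ∞) ∨ (r < p ∧ ∃ Q : ℝ, r < Q ∧ q = ENNReal.ofReal Q ∧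
      1 / Q = n / (2 * α) * (1 / r - 1 / p)) := by
  have hr0 : 0 < r := by linarith [h.one_lt]
  have hn' : (0 : ℝ) < n := by exact_mod_cast hn
  rcases h.le.eq_or_lt with h1 | h1
  · left
    refine ⟨h1.symm, ?_⟩
    have := h.scaling
    rw [h1, sub_self, mul_zero, ENNReal.ofReal_zero, ENNReal.inv_eq_zero] at this
    exact this
  · right
    have hlt := h.scaling_lt hα
    have h2 : 0 < 1 / r - 1 / p := by
      have := one_div_lt_one_div_of_lt hr0 h1
      linarith
    set e := n / (2 * α) * (1 / r - 1 / p) with he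
    have he0 : 0 < e := by positivity
    refine ⟨h1, 1 / e, ?_, ?_, by rw [one_div_one_div]⟩
    · rwa [lt_one_div hr0 he0]
    · rw [← inv_inv q, h.scaling, ← he, one_div e, ENNReal.ofReal_inv_of_pos he0]

end Admissible

/-! ### Solutions in X([0,T)) from the size of the linear flow. -/

section Existence

variable {n : ℕ} {α : ℝ} {𝕜 : Type*} [RCLike 𝕜] {b r s p : ℝ} {q : ℝ≥0∞} {f : 𝕜 → 𝕜}

/-- A solution of the integral equation with finite space-time norm of its linear part. -/
theorem lnorm_time_solution_ne_top (he : IsWeightedExponent n α b r s) (hf : IsPowerSource b f)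
    (hrp : r < p) (hsp : n / (2 * α) * ((b + 1) / s - 1 / p) < 1) {Q : ℝ} (hrQ : r < Q)
    (hQ : 1 / Q = n / (2 * α) * (1 / r - 1 / p)) {T : ℝ} {φ : Sp n → 𝕜} (hφ : Measurable φ)
    (hφr : lnorm r volume (fun x => ‖φ x‖ₑ) ≠ ∞) {U : ℝ × Sp n → 𝕜} (hU : Measurable U)
    (hint : ∀ t ∈ Ioo 0 T, ∀ᵐ x, U (t, x) = semigroup α t φ x + duhamel n α t (fun z => f (U z)) x)
    {M a : ℝ≥0∞} (hM : M ≠ ∞) (ha : a ≠ ∞)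
    (hUM : ∀ t ∈ Ioo 0 T, lnorm r volume (fun x => ‖U (t, x)‖ₑ) ≤ M)
    (hUs : ∀ t ∈ Ioo 0 T, lnorm s volume (fun x => ‖U (t, x)‖ₑ) ≤
      ENNReal.ofReal (t ^ (-(n / (2 * α) * (1 / r - 1 / s)))) * a)
    (hUQ : lnorm Q (volume.restrict (Ioo 0 T)) (fun t => ENNReal.ofReal (t ^ (-(1 / Q))) *
          (ENNReal.ofReal (t ^ (n / (2 * α) * (1 / r - 1 / s))) *
            lnorm s volume (fun x => ‖U (t, x)‖ₑ))) ≠ ∞) :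
    lnorm Q (volume.restrict (Ioo 0 T)) (fun t => lnorm p volume (fun x => ‖U (t, x)‖ₑ)) ≠ ∞ := by
  have hB1 := he.weight_lt_one
  obtain ⟨hα, hn, hb, hs, hr, hbr, hrs, hsr⟩ := he
  have hr0 : 0 < r := by linarith
  have hs0 : 0 < s := by linarith
  have hp0 : 0 < p := by linarith
  have hQ1 : 1 ≤ Q := by linarith
  have hQ0 : 0 < Q := by linarith
  obtain ⟨K, hK⟩ := exists_lnorm_duhamel_le (n := n) hα hn hf (ρ := p) hb hs hr hrp.le hsr one_pos
  set m : ℝ := n / (2 * α) with hm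
  set γ := m * (1 / r - 1 / s) with hγ
  rw [← hQ] at hK
  have hQl : 1 / Q < 1 := by rw [div_lt_one hQ0]; linarith
  have hδ : 0 ≤ 1 - m * b / r := by rw [sub_nonneg, div_le_one hr0]; exact hbr
  set H : ℝ → ℝ≥0∞ := fun t => ENNReal.ofReal (t ^ γ) * lnorm s volume (fun x => ‖U (t, x)‖ₑ)
    with hH
  have hHm : Measurable H := (by fun_prop : Measurable fun t : ℝ => ENNReal.ofReal (t ^ γ)).mul
        (measurable_lnorm_slice hU.enorm)
  set W := betaWeight (m * ((b + 1) / s - 1 / p)) (γ * (b + 1)) with hW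
  have hWm : Measurable W := measurable_betaWeight _ _
  have hWfin : ∫⁻ θ in Ioo (0 : ℝ) 1, W θ ≠ ∞ := lintegral_betaWeight_ne_top hsp hB1
  set β₁ := ∫⁻ θ in Ioo (0 : ℝ) 1, betaWeight (1 / Q) 0 θ with hβ₁
  have hβ₁fin : β₁ ≠ ∞ := lintegral_betaWeight_ne_top hQl (by norm_num)
  set D : ℝ≥0∞ := K * a ^ b * ENNReal.ofReal (T ^ (1 - m * b / r)) with hD
  set lin : ℝ → ℝ≥0∞ := fun t => lnorm p volume (heatMaj n α t fun y => ‖φ y‖ₑ) with hlin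
  set F : ℝ → ℝ≥0∞ := fun t => ENNReal.ofReal (t ^ (-(1 / Q))) *
    ∫⁻ θ in Ioo (0 : ℝ) 1, W θ * H (t * θ) with hF
  set c : ℝ≥0∞ := ENNReal.ofReal (T ^ (1 - 1 / Q)) * (β₁ * M) with hc
  -- Three contributions: the linear flow, integrable by the space-time estimate; a constant from
  -- the linear part of the source; and a dilation average of the weighted L^s norm, bounded on
  -- L^Q(dt/t).
  have hpt : ∀ t ∈ Ioo 0 T, lnorm p volume (fun x => ‖U (t, x)‖ₑ) ≤ lin t + (c + D * F t) := by
    intro t ht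
    have ht0 := ht.1
    have hτ : ∀ τ ∈ Ioo 0 t, τ ∈ Ioo 0 T := fun τ hτ => ⟨hτ.1, hτ.2.trans ht.2⟩
    have key := hK t ht.1 a M U H hU hHm (fun τ h => hUs τ (hτ τ h)) (fun τ h => by
      simp only [hH]
      rw [← mul_assoc, ← ENNReal.ofReal_mul (by have := h.1; positivity), ← Real.rpow_add h.1]
      simp) (fun τ h => hUM τ (hτ τ h))
    have h1 : lnorm p volume (fun x => ‖U (t, x)‖ₑ) ≤ lin t +
        lnorm p volume (duhMaj n α t (fun z => ‖f (U z)‖ₑ)) := by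
      refine le_trans (lnorm_mono_ae hp0 ?_) (lnorm_add_le (by linarith)
        (measurable_heatMaj hφ.enorm).aemeasurable
        (measurable_duhMaj (hf.measurable.comp hU).enorm t).aemeasurable)
      filter_upwards [hint t ht] with x hx
      rw [hx]
      exact (enorm_add_le _ _).trans (add_le_add (enorm_semigroup_le ht.1 _ x)
        (enorm_duhamel_le _ x))
    refine h1.trans (add_le_add le_rfl (key.trans ?_))
    rw [mul_add]
    refine add_le_add ?_ ?_
    · have e : ENNReal.ofReal (t ^ (-(1 / Q))) * (((1 : ℝ≥0) : ℝ≥0∞) * ENNReal.ofReal t * (β₁ * M)) =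
          ENNReal.ofReal (t ^ (1 - 1 / Q)) * (β₁ * M) := by
        rw [ENNReal.coe_one, one_mul, ← mul_assoc, ← ENNReal.ofReal_mul (by positivity),
          ← Real.rpow_add_one ht0.ne']
        congr 3; ring
      rw [e, hc]
      gcongr
      exact ht.2.le
    · rw [hD, hF]
      calc _ = K * a ^ b * ENNReal.ofReal (t ^ (1 - m * b / r)) * (ENNReal.ofReal (t ^ (-(1 / Q))) *
            ∫⁻ θ in Ioo (0 : ℝ) 1, W θ * H (t * θ)) := by ring
        _ ≤ _ := by
          gcongr
          exact ht.2.le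
  have hlinm : Measurable lin := by
    have h1 := measurable_heatMaj_uncurry (α := α) (hφ.enorm.comp (measurable_snd (α := ℝ)))
    have h2 : Measurable fun z : ℝ × Sp n => (((z.1, 0) : ℝ × ℝ), z.2) :=
      (measurable_fst.prodMk measurable_const).prodMk measurable_snd
    have h3 := measurable_lnorm_slice (p := p) (h1.comp h2)
    simpa using h3
  have hFm : Measurable F := by
    refine (by fun_prop : Measurable fun t : ℝ => ENNReal.ofReal (t ^ (-(1 / Q)))).mul ?_
    refine Measurable.lintegral_prod_right' (f := fun z : ℝ × ℝ => W z.2 * H (z.1 * z.2)) ?_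
    exact (hWm.comp measurable_snd).mul (hHm.comp (measurable_fst.mul measurable_snd))
  refine ne_top_of_le_ne_top ?_ (lnorm_mono_ae hQ0 (g := fun t => lin t + (c + D * F t)) (by
    filter_upwards [ae_restrict_mem measurableSet_Ioo] with t ht using hpt t ht))
  have hDt : D ≠ ∞ := by rw [hD]; finiteness
  refine ne_top_of_le_ne_top ?_ (lnorm_add_le hQ1 hlinm.aemeasurable
    (measurable_const.add (hFm.const_mul D)).aemeasurable)
  refine ENNReal.add_ne_top.2 ⟨?_, ne_top_of_le_ne_top ?_ (lnorm_add_le hQ1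
    measurable_const.aemeasurable (hFm.const_mul D).aemeasurable)⟩
  · have h1 := lnorm_time_heatMaj_ne_top hα hn hr hrp hrQ hφ.enorm hφr
    rw [← hm, ← hQ] at h1
    refine ne_top_of_le_ne_top h1 ?_
    refine le_trans ?_ (ENNReal.rpow_le_rpow (lintegral_mono_set (fun t ht => ht.1 : Ioo 0 T ⊆ Ioi 0))
      (by positivity))
    refine lnorm_mono_ae hQ0 ?_
    filter_upwards [ae_restrict_mem measurableSet_Ioo] with t ht
    have ht0 := ht.1
    rw [← mul_assoc, ← ENNReal.ofReal_mul (by positivity), ← Real.rpow_add ht.1]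
    simp [hlin]
  · refine ENNReal.add_ne_top.2 ⟨?_, ?_⟩
    · unfold lnorm
      rw [lintegral_const]
      have hct : c ≠ ∞ := by rw [hc]; finiteness
      refine ENNReal.rpow_ne_top_of_nonneg (by positivity) (ENNReal.mul_ne_top
        (ENNReal.rpow_ne_top_of_nonneg hQ0.le hct) ?_)
      simp
    · rw [lnorm_const_mul hQ0 hDt]
      refine ENNReal.mul_ne_top hDt (ne_top_of_le_ne_top ?_ (lnorm_mellin_le hQ1 hWm hHm))
      exact ENNReal.mul_ne_top hWfin hUQ

theorem eLpNorm_timeInterval {Q T : ℝ} (hQ : 0 < Q) (N : ℝ → ℝ≥0∞) :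
    eLpNorm N (ENNReal.ofReal Q) (volume.restrict (timeInterval (ENNReal.ofReal T))) =
      lnorm Q (volume.restrict (Ioo 0 T)) N := by
  rw [eLpNorm_eq_lintegral_rpow_enorm_toReal (by simpa using hQ) ENNReal.ofReal_ne_top,
    ENNReal.toReal_ofReal hQ.le, timeInterval_ofReal, ← Measure.restrict_congr_set Ioo_ae_eq_Ico]
  rfl

/-- Local existence in `X([0,T))`, in terms of the size of the linear evolution. -/
theorem exists_solutionX [Fact (1 ≤ ENNReal.ofReal r)] (he : IsWeightedExponent n α b r s)
    (hf : IsPowerSource b f) (hadm : IsAdmissible n α q p r)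
    (hsp : n / (2 * α) * ((b + 1) / s - 1 / p) < 1) (T₀ : ℝ) :
    ∃ c : ℝ≥0∞, 0 < c ∧ ∀ T : ℝ, 0 < T → T ≤ T₀ → ∀ φ : LSpace 𝕜 n r, ∀ A : ℝ≥0∞, A ≠ ∞ →
      (∀ t ∈ Ioo 0 T, lnorm s volume (heatMaj n α t fun y => ‖φ y‖ₑ) ≤
        ENNReal.ofReal (t ^ (-(n / (2 * α) * (1 / r - 1 / s)))) * A) →
      ENNReal.ofReal (T ^ (1 - n / (2 * α) * b / r)) * A ^ b ≤ c →
      ∃ u : ℝ → LSpace 𝕜 n r, IsSolutionX α q p f φ (ENNReal.ofReal T) u := by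
  obtain ⟨c, hc0, hc⟩ := exists_integral_solution he hf T₀
  refine ⟨c, hc0, fun T hT hTT φ A hAt hA hAc => ?_⟩
  have hB1 := he.weight_lt_one
  have hA1 := he.source_exponent_lt
  have he' := he
  obtain ⟨hα, hn, hb, hs, hr, hbr, hrs, hsr⟩ := he'
  have hr0 : 0 < r := by linarith
  have hs0 : 0 < s := by linarith
  have hp0 : 0 < p := by linarith [hadm.le]
  have hφ : Measurable (φ : Sp n → 𝕜) := measurable_LSpace φ
  have hφr : lnorm r volume (fun x => ‖φ x‖ₑ) ≠ ∞ := lnorm_LSpace_ne_top hr0 φ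
  obtain ⟨U, hU, hint, hUa, ⟨M, hM, hUM⟩, hUQ⟩ := hc T hT hTT φ hφ hφr A hAt hA hAc
  have hUt : ∀ t, Measurable fun x => U (t, x) := fun t => hU.comp measurable_prodMk_left
  have hfU : Measurable fun z => f (U z) := hf.measurable.comp hU
  have hUA : ∀ t ∈ Ioo 0 T, lnorm s volume (fun x => ‖U (t, x)‖ₑ) ≤
      ENNReal.ofReal (t ^ (-(n / (2 * α) * (1 / r - 1 / s)))) * (2 * A) := fun t ht =>
    hUa t ht A fun τ hτ => hA τ ⟨hτ.1, hτ.2.trans_lt ht.2⟩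
  obtain ⟨K, hK⟩ := exists_lnorm_duhamel_le (n := n) hα hn hf (ρ := r) hb hs hr le_rfl hsr one_pos
  set m : ℝ := n / (2 * α) with hm
  set γ := m * (1 / r - 1 / s) with hγ
  set β := ∫⁻ θ in Ioo (0 : ℝ) 1, betaWeight (m * ((b + 1) / s - 1 / r)) (γ * (b + 1)) θ with hβ
  have hβt : β ≠ ∞ := lintegral_betaWeight_ne_top hA1 hB1
  -- the Duhamel term in `L^r`
  have hdr : ∀ t ∈ Ioo 0 T, ∀ a : ℝ≥0∞,
      (∀ τ ∈ Ioo 0 t, lnorm s volume (heatMaj n α τ fun y => ‖φ y‖ₑ) ≤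
        ENNReal.ofReal (τ ^ (-γ)) * a) →
      lnorm r volume (duhMaj n α t fun z => ‖f (U z)‖ₑ) ≤
        ENNReal.ofReal t * M + K * (2 * a) ^ b * ENNReal.ofReal (t ^ (1 - m * b / r)) *
          (β * (2 * a)) := by
    intro t ht a ha
    have hτ : ∀ τ ∈ Ioo 0 t, τ ∈ Ioo 0 T := fun τ hτ => ⟨hτ.1, hτ.2.trans ht.2⟩
    have hb' : ∀ τ ∈ Ioo 0 t, lnorm s volume (fun y => ‖U (τ, y)‖ₑ) ≤
        ENNReal.ofReal (τ ^ (-γ)) * (2 * a) := fun τ h =>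
      hUa τ (hτ τ h) a fun τ' h' => ha τ' ⟨h'.1, h'.2.trans_lt h.2⟩
    have key := hK t ht.1 (2 * a) M U (fun _ => 2 * a) hU measurable_const hb' hb'
      (fun τ h => hUM τ (hτ τ h))
    rwa [sub_self, mul_zero, neg_zero, Real.rpow_zero, ENNReal.ofReal_one, one_mul,
      lintegral_betaWeight_zero, one_mul, lintegral_mul_const _ (measurable_betaWeight _ _),
      ENNReal.coe_one, one_mul] at key
  have hdfin : ∀ t ∈ Ioo 0 T, lnorm r volume (duhMaj n α t fun z => ‖f (U z)‖ₑ) ≠ ∞ := fun t ht =>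
    ne_top_of_le_ne_top (by finiteness) (hdr t ht A fun τ hτ => hA τ ⟨hτ.1, hτ.2.trans ht.2⟩)
  have hdae : ∀ t ∈ Ioo 0 T, ∀ᵐ x, duhMaj n α t (fun z => ‖f (U z)‖ₑ) x < ∞ := fun t ht =>
    ae_lt_top_of_lnorm hr0 (measurable_duhMaj hfU.enorm t) (hdfin t ht)
  classical
  -- Off (0,T) the curve is set to φ; only its value at t = 0 matters.
  set u : ℝ → LSpace 𝕜 n r := fun t => if h : t ∈ Ioo 0 T then
    (memLp_of_lnorm hr0 (hUt t) (ne_top_of_le_ne_top hM (hUM t h))).toLp _ else φ with hu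
  have hu0 : u 0 = φ := dif_neg (by simp)
  have hut : ∀ t ∈ Ioo 0 T, ∀ᵐ x, u t x = U (t, x) := by
    intro t ht
    have : u t = (memLp_of_lnorm hr0 (hUt t) (ne_top_of_le_ne_top hM (hUM t ht))).toLp _ :=
      dif_pos ht
    rw [this]
    exact MemLp.coeFn_toLp _
  refine ⟨u, ⟨?_, ?_⟩, ?_⟩
  · -- continuity
    rw [timeInterval_ofReal]
    intro t₀ ht₀
    rw [ContinuousWithinAt, tendsto_iff_edist_tendsto_0]
    simp_rw [edist_LSpace hr0]
    rcases ht₀.1.eq_or_lt with h0 | h0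
    · subst h0
      rw [hu0]
      have h1 := tendsto_lnorm_semigroup_sub (n := n) hα hn hr.le hφ hφr
      have h2 := tendsto_lnorm_heatMaj hα hn hr.le hrs hφ.enorm hφr
      have hδ : 0 ≤ 1 - m * b / r := by rw [sub_nonneg, div_le_one hr0]; exact hbr
      set B : ℝ≥0∞ → ℝ≥0∞ := fun a =>
        K * (2 * a) ^ b * ENNReal.ofReal (T ^ (1 - m * b / r)) * (β * (2 * a)) with hB
      have hBlim : Tendsto B (𝓝 0) (𝓝 0) := by
        have c1 : Tendsto (fun a : ℝ≥0∞ => 2 * a) (𝓝 0) (𝓝 0) := by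
          have := ENNReal.Tendsto.const_mul (a := (2 : ℝ≥0∞)) (tendsto_id (α := ℝ≥0∞) (x := 𝓝 0))
            (Or.inr (by norm_num))
          simpa using this
        have c2 : Tendsto (fun a : ℝ≥0∞ => (2 * a) ^ b) (𝓝 0) (𝓝 0) := by
          have := (ENNReal.continuous_rpow_const (y := b)).tendsto 0 |>.comp c1
          rwa [ENNReal.zero_rpow_of_pos hb] at this
        have c3 := ENNReal.Tendsto.const_mul (a := (K : ℝ≥0∞)) c2 (Or.inr ENNReal.coe_ne_top)
        have c4 := ENNReal.Tendsto.mul_const (b := ENNReal.ofReal (T ^ (1 - m * b / r))) c3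
          (Or.inr ENNReal.ofReal_ne_top)
        have c5 := ENNReal.Tendsto.const_mul (a := β) c1 (Or.inr hβt)
        have c6 := ENNReal.Tendsto.mul c4 (Or.inr (by simp)) c5 (Or.inr (by simp))
        simpa [hB] using c6
      have h3 := tendsto_ofReal_rpow_mul one_pos hM
      rw [ENNReal.tendsto_nhds_zero] at h1 h2 h3 hBlim ⊢
      intro ε hε
      have hε3 : 0 < ε / 3 := ENNReal.div_pos hε.ne' (by norm_num)
      -- Continuity at zero: first take a so small that the power part of the Duhamel bound is below
      -- ε/3, then restrict to times at which the weighted norm of the linear flow is below a. This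
      -- works in the critical case as well, where T^δ gives nothing.
      obtain ⟨a, haB, ha0⟩ : ∃ a : ℝ≥0∞, B a ≤ ε / 3 ∧ 0 < a := by
        have hz : ∀ᶠ a in 𝓝[>] (0 : ℝ≥0∞), B a ≤ ε / 3 :=
          (hBlim _ hε3).filter_mono nhdsWithin_le_nhds
        obtain ⟨a, h, h'⟩ := (hz.and self_mem_nhdsWithin).exists
        exact ⟨a, h, h'⟩
      obtain ⟨d, hd, hd'⟩ := mem_nhdsGT_iff_exists_Ioo_subset.1 (h2 a ha0)
      have hev : ∀ᶠ t in 𝓝[>] (0 : ℝ), t ∈ Ioo 0 (min d T) :=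
        Ioo_mem_nhdsGT (lt_min hd hT)
      have hmain : ∀ᶠ t in 𝓝[>] (0 : ℝ), lnorm r volume (fun x => ‖u t x - φ x‖ₑ) ≤ ε := by
        filter_upwards [h1 _ hε3, h3 _ hε3, hev] with t k1 k3 kt
        have ht : t ∈ Ioo 0 T := ⟨kt.1, kt.2.trans_le (min_le_right _ _)⟩
        have htd : t < d := kt.2.trans_le (min_le_left _ _)
        have k2 := hdr t ht a fun τ hτ => by
          have h' : ENNReal.ofReal (τ ^ γ) * lnorm s volume (heatMaj n α τ fun y => ‖φ y‖ₑ) ≤ a :=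
            hd' ⟨hτ.1, hτ.2.trans htd⟩
          calc _ = ENNReal.ofReal (τ ^ (-γ)) * (ENNReal.ofReal (τ ^ γ) *
                lnorm s volume (heatMaj n α τ fun y => ‖φ y‖ₑ)) := by
                rw [← mul_assoc, ← ENNReal.ofReal_mul (by have := hτ.1; positivity),
                  ← Real.rpow_add hτ.1]
                simp
            _ ≤ _ := by gcongr
        have m1 : Measurable fun x => ‖semigroup α t φ x - φ x‖ₑ :=
          ((measurable_semigroup t hφ).sub hφ).enorm
        have m2 : Measurable (duhMaj n α t fun z => ‖f (U z)‖ₑ) := measurable_duhMaj hfU.enorm t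
        have hle : lnorm r volume (fun x => ‖u t x - φ x‖ₑ) ≤
            lnorm r volume (fun x => ‖semigroup α t φ x - φ x‖ₑ) +
            lnorm r volume (duhMaj n α t fun z => ‖f (U z)‖ₑ) := by
          refine le_trans (lnorm_mono_ae hr0 ?_)
            (lnorm_add_le hr.le m1.aemeasurable m2.aemeasurable)
          filter_upwards [hut t ht, hint t ht] with x hx hx'
          rw [hx, hx', add_sub_right_comm]
          exact (enorm_add_le _ _).trans (add_le_add le_rfl (enorm_duhamel_le _ x))
        refine hle.trans ((add_le_add k1 (k2.trans (add_le_add (by simpa using k3) (le_trans ?_ haB)))).trans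
          (le_of_eq ?_))
        · change _ ≤ K * (2 * a) ^ b * ENNReal.ofReal (T ^ (1 - m * b / r)) * (β * (2 * a))
          have := ht.1.le
          gcongr
          exact ht.2.le
        · rw [← add_assoc, ENNReal.add_thirds]
      rw [eventually_nhdsWithin_iff] at hmain ⊢
      filter_upwards [hmain] with t ht htI
      rcases htI.1.eq_or_lt with h | h
      · rw [← h, hu0]; simp [lnorm_zero hr0]
      · exact ht h
    · have ht₀' : t₀ ∈ Ioo 0 T := ⟨h0, ht₀.2⟩
      have h1 := tendsto_lnorm_sub_of_integral_eq he hf hφ hφr hU hint hdfin hM hUM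
        (fun t₁ ht₁ => ⟨ENNReal.ofReal (t₁ ^ (-γ)) * (2 * A), by finiteness, fun t ht => by
          refine (hUA t ⟨ht₁.trans ht.1, ht.2⟩).trans ?_
          gcongr ?_ * _
          refine ENNReal.ofReal_le_ofReal (Real.rpow_le_rpow_of_nonpos ht₁ ht.1.le ?_)
          have := one_div_lt_one_div_of_lt hr0 hrs
          have hn' : (0 : ℝ) < n := by exact_mod_cast hn
          have h2 : 0 < 1 / r - 1 / s := by linarith
          have : 0 < γ := by positivity
          linarith⟩) ht₀'
      refine (h1.mono_left nhdsWithin_le_nhds).congr' ?_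
      filter_upwards [mem_nhdsWithin_of_mem_nhds (Ioo_mem_nhds h0 ht₀.2)] with t ht
      refine lnorm_congr_ae _ ?_
      filter_upwards [hut t ht, hut t₀ ht₀'] with x hx hx'
      rw [hx, hx']
  · -- the mixed norm
    rcases hadm.exponent hα hn with ⟨hpr, hq⟩ | ⟨hrp, Q, hrQ, hq, hQ⟩
    · subst hpr
      rw [hq, eLpNorm_exponent_top]
      refine lt_of_le_of_lt (eLpNormEssSup_le_of_ae_enorm_bound (C := M) ?_) hM.lt_top
      rw [timeInterval_ofReal, ← Measure.restrict_congr_set Ioo_ae_eq_Ico]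
      filter_upwards [ae_restrict_mem measurableSet_Ioo] with t ht
      rw [enorm_eq_self, eLpNorm_eq_lnorm hr0]
      refine le_of_eq_of_le (lnorm_congr_ae _ ?_) (hUM t ht)
      filter_upwards [hut t ht] with x hx
      rw [hx]
    · have hQ0 : 0 < Q := by linarith
      rw [hq, eLpNorm_timeInterval hQ0]
      have h2 := lnorm_time_heatMaj_ne_top hα hn hr hrs hrQ hφ.enorm hφr
      have h3 : lnorm Q (volume.restrict (Ioo 0 T)) (fun t => ENNReal.ofReal (t ^ (-(1 / Q))) *
          (ENNReal.ofReal (t ^ γ) * lnorm s volume (heatMaj n α t fun y => ‖φ y‖ₑ))) ≠ ∞ :=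
        ne_top_of_le_ne_top h2 (ENNReal.rpow_le_rpow
          (lintegral_mono_set (fun t ht => ht.1 : Ioo 0 T ⊆ Ioi 0)) (by positivity))
      have h1 := lnorm_time_solution_ne_top he hf hrp hsp hrQ hQ hφ hφr hU hint hM
        (a := 2 * A) (by finiteness) hUM hUA
        (ne_top_of_le_ne_top (ENNReal.mul_ne_top (by norm_num) h3) (hUQ Q (by linarith)))
      refine lt_of_le_of_lt (le_of_eq (lnorm_congr_ae _ ?_)) h1.lt_top
      filter_upwards [ae_restrict_mem measurableSet_Ioo] with t ht
      rw [eLpNorm_eq_lnorm hp0]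
      refine lnorm_congr_ae _ ?_
      filter_upwards [hut t ht] with x hx
      rw [hx]
  · -- the integral equation
    intro t ht
    rw [mem_timeInterval_ofReal] at ht
    rcases ht.1.eq_or_lt with h0 | h0
    · subst h0
      refine ae_of_all _ fun x => ?_
      simp [hu0, semigroup_zero]
    · have ht' : t ∈ Ioo 0 T := ⟨h0, ht.2⟩
      have huτ : ∀ τ ∈ Ioo 0 t, ∀ᵐ y, u τ y = U (τ, y) := fun τ hτ =>
        hut τ ⟨hτ.1, hτ.2.trans ht.2⟩
      filter_upwards [hdae t ht', hint t ht', hut t ht'] with x h1 h2 h3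
      obtain ⟨k1, k2⟩ := mild_of_representative hf.measurable hU huτ h1
      exact ⟨k1, k2, by rw [h3, h2, integral_eq_duhamel huτ]⟩

end Existence

/-! ### Lipschitz bounds for the nonlinearity. -/

section Nonlinearity

variable {𝕜 : Type*} [RCLike 𝕜]

/-- Bernoulli's inequality for b ≥ 1; for b ≤ 1 simply s ≤ s^b. -/
theorem one_sub_rpow_le {b s : ℝ} (hb : 0 < b) (hs0 : 0 ≤ s) (hs1 : s ≤ 1) :
    1 - s ^ b ≤ (1 + b) * (1 - s) := by
  rcases le_total 1 b with h | h
  · have := one_add_mul_self_le_rpow_one_add (s := s - 1) (by linarith) h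
    rw [add_sub_cancel] at this
    nlinarith
  · have : s ^ (1 : ℝ) ≤ s ^ b := by
      rcases hs0.eq_or_lt with h0 | h0
      · rw [← h0, Real.zero_rpow one_ne_zero]; positivity
      · exact Real.rpow_le_rpow_of_exponent_ge h0 hs1 h
    rw [Real.rpow_one] at this
    nlinarith

theorem rpow_sub_rpow_mul_le {b x y : ℝ} (hb : 0 < b) (hy : 0 ≤ y) (hyx : y ≤ x) :
    (x ^ b - y ^ b) * y ≤ (1 + b) * x ^ b * (x - y) := by
  rcases hy.eq_or_lt with h0 | h0
  · rw [← h0, mul_zero]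
    have : 0 ≤ x := hy.trans hyx
    have : 0 ≤ x ^ b * (x - 0) := by rw [sub_zero]; positivity
    nlinarith
  have hx : 0 < x := h0.trans_le hyx
  have h1 := one_sub_rpow_le hb (div_nonneg hy hx.le) ((div_le_one hx).2 hyx)
  rw [Real.div_rpow hy hx.le] at h1
  have hxb : 0 < x ^ b := by positivity
  have h2 : x ^ b - y ^ b = x ^ b * (1 - y ^ b / x ^ b) := by field_simp
  have h3 : x * (1 - y / x) = x - y := by field_simp
  have h4 : 0 ≤ 1 - y / x := sub_nonneg.2 ((div_le_one hx).2 hyx)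
  calc (x ^ b - y ^ b) * y ≤ (x ^ b * ((1 + b) * (1 - y / x))) * y := by
        rw [h2]; gcongr
    _ ≤ (x ^ b * ((1 + b) * (1 - y / x))) * x := by gcongr
    _ = (1 + b) * x ^ b * (x * (1 - y / x)) := by ring
    _ = _ := by rw [h3]

/-- With |v| ≤ |u|, write the difference as |u|^b (u-v) + (|u|^b-|v|^b) v. The second term is
controlled by the scalar inequality, even for b < 1, because of the extra factor v. -/
theorem norm_power_sub_power_le {b : ℝ} (hb : 0 < b) (u v : 𝕜) :
    ‖(‖u‖ ^ b) • u - (‖v‖ ^ b) • v‖ ≤ (2 + b) * (‖u‖ ^ b + ‖v‖ ^ b) * ‖u - v‖ := by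
  wlog h : ‖v‖ ≤ ‖u‖ generalizing u v
  · have := this v u (le_of_not_ge h)
    rwa [norm_sub_rev, add_comm (‖v‖ ^ b), norm_sub_rev v u] at this
  have e : (‖u‖ ^ b) • u - (‖v‖ ^ b) • v = (‖u‖ ^ b) • (u - v) + (‖u‖ ^ b - ‖v‖ ^ b) • v := by
    rw [smul_sub, sub_smul]; abel
  have h1 := rpow_sub_rpow_mul_le hb (norm_nonneg v) h
  have h2 : ‖u‖ - ‖v‖ ≤ ‖u - v‖ := norm_sub_norm_le u v
  have h3 : 0 ≤ ‖u‖ ^ b := by positivity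
  have h4 : 0 ≤ ‖v‖ ^ b := by positivity
  have h5 : ‖v‖ ^ b ≤ ‖u‖ ^ b := by gcongr
  have h6 := norm_nonneg (u - v)
  rw [e]
  refine (norm_add_le _ _).trans ?_
  rw [norm_smul, norm_smul, Real.norm_of_nonneg h3, Real.norm_of_nonneg (sub_nonneg.2 h5)]
  have h7 : (1 + b) * ‖u‖ ^ b * (‖u‖ - ‖v‖) ≤ (1 + b) * ‖u‖ ^ b * ‖u - v‖ := by gcongr
  have h8 : 0 ≤ (2 + b) * ‖v‖ ^ b * ‖u - v‖ := by positivity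
  nlinarith

variable {ε₁ ε₂ b₁ b₂ : ℝ}

theorem norm_source_sub_le (hb₂ : 0 < b₂) (hb : b₂ < b₁) (hε₁ : |ε₁| = 1) (hε₂ : |ε₂| = 1)
    (u v : 𝕜) : ‖source ε₁ ε₂ b₁ b₂ u - source ε₁ ε₂ b₁ b₂ v‖ ≤
      (2 + b₁) * ((‖u‖ ^ b₁ + ‖v‖ ^ b₁) + (‖u‖ ^ b₂ + ‖v‖ ^ b₂)) * ‖u - v‖ := by
  have e : source ε₁ ε₂ b₁ b₂ u - source ε₁ ε₂ b₁ b₂ v =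
      ε₁ • ((‖u‖ ^ b₁) • u - (‖v‖ ^ b₁) • v) + ε₂ • ((‖u‖ ^ b₂) • u - (‖v‖ ^ b₂) • v) := by
    simp only [source, mul_smul, smul_sub]
    abel
  rw [e]
  refine (norm_add_le _ _).trans ?_
  rw [norm_smul, norm_smul, Real.norm_eq_abs, Real.norm_eq_abs, hε₁, hε₂, one_mul, one_mul]
  have h1 := norm_power_sub_power_le (hb₂.trans hb) u v
  have h2 := norm_power_sub_power_le hb₂ u v
  have h3 : (2 + b₂) * (‖u‖ ^ b₂ + ‖v‖ ^ b₂) * ‖u - v‖ ≤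
      (2 + b₁) * (‖u‖ ^ b₂ + ‖v‖ ^ b₂) * ‖u - v‖ := by gcongr
  linarith

theorem ofReal_norm_rpow {b : ℝ} (hb : 0 < b) (u : 𝕜) : ENNReal.ofReal (‖u‖ ^ b) = ‖u‖ₑ ^ b := by
  rw [← ofReal_norm, ENNReal.ofReal_rpow_of_nonneg (norm_nonneg _) hb.le]

/-- The local Lipschitz bound for the nonlinearity. -/
theorem enorm_source_sub_le (hb₂ : 0 < b₂) (hb : b₂ < b₁) (hε₁ : |ε₁| = 1) (hε₂ : |ε₂| = 1)
    (u v : 𝕜) : ‖source ε₁ ε₂ b₁ b₂ u - source ε₁ ε₂ b₁ b₂ v‖ₑ ≤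
      ENNReal.ofReal (2 + b₁) * ((‖u‖ₑ ^ b₁ + ‖v‖ₑ ^ b₁) + (‖u‖ₑ ^ b₂ + ‖v‖ₑ ^ b₂)) * ‖u - v‖ₑ := by
  have hb₁ := hb₂.trans hb
  rw [← ofReal_norm_rpow hb₁, ← ofReal_norm_rpow hb₁, ← ofReal_norm_rpow hb₂, ← ofReal_norm_rpow hb₂,
    ← ofReal_norm, ← ofReal_norm, ← ENNReal.ofReal_add (by positivity) (by positivity),
    ← ENNReal.ofReal_add (by positivity) (by positivity),
    ← ENNReal.ofReal_add (by positivity) (by positivity), ← ENNReal.ofReal_mul (by positivity),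
    ← ENNReal.ofReal_mul (by positivity)]
  exact ENNReal.ofReal_le_ofReal (norm_source_sub_le hb₂ hb hε₁ hε₂ u v)

/-- Compare with the threshold L: below it the constant dominates, above it the higher power does.
-/
theorem rpow_le_add_mul_rpow (hb₂ : 0 < b₂) (hb : b₂ < b₁) {L : ℝ} (hL : 0 < L) (x : ℝ≥0∞) :
    x ^ b₂ ≤ ENNReal.ofReal (L ^ b₂) + ENNReal.ofReal (L ^ (b₂ - b₁)) * x ^ b₁ := by
  rcases le_or_gt x (ENNReal.ofReal L) with h | h
  · rw [← ENNReal.ofReal_rpow_of_pos hL]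
    exact le_add_right (ENNReal.rpow_le_rpow h hb₂.le)
  · refine le_add_left ?_
    rcases eq_or_ne x ∞ with ht | ht
    · rw [ht, ENNReal.top_rpow_of_pos (hb₂.trans hb), ENNReal.mul_top]
      · exact le_top
      · simp only [ne_eq, ENNReal.ofReal_eq_zero, not_le]; positivity
    have h0 : x ≠ 0 := (lt_of_le_of_lt zero_le h).ne'
    have e : x ^ b₂ = x ^ (b₂ - b₁) * x ^ b₁ := by rw [← ENNReal.rpow_add _ _ h0 ht]; simp
    rw [e, ← ENNReal.ofReal_rpow_of_pos hL]
    gcongr ?_ * _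
    rw [← neg_sub b₁ b₂, ENNReal.rpow_neg, ENNReal.rpow_neg]
    exact ENNReal.inv_le_inv.2 (ENNReal.rpow_le_rpow h.le (by linarith))

/-- The lower power is absorbed into a small constant and a multiple of the higher power, so a
single exponent governs existence. -/
theorem isPowerSource_source (hb₂ : 0 < b₂) (hb : b₂ < b₁) (hε₁ : |ε₁| = 1) (hε₂ : |ε₂| = 1) :
    IsPowerSource b₁ (source (𝕜 := 𝕜) ε₁ ε₂ b₁ b₂) := by
  have hb₁ := hb₂.trans hb
  refine ⟨?_, ?_, fun ε hε => ?_⟩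
  · unfold source
    exact ((measurable_const.mul (measurable_norm.pow_const b₁)).smul measurable_id).add
      ((measurable_const.mul (measurable_norm.pow_const b₂)).smul measurable_id)
  · simp [source]
  · set c : ℝ := 2 + b₁ with hc
    have hc0 : 0 < c := by positivity
    have hεr : (0 : ℝ) < ε := hε
    -- The threshold at which the contributions of u and v to the constant add up to ε.
    set L : ℝ := ((ε : ℝ) / (2 * c)) ^ (1 / b₂) with hL
    have hL0 : 0 < L := by positivity
    have hLb : L ^ b₂ = ε / (2 * c) := by
      rw [hL, ← Real.rpow_mul (by positivity), one_div_mul_cancel hb₂.ne', Real.rpow_one]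
    set D : ℝ := L ^ (b₂ - b₁) with hD
    refine ⟨(c * (1 + D)).toNNReal, fun u v => ?_⟩
    refine (enorm_source_sub_le hb₂ hb hε₁ hε₂ u v).trans ?_
    gcongr
    have h1 := rpow_le_add_mul_rpow hb₂ hb hL0 ‖u‖ₑ
    have h2 := rpow_le_add_mul_rpow hb₂ hb hL0 ‖v‖ₑ
    have e1 : ENNReal.ofReal c * (ENNReal.ofReal (L ^ b₂) + ENNReal.ofReal (L ^ b₂)) = ε := by
      rw [← ENNReal.ofReal_add (by positivity) (by positivity), ← ENNReal.ofReal_mul hc0.le, hLb,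
        show c * (ε / (2 * c) + ε / (2 * c)) = ε by field_simp; ring, ENNReal.ofReal_coe_nnreal]
    have e2 : ((c * (1 + D)).toNNReal : ℝ≥0∞) = ENNReal.ofReal c * (1 + ENNReal.ofReal D) := by
      change ENNReal.ofReal (c * (1 + D)) = _
      rw [ENNReal.ofReal_mul hc0.le, ENNReal.ofReal_add zero_le_one (by positivity),
        ENNReal.ofReal_one]
    calc _ ≤ ENNReal.ofReal c * ((‖u‖ₑ ^ b₁ + ‖v‖ₑ ^ b₁) +
          ((ENNReal.ofReal (L ^ b₂) + ENNReal.ofReal D * ‖u‖ₑ ^ b₁) +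
            (ENNReal.ofReal (L ^ b₂) + ENNReal.ofReal D * ‖v‖ₑ ^ b₁))) := by gcongr
      _ = ENNReal.ofReal c * (ENNReal.ofReal (L ^ b₂) + ENNReal.ofReal (L ^ b₂)) +
          ENNReal.ofReal c * (1 + ENNReal.ofReal D) * (‖u‖ₑ ^ b₁ + ‖v‖ₑ ^ b₁) := by ring
      _ = _ := by rw [e1, e2]

end Nonlinearity

/-! ### Choice of the auxiliary exponent, and local existence. -/

section LocalExistence

variable {n : ℕ} {α : ℝ} {𝕜 : Type*} [RCLike 𝕜] {b r p : ℝ} {q : ℝ≥0∞} {f : 𝕜 → 𝕜}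

/-- Any s just below r(b+1) works: the last condition is the lower bound s > s₁, and s₁ < r(b+1)
amounts to m(1/r-1/p) < 1, which admissibility provides. -/
theorem exists_weighted_exponent (hα : 0 < α) (hn : 0 < n) (hb : 0 < b)
    (hbr : n / (2 * α) * b ≤ r) (hadm : IsAdmissible n α q p r) :
    ∃ s, IsWeightedExponent n α b r s ∧ n / (2 * α) * ((b + 1) / s - 1 / p) < 1 := by
  have hr := hadm.one_lt
  have hr0 : 0 < r := by linarith
  have hp0 : 0 < p := by linarith [hadm.le]
  have hn' : (0 : ℝ) < n := by exact_mod_cast hn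
  have hlt := hadm.scaling_lt hα
  set m : ℝ := n / (2 * α) with hm
  have hm0 : 0 < m := by positivity
  have h1 : m * (1 / r - 1 / p) < 1 := hlt.trans (by rw [div_lt_one hr0]; exact hr)
  have h2 : 1 / r < 1 / p + 1 / m := by
    have : 1 / r - 1 / p < 1 / m := by rw [lt_div_iff₀ hm0]; linarith
    linarith
  set s₁ := (b + 1) / (1 / p + 1 / m) with hs₁
  have hs₁r : s₁ < r * (b + 1) := by
    rw [hs₁, div_lt_iff₀ (by positivity)]
    have : 1 = r * (1 / r) := by field_simp
    have h3 : r * (1 / r) < r * (1 / p + 1 / m) := by gcongr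
    nlinarith
  obtain ⟨s, hs, hs'⟩ := exists_between (show max (max r (b + 1)) s₁ < r * (b + 1) from
    max_lt (max_lt (by nlinarith) (by nlinarith)) hs₁r)
  have hsr : r < s := ((le_max_left _ _).trans (le_max_left _ _)).trans_lt hs
  have hsb : b + 1 < s := ((le_max_right _ _).trans (le_max_left _ _)).trans_lt hs
  have hss₁ : s₁ < s := (le_max_right _ _).trans_lt hs
  have hs0 : 0 < s := by linarith
  refine ⟨s, ⟨hα, hn, hb, hsb.le, hr, hbr, hsr, hs'⟩, ?_⟩
  rw [hs₁, div_lt_iff₀ (by positivity)] at hss₁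
  have h4 : (b + 1) / s < 1 / p + 1 / m := by
    rw [div_lt_iff₀ hs0]; linarith
  calc m * ((b + 1) / s - 1 / p) < m * (1 / m) := by gcongr; linarith
    _ = 1 := by field_simp

variable [Fact (1 ≤ ENNReal.ofReal r)]

/-- Local existence for arbitrary data. -/
theorem exists_local_solution (hα : 0 < α) (hn : 0 < n) (hb : 0 < b)
    (hbr : n / (2 * α) * b ≤ r) (hadm : IsAdmissible n α q p r) (hf : IsPowerSource b f)
    (φ : LSpace 𝕜 n r) : ∃ T : ℝ, 0 < T ∧ ∃ u, IsSolutionX α q p f φ (ENNReal.ofReal T) u := by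
  obtain ⟨s, he, hsp⟩ := exists_weighted_exponent hα hn hb hbr hadm
  obtain ⟨c, hc0, hc⟩ := exists_solutionX (𝕜 := 𝕜) he hf hadm hsp 1
  have hr0 : 0 < r := by linarith [he.one_lt]
  have h1 := tendsto_lnorm_heatMaj hα hn he.one_lt.le he.lt (measurable_LSpace φ).enorm
    (lnorm_LSpace_ne_top hr0 φ)
  -- The size A is fixed by the smallness threshold alone, and T is then found from t^γ‖S(t)φ‖_s →
  -- 0. For T ≤ 1 the factor T^δ, δ ≥ 0, is harmless.
  obtain ⟨A, hA0, hAt, hAc⟩ : ∃ A : ℝ≥0∞, 0 < A ∧ A ≠ ∞ ∧ A ^ b ≤ c := by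
    obtain ⟨c', hc', hcc⟩ := ENNReal.lt_iff_exists_nnreal_btwn.1 hc0
    refine ⟨(c' : ℝ≥0∞) ^ (1 / b), ?_, by finiteness, ?_⟩
    · exact ENNReal.rpow_pos (by simpa using hc') ENNReal.coe_ne_top
    · rw [← ENNReal.rpow_mul, one_div_mul_cancel hb.ne', ENNReal.rpow_one]
      exact hcc.le
  obtain ⟨d, hd, hd'⟩ := mem_nhdsGT_iff_exists_Ioo_subset.1
    ((ENNReal.tendsto_nhds_zero.1 h1) A hA0)
  have hd0 : 0 < d := hd
  refine ⟨min d 1, lt_min hd0 one_pos, hc _ (lt_min hd0 one_pos) (min_le_right _ _) φ A hAt ?_ ?_⟩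
  · intro t ht
    have ht0 := ht.1
    have h' : ENNReal.ofReal (t ^ (n / (2 * α) * (1 / r - 1 / s))) *
        lnorm s volume (heatMaj n α t fun y => ‖φ y‖ₑ) ≤ A :=
      hd' ⟨ht.1, ht.2.trans_le (min_le_left _ _)⟩
    calc _ = ENNReal.ofReal (t ^ (-(n / (2 * α) * (1 / r - 1 / s)))) *
          (ENNReal.ofReal (t ^ (n / (2 * α) * (1 / r - 1 / s))) *
            lnorm s volume (heatMaj n α t fun y => ‖φ y‖ₑ)) := by
          rw [← mul_assoc, ← ENNReal.ofReal_mul (by positivity), ← Real.rpow_add ht0]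
          simp
      _ ≤ _ := by gcongr
  · refine le_trans (mul_le_of_le_one_left zero_le ?_) hAc
    rw [ENNReal.ofReal_le_one]
    refine Real.rpow_le_one (by positivity) (min_le_right _ _) ?_
    rw [sub_nonneg, div_le_one hr0]
    exact hbr

/-- Local existence with a lower bound for the existence time in terms of the norm of the data. -/
theorem exists_solution_of_norm_le (hα : 0 < α) (hn : 0 < n) (hb : 0 < b)
    (hbr : n / (2 * α) * b ≤ r) (hadm : IsAdmissible n α q p r) (hf : IsPowerSource b f) (T₀ : ℝ) :
    ∃ c : ℝ, 0 < c ∧ ∀ T : ℝ, 0 < T → T ≤ T₀ → ∀ φ : LSpace 𝕜 n r,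
      T ^ (1 - n / (2 * α) * b / r) * ‖φ‖ ^ b ≤ c →
      ∃ u, IsSolutionX α q p f φ (ENNReal.ofReal T) u := by
  obtain ⟨s, he, hsp⟩ := exists_weighted_exponent hα hn hb hbr hadm
  obtain ⟨c, hc0, hc⟩ := exists_solutionX (𝕜 := 𝕜) he hf hadm hsp T₀
  have hr0 : 0 < r := by linarith [he.one_lt]
  obtain ⟨C, hC⟩ := exists_lnorm_heatMaj_le (n := n) hα hn he.one_lt.le he.lt.le
  obtain ⟨c', hc', hcc⟩ := ENNReal.lt_iff_exists_nnreal_btwn.1 hc0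
  have hc'0 : 0 < c' := by simpa using hc'
  -- Here A = C‖φ‖, so the smoothing constant, raised to the power b, is divided out of the
  -- threshold.
  refine ⟨(c' / (C ^ b + 1) : ℝ≥0), by positivity, fun T hT hTT φ hφ => ?_⟩
  refine hc T hT hTT φ (C * ‖φ‖ₑ) (by finiteness) (fun t ht => ?_) ?_
  · refine (hC t ht.1 _ (measurable_LSpace φ).enorm).trans (le_of_eq ?_)
    rw [enorm_LSpace hr0]
    ring
  · rw [ENNReal.mul_rpow_of_nonneg _ _ hb.le, ← ofReal_norm,
      ENNReal.ofReal_rpow_of_nonneg (norm_nonneg _) hb.le, mul_left_comm,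
      ← ENNReal.ofReal_mul (by positivity)]
    refine le_trans ?_ hcc.le
    calc (C : ℝ≥0∞) ^ b * ENNReal.ofReal (T ^ (1 - n / (2 * α) * b / r) * ‖φ‖ ^ b)
        ≤ (C : ℝ≥0∞) ^ b * ENNReal.ofReal ((c' / (C ^ b + 1) : ℝ≥0) : ℝ) := by gcongr
      _ = ((C ^ b * (c' / (C ^ b + 1)) : ℝ≥0) : ℝ≥0∞) := by
          rw [ENNReal.ofReal_coe_nnreal, ENNReal.coe_mul, ENNReal.coe_rpow_of_nonneg _ hb.le]
      _ ≤ c' := by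
          rw [ENNReal.coe_le_coe, mul_div_left_comm]
          refine mul_le_of_le_one_right zero_le ?_
          rw [div_le_one (by positivity)]
          exact le_add_of_nonneg_right zero_le_one

end LocalExistence

/-! ### Weak spaces and singular integrals at the critical exponent. -/

section RealInterpolation

variable {X : Type*} [MeasurableSpace X] {μ : Measure X}

/-- The function `w` has norm at most `N` in the real interpolation space
`(L^{s₁}, L^{s₂})_{1/2, ∞}`, a weak Lebesgue space. -/
def WeakBound (μ : Measure X) (s₁ s₂ : ℝ) (N : ℝ≥0∞) (w : X → ℝ≥0∞) : Prop :=
  ∀ l : ℝ, 0 < l → ∃ w₁ w₂ : X → ℝ≥0∞, Measurable w₁ ∧ Measurable w₂ ∧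
    (∀ᵐ x ∂μ, w x ≤ w₁ x + w₂ x) ∧
    lnorm s₁ μ w₁ ≤ N * ENNReal.ofReal l ∧ lnorm s₂ μ w₂ ≤ N * ENNReal.ofReal l⁻¹

theorem weakBound_of_lnorm_le {r d s₁ s₂ : ℝ} (hr : 0 < r) (hd : 0 < d) (hs₁ : 1 / s₁ = 1 / r + d)
    (hs₂ : 1 / s₂ = 1 / r - d) (hdr : d < 1 / r) {w : X → ℝ≥0∞} (hw : Measurable w) {M : ℝ≥0∞}
    (hM : lnorm r μ w ≤ M) : WeakBound μ s₁ s₂ (M ^ (r / s₁) + M ^ (r / s₂)) w := by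
  intro l hl
  have h₁ : 0 < s₁ := one_div_pos.1 (hs₁ ▸ by positivity)
  have h₂ : 0 < s₂ := one_div_pos.1 (hs₂ ▸ by linarith)
  have hs₁r : s₁ ≤ r := (one_div_le_one_div hr h₁).1 (by linarith)
  have hrs₂ : r ≤ s₂ := (one_div_le_one_div h₂ hr).1 (by linarith)
  -- The height at which truncation has the norms l and 1/l in the two endpoint spaces, up to powers
  -- of M; one height serves both since 1/r is the midpoint of 1/s₁ and 1/s₂.
  set L : ℝ := l ^ (-(1 / (r * d))) with hL
  have hL0 : 0 < L := by positivity
  have e₁ : L ^ (1 - r / s₁) = l := by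
    rw [hL, ← Real.rpow_mul hl.le, div_eq_mul_one_div r s₁, hs₁,
      show -(1 / (r * d)) * (1 - r * (1 / r + d)) = 1 by field_simp; ring, Real.rpow_one]
  have e₂ : L ^ (1 - r / s₂) = l⁻¹ := by
    rw [hL, ← Real.rpow_mul hl.le, div_eq_mul_one_div r s₂, hs₂,
      show -(1 / (r * d)) * (1 - r * (1 / r - d)) = -1 by field_simp; ring, Real.rpow_neg_one]
  refine ⟨_, _, hw.indicator (measurableSet_lt measurable_const hw),
    hw.indicator (measurableSet_le hw measurable_const),
    ae_of_all _ fun x => (indicator_lt_add_indicator_ge L w x).ge, ?_, ?_⟩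
  · refine (lnorm_indicator_lt_le h₁ hs₁r hL0 w).trans ?_
    rw [e₁, mul_comm]
    gcongr
    exact le_trans (by gcongr) le_self_add
  · refine (lnorm_indicator_ge_le hr hrs₂ hL0 w).trans ?_
    rw [e₂, mul_comm]
    gcongr
    exact le_trans (by gcongr) le_add_self

/-- Only the level l = 1 is used: w is dominated by pairs whose norms are summable in k, hence by
pairs tending to zero almost everywhere. -/
theorem WeakBound.ae_eq_zero [SigmaFinite μ] {s₁ s₂ : ℝ} (hs₁ : 1 ≤ s₁) (hs₂ : 1 ≤ s₂) {w : X → ℝ≥0∞}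
    {N : ℝ≥0∞} (hN : N ≠ ∞) (h : ∀ k : ℕ, WeakBound μ s₁ s₂ (N * 2⁻¹ ^ k) w) :
    ∀ᵐ x ∂μ, w x = 0 := by
  choose w₁ w₂ hw₁ hw₂ hle h₁ h₂ using fun k => h k 1 one_pos
  have hsum : ∑' k : ℕ, N * (2⁻¹ : ℝ≥0∞) ^ k ≠ ∞ := by
    rw [ENNReal.tsum_mul_left, ENNReal.tsum_geometric]
    refine ENNReal.mul_ne_top hN ?_
    simp
  have key : ∀ {s : ℝ} (_ : 1 ≤ s) {v : ℕ → X → ℝ≥0∞} (_ : ∀ k, Measurable (v k))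
      (_ : ∀ k, lnorm s μ (v k) ≤ N * 2⁻¹ ^ k), ∀ᵐ x ∂μ, Tendsto (fun k => v k x) atTop (𝓝 0) := by
    intro s hs v hv hvN
    filter_upwards [ae_tsum_lt_top hs hv (ne_top_of_le_ne_top hsum (ENNReal.tsum_le_tsum hvN))]
      with x hx
    exact ENNReal.tendsto_atTop_zero_of_tsum_ne_top hx.ne
  filter_upwards [key hs₁ hw₁ (fun k => by simpa using h₁ k), key hs₂ hw₂ (fun k => by simpa using h₂ k),
    ae_all_iff.2 hle] with x a₁ a₂ hx
  have := ge_of_tendsto' (a₁.add a₂) hx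
  simpa using this

/-- Integration of a family of functions whose norms in `L^{s₁}` and `L^{s₂}` have reciprocal
growth. -/
theorem weakBound_lintegral [SigmaFinite μ] {s₁ s₂ k : ℝ} (hs₁ : 1 ≤ s₁) (hs₂ : 1 ≤ s₂) (hk : 0 < k)
    {F : ℝ → X → ℝ≥0∞} (hF : Measurable (Function.uncurry F)) {M : ℝ≥0∞}
    (h₁ : ∀ σ, 0 < σ → lnorm s₁ μ (F σ) ≤ M * ENNReal.ofReal (σ ^ (-1 + k)))
    (h₂ : ∀ σ, 0 < σ → lnorm s₂ μ (F σ) ≤ M * ENNReal.ofReal (σ ^ (-1 - k))) {w : X → ℝ≥0∞}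
    (hw : ∀ᵐ x ∂μ, w x ≤ ∫⁻ σ in Ioi 0, F σ x) :
    WeakBound μ s₁ s₂ (M * ENNReal.ofReal k⁻¹) w := by
  intro l hl
  -- Cutting the σ-integral at δ = l^{1/k} makes the two pieces of sizes l and 1/l.
  set δ : ℝ := l ^ (1 / k) with hδ
  have hδ0 : 0 < δ := by positivity
  have hδk : δ ^ k = l := by rw [hδ, ← Real.rpow_mul hl.le, one_div_mul_cancel hk.ne', Real.rpow_one]
  have hm : ∀ ν : Measure ℝ, SFinite ν → Measurable fun x => ∫⁻ σ, F σ x ∂ν := fun ν _ =>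
    Measurable.lintegral_prod_left' hF
  have hF' : Measurable (Function.uncurry fun x σ => F σ x) := hF.comp measurable_swap
  refine ⟨fun x => ∫⁻ σ in Ioo 0 δ, F σ x, fun x => ∫⁻ σ in Ici δ, F σ x, hm _ inferInstance,
    hm _ inferInstance, ?_, ?_, ?_⟩
  · filter_upwards [hw] with x hx
    refine hx.trans ?_
    rw [← Ioo_union_Ici_eq_Ioi hδ0]
    exact lintegral_union_le _ _ _
  · refine (lnorm_lintegral_le hs₁ hF').trans ?_
    refine (setLIntegral_mono (by fun_prop) fun σ hσ => h₁ σ hσ.1).trans ?_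
    rw [lintegral_const_mul _ (by fun_prop), lintegral_Ioo_rpow hk hδ0, hδk, mul_assoc,
      ← ENNReal.ofReal_mul (by positivity), div_eq_inv_mul]
  · refine (lnorm_lintegral_le hs₂ hF').trans ?_
    refine (setLIntegral_mono (s := Ici δ) (by fun_prop) fun σ hσ => h₂ σ (hδ0.trans_le (mem_Ici.1 hσ))).trans ?_
    rw [setLIntegral_congr Ioi_ae_eq_Ici.symm]
    rw [lintegral_const_mul _ (by fun_prop), lintegral_Ioi_rpow hk hδ0, Real.rpow_neg hδ0.le, hδk,
      mul_assoc, ← ENNReal.ofReal_mul (by positivity), div_eq_inv_mul]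

/-- A singular integral operator `∫ B_σ dσ`, in which `B_σ` has norm `E σ^{-1 - m(1/s - 1/s')}` from
`L^s` to `L^{s'}`, on the weak space. -/
theorem WeakBound.lintegral [SigmaFinite μ] {s₁ s₂ k : ℝ} (hs₁ : 1 ≤ s₁) (hs₂ : 1 ≤ s₂) (hk : 0 < k)
    {B : ℝ → (X → ℝ≥0∞) → X → ℝ≥0∞} {v : ℝ → X → ℝ≥0∞} {E N : ℝ≥0∞}
    (hB : Measurable fun z : ℝ × X => B z.1 (v z.1) z.2)
    (hBm : ∀ σ g, Measurable g → Measurable (B σ g))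
    (hBle : ∀ σ g g₁ g₂, Measurable g₁ → Measurable g₂ → (∀ᵐ x ∂μ, g x ≤ g₁ x + g₂ x) →
      ∀ x, B σ g x ≤ B σ g₁ x + B σ g₂ x)
    (h₁₁ : ∀ σ g, 0 < σ → Measurable g →
      lnorm s₁ μ (B σ g) ≤ E * ENNReal.ofReal (σ ^ (-1 : ℝ)) * lnorm s₁ μ g)
    (h₁₂ : ∀ σ g, 0 < σ → Measurable g →
      lnorm s₂ μ (B σ g) ≤ E * ENNReal.ofReal (σ ^ (-1 - 2 * k)) * lnorm s₁ μ g)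
    (h₂₁ : ∀ σ g, 0 < σ → Measurable g →
      lnorm s₁ μ (B σ g) ≤ E * ENNReal.ofReal (σ ^ (-1 + 2 * k)) * lnorm s₂ μ g)
    (h₂₂ : ∀ σ g, 0 < σ → Measurable g →
      lnorm s₂ μ (B σ g) ≤ E * ENNReal.ofReal (σ ^ (-1 : ℝ)) * lnorm s₂ μ g)
    (hv : ∀ σ, 0 < σ → WeakBound μ s₁ s₂ N (v σ)) {w : X → ℝ≥0∞}
    (hw : ∀ᵐ x ∂μ, w x ≤ ∫⁻ σ in Ioi 0, B σ (v σ) x) :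
    WeakBound μ s₁ s₂ (2 * E * N * ENNReal.ofReal k⁻¹) w := by
  refine weakBound_lintegral hs₁ hs₂ hk (F := fun σ => B σ (v σ)) hB (fun σ hσ => ?_)
    (fun σ hσ => ?_) hw
  all_goals
    -- Decomposing at the level σ^k balances the two input spaces: both give σ^{-1+k} in L^{s₁} and
    -- σ^{-1-k} in L^{s₂}, in place of the non-integrable σ^{-1}.
    obtain ⟨g₁, g₂, hg₁, hg₂, hle, hn₁, hn₂⟩ := hv σ hσ (σ ^ k) (by positivity)
    rw [← Real.rpow_neg hσ.le] at hn₂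
  · refine (lnorm_mono (by linarith) (hBle σ _ g₁ g₂ hg₁ hg₂ hle)).trans
      ((lnorm_add_le hs₁ (hBm σ _ hg₁).aemeasurable (hBm σ _ hg₂).aemeasurable).trans ?_)
    refine (add_le_add ((h₁₁ σ _ hσ hg₁).trans (mul_le_mul_right hn₁ _))
      ((h₂₁ σ _ hσ hg₂).trans (mul_le_mul_right hn₂ _))).trans (le_of_eq ?_)
    rw [mul_mul_mul_comm, mul_mul_mul_comm E _ N, ← ENNReal.ofReal_mul (by positivity),
      ← ENNReal.ofReal_mul (by positivity), ← Real.rpow_add hσ, ← Real.rpow_add hσ,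
      show -1 + 2 * k + -k = -1 + k by ring]
    ring
  · refine (lnorm_mono (by linarith) (hBle σ _ g₁ g₂ hg₁ hg₂ hle)).trans
      ((lnorm_add_le hs₂ (hBm σ _ hg₁).aemeasurable (hBm σ _ hg₂).aemeasurable).trans ?_)
    refine (add_le_add ((h₁₂ σ _ hσ hg₁).trans (mul_le_mul_right hn₁ _))
      ((h₂₂ σ _ hσ hg₂).trans (mul_le_mul_right hn₂ _))).trans (le_of_eq ?_)
    rw [mul_mul_mul_comm, mul_mul_mul_comm E _ N, ← ENNReal.ofReal_mul (by positivity),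
      ← ENNReal.ofReal_mul (by positivity), ← Real.rpow_add hσ, ← Real.rpow_add hσ,
      show -1 - 2 * k + k = -1 - k by ring, show -1 + -k = -1 - k by ring]
    ring

/-- Two exponents around r, close enough for multiplication by a potential in L^{r/b} to keep both
of them within L^1; there is room because r > b + 1. -/
theorem exists_exponent_gap {r b c : ℝ} (hb : 0 < b) (hbr : b + 1 < r) (hc : 0 < c) :
    ∃ d s₁ s₂ : ℝ, 0 < d ∧ d < 1 / r ∧ 1 / s₁ = 1 / r + d ∧ 1 / s₂ = 1 / r - d ∧
      1 / s₁ + b / r ≤ 1 ∧ 2 * d ≤ c := by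
  have hr : 0 < r := by linarith
  have h1 : 0 < 1 - (b + 1) / r := by rw [sub_pos, div_lt_one hr]; exact hbr
  have h2 : 0 < 1 / r := by positivity
  have h3 : (b + 1) / r = b / r + 1 / r := add_div _ _ _
  obtain ⟨d, hd0, hd⟩ := exists_between
    (show 0 < min (1 / r) (min (1 - (b + 1) / r) (c / 2)) by positivity)
  obtain ⟨a1, a2⟩ := lt_min_iff.1 hd
  obtain ⟨a2, a3⟩ := lt_min_iff.1 a2
  exact ⟨d, 1 / (1 / r + d), 1 / (1 / r - d), hd0, a1, one_div_one_div _, one_div_one_div _,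
    by rw [one_div_one_div]; linarith, by linarith⟩

end RealInterpolation

/-! ### Uniqueness for a critical Volterra inequality in time. -/

section FractionalIntegral

variable {b Q : ℝ}

theorem lnorm_indicator_Ioo {c ρ : ℝ} (hc : 0 < c) (hρ : 0 < ρ) :
    lnorm c volume ((Ioo 0 ρ).indicator fun _ : ℝ => 1) = ENNReal.ofReal (ρ ^ (1 / c)) := by
  unfold lnorm
  have : ∀ x : ℝ, ((Ioo 0 ρ).indicator (fun _ : ℝ => (1 : ℝ≥0∞)) x) ^ c =
      (Ioo 0 ρ).indicator (fun _ => 1) x := by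
    intro x
    by_cases h : x ∈ Ioo 0 ρ <;> simp [h, hc]
  simp_rw [this]
  rw [lintegral_indicator measurableSet_Ioo, setLIntegral_one, Real.volume_Ioo, sub_zero,
    ENNReal.ofReal_rpow_of_nonneg hρ.le (by positivity)]

/-- Convolution on the line, restricted to the range `(0, ρ)`, after multiplication by `k`. -/
noncomputable def windowConv (a : ℝ) (k : ℝ → ℝ≥0∞) (ρ : ℝ) (g : ℝ → ℝ≥0∞) (t : ℝ) : ℝ≥0∞ :=
  ENNReal.ofReal (a * ρ ^ (-1 - a)) *
    ∫⁻ τ, (Ioo 0 ρ).indicator (fun _ => 1) (t - τ) * (k τ * g τ)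

theorem measurable_windowConv_uncurry (a : ℝ) {k g : ℝ → ℝ≥0∞} (hk : Measurable k)
    (hg : Measurable g) : Measurable fun z : ℝ × ℝ => windowConv a k z.1 g z.2 := by
  refine (by fun_prop : Measurable fun z : ℝ × ℝ => ENNReal.ofReal (a * z.1 ^ (-1 - a))).mul ?_
  have h1 : Measurable fun z : (ℝ × ℝ) × ℝ =>
      (Ioo 0 z.1.1).indicator (fun _ : ℝ => (1 : ℝ≥0∞)) (z.1.2 - z.2) := by
    have hs : MeasurableSet ({z : (ℝ × ℝ) × ℝ | 0 < z.1.2 - z.2} ∩ {z | z.1.2 - z.2 < z.1.1}) :=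
      (measurableSet_lt (by fun_prop) (by fun_prop)).inter
        (measurableSet_lt (by fun_prop) (by fun_prop))
    exact measurable_const.indicator hs
  have h2 : Measurable fun z : (ℝ × ℝ) × ℝ => k z.2 * g z.2 :=
    (hk.comp measurable_snd).mul (hg.comp measurable_snd)
  exact Measurable.lintegral_prod_right' (h1.mul h2)

/-- Hölder puts k g into L^e with 1/e = 1/s + b/Q, and Young's inequality with the indicator of
(0,ρ) does the rest. -/
theorem lnorm_windowConv_le (hb : 0 < b) (hQ : 0 < Q) {s s' : ℝ} (hs : 0 < s) (hs' : 1 ≤ s')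
    (h : 1 / s + b / Q ≤ 1) (h' : 1 / s' ≤ 1 / s + b / Q) {k g : ℝ → ℝ≥0∞} (hk : Measurable k)
    (hg : Measurable g) {ρ : ℝ} (hρ : 0 < ρ) :
    lnorm s' volume (windowConv (1 - b / Q) k ρ g) ≤ lnorm (Q / b) volume k *
      ENNReal.ofReal (ρ ^ (-1 - (1 / s - 1 / s'))) * lnorm s volume g := by
  have hs'0 : 0 < 1 / s' := one_div_pos.2 (by linarith)
  have hs0 : 0 < 1 / s := one_div_pos.2 hs
  have hbQ : 0 < b / Q := by positivity
  set c : ℝ := 1 / (1 + 1 / s' - (1 / s + b / Q)) with hc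
  have hc1 : 1 ≤ c := by
    rw [hc, le_div_iff₀ (by linarith)]
    linarith
  set e : ℝ := 1 / (1 / s + b / Q) with he
  have he1 : 1 ≤ e := by
    rw [he, le_div_iff₀ (by positivity)]
    linarith
  have hind : Measurable ((Ioo 0 ρ).indicator fun _ : ℝ => (1 : ℝ≥0∞)) :=
    measurable_const.indicator measurableSet_Ioo
  have h1 := lnorm_conv_le (E := ℝ) (p := s') hc1 he1 (by linarith) (f := (Ioo 0 ρ).indicator fun _ : ℝ => (1 : ℝ≥0∞))
    (g := fun τ => k τ * g τ) (by rw [hc, he, one_div_one_div, one_div_one_div]; ring) hind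
    (hk.mul hg)
  rw [lnorm_indicator_Ioo (by linarith) hρ] at h1
  have h2 : lnorm e volume (fun τ => k τ * g τ) ≤ lnorm (Q / b) volume k * lnorm s volume g :=
    lnorm_mul_le (by positivity) hs (by rw [he, one_div_one_div, one_div_div]; ring) hk.aemeasurable
      hg.aemeasurable
  unfold windowConv
  rw [lnorm_const_mul (by linarith) ENNReal.ofReal_ne_top]
  calc _ ≤ ENNReal.ofReal (1 * ρ ^ (-1 - (1 - b / Q))) * (ENNReal.ofReal (ρ ^ (1 / c)) *
        (lnorm (Q / b) volume k * lnorm s volume g)) := by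
        gcongr
        · linarith
        · exact h1.trans (by gcongr)
    _ = _ := by
        rw [one_mul, ← mul_assoc, ← ENNReal.ofReal_mul (by positivity), ← Real.rpow_add hρ, hc,
          one_div_one_div, show -1 - (1 - b / Q) + (1 + 1 / s' - (1 / s + b / Q)) =
            -1 - (1 / s - 1 / s') by ring]
        ring

/-- Layer-cake formula: (t-τ)^{-a} is the integral of a ρ^{-1-a} over ρ > t-τ. It presents the
fractional integral as a superposition of operators with power bounds. -/
theorem lintegral_windowConv {a : ℝ} (ha : 0 < a) {k g : ℝ → ℝ≥0∞} (hk : Measurable k)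
    (hg : Measurable g) (t : ℝ) : ∫⁻ ρ in Ioi 0, windowConv a k ρ g t =
      ∫⁻ τ in Iio t, ENNReal.ofReal ((t - τ) ^ (-a)) * (k τ * g τ) := by
  unfold windowConv
  have h1 : Measurable fun z : ℝ × ℝ => (Ioo 0 z.1).indicator (fun _ : ℝ => (1 : ℝ≥0∞)) (t - z.2) := by
    have hs : MeasurableSet ({z : ℝ × ℝ | 0 < t - z.2} ∩ {z | t - z.2 < z.1}) :=
      (measurableSet_lt (by fun_prop) (by fun_prop)).inter
        (measurableSet_lt (by fun_prop) (by fun_prop))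
    exact measurable_const.indicator hs
  have h2 : Measurable fun z : ℝ × ℝ => k z.2 * g z.2 :=
    (hk.comp measurable_snd).mul (hg.comp measurable_snd)
  have h3 : Measurable fun z : ℝ × ℝ => ENNReal.ofReal (a * z.1 ^ (-1 - a)) := by fun_prop
  calc _ = ∫⁻ ρ in Ioi 0, ∫⁻ τ, ENNReal.ofReal (a * ρ ^ (-1 - a)) *
        ((Ioo 0 ρ).indicator (fun _ => 1) (t - τ) * (k τ * g τ)) := by
        refine lintegral_congr fun ρ => ?_
        rw [lintegral_const_mul]
        exact (h1.mul h2).comp measurable_prodMk_left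
    _ = ∫⁻ τ, ∫⁻ ρ in Ioi 0, ENNReal.ofReal (a * ρ ^ (-1 - a)) *
        ((Ioo 0 ρ).indicator (fun _ => 1) (t - τ) * (k τ * g τ)) :=
        lintegral_lintegral_swap (h3.mul (h1.mul h2)).aemeasurable
    _ = ∫⁻ τ, (Iio t).indicator (fun τ => ENNReal.ofReal ((t - τ) ^ (-a)) * (k τ * g τ)) τ := by
        refine lintegral_congr fun τ => ?_
        by_cases hτ : τ < t
        · rw [indicator_of_mem (show τ ∈ Iio t from hτ)]
          have hpos : 0 < t - τ := sub_pos.2 hτ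
          have e : ∀ ρ, ENNReal.ofReal (a * ρ ^ (-1 - a)) *
              ((Ioo 0 ρ).indicator (fun _ => 1) (t - τ) * (k τ * g τ)) = (Ioi (t - τ)).indicator
                (fun ρ => ENNReal.ofReal (ρ ^ (-1 - a))) ρ * (ENNReal.ofReal a * (k τ * g τ)) := by
            intro ρ
            rw [ENNReal.ofReal_mul ha.le]
            by_cases h : t - τ < ρ
            · rw [indicator_of_mem (show t - τ ∈ Ioo 0 ρ from ⟨hpos, h⟩),
                indicator_of_mem (show ρ ∈ Ioi (t - τ) from h)]
              ring
            · rw [indicator_of_notMem (show t - τ ∉ Ioo 0 ρ from fun h' => h h'.2),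
                indicator_of_notMem (show ρ ∉ Ioi (t - τ) from h)]
              simp
          simp_rw [e]
          rw [lintegral_mul_const _ (Measurable.indicator (by fun_prop) measurableSet_Ioi),
            setLIntegral_indicator measurableSet_Ioi,
            inter_eq_left.2 (Ioi_subset_Ioi hpos.le), lintegral_Ioi_rpow ha hpos, ← mul_assoc,
            ← ENNReal.ofReal_mul (by positivity), div_mul_cancel₀ _ ha.ne']
        · rw [indicator_of_notMem (show τ ∉ Iio t from hτ)]
          have : ∀ ρ, (Ioo 0 ρ).indicator (fun _ => (1 : ℝ≥0∞)) (t - τ) = 0 := fun ρ =>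
            indicator_of_notMem (fun h' => hτ (sub_pos.1 h'.1)) _
          simp [this]
    _ = _ := lintegral_indicator measurableSet_Iio _

/-- Uniqueness for the singular Volterra inequality `h ≤ ∫ (t - τ)^{-(1 - b/Q)} k h dτ` at the
critical exponent, for small `k ∈ L^{Q/b}` and `h ∈ L^Q`. -/
theorem exists_ae_eq_zero_of_le_fractional_integral (hb : 0 < b) (hQ : b + 1 < Q) :
    ∃ η : ℝ≥0∞, 0 < η ∧ ∀ k h : ℝ → ℝ≥0∞, Measurable k → Measurable h →
      lnorm Q volume h ≠ ∞ → lnorm (Q / b) volume k ≤ η →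
      (∀ᵐ t, h t ≤ ∫⁻ τ in Iio t, ENNReal.ofReal ((t - τ) ^ (-(1 - b / Q))) * (k τ * h τ)) →
      ∀ᵐ t, h t = 0 := by
  have hQ0 : 0 < Q := by linarith
  have hbQ : 0 < b / Q := by positivity
  obtain ⟨d, s₁, s₂, hd, hdQ, hs₁, hs₂, h₁, h₂⟩ := exists_exponent_gap hb hQ hbQ
  have hs₁0 : 0 < s₁ := one_div_pos.1 (hs₁ ▸ by positivity)
  have hs₂0 : 0 < s₂ := one_div_pos.1 (hs₂ ▸ by linarith)
  have hs₁1 : 1 ≤ s₁ := by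
    have : 1 / s₁ ≤ 1 / 1 := by linarith
    exact (one_div_le_one_div hs₁0 one_pos).1 this
  have hs₂1 : 1 ≤ s₂ := hs₁1.trans ((one_div_le_one_div hs₂0 hs₁0).1 (by linarith))
  have ha : 0 < 1 - b / Q := by linarith [one_div_pos.2 hs₁0]
  -- With E = d/4 the weak bound is multiplied by 2E/d = 1/2 at every application.
  refine ⟨ENNReal.ofReal (d / 4), by simpa using hd, fun k h hk hh hhQ hkη hle => ?_⟩
  set N : ℝ≥0∞ := lnorm Q volume h ^ (Q / s₁) + lnorm Q volume h ^ (Q / s₂) with hN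
  have hNt : N ≠ ∞ := by rw [hN]; finiteness
  refine WeakBound.ae_eq_zero hs₁1 hs₂1 hNt fun j => ?_
  induction j with
  | zero => simpa using weakBound_of_lnorm_le hQ0 hd hs₁ hs₂ hdQ hh le_rfl
  | succ j ih =>
    have key := WeakBound.lintegral hs₁1 hs₂1 hd (B := windowConv (1 - b / Q) k) (v := fun _ => h)
      (E := ENNReal.ofReal (d / 4)) (N := N * 2⁻¹ ^ j) (w := h)
      (measurable_windowConv_uncurry _ hk hh)
      (fun σ g hg => (measurable_windowConv_uncurry _ hk hg).comp measurable_prodMk_left)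
      (fun σ g g₁ g₂ hg₁ hg₂ hgg t => ?_) (fun σ g hσ hg => ?_) (fun σ g hσ hg => ?_)
      (fun σ g hσ hg => ?_) (fun σ g hσ hg => ?_) (fun _ _ => ih) ?_
    · have e : 2 * ENNReal.ofReal (d / 4) * ENNReal.ofReal d⁻¹ = 2⁻¹ := by
        rw [mul_assoc, ← ENNReal.ofReal_mul (by positivity), show d / 4 * d⁻¹ = 4⁻¹ by field_simp,
          ENNReal.ofReal_inv_of_pos (by norm_num), ENNReal.ofReal_ofNat,
          show (4 : ℝ≥0∞) = 2 * 2 by norm_num, ENNReal.mul_inv (by simp) (by simp), ← mul_assoc,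
          ENNReal.mul_inv_cancel (by simp) (by simp), one_mul]
      rwa [mul_right_comm, e, mul_comm, mul_assoc, ← pow_succ] at key
    · unfold windowConv
      rw [← mul_add, ← lintegral_add_left]
      · refine mul_le_mul_right (lintegral_mono_ae ?_) _
        filter_upwards [hgg] with τ hτ
        rw [← mul_add, ← mul_add]
        gcongr
      · exact ((measurable_const.indicator measurableSet_Ioo).comp
          (measurable_const.sub measurable_id)).mul (hk.mul hg₁)
    · refine (lnorm_windowConv_le hb hQ0 hs₁0 hs₁1 h₁ (by linarith) hk hg hσ).trans ?_
      rw [sub_self, sub_zero]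
      gcongr
    · refine (lnorm_windowConv_le hb hQ0 hs₁0 hs₂1 h₁ (by linarith) hk hg hσ).trans ?_
      rw [show 1 / s₁ - 1 / s₂ = 2 * d by rw [hs₁, hs₂]; ring]
      gcongr
    · refine (lnorm_windowConv_le hb hQ0 hs₂0 hs₁1 (by linarith) (by linarith) hk hg hσ).trans ?_
      rw [show -1 - (1 / s₂ - 1 / s₁) = -1 + 2 * d by rw [hs₁, hs₂]; ring]
      gcongr
    · refine (lnorm_windowConv_le hb hQ0 hs₂0 hs₂1 (by linarith) (by linarith) hk hg hσ).trans ?_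
      rw [sub_self, sub_zero]
      gcongr
    · filter_upwards [hle] with t ht
      rwa [lintegral_windowConv ha hk hh]

end FractionalIntegral

/-! ### Uniqueness for the heat flow with a potential of critical regularity. -/

section SingularPotential

variable {n : ℕ} {α b b₁ b₂ r : ℝ}

theorem exists_lnorm_heatMaj_mul_le (hα : 0 < α) (hn : 0 < n) (hb : 0 < b) (hr : 0 < r) {s s' : ℝ}
    (hs : 0 < s) (hs' : 0 < s') (h : 1 / s + b / r ≤ 1) (h' : 1 / s' ≤ 1 / s + b / r) :
    ∃ C : ℝ≥0, ∀ σ : ℝ, 0 < σ → ∀ a g : Sp n → ℝ≥0∞, Measurable a → Measurable g →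
      lnorm s' volume (heatMaj n α σ fun y => a y * g y) ≤
        C * ENNReal.ofReal (σ ^ (-(n / (2 * α) * (b / r)) - n / (2 * α) * (1 / s - 1 / s'))) *
          (lnorm (r / b) volume a * lnorm s volume g) := by
  set e : ℝ := 1 / (1 / s + b / r) with he
  have he0 : 0 < 1 / s + b / r := by positivity
  have he1 : 1 ≤ e := by
    rw [he, le_div_iff₀ he0]
    linarith
  have hes : e ≤ s' := by
    rw [he, div_le_iff₀ he0]
    calc (1 : ℝ) = s' * (1 / s') := by field_simp
      _ ≤ _ := by gcongr
  obtain ⟨C, hC⟩ := exists_lnorm_heatMaj_le (n := n) hα hn he1 hes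
  refine ⟨C, fun σ hσ a g ha hg => (hC σ hσ _ (ha.mul hg)).trans ?_⟩
  rw [he, one_div_one_div, show -(n / (2 * α) * (1 / s + b / r - 1 / s')) =
    -(n / (2 * α) * (b / r)) - n / (2 * α) * (1 / s - 1 / s') by ring]
  gcongr
  exact lnorm_mul_le (by positivity) hs (by rw [one_div_one_div, one_div_div]; ring)
    ha.aemeasurable hg.aemeasurable

/-- Multiplication by a potential in `L^{r/b₁} + L^{r/b₂}`, followed by the semigroup. -/
theorem exists_lnorm_heatMaj_potential_le (hα : 0 < α) (hn : 0 < n) (hb₂ : 0 < b₂) (hb : b₂ < b₁)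
    (hr : 0 < r) (hbr : n / (2 * α) * b₁ ≤ r) {s s' : ℝ} (hs : 0 < s) (hs' : 1 ≤ s')
    (h : 1 / s + b₁ / r ≤ 1) (h' : 1 / s' ≤ 1 / s + b₂ / r) :
    ∃ C : ℝ≥0, ∀ σ T : ℝ, 0 < σ → σ ≤ T → T ≤ 1 → ∀ c a₁ a₂ g : Sp n → ℝ≥0∞, Measurable a₁ →
      Measurable a₂ → Measurable g → (∀ x, c x ≤ a₁ x + a₂ x) →
      lnorm s' volume (heatMaj n α σ fun y => c y * g y) ≤
        C * (lnorm (r / b₁) volume a₁ +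
            ENNReal.ofReal (T ^ (1 - n / (2 * α) * b₂ / r)) * lnorm (r / b₂) volume a₂) *
          ENNReal.ofReal (σ ^ (-1 - n / (2 * α) * (1 / s - 1 / s'))) * lnorm s volume g := by
  have hb₁ : 0 < b₁ := hb₂.trans hb
  have hs'0 : 0 < s' := by linarith
  have hbr2 : b₂ / r ≤ b₁ / r := by gcongr
  obtain ⟨C₁, hC₁⟩ := exists_lnorm_heatMaj_mul_le (n := n) hα hn hb₁ hr hs hs'0 h (by linarith)
  obtain ⟨C₂, hC₂⟩ := exists_lnorm_heatMaj_mul_le (n := n) hα hn hb₂ hr hs hs'0 (by linarith) h'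
  refine ⟨C₁ + C₂, fun σ T hσ hσT hT c a₁ a₂ g ha₁ ha₂ hg hc => ?_⟩
  set m : ℝ := n / (2 * α) with hm
  have hm0 : 0 ≤ m := by positivity
  have h1 : m * b₁ / r ≤ 1 := (div_le_one hr).2 hbr
  have h2 : m * b₂ / r ≤ m * b₁ / r := by gcongr
  have hT0 : 0 < T := hσ.trans_le hσT
  have hle : lnorm s' volume (heatMaj n α σ fun y => c y * g y) ≤
      lnorm s' volume (heatMaj n α σ fun y => a₁ y * g y) +
        lnorm s' volume (heatMaj n α σ fun y => a₂ y * g y) := by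
    refine le_trans (lnorm_mono hs'0 fun x => ?_) (lnorm_add_le hs'
      (measurable_heatMaj (ha₁.mul hg)).aemeasurable (measurable_heatMaj (ha₂.mul hg)).aemeasurable)
    refine (heatMaj_mono_ae (ae_of_all _ fun y => mul_le_mul_left (hc y) (g y)) x).trans ?_
    simp_rw [add_mul]
    have hm₁ : Measurable fun y => a₁ y * g y := ha₁.mul hg
    exact (heatMaj_add hm₁ x).le
  refine (hle.trans (add_le_add (hC₁ σ hσ a₁ g ha₁ hg) (hC₂ σ hσ a₂ g ha₂ hg))).trans ?_
  set e := -1 - m * (1 / s - 1 / s') with he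
  have k1 : ENNReal.ofReal (σ ^ (-(m * (b₁ / r)) - m * (1 / s - 1 / s'))) ≤
      ENNReal.ofReal (σ ^ e) := by
    refine ENNReal.ofReal_le_ofReal (Real.rpow_le_rpow_of_exponent_ge hσ (hσT.trans hT) ?_)
    rw [← mul_div_assoc]
    linarith
  -- The L^{r/b₂} part of the potential leaves a surplus σ^{1-mb₂/r}, bounded by the same power of
  -- T; on a short interval this part need only be bounded.
  have k2 : ENNReal.ofReal (σ ^ (-(m * (b₂ / r)) - m * (1 / s - 1 / s'))) ≤
      ENNReal.ofReal (T ^ (1 - m * b₂ / r)) * ENNReal.ofReal (σ ^ e) := by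
    rw [← ENNReal.ofReal_mul (by positivity), show -(m * (b₂ / r)) - m * (1 / s - 1 / s') =
      (1 - m * b₂ / r) + e by rw [he]; ring, Real.rpow_add hσ]
    have : 0 ≤ 1 - m * b₂ / r := by linarith
    gcongr
  have l1 : (C₁ : ℝ≥0∞) ≤ (C₁ + C₂ : ℝ≥0) := by exact_mod_cast le_self_add
  have l2 : (C₂ : ℝ≥0∞) ≤ (C₁ + C₂ : ℝ≥0) := by exact_mod_cast le_add_self
  calc _ ≤ (C₁ + C₂ : ℝ≥0) * ENNReal.ofReal (σ ^ e) *
          (lnorm (r / b₁) volume a₁ * lnorm s volume g) +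
        (C₁ + C₂ : ℝ≥0) * (ENNReal.ofReal (T ^ (1 - m * b₂ / r)) * ENNReal.ofReal (σ ^ e)) *
          (lnorm (r / b₂) volume a₂ * lnorm s volume g) := by gcongr
    _ = _ := by ring

theorem duhMaj_le_lintegral_Ioi (t : ℝ) (g : ℝ × Sp n → ℝ≥0∞) (x : Sp n) :
    duhMaj n α t g x ≤ ∫⁻ σ in Ioi 0, heatMaj n α σ (fun y => g (t - σ, y)) x := by
  unfold duhMaj
  rw [← lintegral_indicator measurableSet_Ioo, ← lintegral_indicator measurableSet_Ioi,
    ← lintegral_sub_left_eq_self _ t]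
  refine lintegral_mono fun σ => ?_
  by_cases h : t - σ ∈ Ioo 0 t
  · rw [indicator_of_mem h, indicator_of_mem (show σ ∈ Ioi 0 by
      have := h.2
      simp only [mem_Ioi]
      linarith), sub_sub_cancel]
  · rw [indicator_of_notMem h]
    exact zero_le

/-- Uniqueness for the inequality `w ≤ ∫ S(t-τ) (c w) dτ` in `L^∞_t L^r_x` at the critical regularity
of the potential `c`. -/
theorem exists_ae_eq_zero_of_le_duhMaj (hα : 0 < α) (hn : 0 < n) (hb₂ : 0 < b₂) (hb : b₂ < b₁)
    (hr : b₁ + 1 < r) (hbr : n / (2 * α) * b₁ ≤ r) :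
    ∃ η : ℝ≥0∞, 0 < η ∧ ∀ (T : ℝ) (c w : ℝ × Sp n → ℝ≥0∞) (N δ M : ℝ≥0∞), T ≤ 1 → Measurable c →
      Measurable w → N ≠ ∞ → (∀ t, lnorm r volume (fun x => w (t, x)) ≤ N) →
      (∀ t, ∃ a₁ a₂ : Sp n → ℝ≥0∞, Measurable a₁ ∧ Measurable a₂ ∧ (∀ x, c (t, x) ≤ a₁ x + a₂ x) ∧
        lnorm (r / b₁) volume a₁ ≤ δ ∧ lnorm (r / b₂) volume a₂ ≤ M) →
      δ + ENNReal.ofReal (T ^ (1 - n / (2 * α) * b₂ / r)) * M ≤ η →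
      (∀ t, t ∉ Ioo 0 T → ∀ x, c (t, x) = 0 ∧ w (t, x) = 0) →
      (∀ t ∈ Ioo 0 T, ∀ᵐ x, w (t, x) ≤ duhMaj n α t (fun z => c z * w z) x) →
      ∀ t, ∀ᵐ x, w (t, x) = 0 := by
  have hb₁ : 0 < b₁ := hb₂.trans hb
  have hr0 : 0 < r := by linarith
  have hn' : (0 : ℝ) < n := by exact_mod_cast hn
  obtain ⟨d, s₁, s₂, hd, hdr, hs₁, hs₂, h₁, h₂⟩ := exists_exponent_gap hb₁ hr (div_pos hb₂ hr0)
  have hs₁0 : 0 < s₁ := one_div_pos.1 (hs₁ ▸ by positivity)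
  have hs₂0 : 0 < s₂ := one_div_pos.1 (hs₂ ▸ by linarith)
  have hbr0 : 0 < b₁ / r := by positivity
  have hbr2 : 0 < b₂ / r := by positivity
  have hs₁1 : 1 ≤ s₁ := by
    have : 1 / s₁ ≤ 1 / 1 := by linarith
    exact (one_div_le_one_div hs₁0 one_pos).1 this
  have hs₂1 : 1 ≤ s₂ := hs₁1.trans ((one_div_le_one_div hs₂0 hs₁0).1 (by linarith))
  obtain ⟨C₁₁, hC₁₁⟩ := exists_lnorm_heatMaj_potential_le (n := n) hα hn hb₂ hb hr0 hbr (s' := s₁)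
    hs₁0 hs₁1 h₁ (by linarith)
  obtain ⟨C₁₂, hC₁₂⟩ := exists_lnorm_heatMaj_potential_le (n := n) hα hn hb₂ hb hr0 hbr (s' := s₂)
    hs₁0 hs₂1 h₁ (by linarith)
  obtain ⟨C₂₁, hC₂₁⟩ := exists_lnorm_heatMaj_potential_le (n := n) hα hn hb₂ hb hr0 hbr (s' := s₁)
    hs₂0 hs₁1 (by linarith) (by linarith)
  obtain ⟨C₂₂, hC₂₂⟩ := exists_lnorm_heatMaj_potential_le (n := n) hα hn hb₂ hb hr0 hbr (s' := s₂)
    hs₂0 hs₂1 (by linarith) (by linarith)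
  set m : ℝ := n / (2 * α) with hm
  have hm0 : 0 < m := by positivity
  -- The flow loses m(1/s₁-1/s₂) = 2md between the two endpoint spaces.
  set k : ℝ := m * d with hk
  have hk0 : 0 < k := by positivity
  have e₁₁ : -1 - m * (1 / s₁ - 1 / s₁) = -1 := by ring
  have e₂₂ : -1 - m * (1 / s₂ - 1 / s₂) = -1 := by ring
  have e₁₂ : -1 - m * (1 / s₁ - 1 / s₂) = -1 - 2 * k := by rw [hs₁, hs₂, hk]; ring
  have e₂₁ : -1 - m * (1 / s₂ - 1 / s₁) = -1 + 2 * k := by rw [hs₁, hs₂, hk]; ring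
  rw [e₁₁] at hC₁₁
  rw [e₁₂] at hC₁₂
  rw [e₂₁] at hC₂₁
  rw [e₂₂] at hC₂₂
  set C : ℝ≥0 := C₁₁ + C₁₂ + C₂₁ + C₂₂ + 1 with hC
  have hC0 : 0 < C := by positivity
  -- Chosen to give E ≤ k/4, so that the weak bound is halved.
  set η : ℝ≥0 := (k / 4).toNNReal / C with hη
  refine ⟨η, ENNReal.coe_pos.2 (div_pos (Real.toNNReal_pos.2 (by positivity)) hC0),
    fun T c w N δ M hT hc hw hNt hwN hca hsmall hout hle => ?_⟩
  set E : ℝ≥0∞ := C * (δ + ENNReal.ofReal (T ^ (1 - m * b₂ / r)) * M) with hE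
  have hE4 : E ≤ ENNReal.ofReal (k / 4) := by
    rw [hE]
    refine (mul_le_mul_right hsmall _).trans (le_of_eq ?_)
    rw [← ENNReal.coe_mul, hη, mul_div_cancel₀ _ hC0.ne']
    rfl
  have hcs : ∀ t, Measurable fun y => c (t, y) := fun t => hc.comp measurable_prodMk_left
  have hws : ∀ t, Measurable fun y => w (t, y) := fun t => hw.comp measurable_prodMk_left
  have hbound : ∀ {e s s' : ℝ} {C' : ℝ≥0}, C' ≤ C → 0 < s' → (∀ σ T : ℝ, 0 < σ → σ ≤ T → T ≤ 1 →
      ∀ c a₁ a₂ g : Sp n → ℝ≥0∞, Measurable a₁ → Measurable a₂ → Measurable g →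
      (∀ x, c x ≤ a₁ x + a₂ x) → lnorm s' volume (heatMaj n α σ fun y => c y * g y) ≤
        C' * (lnorm (r / b₁) volume a₁ +
            ENNReal.ofReal (T ^ (1 - m * b₂ / r)) * lnorm (r / b₂) volume a₂) *
          ENNReal.ofReal (σ ^ e) * lnorm s volume g) →
      ∀ t ∈ Ioo 0 T, ∀ σ g, 0 < σ → Measurable g →
        lnorm s' volume (heatMaj n α σ fun y => c (t - σ, y) * g y) ≤
          E * ENNReal.ofReal (σ ^ e) * lnorm s volume g := by
    intro e s s' C' hC' hs' key t ht σ g hσ hg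
    by_cases hσt : t - σ ∈ Ioo 0 T
    · obtain ⟨a₁, a₂, ha₁, ha₂, hle, hn₁, hn₂⟩ := hca (t - σ)
      have h1 := hσt.1
      have h2 := ht.2
      refine (key σ T hσ (by linarith) hT _ a₁ a₂ g ha₁ ha₂ hg hle).trans ?_
      rw [hE]
      gcongr
    · have : (heatMaj n α σ fun y => c (t - σ, y) * g y) = fun _ => 0 := by
        funext x
        simp [heatMaj, (hout _ hσt _).1]
      rw [this, lnorm_zero hs']
      exact zero_le
  have l₁₁ : C₁₁ ≤ C := by rw [hC, ← NNReal.coe_le_coe]; push_cast; linarith [C₁₁.2, C₁₂.2, C₂₁.2, C₂₂.2]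
  have l₁₂ : C₁₂ ≤ C := by rw [hC, ← NNReal.coe_le_coe]; push_cast; linarith [C₁₁.2, C₁₂.2, C₂₁.2, C₂₂.2]
  have l₂₁ : C₂₁ ≤ C := by rw [hC, ← NNReal.coe_le_coe]; push_cast; linarith [C₁₁.2, C₁₂.2, C₂₁.2, C₂₂.2]
  have l₂₂ : C₂₂ ≤ C := by rw [hC, ← NNReal.coe_le_coe]; push_cast; linarith [C₁₁.2, C₁₂.2, C₂₁.2, C₂₂.2]
  set N' : ℝ≥0∞ := N ^ (r / s₁) + N ^ (r / s₂) with hN'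
  have hN't : N' ≠ ∞ := by rw [hN']; finiteness
  have main : ∀ j : ℕ, ∀ t, WeakBound volume s₁ s₂ (N' * 2⁻¹ ^ j) fun x => w (t, x) := by
    intro j
    induction j with
    | zero =>
      intro t
      simpa using weakBound_of_lnorm_le hr0 hd hs₁ hs₂ hdr (hws t) (hwN t)
    | succ j ih =>
      intro t
      by_cases ht : t ∈ Ioo 0 T
      swap
      · refine fun l hl => ⟨fun _ => 0, fun _ => 0, measurable_const, measurable_const,
          ae_of_all _ fun x => (hout t ht x).2.trans_le zero_le, ?_, ?_⟩
        · rw [lnorm_zero hs₁0]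
          exact zero_le
        · rw [lnorm_zero hs₂0]
          exact zero_le
      have hmeas : Measurable fun z : ℝ × Sp n =>
          heatMaj n α z.1 (fun y => c (t - z.1, y) * w (t - z.1, y)) z.2 := by
        have h1 := measurable_heatMaj_uncurry (n := n) (α := α) (hc.mul hw)
        have h2 : Measurable fun z : ℝ × Sp n => (((t, t - z.1), z.2) : (ℝ × ℝ) × Sp n) := by fun_prop
        simpa [Function.comp_def] using h1.comp h2
      have key := WeakBound.lintegral (μ := (volume : Measure (Sp n))) hs₁1 hs₂1 hk0
        (B := fun σ g => heatMaj n α σ fun y => c (t - σ, y) * g y)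
        (v := fun σ x => w (t - σ, x)) (E := E) (N := N' * 2⁻¹ ^ j) (w := fun x => w (t, x)) hmeas
        (fun σ g hg => measurable_heatMaj ((hcs _).mul hg))
        (fun σ g g₁ g₂ hg₁ hg₂ hgg x => by
          have hm₁ : Measurable fun y => c (t - σ, y) * g₁ y := (hcs _).mul hg₁
          refine (heatMaj_mono_ae ?_ x).trans (heatMaj_add hm₁ x).le
          filter_upwards [hgg] with y hy
          rw [← mul_add]
          gcongr)
        (hbound l₁₁ hs₁0 hC₁₁ t ht) (hbound l₁₂ hs₂0 hC₁₂ t ht) (hbound l₂₁ hs₁0 hC₂₁ t ht)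
        (hbound l₂₂ hs₂0 hC₂₂ t ht) (fun σ _ => ih (t - σ)) (by
          filter_upwards [hle t ht] with x hx
          exact hx.trans (duhMaj_le_lintegral_Ioi t _ x))
      have e : 2 * E * ENNReal.ofReal k⁻¹ ≤ 2⁻¹ := by
        refine (mul_le_mul_left (mul_le_mul_right hE4 2) _).trans (le_of_eq ?_)
        rw [mul_assoc, ← ENNReal.ofReal_mul (by positivity), show k / 4 * k⁻¹ = 4⁻¹ by field_simp,
          ENNReal.ofReal_inv_of_pos (by norm_num), ENNReal.ofReal_ofNat,
          show (4 : ℝ≥0∞) = 2 * 2 by norm_num, ENNReal.mul_inv (by simp) (by simp), ← mul_assoc,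
          ENNReal.mul_inv_cancel (by simp) (by simp), one_mul]
      intro l hl
      obtain ⟨w₁, w₂, hw₁, hw₂, hww, hn₁, hn₂⟩ := key l hl
      have e' : 2 * E * (N' * 2⁻¹ ^ j) * ENNReal.ofReal k⁻¹ ≤ N' * 2⁻¹ ^ (j + 1) := by
        calc _ = 2 * E * ENNReal.ofReal k⁻¹ * (N' * 2⁻¹ ^ j) := by ring
          _ ≤ 2⁻¹ * (N' * 2⁻¹ ^ j) := mul_le_mul_left e _
          _ = _ := by rw [pow_succ]; ring
      exact ⟨w₁, w₂, hw₁, hw₂, hww, hn₁.trans (mul_le_mul_left e' _),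
        hn₂.trans (mul_le_mul_left e' _)⟩
  exact fun t => WeakBound.ae_eq_zero hs₁1 hs₂1 hN't fun j => main j t

end SingularPotential

/-! ### Smallness on short intervals. -/

section Smallness

theorem rpow_add_le_two_rpow_mul {b : ℝ} (hb : 0 ≤ b) (x y : ℝ≥0∞) :
    (x + y) ^ b ≤ 2 ^ b * (x ^ b + y ^ b) := by
  have h : (x + y) ^ b ≤ (2 * max x y) ^ b := by
    rw [two_mul]
    gcongr
    · exact le_max_left _ _
    · exact le_max_right _ _
  refine h.trans ?_
  rw [ENNReal.mul_rpow_of_nonneg _ _ hb]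
  gcongr
  rcases le_total x y with h | h
  · rw [max_eq_right h]
    exact le_add_self
  · rw [max_eq_left h]
    exact le_self_add

theorem exists_mul_rpow_le {b : ℝ} (hb : 0 < b) {c η : ℝ≥0∞} (hc : c ≠ ∞) (hη : 0 < η) :
    ∃ e : ℝ≥0∞, 0 < e ∧ e ≤ 1 ∧ c * e ^ b ≤ η := by
  have h1 : Tendsto (fun e : ℝ≥0∞ => c * e ^ b) (𝓝 0) (𝓝 0) := by
    have h := ENNReal.Tendsto.const_mul (a := c) ((ENNReal.continuous_rpow_const (y := b)).tendsto 0)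
      (Or.inr hc)
    rwa [ENNReal.zero_rpow_of_pos hb, mul_zero] at h
  have h2 : ∀ᶠ e in 𝓝[>] (0 : ℝ≥0∞), c * e ^ b ≤ η :=
    (ENNReal.tendsto_nhds_zero.1 h1 η hη).filter_mono nhdsWithin_le_nhds
  have h3 : ∀ᶠ e in 𝓝[>] (0 : ℝ≥0∞), e < 1 :=
    (eventually_lt_nhds zero_lt_one).filter_mono nhdsWithin_le_nhds
  obtain ⟨e, ⟨a, b⟩, c⟩ := ((h2.and h3).and self_mem_nhdsWithin).exists
  exact ⟨e, c, b.le, a⟩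

theorem lnorm_indicator {X : Type*} [MeasurableSpace X] {μ : Measure X} {p : ℝ} (hp : 0 < p)
    {s : Set X} (hs : MeasurableSet s) (g : X → ℝ≥0∞) :
    lnorm p μ (s.indicator g) = lnorm p (μ.restrict s) g := by
  unfold lnorm
  rw [← lintegral_indicator hs]
  congr 2
  funext x
  by_cases h : x ∈ s <;> simp [h, hp]

/-- Absolute continuity of the integral. -/
theorem exists_lnorm_Ioo_le {p T : ℝ} (hp : 0 < p) (hT : 0 < T) {k : ℝ → ℝ≥0∞}
    (hk : lnorm p (volume.restrict (Ioo 0 T)) k ≠ ∞) {η : ℝ≥0∞} (hη : 0 < η) :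
    ∃ h : ℝ, 0 < h ∧ h ≤ T ∧ lnorm p (volume.restrict (Ioo 0 h)) k ≤ η := by
  have hfin : ∫⁻ x in Ioo 0 T, k x ^ p ≠ ∞ := by
    rw [← lnorm_rpow_self hp]
    exact ENNReal.rpow_ne_top_of_nonneg hp.le hk
  have hv : Tendsto (fun h : ℝ => (volume.restrict (Ioo 0 T)) (Ioo 0 h)) (𝓝[>] 0) (𝓝 0) := by
    have h0 : Tendsto (fun h : ℝ => ENNReal.ofReal h) (𝓝[>] 0) (𝓝 0) := by
      have := (ENNReal.continuous_ofReal.tendsto 0).mono_left (nhdsWithin_le_nhds (s := Ioi 0))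
      rwa [ENNReal.ofReal_zero] at this
    refine tendsto_of_tendsto_of_tendsto_of_le_of_le tendsto_const_nhds h0 (fun _ => zero_le)
      fun h => (Measure.restrict_apply_le _ _).trans ?_
    simp
  have h1 := tendsto_setLIntegral_zero hfin hv
  have h2 := (ENNReal.continuous_rpow_const (y := 1 / p)).tendsto 0 |>.comp h1
  rw [ENNReal.zero_rpow_of_pos (by positivity)] at h2
  obtain ⟨h, ha, hb⟩ := ((ENNReal.tendsto_nhds_zero.1 h2 η hη).and (Ioo_mem_nhdsGT hT)).exists
  refine ⟨h, hb.1, hb.2.le, ?_⟩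
  unfold lnorm
  simpa only [Function.comp_apply, Measure.restrict_restrict measurableSet_Ioo, Ioo_inter_Ioo,
    sup_idem, min_eq_left hb.2.le] using ha

end Smallness

/-! ### Local uniqueness in the two cases p = r and p > r. -/

section LocalUniqueness

variable {n : ℕ} {α : ℝ} {𝕜 : Type*} [RCLike 𝕜] {b b₁ b₂ r s : ℝ} {f : 𝕜 → 𝕜}

/-- Splitting of `|u|^{b₁} + |u|^{b₂}` for `u` close in `L^r` to a fixed function. -/
theorem exists_potential_split (hb₂ : 0 < b₂) (hb : b₂ < b₁) (hr : b₁ ≤ r) (hr1 : 1 ≤ r) {u₀ : Sp n → 𝕜}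
    (hu₀ : Measurable u₀) (hu₀r : lnorm r volume (fun x => ‖u₀ x‖ₑ) ≠ ∞) {δ : ℝ≥0∞} (hδ : 0 < δ) :
    ∃ e M : ℝ≥0∞, 0 < e ∧ e ≤ 1 ∧ M ≠ ∞ ∧ ∀ u : Sp n → 𝕜, Measurable u →
      lnorm r volume (fun x => ‖u x - u₀ x‖ₑ) ≤ e → ∃ a₁ a₂ : Sp n → ℝ≥0∞, Measurable a₁ ∧
        Measurable a₂ ∧ (∀ x, ‖u x‖ₑ ^ b₁ + ‖u x‖ₑ ^ b₂ ≤ a₁ x + a₂ x) ∧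
        lnorm (r / b₁) volume a₁ ≤ δ ∧ lnorm (r / b₂) volume a₂ ≤ M := by
  have hb₁ : 0 < b₁ := hb₂.trans hb
  have hr0 : 0 < r := hb₁.trans_le hr
  -- The part u - u₀ and the upper truncation of u₀ both have norm at most e; their sum, with the
  -- two factors 2^{b₁}, must stay below δ.
  obtain ⟨e, he0, he1, he⟩ := exists_mul_rpow_le hb₁ (c := 2 ^ b₁ * 2 ^ b₁) (by finiteness) hδ
  obtain ⟨L, hLe, hL⟩ := ((ENNReal.tendsto_nhds_zero.1
    (tendsto_lnorm_indicator_lt hr0 hu₀.enorm hu₀r) e he0).and (eventually_gt_atTop 0)).exists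
  set M₀ := lnorm r volume (fun x => ‖u₀ x‖ₑ) with hM₀
  refine ⟨e, 2 ^ b₁ * ENNReal.ofReal (L ^ (b₁ - b₂)) * M₀ ^ b₂ + (1 + M₀) ^ b₂, he0, he1,
    by finiteness, fun u hu hue => ?_⟩
  set g : Sp n → ℝ≥0∞ := {x | ENNReal.ofReal L < ‖u₀ x‖ₑ}.indicator fun x => ‖u₀ x‖ₑ with hg
  set g' : Sp n → ℝ≥0∞ := {x | ‖u₀ x‖ₑ ≤ ENNReal.ofReal L}.indicator fun x => ‖u₀ x‖ₑ with hg'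
  have hgm : Measurable g := hu₀.enorm.indicator (measurableSet_lt measurable_const hu₀.enorm)
  have hdm : Measurable fun x => ‖u x - u₀ x‖ₑ := (hu.sub hu₀).enorm
  have hXm : Measurable fun x => ‖u x - u₀ x‖ₑ + g x := hdm.add hgm
  have hum : Measurable fun x => ‖u x‖ₑ := hu.enorm
  have hum₀ : Measurable fun x => ‖u₀ x‖ₑ := hu₀.enorm
  -- Below the height L the critical power of u₀ is dominated by the subcritical one; its
  -- coefficient may be large.
  have hgL : ∀ x, g' x ^ b₁ ≤ ENNReal.ofReal (L ^ (b₁ - b₂)) * ‖u₀ x‖ₑ ^ b₂ := by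
    intro x
    by_cases h : ‖u₀ x‖ₑ ≤ ENNReal.ofReal L
    · rw [hg', indicator_of_mem (show x ∈ {x | ‖u₀ x‖ₑ ≤ ENNReal.ofReal L} from h),
        ← ENNReal.ofReal_rpow_of_pos hL]
      calc ‖u₀ x‖ₑ ^ b₁ = ‖u₀ x‖ₑ ^ (b₁ - b₂) * ‖u₀ x‖ₑ ^ b₂ := by
            rw [← ENNReal.rpow_add_of_nonneg _ _ (by linarith) hb₂.le, sub_add_cancel]
        _ ≤ _ := by
            have : 0 ≤ b₁ - b₂ := by linarith
            gcongr
    · rw [hg', indicator_of_notMem (show x ∉ {x | ‖u₀ x‖ₑ ≤ ENNReal.ofReal L} from h),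
        ENNReal.zero_rpow_of_pos hb₁]
      exact zero_le
  have htri : ∀ x, ‖u x‖ₑ ≤ ‖u x - u₀ x‖ₑ + ‖u₀ x‖ₑ := fun x => by
    calc ‖u x‖ₑ = ‖(u x - u₀ x) + u₀ x‖ₑ := by rw [sub_add_cancel]
      _ ≤ _ := enorm_add_le _ _
  refine ⟨fun x => 2 ^ b₁ * (‖u x - u₀ x‖ₑ + g x) ^ b₁,
    fun x => 2 ^ b₁ * ENNReal.ofReal (L ^ (b₁ - b₂)) * ‖u₀ x‖ₑ ^ b₂ + ‖u x‖ₑ ^ b₂,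
    (hXm.pow_const _).const_mul _, ((hum₀.pow_const _).const_mul _).add (hum.pow_const _), fun x => ?_,
    ?_, ?_⟩
  · have h1 : ‖u x‖ₑ ≤ (‖u x - u₀ x‖ₑ + g x) + g' x := by
      rw [add_assoc, hg, hg', indicator_lt_add_indicator_ge]
      exact htri x
    have h2 : ‖u x‖ₑ ^ b₁ ≤ 2 ^ b₁ * ((‖u x - u₀ x‖ₑ + g x) ^ b₁ + g' x ^ b₁) :=
      le_trans (by gcongr) (rpow_add_le_two_rpow_mul hb₁.le _ _)
    calc _ ≤ 2 ^ b₁ * ((‖u x - u₀ x‖ₑ + g x) ^ b₁ +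
          ENNReal.ofReal (L ^ (b₁ - b₂)) * ‖u₀ x‖ₑ ^ b₂) + ‖u x‖ₑ ^ b₂ := by
          gcongr
          exact h2.trans (by gcongr; exact hgL x)
      _ = _ := by ring
  · rw [lnorm_const_mul (by positivity) (by finiteness), lnorm_rpow (by positivity) hb₁,
      div_mul_cancel₀ _ hb₁.ne']
    refine le_trans ?_ he
    rw [mul_assoc]
    gcongr
    rw [← ENNReal.mul_rpow_of_nonneg _ _ hb₁.le, two_mul]
    gcongr
    exact (lnorm_add_le hr1 hdm.aemeasurable hgm.aemeasurable).trans
      (add_le_add hue hLe)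
  · have h1 : Measurable fun x => 2 ^ b₁ * ENNReal.ofReal (L ^ (b₁ - b₂)) * ‖u₀ x‖ₑ ^ b₂ :=
      (hum₀.pow_const _).const_mul _
    refine (lnorm_add_le (by rw [one_le_div hb₂]; linarith) h1.aemeasurable
      (hum.pow_const _).aemeasurable).trans ?_
    rw [lnorm_const_mul (by positivity) (by finiteness), lnorm_rpow (by positivity) hb₂,
      lnorm_rpow (by positivity) hb₂, div_mul_cancel₀ _ hb₂.ne']
    gcongr
    refine (lnorm_mono hr0 htri).trans ((lnorm_add_le hr1 hdm.aemeasurable hum₀.aemeasurable).trans ?_)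
    exact add_le_add (hue.trans he1) le_rfl

/-- Local uniqueness in `C([0,T); L^r)`, `r > b₁ + 1`. -/
theorem exists_ae_eq_of_tendsto (hα : 0 < α) (hn : 0 < n) (hb₂ : 0 < b₂) (hb : b₂ < b₁)
    (hr : b₁ + 1 < r) (hbr : n / (2 * α) * b₁ ≤ r) {K : ℝ≥0} (hf : ∀ u v : 𝕜, ‖f u - f v‖ₑ ≤
      K * ((‖u‖ₑ ^ b₁ + ‖v‖ₑ ^ b₁) + (‖u‖ₑ ^ b₂ + ‖v‖ₑ ^ b₂)) * ‖u - v‖ₑ) {T : ℝ} (hT : 0 < T)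
    {u₀ : Sp n → 𝕜} (hu₀ : Measurable u₀) (hu₀r : lnorm r volume (fun x => ‖u₀ x‖ₑ) ≠ ∞)
    {U V : ℝ × Sp n → 𝕜} (hU : Measurable U) (hV : Measurable V)
    (hUt : Tendsto (fun t => lnorm r volume (fun x => ‖U (t, x) - u₀ x‖ₑ)) (𝓝[>] 0) (𝓝 0))
    (hVt : Tendsto (fun t => lnorm r volume (fun x => ‖V (t, x) - u₀ x‖ₑ)) (𝓝[>] 0) (𝓝 0))
    (hle : ∀ t ∈ Ioo 0 T, ∀ᵐ x, ‖U (t, x) - V (t, x)‖ₑ ≤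
      duhMaj n α t (fun z => ‖f (U z) - f (V z)‖ₑ) x) :
    ∃ h : ℝ, 0 < h ∧ ∀ t ∈ Ioo 0 h, ∀ᵐ x, U (t, x) = V (t, x) := by
  have hb₁ : 0 < b₁ := hb₂.trans hb
  have hr0 : 0 < r := by linarith
  obtain ⟨η, hη0, hη⟩ := exists_ae_eq_zero_of_le_duhMaj (n := n) hα hn hb₂ hb hr hbr
  have hn' : (0 : ℝ) < n := by exact_mod_cast hn
  -- Two functions contribute, with the factor K, so δ = η/(4(K+1)) uses up at most half of η; the
  -- other half is left for the L^{r/b₂} part.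
  obtain ⟨e, M, he0, he1, hM, hsplit⟩ := exists_potential_split hb₂ hb (by linarith : b₁ ≤ r) (by linarith) hu₀
    hu₀r
    (δ := η / (4 * (K + 1))) (ENNReal.div_pos hη0.ne' (by finiteness))
  set m : ℝ := n / (2 * α) with hm
  have hκ : 0 < 1 - m * b₂ / r := by
    have hm0 : 0 < m := by positivity
    rw [sub_pos, div_lt_one hr0]
    exact (mul_lt_mul_of_pos_left hb hm0).trans_le hbr
  have het : e ≠ ∞ := ne_top_of_le_ne_top ENNReal.one_ne_top he1
  have hM2 : (K : ℝ≥0∞) * (2 * M) ≠ ∞ := by finiteness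
  have ev := (((ENNReal.tendsto_nhds_zero.1 hUt e he0).and (ENNReal.tendsto_nhds_zero.1 hVt e he0)).and
    (ENNReal.tendsto_nhds_zero.1 (tendsto_ofReal_rpow_mul hκ hM2) (η / 2)
      (ENNReal.div_pos hη0.ne' (by finiteness)))).and (Ioo_mem_nhdsGT (lt_min hT one_pos))
  obtain ⟨d, hd, hd'⟩ := mem_nhdsGT_iff_exists_Ioo_subset.1 ev
  have hd0 : 0 < d := hd
  set h : ℝ := d / 2 with hh
  have hh0 : 0 < h := by positivity
  have hsub : ∀ t ∈ Ioc 0 h, t ∈ Ioo 0 d := fun t ht => ⟨ht.1, by linarith [ht.2]⟩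
  have hhd := hd' (hsub h ⟨hh0, le_rfl⟩)
  have hhT : h < min T 1 := hhd.2.2
  set S : Set (ℝ × Sp n) := Prod.fst ⁻¹' Ioo 0 h with hS
  have hSm : MeasurableSet S := measurable_fst measurableSet_Ioo
  set c : ℝ × Sp n → ℝ≥0∞ := S.indicator fun z =>
    K * ((‖U z‖ₑ ^ b₁ + ‖V z‖ₑ ^ b₁) + (‖U z‖ₑ ^ b₂ + ‖V z‖ₑ ^ b₂)) with hc
  set w : ℝ × Sp n → ℝ≥0∞ := S.indicator fun z => ‖U z - V z‖ₑ with hw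
  have hUVm : Measurable fun z => ‖U z - V z‖ₑ := (hU.sub hV).enorm
  have hUe : Measurable fun z => ‖U z‖ₑ := hU.enorm
  have hVe : Measurable fun z => ‖V z‖ₑ := hV.enorm
  have hcm : Measurable c := Measurable.indicator ((((hUe.pow_const _).add (hVe.pow_const _)).add
    ((hUe.pow_const _).add (hVe.pow_const _))).const_mul _) hSm
  have hwm : Measurable w := hUVm.indicator hSm
  have hin : ∀ t ∈ Ioo 0 h, ∀ x, (t, x) ∈ S := fun t ht x => ht
  have hnin : ∀ t, t ∉ Ioo 0 h → ∀ x : Sp n, (t, x) ∉ S := fun t ht x => ht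
  have hUt' : ∀ t, Measurable fun x => U (t, x) := fun t => hU.comp measurable_prodMk_left
  have hVt' : ∀ t, Measurable fun x => V (t, x) := fun t => hV.comp measurable_prodMk_left
  have key := hη h c w (e + e) (K * (2 * (η / (4 * (K + 1))))) (K * (2 * M)) (by
    linarith [min_le_right T 1]) hcm hwm (by finiteness) (fun t => ?_) (fun t => ?_) ?_
    (fun t ht x => ⟨indicator_of_notMem (hnin t ht x) _, indicator_of_notMem (hnin t ht x) _⟩)
    (fun t ht => ?_)
  · refine ⟨h, hh0, fun t ht => ?_⟩
    filter_upwards [key t] with x hx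
    rw [hw, indicator_of_mem (hin t ht x), enorm_eq_zero, sub_eq_zero] at hx
    exact hx
  · by_cases ht : t ∈ Ioo 0 h
    · have ht' := hd' (hsub t ⟨ht.1, ht.2.le⟩)
      have h1 : Measurable fun x => ‖U (t, x) - u₀ x‖ₑ := ((hUt' t).sub hu₀).enorm
      have h2 : Measurable fun x => ‖V (t, x) - u₀ x‖ₑ := ((hVt' t).sub hu₀).enorm
      refine le_trans (lnorm_mono hr0 fun x => ?_) ((lnorm_add_le (by linarith) h1.aemeasurable
        h2.aemeasurable).trans (add_le_add ht'.1.1.1 ht'.1.1.2))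
      rw [hw, indicator_of_mem (hin t ht x), enorm_sub_rev (V (t, x))]
      calc _ = ‖(U (t, x) - u₀ x) + (u₀ x - V (t, x))‖ₑ := by congr 1; ring
        _ ≤ _ := enorm_add_le _ _
    · have : (fun x => w (t, x)) = fun _ => 0 := by
        funext x
        exact indicator_of_notMem (hnin t ht x) _
      rw [this, lnorm_zero hr0]
      exact zero_le
  · by_cases ht : t ∈ Ioo 0 h
    · have ht' := hd' (hsub t ⟨ht.1, ht.2.le⟩)
      obtain ⟨a₁, a₂, ha₁, ha₂, hle₁, hn₁, hn₂⟩ := hsplit _ (hUt' t) ht'.1.1.1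
      obtain ⟨c₁, c₂, hc₁, hc₂, hle₂, hm₁, hm₂⟩ := hsplit _ (hVt' t) ht'.1.1.2
      refine ⟨fun x => K * (a₁ x + c₁ x), fun x => K * (a₂ x + c₂ x), (ha₁.add hc₁).const_mul _,
        (ha₂.add hc₂).const_mul _, fun x => ?_, ?_, ?_⟩
      · rw [hc, indicator_of_mem (hin t ht x), ← mul_add]
        refine mul_le_mul_right ?_ _
        rw [add_add_add_comm, add_add_add_comm (a₁ x)]
        exact add_le_add (hle₁ x) (hle₂ x)
      · rw [lnorm_const_mul (by positivity) ENNReal.coe_ne_top, two_mul]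
        gcongr
        exact (lnorm_add_le (by rw [one_le_div hb₁]; linarith) ha₁.aemeasurable
          hc₁.aemeasurable).trans (add_le_add hn₁ hm₁)
      · rw [lnorm_const_mul (by positivity) ENNReal.coe_ne_top, two_mul]
        gcongr
        exact (lnorm_add_le (by rw [one_le_div hb₂]; linarith) ha₂.aemeasurable
          hc₂.aemeasurable).trans (add_le_add hn₂ hm₂)
    · refine ⟨fun _ => 0, fun _ => 0, measurable_const, measurable_const, fun x =>
        (indicator_of_notMem (hnin t ht x) _).trans_le zero_le, ?_, ?_⟩
      · rw [lnorm_zero (by positivity)]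
        exact zero_le
      · rw [lnorm_zero (by positivity)]
        exact zero_le
  · refine (add_le_add ?_ hhd.1.2).trans_eq (ENNReal.add_halves η)
    rw [ENNReal.le_div_iff_mul_le (Or.inl (by simp)) (Or.inl (by simp))]
    calc _ = 4 * K * (η / (4 * (K + 1))) := by
          generalize η / (4 * ((K : ℝ≥0∞) + 1)) = x
          ring
      _ ≤ 4 * (K + 1) * (η / (4 * (K + 1))) := by gcongr; exact le_self_add
      _ ≤ η := ENNReal.mul_div_le
  · filter_upwards [hle t ⟨ht.1, ht.2.trans (hhT.trans_le (min_le_left _ _))⟩] with x hx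
    rw [hw, indicator_of_mem (hin t ht x)]
    refine hx.trans (duhMaj_mono_ae (fun τ hτ => ae_of_all _ fun y => ?_) x)
    have hτ' : τ ∈ Ioo 0 h := ⟨hτ.1, hτ.2.trans ht.2⟩
    rw [hc, indicator_of_mem (hin τ hτ' y), indicator_of_mem (hin τ hτ' y)]
    exact hf _ _

/-- The power part goes through L^{s/(b+1)}, which costs (t-τ)^{-mb/s}; the summand 1 stems from the
linear part of the Lipschitz bound. This reduces uniqueness in L^Q_t L^s_x to a scalar inequality in
time. -/
theorem exists_lnorm_duhMaj_sub_le (hα : 0 < α) (hn : 0 < n) (hb : 0 < b) (hf : IsPowerSource b f)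
    (hs : b + 1 ≤ s) : ∃ C : ℝ≥0, ∀ (t : ℝ) (U V : ℝ × Sp n → 𝕜), Measurable U → Measurable V →
      lnorm s volume (duhMaj n α t fun z => ‖f (U z) - f (V z)‖ₑ) ≤
        C * ∫⁻ τ in Ioo 0 t, (1 + ENNReal.ofReal ((t - τ) ^ (-(n / (2 * α) * b / s))) *
          (lnorm s volume (fun x => ‖U (τ, x)‖ₑ) ^ b + lnorm s volume (fun x => ‖V (τ, x)‖ₑ) ^ b)) *
          lnorm s volume (fun x => ‖U (τ, x) - V (τ, x)‖ₑ) := by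
  have hs0 : 0 < s := by linarith
  have hs1 : 1 ≤ s := by linarith
  obtain ⟨C₁, hC₁⟩ := exists_lnorm_duhMaj_le (n := n) hα hn hs1 (le_refl s)
  obtain ⟨C₂, hC₂⟩ := exists_lnorm_duhMaj_le (n := n) hα hn (s := s / (b + 1)) (p := s)
    (by rw [one_le_div (by linarith)]; exact hs) (div_le_self hs0.le (by linarith))
  obtain ⟨K, hK⟩ := hf.lipschitz 1 one_pos
  refine ⟨C₁ + K * C₂, fun t U V hU hV => ?_⟩
  have hwm : Measurable fun z => ‖U z - V z‖ₑ := (hU.sub hV).enorm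
  have hGm : Measurable fun z => (‖U z‖ₑ ^ b + ‖V z‖ₑ ^ b) * ‖U z - V z‖ₑ :=
    ((hU.enorm.pow_const b).add (hV.enorm.pow_const b)).mul hwm
  have hUt : ∀ τ, Measurable fun x => ‖U (τ, x)‖ₑ := fun τ => hU.enorm.comp measurable_prodMk_left
  have hVt : ∀ τ, Measurable fun x => ‖V (τ, x)‖ₑ := fun τ => hV.enorm.comp measurable_prodMk_left
  have hwt : ∀ τ, Measurable fun x => ‖U (τ, x) - V (τ, x)‖ₑ := fun τ =>
    hwm.comp measurable_prodMk_left
  have h1 : lnorm s volume (duhMaj n α t fun z => ‖f (U z) - f (V z)‖ₑ) ≤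
      lnorm s volume (duhMaj n α t fun z => ‖U z - V z‖ₑ) +
        K * lnorm s volume (duhMaj n α t fun z => (‖U z‖ₑ ^ b + ‖V z‖ₑ ^ b) * ‖U z - V z‖ₑ) := by
    rw [← lnorm_const_mul hs0 ENNReal.coe_ne_top]
    refine le_trans (lnorm_mono hs0 fun x => ?_) (lnorm_add_le hs1
      (measurable_duhMaj hwm t).aemeasurable ((measurable_duhMaj hGm t).const_mul _).aemeasurable)
    rw [← duhMaj_const_mul ENNReal.coe_ne_top, ← duhMaj_add hwm]
    refine duhMaj_mono_ae (fun τ _ => ae_of_all _ fun y => (hK _ _).trans (le_of_eq ?_)) x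
    rw [ENNReal.coe_one]
    ring
  set w : ℝ → ℝ≥0∞ := fun τ => lnorm s volume (fun x => ‖U (τ, x) - V (τ, x)‖ₑ) with hw
  set k : ℝ → ℝ≥0∞ := fun τ => lnorm s volume (fun x => ‖U (τ, x)‖ₑ) ^ b +
    lnorm s volume (fun x => ‖V (τ, x)‖ₑ) ^ b with hk
  have hwm' : Measurable w := measurable_lnorm_slice hwm
  have h2 : lnorm s volume (duhMaj n α t fun z => ‖U z - V z‖ₑ) ≤ C₁ * ∫⁻ τ in Ioo 0 t, w τ := by
    have := hC₁ t _ hwm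
    simpa using this
  have h3 : lnorm s volume (duhMaj n α t fun z => (‖U z‖ₑ ^ b + ‖V z‖ₑ ^ b) * ‖U z - V z‖ₑ) ≤
      C₂ * ∫⁻ τ in Ioo 0 t, ENNReal.ofReal ((t - τ) ^ (-(n / (2 * α) * b / s))) * (k τ * w τ) := by
    refine (hC₂ t _ hGm).trans ?_
    rw [show -(n / (2 * α) * (1 / (s / (b + 1)) - 1 / s)) = -(n / (2 * α) * b / s) by
      rw [one_div_div]; ring]
    gcongr with τ
    exact lnorm_power_mul_le hb (by linarith) (hUt τ) (hVt τ) (hwt τ)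
  calc _ ≤ C₁ * (∫⁻ τ in Ioo 0 t, w τ) + K * (C₂ * ∫⁻ τ in Ioo 0 t,
        ENNReal.ofReal ((t - τ) ^ (-(n / (2 * α) * b / s))) * (k τ * w τ)) :=
        h1.trans (add_le_add h2 (mul_le_mul_right h3 _))
    _ ≤ ((C₁ + K * C₂ : ℝ≥0) : ℝ≥0∞) * (∫⁻ τ in Ioo 0 t, w τ) +
        ((C₁ + K * C₂ : ℝ≥0) : ℝ≥0∞) * ∫⁻ τ in Ioo 0 t,
          ENNReal.ofReal ((t - τ) ^ (-(n / (2 * α) * b / s))) * (k τ * w τ) := by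
        rw [← mul_assoc, ← ENNReal.coe_mul]
        gcongr
        · exact le_self_add
        · exact le_add_self
    _ = _ := by
        rw [← mul_add, ← lintegral_add_left hwm']
        congr 1
        refine lintegral_congr fun τ => ?_
        ring

/-- Equivalent to γ(b+1) < 1. It makes the (b+1)st power of the L^s norm integrable in time. -/
theorem IsWeightedExponent.add_one_lt_time_exponent (he : IsWeightedExponent n α b r s) {Q : ℝ}
    (hQ0 : 0 < Q) (hQ : 1 / Q = n / (2 * α) * (1 / r - 1 / s)) : b + 1 < Q := by
  obtain ⟨hα, hn, hb, hs, hr, hbr, hrs, hsr⟩ := he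
  have hn' : (0 : ℝ) < n := by exact_mod_cast hn
  have hr0 : 0 < r := by linarith
  have hs0 : 0 < s := by linarith
  set m : ℝ := n / (2 * α) with hm
  have hm0 : 0 < m := by positivity
  have h1 : (b + 1) * (1 / Q) < 1 := by
    rw [hQ]
    have h2 : (b + 1) / s > 1 / r := by
      rw [gt_iff_lt, div_lt_div_iff₀ hr0 hs0]; linarith
    have h3 : (b + 1) * (1 / r - 1 / s) < b / r := by
      have : (b + 1) * (1 / r - 1 / s) = b / r + (1 / r - (b + 1) / s) := by ring
      linarith
    calc (b + 1) * (m * (1 / r - 1 / s)) = m * ((b + 1) * (1 / r - 1 / s)) := by ring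
      _ < m * (b / r) := by gcongr
      _ ≤ 1 := by rw [← mul_div_assoc, div_le_one hr0]; exact hbr
  rwa [mul_one_div, div_lt_one hQ0] at h1

/-- Local uniqueness in `L^Q((0,T); L^s)`. -/
theorem exists_ae_eq_of_lnorm_time_ne_top (he : IsWeightedExponent n α b r s)
    (hf : IsPowerSource b f) {Q T : ℝ} (hQ : 1 / Q = n / (2 * α) * (1 / r - 1 / s)) (hT : 0 < T)
    {U V : ℝ × Sp n → 𝕜} (hU : Measurable U) (hV : Measurable V)
    (hUQ : lnorm Q (volume.restrict (Ioo 0 T)) (fun t => lnorm s volume fun x => ‖U (t, x)‖ₑ) ≠ ∞)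
    (hVQ : lnorm Q (volume.restrict (Ioo 0 T)) (fun t => lnorm s volume fun x => ‖V (t, x)‖ₑ) ≠ ∞)
    (hle : ∀ t ∈ Ioo 0 T, ∀ᵐ x, ‖U (t, x) - V (t, x)‖ₑ ≤
      duhMaj n α t (fun z => ‖f (U z) - f (V z)‖ₑ) x) :
    ∃ h : ℝ, 0 < h ∧ ∀ᵐ t ∂(volume.restrict (Ioo 0 h)), ∀ᵐ x, U (t, x) = V (t, x) := by
  have he' := he
  obtain ⟨hα, hn, hb, hs, hr, hbr, hrs, hsr⟩ := he'
  have hn' : (0 : ℝ) < n := by exact_mod_cast hn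
  have hr0 : 0 < r := by linarith
  have hs0 : 0 < s := by linarith
  obtain ⟨C, hC⟩ := exists_lnorm_duhMaj_sub_le (n := n) hα hn hb hf hs
  set m : ℝ := n / (2 * α) with hm
  have hm0 : 0 < m := by positivity
  have hrs' : 0 < 1 / r - 1 / s := sub_pos.2 (one_div_lt_one_div_of_lt hr0 hrs)
  have hQ0 : 0 < Q := one_div_pos.1 (hQ ▸ by positivity)
  have hbQ : b + 1 < Q := he.add_one_lt_time_exponent hQ0 hQ
  obtain ⟨η, hη0, hη⟩ := exists_ae_eq_zero_of_le_fractional_integral hb hbQ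
  set w : ℝ → ℝ≥0∞ := fun τ => lnorm s volume (fun x => ‖U (τ, x) - V (τ, x)‖ₑ) with hw
  set NU : ℝ → ℝ≥0∞ := fun τ => lnorm s volume (fun x => ‖U (τ, x)‖ₑ) with hNU
  set NV : ℝ → ℝ≥0∞ := fun τ => lnorm s volume (fun x => ‖V (τ, x)‖ₑ) with hNV
  have hwm : Measurable fun z => ‖U z - V z‖ₑ := (hU.sub hV).enorm
  have hwm' : Measurable w := measurable_lnorm_slice hwm
  have hNUm : Measurable NU := measurable_lnorm_slice hU.enorm
  have hNVm : Measurable NV := measurable_lnorm_slice hV.enorm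
  set k : ℝ → ℝ≥0∞ := fun τ => C * (1 + (NU τ ^ b + NV τ ^ b)) with hk
  have hbm : Measurable fun τ => NU τ ^ b + NV τ ^ b := (hNUm.pow_const b).add (hNVm.pow_const b)
  have hkm : Measurable k := (measurable_const.add hbm).const_mul _
  have hQb : 1 ≤ Q / b := by rw [one_le_div hb]; linarith
  have hkT : lnorm (Q / b) (volume.restrict (Ioo 0 (min T 1))) k ≠ ∞ := by
    have hmono : ∀ g : ℝ → ℝ≥0∞, lnorm Q (volume.restrict (Ioo 0 T)) g ≠ ∞ →
        lnorm Q (volume.restrict (Ioo 0 (min T 1))) g ≠ ∞ := fun g hg =>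
      ne_top_of_le_ne_top hg (ENNReal.rpow_le_rpow (lintegral_mono_set
        (Ioo_subset_Ioo_right (min_le_left _ _))) (by positivity))
    have hpow : ∀ g : ℝ → ℝ≥0∞, lnorm Q (volume.restrict (Ioo 0 T)) g ≠ ∞ →
        lnorm (Q / b) (volume.restrict (Ioo 0 (min T 1))) (fun t => g t ^ b) ≠ ∞ := fun g hg => by
      rw [lnorm_rpow (by positivity) hb, div_mul_cancel₀ _ hb.ne']
      exact ENNReal.rpow_ne_top_of_nonneg hb.le (hmono g hg)
    rw [hk, lnorm_const_mul (by positivity) ENNReal.coe_ne_top]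
    refine ENNReal.mul_ne_top ENNReal.coe_ne_top (ne_top_of_le_ne_top ?_ (lnorm_add_le hQb
      measurable_const.aemeasurable hbm.aemeasurable))
    refine ENNReal.add_ne_top.2 ⟨?_, ne_top_of_le_ne_top ?_ (lnorm_add_le hQb
      (hNUm.pow_const b).aemeasurable (hNVm.pow_const b).aemeasurable)⟩
    · unfold lnorm
      rw [lintegral_const]
      exact ENNReal.rpow_ne_top_of_nonneg (by positivity) (by simp)
    · exact ENNReal.add_ne_top.2 ⟨hpow _ hUQ, hpow _ hVQ⟩
  obtain ⟨h, hh0, hhT, hkh⟩ := exists_lnorm_Ioo_le (by positivity) (lt_min hT one_pos) hkT hη0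
  have hwQ : lnorm Q (volume.restrict (Ioo 0 h)) w ≠ ∞ := by
    refine ne_top_of_le_ne_top (ENNReal.add_ne_top.2 ⟨hUQ, hVQ⟩) (le_trans (ENNReal.rpow_le_rpow
      (lintegral_mono_set (Ioo_subset_Ioo_right (hhT.trans (min_le_left _ _)))) (by positivity))
      (le_trans (lnorm_mono hQ0 fun t => ?_) (lnorm_add_le (by linarith) hNUm.aemeasurable
        hNVm.aemeasurable)))
    refine le_trans (lnorm_mono hs0 fun x => enorm_sub_le) (lnorm_add_le (by linarith)
      (hU.enorm.comp measurable_prodMk_left).aemeasurable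
      (hV.enorm.comp measurable_prodMk_left).aemeasurable)
  refine ⟨h, hh0, ?_⟩
  have hz := hη ((Ioo 0 h).indicator k) ((Ioo 0 h).indicator w) (hkm.indicator measurableSet_Ioo)
    (hwm'.indicator measurableSet_Ioo) (by rwa [lnorm_indicator hQ0 measurableSet_Ioo])
    (by rwa [lnorm_indicator (by positivity) measurableSet_Ioo]) (ae_of_all _ fun t => ?_)
  · rw [ae_restrict_iff' measurableSet_Ioo]
    filter_upwards [hz] with t ht hth
    rw [indicator_of_mem hth] at ht
    have hwt : Measurable fun x => ‖U (t, x) - V (t, x)‖ₑ := hwm.comp measurable_prodMk_left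
    have := lnorm_rpow_self (μ := (volume : Measure (Sp n))) hs0 fun x => ‖U (t, x) - V (t, x)‖ₑ
    rw [show lnorm s volume (fun x => ‖U (t, x) - V (t, x)‖ₑ) = 0 from ht,
      ENNReal.zero_rpow_of_pos hs0, eq_comm,
      lintegral_eq_zero_iff (hwt.pow_const s)] at this
    filter_upwards [this] with x hx
    simpa [hs0, hs0.not_gt, sub_eq_zero] using hx
  · by_cases ht : t ∈ Ioo 0 h
    swap
    · rw [indicator_of_notMem ht]
      exact zero_le
    rw [indicator_of_mem ht]
    have ht' : t ∈ Ioo 0 T := ⟨ht.1, ht.2.trans_le (hhT.trans (min_le_left _ _))⟩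
    refine (lnorm_mono_ae hs0 (hle t ht')).trans ((hC t U V hU hV).trans ?_)
    rw [← lintegral_const_mul' _ _ ENNReal.coe_ne_top, ← lintegral_indicator measurableSet_Ioo,
      ← lintegral_indicator measurableSet_Iio]
    refine lintegral_mono fun τ => ?_
    by_cases hτ : τ ∈ Ioo 0 t
    swap
    · rw [indicator_of_notMem hτ]
      exact zero_le
    have hτh : τ ∈ Ioo 0 h := ⟨hτ.1, hτ.2.trans ht.2⟩
    rw [indicator_of_mem hτ, indicator_of_mem (show τ ∈ Iio t from hτ.2), indicator_of_mem hτh,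
      indicator_of_mem hτh]
    have hd0 : 0 < t - τ := sub_pos.2 hτ.2
    have hd1 : t - τ ≤ 1 := by
      have := hτ.1
      have := ht.2
      have := hhT.trans (min_le_right _ _)
      linarith
    -- By the definition of Q this is mb ≤ r again, with equality in the critical case. As t-τ ≤ 1,
    -- both singularities are dominated by the critical one.
    have hexp : m * b / s ≤ 1 - b / Q := by
      rw [div_eq_mul_one_div b Q, hQ]
      have : m * b / r ≤ 1 := (div_le_one hr0).2 hbr
      have e : b * (m * (1 / r - 1 / s)) = m * b / r - m * b / s := by ring
      linarith
    have hbQ1 : 0 ≤ 1 - b / Q := by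
      rw [sub_nonneg, div_le_one hQ0]; linarith
    have k1 : 1 ≤ ENNReal.ofReal ((t - τ) ^ (-(1 - b / Q))) := by
      rw [ENNReal.one_le_ofReal]
      exact Real.one_le_rpow_of_pos_of_le_one_of_nonpos hd0 hd1 (by linarith)
    have k2 : ENNReal.ofReal ((t - τ) ^ (-(m * b / s))) ≤
        ENNReal.ofReal ((t - τ) ^ (-(1 - b / Q))) :=
      ENNReal.ofReal_le_ofReal (Real.rpow_le_rpow_of_exponent_ge hd0 hd1 (by linarith))
    set E := ENNReal.ofReal ((t - τ) ^ (-(1 - b / Q))) with hE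
    calc C * ((1 + ENNReal.ofReal ((t - τ) ^ (-(m * b / s))) * (NU τ ^ b + NV τ ^ b)) * w τ)
        ≤ C * ((E + E * (NU τ ^ b + NV τ ^ b)) * w τ) := by gcongr
      _ = E * (C * (1 + (NU τ ^ b + NV τ ^ b)) * w τ) := by ring

end LocalUniqueness

/-! ### Uniqueness on the whole interval. -/

section Solutions

variable {n : ℕ} {α : ℝ} {𝕜 : Type*} [RCLike 𝕜] {b b₁ b₂ r p : ℝ} {q : ℝ≥0∞} {f : 𝕜 → 𝕜}

theorem IsMildSolution.initial {φ : LSpace 𝕜 n r} {T : ℝ≥0∞} {u : ℝ → LSpace 𝕜 n r}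
    (hu : IsMildSolution α f φ T u) (hT : 0 < T) : u 0 = φ := by
  refine Lp.ext ?_
  filter_upwards [hu 0 ⟨le_rfl, by simpa using hT⟩] with x hx
  simpa [semigroup_zero] using hx.2.2

/-- The difference of two mild solutions that agree up to time `s`. -/
theorem IsMildSolution.enorm_sub_le {φ : LSpace 𝕜 n r} {T : ℝ≥0∞}
    {u v : ℝ → LSpace 𝕜 n r} (hu : IsMildSolution α f φ T u) (hv : IsMildSolution α f φ T v)
    {s R : ℝ} (hs : 0 ≤ s) (hR : R ∈ timeInterval T) (huv : ∀ τ ∈ Icc 0 s, u τ = v τ)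
    {U V : ℝ × Sp n → 𝕜}
    (huU : ∀ t ∈ Ico 0 R, ∀ᵐ x, u t x = U (t, x)) (hvV : ∀ t ∈ Ico 0 R, ∀ᵐ x, v t x = V (t, x))
    {t : ℝ} (ht : t ∈ Ioo 0 (R - s)) :
    ∀ᵐ x, ‖U (s + t, x) - V (s + t, x)‖ₑ ≤
      duhMaj n α t (fun z => ‖f (U (s + z.1, z.2)) - f (V (s + z.1, z.2))‖ₑ) x := by
  have hst : s + t ∈ Ico 0 R := ⟨by linarith [ht.1], by linarith [ht.2]⟩
  have hstT : s + t ∈ timeInterval T :=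
    ⟨hst.1, (ENNReal.ofReal_le_ofReal hst.2.le).trans_lt hR.2⟩
  filter_upwards [huU _ hst, hvV _ hst, hu _ hstT, hv _ hstT] with x h1 h2 h3 h4
  obtain ⟨a1, a2, a3⟩ := h3
  obtain ⟨c1, c2, c3⟩ := h4
  rw [← h1, ← h2, a3, c3, add_sub_add_left_eq_sub, ← integral_sub a2 c2]
  refine (enorm_integral_le_lintegral_enorm _).trans ?_
  have hsplit : Ioo 0 (s + t) ⊆ Ioc 0 s ∪ Ioo s (s + t) := by
    intro τ hτ
    rcases le_or_gt τ s with h | h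
    · exact Or.inl ⟨hτ.1, h⟩
    · exact Or.inr ⟨h, hτ.2⟩
  refine (lintegral_mono_set hsplit).trans ((lintegral_union_le _ _ _).trans ?_)
  have hz : ∫⁻ τ in Ioc 0 s, ‖semigroup α (s + t - τ) (fun y => f (u τ y)) x -
      semigroup α (s + t - τ) (fun y => f (v τ y)) x‖ₑ = 0 := by
    rw [setLIntegral_congr_fun (g := fun _ => 0) measurableSet_Ioc fun τ hτ => ?_]
    · simp
    · simp only [huv τ ⟨hτ.1.le, hτ.2⟩, sub_self, enorm_zero]
  rw [hz, zero_add]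
  unfold duhMaj
  have e := lintegral_Ioo_shift (fun τ => heatMaj n α (s + t - τ)
    (fun y => ‖f (U (τ, y)) - f (V (τ, y))‖ₑ) x) s t
  simp only [add_sub_add_left_eq_sub] at e
  rw [← e]
  have hsub : Ioo s (s + t) ⊆ Ioo 0 (s + t) := Ioo_subset_Ioo_left hs
  refine lintegral_mono_ae ?_
  filter_upwards [ae_restrict_of_ae_restrict_of_subset hsub a1,
    ae_restrict_of_ae_restrict_of_subset hsub c1, ae_restrict_mem measurableSet_Ioo] with τ k1 k2 hτ
  have hτ0 : 0 < s + t - τ := sub_pos.2 hτ.2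
  have hτR : τ ∈ Ico 0 R := ⟨hs.trans hτ.1.le, hτ.2.trans hst.2⟩
  have e2 : semigroup α (s + t - τ) (fun y => f (u τ y)) x -
      semigroup α (s + t - τ) (fun y => f (v τ y)) x =
      semigroup α (s + t - τ) (fun y => f (U (τ, y)) - f (V (τ, y))) x := by
    rw [semigroup_of_pos hτ0, semigroup_of_pos hτ0, semigroup_of_pos hτ0, ← integral_sub k1 k2]
    refine integral_congr_ae ?_
    filter_upwards [huU τ hτR, hvV τ hτR] with y hy hy'
    rw [hy, hy', smul_sub]
  rw [e2]
  exact enorm_semigroup_le hτ0 _ x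

theorem exists_weighted_exponent_lt (hα : 0 < α) (hn : 0 < n) (hb : 0 < b) (hr : 1 < r)
    (hbr : n / (2 * α) * b ≤ r) (hrp : r < p) (hp : b + 1 < p) :
    ∃ s, IsWeightedExponent n α b r s ∧ s < p := by
  obtain ⟨s, hs, hs'⟩ := exists_between (show max r (b + 1) < min p (r * (b + 1)) from
    max_lt (lt_min hrp (by nlinarith)) (lt_min hp (by nlinarith)))
  obtain ⟨h1, h2⟩ := max_lt_iff.1 hs
  obtain ⟨h3, h4⟩ := lt_min_iff.1 hs'
  exact ⟨s, ⟨hα, hn, hb, h2.le, hr, hbr, h1, h4⟩, h3⟩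

variable [Fact (1 ≤ ENNReal.ofReal r)]

theorem MemX.exists_enorm_le {T : ℝ≥0∞} {u : ℝ → LSpace 𝕜 n r} (hu : MemX q p T u) {R : ℝ}
    (hR : R ∈ timeInterval T) : ∃ M : ℝ≥0∞, M ≠ ∞ ∧ ∀ t ∈ Icc 0 R, ‖u t‖ₑ ≤ M := by
  have hsub : Icc 0 R ⊆ timeInterval T := fun t ht =>
    ⟨ht.1, (ENNReal.ofReal_le_ofReal ht.2).trans_lt hR.2⟩
  obtain ⟨C, hC⟩ := isCompact_Icc.exists_bound_of_continuousOn (hu.1.mono hsub)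
  refine ⟨ENNReal.ofReal C, ENNReal.ofReal_ne_top, fun t ht => ?_⟩
  rw [← ofReal_norm]
  exact ENNReal.ofReal_le_ofReal (hC t ht)

/-- Interpolation between `L^∞_t L^r_x` and `L^q_t L^p_x`. -/
theorem MemX.lnorm_time_ne_top (hadm : IsAdmissible n α q p r) (hα : 0 < α) (hn : 0 < n) {T : ℝ≥0∞}
    {u : ℝ → LSpace 𝕜 n r} (hu : MemX q p T u) {R : ℝ} (hR : R ∈ timeInterval T) {s Q : ℝ}
    (hrs : r < s) (hsp : s < p) (hQ : 1 / Q = n / (2 * α) * (1 / r - 1 / s)) :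
    lnorm Q (volume.restrict (Ioo 0 R)) (fun t => lnorm s volume fun x => ‖u t x‖ₑ) ≠ ∞ := by
  have hr0 : 0 < r := by linarith [hadm.one_lt]
  have hn' : (0 : ℝ) < n := by exact_mod_cast hn
  have hs0 : 0 < s := by linarith
  have hp0 : 0 < p := by linarith
  obtain ⟨M, hM, hMu⟩ := hu.exists_enorm_le hR
  obtain ⟨P, hP, hqP, hPe⟩ : ∃ P : ℝ, r < P ∧ q = ENNReal.ofReal P ∧
      1 / P = n / (2 * α) * (1 / r - 1 / p) := by
    rcases hadm.exponent hα hn with h | h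
    · linarith [h.1]
    · exact h.2
  have hP0 : 0 < P := by linarith
  set m : ℝ := n / (2 * α) with hm
  have hm0 : 0 < m := by positivity
  have h1 : 0 < 1 / r - 1 / s := sub_pos.2 (one_div_lt_one_div_of_lt hr0 hrs)
  have h2 : 1 / r - 1 / s < 1 / r - 1 / p := by linarith [one_div_lt_one_div_of_lt hs0 hsp]
  have hQ0 : 0 < Q := one_div_pos.1 (hQ ▸ by positivity)
  -- The interpolation parameter between L^r and L^p; the scaling relations give θQ = P, so the L^p
  -- norm enters to the integrable power P.
  set θ : ℝ := (1 / r - 1 / s) / (1 / r - 1 / p) with hθ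
  have hd : 0 < 1 / r - 1 / p := h1.trans h2
  have hθ0 : 0 < θ := by positivity
  have hθ1 : θ < 1 := by rw [hθ, div_lt_one hd]; exact h2
  have hθe : θ * (1 / r - 1 / p) = 1 / r - 1 / s := div_mul_cancel₀ _ hd.ne'
  have hθQ : θ * Q = P := by
    have e : θ * (1 / P) = 1 / Q := by rw [hPe, hQ, ← hθe]; ring
    field_simp at e
    linarith
  set N : ℝ → ℝ≥0∞ := fun t => lnorm p volume fun x => ‖u t x‖ₑ with hN
  have hNfin : ∫⁻ t in Ioo 0 R, N t ^ P ≠ ∞ := by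
    have h3 := hu.2
    rw [hqP] at h3
    have h4 : eLpNorm N (ENNReal.ofReal P) (volume.restrict (timeInterval (ENNReal.ofReal R))) ≠ ∞ := by
      refine ne_top_of_le_ne_top h3.ne ?_
      refine le_trans (eLpNorm_mono_measure _ (Measure.restrict_mono (timeInterval_mono hR.2.le)
        le_rfl)) (le_of_eq ?_)
      simp_rw [hN, ← eLpNorm_eq_lnorm hp0]
    rw [eLpNorm_timeInterval hP0] at h4
    rw [← lnorm_rpow_self hP0]
    exact ENNReal.rpow_ne_top_of_nonneg hP0.le h4
  have hle : ∀ t ∈ Ioo 0 R, (lnorm s volume fun x => ‖u t x‖ₑ) ^ Q ≤ M ^ ((1 - θ) * Q) * N t ^ P := by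
    intro t ht
    have h5 := lnorm_interpolate (μ := (volume : Measure (Sp n))) (p := s) hr0 hp0 hθ0 hθ1
      (by clear_value θ; linear_combination hθe) (g := fun x => ‖u t x‖ₑ) (measurable_LSpace (u t)).enorm.aemeasurable
    rw [← enorm_LSpace hr0] at h5
    calc _ ≤ (‖u t‖ₑ ^ (1 - θ) * N t ^ θ) ^ Q := by gcongr
      _ = ‖u t‖ₑ ^ ((1 - θ) * Q) * N t ^ P := by
          rw [ENNReal.mul_rpow_of_nonneg _ _ hQ0.le, ← ENNReal.rpow_mul, ← ENNReal.rpow_mul, hθQ]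
      _ ≤ _ := by
          have : 0 ≤ (1 - θ) * Q := by nlinarith
          gcongr
          exact hMu t ⟨ht.1.le, ht.2.le⟩
  unfold lnorm
  refine ENNReal.rpow_ne_top_of_nonneg (by positivity) (ne_top_of_le_ne_top ?_
    (setLIntegral_mono' measurableSet_Ioo hle))
  have hc : M ^ ((1 - θ) * Q) ≠ ∞ := ENNReal.rpow_ne_top_of_nonneg (by nlinarith) hM
  rw [lintegral_const_mul' _ _ hc]
  exact ENNReal.mul_ne_top hc hNfin

/-- Uniqueness of mild solutions. -/
theorem IsSolutionX.eqOn (hα : 0 < α) (hn : 0 < n) (hb₂ : 0 < b₂) (hb : b₂ < b₁)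
    (hbr : n / (2 * α) * b₁ ≤ r) (hadm : IsAdmissible n α q p r) (hp : b₁ + 1 < p)
    (hf : IsPowerSource b₁ f) {K : ℝ≥0} (hfK : ∀ u v : 𝕜, ‖f u - f v‖ₑ ≤
      K * ((‖u‖ₑ ^ b₁ + ‖v‖ₑ ^ b₁) + (‖u‖ₑ ^ b₂ + ‖v‖ₑ ^ b₂)) * ‖u - v‖ₑ)
    {φ : LSpace 𝕜 n r} {T : ℝ≥0∞} {u v : ℝ → LSpace 𝕜 n r} (hu : IsSolutionX α q p f φ T u)
    (hv : IsSolutionX α q p f φ T v) : EqOn u v (timeInterval T) := by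
  intro R hR
  have hr0 : 0 < r := by linarith [hadm.one_lt]
  have hIcc : Icc 0 R ⊆ timeInterval T := fun t ht =>
    ⟨ht.1, (ENNReal.ofReal_le_ofReal ht.2).trans_lt hR.2⟩
  have huc := hu.1.1.mono hIcc
  have hvc := hv.1.1.mono hIcc
  -- Continuous induction: the set of times up to which both solutions agree is closed within [0,R],
  -- contains 0, and extends to the right of each of its points below R.
  set A : Set ℝ := {x | ∀ τ ∈ Icc 0 x, u τ = v τ} with hA
  have hT : 0 < T := zero_le.trans_lt hR.2
  have hEc : IsClosed {x ∈ Icc 0 R | u x = v x} := by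
    exact (huc.prodMk hvc).preimage_isClosed_of_isClosed isClosed_Icc isClosed_diagonal
  have key : Icc 0 R ⊆ A := by
    refine IsClosed.Icc_subset_of_forall_exists_gt ?_ ?_ ?_
    · refine isClosed_of_closure_subset fun x hx => ?_
      have hx' : x ∈ {x ∈ Icc 0 R | u x = v x} := by
        refine closure_minimal (fun y hy => ?_) hEc hx
        exact ⟨hy.2, hy.1 y ⟨hy.2.1, le_rfl⟩⟩
      refine ⟨fun τ hτ => ?_, hx'.1⟩
      rcases hτ.2.eq_or_lt with h | h
      · rw [h]; exact hx'.2
      · obtain ⟨y, hy, hyA⟩ := mem_closure_iff.1 hx (Ioi τ) isOpen_Ioi h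
        exact hyA.1 τ ⟨hτ.1, le_of_lt hy⟩
    · intro τ hτ
      rw [le_antisymm hτ.2 hτ.1, hu.2.initial hT, hv.2.initial hT]
    · rintro s ⟨hsA, hs⟩ y hy
      have hs0 : 0 ≤ s := hs.1
      have hsR : 0 < R - s := sub_pos.2 hs.2
      suffices h : ∃ h > 0, h ≤ R - s ∧ ∀ τ ∈ Ioo 0 h, u (s + τ) = v (s + τ) by
        obtain ⟨h, hh0, hhR, hh⟩ := h
        have hys : 0 < y - s := sub_pos.2 hy
        have hmin : 0 < min h (y - s) := lt_min hh0 hys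
        refine ⟨s + min h (y - s) / 2, fun τ hτ => ?_, by linarith, by
          linarith [min_le_right h (y - s)]⟩
        rcases le_or_gt τ s with h' | h'
        · exact hsA τ ⟨hτ.1, h'⟩
        · have := hh (τ - s) ⟨by linarith, by linarith [hτ.2, min_le_left h (y - s)]⟩
          rwa [add_sub_cancel] at this
      obtain ⟨U, hU, huU⟩ := exists_measurable_representative measurableSet_Icc huc
      obtain ⟨V, hV, hvV⟩ := exists_measurable_representative measurableSet_Icc hvc
      have hmap : Measurable fun z : ℝ × Sp n => (s + z.1, z.2) := by fun_prop
      have hUs : Measurable fun z : ℝ × Sp n => U (s + z.1, z.2) := hU.comp hmap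
      have hVs : Measurable fun z : ℝ × Sp n => V (s + z.1, z.2) := hV.comp hmap
      have hle := fun t (ht : t ∈ Ioo 0 (R - s)) => hu.2.enorm_sub_le hv.2 hs0 hR hsA
        (fun t ht => huU t ⟨ht.1, ht.2.le⟩) (fun t ht => hvV t ⟨ht.1, ht.2.le⟩) ht
      have hmem : ∀ t ∈ Ioo 0 (R - s), s + t ∈ Icc 0 R := fun t ht =>
        ⟨by linarith [ht.1], by linarith [ht.2]⟩
      have hLp : ∀ t ∈ Ioo 0 (R - s), (∀ᵐ x, U (s + t, x) = V (s + t, x)) → u (s + t) = v (s + t) := by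
        intro t ht h
        refine Lp.ext ?_
        filter_upwards [h, huU _ (hmem t ht), hvV _ (hmem t ht)] with x h1 h2 h3
        rw [h2, h3, h1]
      -- For p = r the condition on p reads r > b₁+1, and continuity in L^r suffices. For p > r
      -- there is an s < p with s ≥ b₁+1, and interpolation with L^q_t L^p_x gives integrability in
      -- time.
      rcases hadm.le.eq_or_lt with hrp | hrp
      · have htend : ∀ {w : ℝ → LSpace 𝕜 n r} {W : ℝ × Sp n → 𝕜}, ContinuousOn w (Icc 0 R) →
            (∀ t ∈ Icc 0 R, ∀ᵐ x, w t x = W (t, x)) →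
            Tendsto (fun t => lnorm r volume (fun x => ‖W (s + t, x) - w s x‖ₑ)) (𝓝[>] 0) (𝓝 0) := by
          intro w W hw hW
          have h1 := hw s ⟨hs0, hs.2.le⟩
          rw [ContinuousWithinAt, tendsto_iff_edist_tendsto_0] at h1
          have h2 : Tendsto (fun t => s + t) (𝓝[>] 0) (𝓝[Icc 0 R] s) := by
            refine tendsto_nhdsWithin_iff.2 ⟨?_, ?_⟩
            · have : Tendsto (fun t => s + t) (𝓝 0) (𝓝 (s + 0)) := by
                exact (continuous_const.add continuous_id).tendsto 0
              rw [add_zero] at this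
              exact this.mono_left nhdsWithin_le_nhds
            · filter_upwards [Ioo_mem_nhdsGT hsR] with t ht using hmem t ht
          refine (h1.comp h2).congr' ?_
          filter_upwards [Ioo_mem_nhdsGT hsR] with t ht
          rw [Function.comp_apply, edist_LSpace hr0]
          refine lnorm_congr_ae _ ?_
          filter_upwards [hW _ (hmem t ht)] with x hx
          rw [hx]
        have hvt := htend hvc hvV
        rw [← hsA s ⟨hs0, le_rfl⟩] at hvt
        obtain ⟨h, hh0, hh⟩ := exists_ae_eq_of_tendsto hα hn hb₂ hb (hrp ▸ hp) hbr hfK hsR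
          (measurable_LSpace (u s)) (lnorm_LSpace_ne_top hr0 (u s)) hUs hVs (htend huc huU) hvt hle
        exact ⟨min h (R - s), lt_min hh0 hsR, min_le_right _ _, fun τ hτ =>
          hLp τ ⟨hτ.1, hτ.2.trans_le (min_le_right _ _)⟩
            (hh τ ⟨hτ.1, hτ.2.trans_le (min_le_left _ _)⟩)⟩
      · obtain ⟨σ, he, hσp⟩ := exists_weighted_exponent_lt hα hn (hb₂.trans hb) hadm.one_lt hbr hrp hp
        have hn' : (0 : ℝ) < n := by exact_mod_cast hn
        have h1 : 0 < 1 / r - 1 / σ := sub_pos.2 (one_div_lt_one_div_of_lt hr0 he.lt)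
        set Q : ℝ := 1 / (n / (2 * α) * (1 / r - 1 / σ)) with hQ
        have hQ0 : 0 < Q := by positivity
        have hQe : 1 / Q = n / (2 * α) * (1 / r - 1 / σ) := by rw [hQ, one_div_one_div]
        have hfin : ∀ {w : ℝ → LSpace 𝕜 n r} {W : ℝ × Sp n → 𝕜}, MemX q p T w →
            (∀ t ∈ Icc 0 R, ∀ᵐ x, w t x = W (t, x)) → lnorm Q (volume.restrict (Ioo 0 (R - s)))
              (fun t => lnorm σ volume fun x => ‖W (s + t, x)‖ₑ) ≠ ∞ := by
          intro w W hw hW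
          refine ne_top_of_le_ne_top (hw.lnorm_time_ne_top hadm hα hn hR he.lt hσp hQe) ?_
          have e := lintegral_Ioo_shift (fun t => (lnorm σ volume fun x => ‖W (t, x)‖ₑ) ^ Q) s (R - s)
          unfold lnorm at e ⊢
          rw [← e, add_sub_cancel]
          refine ENNReal.rpow_le_rpow ?_ (by positivity)
          refine (lintegral_mono_set (Ioo_subset_Ioo_left hs0)).trans
            (setLIntegral_mono' measurableSet_Ioo fun t ht => le_of_eq ?_)
          congr 2
          refine lintegral_congr_ae ?_
          filter_upwards [hW t ⟨ht.1.le, ht.2.le⟩] with x hx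
          rw [hx]
        obtain ⟨h, hh0, hh⟩ := exists_ae_eq_of_lnorm_time_ne_top he hf hQe hsR hUs hVs
          (hfin hu.1 huU) (hfin hv.1 hvV) hle
        have hcont : ∀ {w : ℝ → LSpace 𝕜 n r}, ContinuousOn w (Icc 0 R) →
            ContinuousOn (fun t => w (s + t)) (Ioo 0 (min h (R - s))) := fun hw =>
          hw.comp (by fun_prop) fun t ht => hmem t ⟨ht.1, ht.2.trans_le (min_le_right _ _)⟩
        -- Agreement at almost every time becomes agreement at every time by continuity into L^r.
        refine ⟨min h (R - s), lt_min hh0 hsR, min_le_right _ _,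
          Measure.eqOn_open_of_ae_eq (μ := volume) ?_ isOpen_Ioo (hcont huc) (hcont hvc)⟩
        filter_upwards [ae_restrict_of_ae_restrict_of_subset
          (Ioo_subset_Ioo_right (min_le_left h (R - s))) hh, ae_restrict_mem measurableSet_Ioo]
          with t h1 ht
        exact hLp t ⟨ht.1, ht.2.trans_le (min_le_right _ _)⟩ h1
  exact key ⟨hR.1, le_rfl⟩ R ⟨hR.1, le_rfl⟩

end Solutions

/-! ### Restriction and continuation of solutions. -/

section Gluing

variable {n : ℕ} {α : ℝ} {𝕜 : Type*} [RCLike 𝕜] {b r p : ℝ} {q : ℝ≥0∞} {f : 𝕜 → 𝕜}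

/-- The integral equation of a mild solution at time `t`. -/
def MildAt (α : ℝ) (f : 𝕜 → 𝕜) (φ : LSpace 𝕜 n r) (u : ℝ → LSpace 𝕜 n r) (t : ℝ) : Prop :=
  ∀ᵐ x : Sp n,
    (∀ᵐ τ ∂(volume.restrict (Ioo 0 t)),
      Integrable (fun y => kernel n α (t - τ) (x - y) • f (u τ y))) ∧
    IntegrableOn (fun τ => semigroup α (t - τ) (fun y => f (u τ y)) x) (Ioo 0 t) ∧
    u t x = semigroup α t φ x + ∫ τ in Ioo 0 t, semigroup α (t - τ) (fun y => f (u τ y)) x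

theorem MildAt.congr {φ : LSpace 𝕜 n r} {u v : ℝ → LSpace 𝕜 n r} {t : ℝ} (ht : 0 ≤ t)
    (hu : MildAt α f φ u t) (h : EqOn v u (Icc 0 t)) : MildAt α f φ v t := by
  have hτ : ∀ τ ∈ Ioo 0 t, v τ = u τ := fun τ hτ => h ⟨hτ.1.le, hτ.2.le⟩
  filter_upwards [hu] with x hx
  refine ⟨?_, hx.2.1.congr_fun (fun τ h' => by simp only [hτ τ h']) measurableSet_Ioo, ?_⟩
  · filter_upwards [hx.1, ae_restrict_mem measurableSet_Ioo] with τ h1 h2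
    rwa [hτ τ h2]
  · rw [h ⟨ht, le_rfl⟩, hx.2.2]
    congr 1
    exact setIntegral_congr_fun measurableSet_Ioo fun τ h' => by simp only [hτ τ h']

theorem lintegral_Ioo_add_le (g : ℝ → ℝ≥0∞) (s h : ℝ) :
    ∫⁻ t in Ioo 0 (s + h), g t ≤ (∫⁻ t in Ioo 0 s, g t) + ∫⁻ t in Ioo 0 h, g (s + t) := by
  have hsplit : Ioo 0 (s + h) ⊆ Ioc 0 s ∪ Ioo s (s + h) := by
    intro τ hτ
    rcases le_or_gt τ s with h | h
    · exact Or.inl ⟨hτ.1, h⟩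
    · exact Or.inr ⟨h, hτ.2⟩
  refine (lintegral_mono_set hsplit).trans ((lintegral_union_le _ _ _).trans (le_of_eq ?_))
  rw [lintegral_Ioo_shift, setLIntegral_congr Ioo_ae_eq_Ioc.symm]

/-- Finiteness of the Duhamel integral of a nonlinearity of power growth. -/
theorem duhMaj_source_finite (hα : 0 < α) (hn : 0 < n) (hb : 0 < b) (hf : IsPowerSource b f)
    (hr : 1 ≤ r) {s : ℝ} (hs : b + 1 ≤ s) {t : ℝ} {W : ℝ × Sp n → 𝕜} (hW : Measurable W)
    (h1 : ∫⁻ τ in Ioo 0 t, lnorm r volume (fun x => ‖W (τ, x)‖ₑ) ≠ ∞)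
    (h2 : ∫⁻ τ in Ioo 0 t, lnorm s volume (fun x => ‖W (τ, x)‖ₑ) ^ (b + 1) ≠ ∞) :
    (∀ᵐ x, duhMaj n α t (fun z => ‖f (W z)‖ₑ) x < ∞) ∧
      ∀ h : ℝ, 0 < h → ∀ᵐ x, heatMaj n α h (duhMaj n α t fun z => ‖f (W z)‖ₑ) x < ∞ := by
  have hs0 : 0 < s := by linarith
  have hsb : 1 ≤ s / (b + 1) := by rw [one_le_div (by linarith)]; exact hs
  obtain ⟨C₁, hC₁⟩ := exists_lnorm_duhMaj_le (n := n) hα hn hr (le_refl r)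
  obtain ⟨C₂, hC₂⟩ := exists_lnorm_duhMaj_le (n := n) hα hn hsb le_rfl
  obtain ⟨K, hK⟩ := hf.lipschitz 1 one_pos
  have hWm : Measurable fun z => ‖W z‖ₑ := hW.enorm
  have hPm : Measurable fun z => ‖W z‖ₑ ^ (b + 1) := hWm.pow_const _
  have hle : ∀ z, ‖f (W z)‖ₑ ≤ ‖W z‖ₑ + K * ‖W z‖ₑ ^ (b + 1) := fun z => by
    have := hK (W z) 0
    rw [hf.map_zero, sub_zero, sub_zero, enorm_zero, ENNReal.zero_rpow_of_pos hb, add_zero,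
      ENNReal.coe_one] at this
    refine this.trans (le_of_eq ?_)
    rw [ENNReal.rpow_add_of_nonneg _ _ hb.le zero_le_one, ENNReal.rpow_one]
    ring
  have hdle : ∀ x, duhMaj n α t (fun z => ‖f (W z)‖ₑ) x ≤ duhMaj n α t (fun z => ‖W z‖ₑ) x +
      K * duhMaj n α t (fun z => ‖W z‖ₑ ^ (b + 1)) x := fun x => by
    rw [← duhMaj_const_mul ENNReal.coe_ne_top, ← duhMaj_add hWm]
    exact duhMaj_mono_ae (fun τ _ => ae_of_all _ fun y => hle _) x
  have k1 : lnorm r volume (duhMaj n α t fun z => ‖W z‖ₑ) ≠ ∞ := by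
    refine ne_top_of_le_ne_top (ENNReal.mul_ne_top (ENNReal.coe_ne_top (r := C₁)) h1) ((hC₁ t _ hWm).trans ?_)
    simp
  have k2 : lnorm (s / (b + 1)) volume (duhMaj n α t fun z => ‖W z‖ₑ ^ (b + 1)) ≠ ∞ := by
    refine ne_top_of_le_ne_top (ENNReal.mul_ne_top (ENNReal.coe_ne_top (r := C₂)) h2) ((hC₂ t _ hPm).trans ?_)
    simp_rw [lnorm_rpow (show 0 < s / (b + 1) by positivity) (show 0 < b + 1 by linarith),
      div_mul_cancel₀ s (show b + 1 ≠ 0 by linarith)]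
    simp
  have m1 : Measurable (duhMaj n α t fun z => ‖W z‖ₑ) := measurable_duhMaj hWm t
  have m2 : Measurable (duhMaj n α t fun z => ‖W z‖ₑ ^ (b + 1)) := measurable_duhMaj hPm t
  refine ⟨?_, fun h hh => ?_⟩
  · filter_upwards [ae_lt_top_of_lnorm (by linarith) m1 k1, ae_lt_top_of_lnorm (by linarith) m2 k2]
      with x a1 a2
    exact (hdle x).trans_lt (by finiteness)
  · filter_upwards [ae_heatMaj_lt_top hα hn hr hh m1 k1, ae_heatMaj_lt_top hα hn hsb hh m2 k2]
      with x a1 a2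
    refine (heatMaj_mono_ae (ae_of_all _ hdle) x).trans_lt ?_
    rw [heatMaj_add m1, heatMaj_const_mul ENNReal.coe_ne_top]
    finiteness

variable [Fact (1 ≤ ENNReal.ofReal r)]

theorem MemX.mono {S T : ℝ≥0∞} (h : S ≤ T) {u : ℝ → LSpace 𝕜 n r} (hu : MemX q p T u) :
    MemX q p S u :=
  ⟨hu.1.mono (timeInterval_mono h), (eLpNorm_mono_measure _ (Measure.restrict_mono
    (timeInterval_mono h) le_rfl)).trans_lt hu.2⟩

theorem IsSolutionX.mono {S T : ℝ≥0∞} (h : S ≤ T) {φ : LSpace 𝕜 n r} {u : ℝ → LSpace 𝕜 n r}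
    (hu : IsSolutionX α q p f φ T u) : IsSolutionX α q p f φ S u :=
  ⟨hu.1.mono h, fun t ht => hu.2 t (timeInterval_mono h ht)⟩

theorem IsSolutionX.congr {T : ℝ≥0∞} {φ : LSpace 𝕜 n r} {u v : ℝ → LSpace 𝕜 n r}
    (hu : IsSolutionX α q p f φ T u) (h : EqOn v u (timeInterval T)) : IsSolutionX α q p f φ T v := by
  refine ⟨⟨hu.1.1.congr h, ?_⟩, fun t ht => ?_⟩
  · refine (eLpNorm_congr_ae ?_).trans_lt hu.1.2
    filter_upwards [ae_restrict_mem (measurableSet_timeInterval T)] with t ht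
    rw [h ht]
  · exact MildAt.congr ht.1 (hu.2 t ht) fun τ hτ =>
      h ⟨hτ.1, (ENNReal.ofReal_le_ofReal hτ.2).trans_lt ht.2⟩

/-- This is where p > b+1 enters continuation: it makes the source absolutely integrable for every
member of X, not only for the constructed solutions. -/
theorem MemX.exists_lintegral_rpow_ne_top (hα : 0 < α) (hn : 0 < n) (hb : 0 < b)
    (hbr : n / (2 * α) * b ≤ r) (hadm : IsAdmissible n α q p r) (hp : b + 1 < p) {T : ℝ≥0∞}
    {u : ℝ → LSpace 𝕜 n r} (hu : MemX q p T u) {R : ℝ} (hR : R ∈ timeInterval T) :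
    (∫⁻ t in Ioo 0 R, ‖u t‖ₑ ≠ ∞) ∧ ∃ s, b + 1 ≤ s ∧
      ∫⁻ t in Ioo 0 R, (lnorm s volume fun x => ‖u t x‖ₑ) ^ (b + 1) ≠ ∞ := by
  have hr0 : 0 < r := by linarith [hadm.one_lt]
  obtain ⟨M, hM, hMu⟩ := hu.exists_enorm_le hR
  have hbd : ∀ {N : ℝ → ℝ≥0∞} {c : ℝ≥0∞}, c ≠ ∞ → (∀ t ∈ Ioo 0 R, N t ≤ c) →
      ∫⁻ t in Ioo 0 R, N t ≠ ∞ := fun hc hN => by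
    refine ne_top_of_le_ne_top ?_ (setLIntegral_mono' measurableSet_Ioo hN)
    rw [lintegral_const]
    exact ENNReal.mul_ne_top hc (by simp)
  refine ⟨hbd hM fun t ht => hMu t ⟨ht.1.le, ht.2.le⟩, ?_⟩
  rcases hadm.le.eq_or_lt with h | h
  · refine ⟨r, by linarith, hbd (c := M ^ (b + 1)) (by finiteness) fun t ht => ?_⟩
    rw [← enorm_LSpace hr0]
    gcongr
    exact hMu t ⟨ht.1.le, ht.2.le⟩
  · obtain ⟨s, he, hsp⟩ := exists_weighted_exponent_lt hα hn hb hadm.one_lt hbr h hp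
    have hn' : (0 : ℝ) < n := by exact_mod_cast hn
    have h1 : 0 < 1 / r - 1 / s := sub_pos.2 (one_div_lt_one_div_of_lt hr0 he.lt)
    set Q : ℝ := 1 / (n / (2 * α) * (1 / r - 1 / s)) with hQ
    have hQ0 : 0 < Q := by positivity
    have hQe : 1 / Q = n / (2 * α) * (1 / r - 1 / s) := by rw [hQ, one_div_one_div]
    have hbQ := he.add_one_lt_time_exponent hQ0 hQe
    have hfin := ENNReal.rpow_ne_top_of_nonneg hQ0.le
      (hu.lnorm_time_ne_top hadm hα hn hR he.lt hsp hQe)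
    rw [lnorm_rpow_self hQ0] at hfin
    have hpt : ∀ x : ℝ≥0∞, x ^ (b + 1) ≤ 1 + x ^ Q := fun x => by
      rcases le_total x 1 with hx | hx
      · exact (ENNReal.rpow_le_one hx (by linarith)).trans le_self_add
      · exact (ENNReal.rpow_le_rpow_of_exponent_le hx hbQ.le).trans le_add_self
    refine ⟨s, he.add_one_le, ne_top_of_le_ne_top ?_ (lintegral_mono fun t => hpt _)⟩
    rw [lintegral_add_left measurable_const]
    exact ENNReal.add_ne_top.2 ⟨by simp, hfin⟩

/-- Continuation of a solution by a solution that starts from its value at a positive time. -/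
theorem IsSolutionX.glue (hα : 0 < α) (hn : 0 < n) (hb : 0 < b)
    (hbr : n / (2 * α) * b ≤ r) (hadm : IsAdmissible n α q p r) (hp : b + 1 < p)
    (hf : IsPowerSource b f) {φ : LSpace 𝕜 n r} {T T' : ℝ≥0∞} {u v : ℝ → LSpace 𝕜 n r} {s R : ℝ}
    (hu : IsSolutionX α q p f φ T u) (hs : s ∈ timeInterval T) (hs0 : 0 < s)
    (hv : IsSolutionX α q p f (u s) T' v) (hR : R ∈ timeInterval T') :
    IsSolutionX α q p f φ (ENNReal.ofReal (s + R)) fun t => if t ≤ s then u t else v (t - s) := by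
  have hr := hadm.one_lt
  have hr0 : 0 < r := by linarith
  have hp0 : 0 < p := by linarith [hadm.le]
  set w : ℝ → LSpace 𝕜 n r := fun t => if t ≤ s then u t else v (t - s) with hw
  have hwu : ∀ t, t ≤ s → w t = u t := fun t ht => if_pos ht
  have hwv : ∀ t, 0 < t → w (s + t) = v t := fun t ht => by
    rw [hw]
    simp only
    rw [if_neg (by linarith), add_sub_cancel_left]
  have hT' : 0 < T' := zero_le.trans_lt hR.2
  have hIu : Icc 0 s ⊆ timeInterval T := fun t ht =>
    ⟨ht.1, (ENNReal.ofReal_le_ofReal ht.2).trans_lt hs.2⟩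
  have hIv : Icc 0 R ⊆ timeInterval T' := fun t ht =>
    ⟨ht.1, (ENNReal.ofReal_le_ofReal ht.2).trans_lt hR.2⟩
  have hwX : MemX q p (ENNReal.ofReal (s + R)) w := by
    refine ⟨?_, ?_⟩
    · rw [timeInterval_ofReal]
      refine ContinuousOn.if (fun t ht => ?_) (hu.1.1.mono fun t ht => ?_)
        ((hv.1.1).comp (by fun_prop) fun t ht => ?_)
      · have : t = s := by simpa [frontier_Iic] using (show t ∈ frontier (Iic s) from ht.2)
        rw [this, sub_self, hv.2.initial hT']
      · have h2 : t ∈ closure (Iic s) := ht.2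
        rw [closure_Iic] at h2
        exact hIu ⟨ht.1.1, h2⟩
      · have h2 : t ∈ closure {a | ¬ a ≤ s} := ht.2
        simp only [not_le] at h2
        have h3 : t ∈ closure (Ioi s) := h2
        rw [closure_Ioi] at h3
        exact hIv ⟨sub_nonneg.2 h3, by linarith [ht.1.2]⟩
    · rcases hadm.exponent hα hn with ⟨hpr, hq⟩ | ⟨hrp, Q, hrQ, hq, -⟩
      · obtain ⟨M₁, hM₁, h1⟩ := hu.1.exists_enorm_le hs
        obtain ⟨M₂, hM₂, h2⟩ := hv.1.exists_enorm_le hR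
        rw [hq, eLpNorm_exponent_top]
        refine lt_of_le_of_lt (essSup_le_of_ae_le (M₁ + M₂) ?_) (ENNReal.add_lt_top.2
          ⟨hM₁.lt_top, hM₂.lt_top⟩)
        filter_upwards [ae_restrict_mem (measurableSet_timeInterval _)] with t ht
        rw [timeInterval_ofReal] at ht
        rw [enorm_eq_self, eLpNorm_eq_lnorm hp0, hpr, ← enorm_LSpace hr0]
        rcases le_or_gt t s with h | h
        · rw [hwu t h]
          exact (h1 t ⟨ht.1, h⟩).trans le_self_add
        · have := hwv (t - s) (sub_pos.2 h)
          rw [add_sub_cancel] at this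
          rw [this]
          exact (h2 _ ⟨(sub_pos.2 h).le, by linarith [ht.2]⟩).trans le_add_self
      · have hQ0 : 0 < Q := by linarith
        have h1 := (hu.1.mono hs.2.le).2
        have h2 := (hv.1.mono hR.2.le).2
        rw [hq, eLpNorm_timeInterval hQ0] at h1 h2 ⊢
        have h1' := ENNReal.rpow_lt_top_of_nonneg hQ0.le h1.ne
        have h2' := ENNReal.rpow_lt_top_of_nonneg hQ0.le h2.ne
        rw [lnorm_rpow_self hQ0] at h1' h2'
        refine ENNReal.rpow_lt_top_of_nonneg (by positivity) (ne_top_of_le_ne_top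
          (ENNReal.add_lt_top.2 ⟨h1', h2'⟩).ne ((lintegral_Ioo_add_le _ s R).trans ?_))
        refine add_le_add (setLIntegral_mono' measurableSet_Ioo fun t ht => ?_)
          (setLIntegral_mono' measurableSet_Ioo fun t ht => ?_)
        · simp only [hwu t ht.2.le, le_refl]
        · simp only [hwv t ht.1, le_refl]
  refine ⟨hwX, fun t ht => ?_⟩
  rcases le_or_gt t s with hts | hts
  · exact MildAt.congr ht.1 (hu.2 t (hIu ⟨ht.1, hts⟩)) fun τ hτ => hwu τ (hτ.2.trans hts)
  obtain ⟨h, rfl⟩ : ∃ h, t = s + h := ⟨t - s, by ring⟩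
  have hh : 0 < h := by linarith
  have hshR : s + h < s + R := (mem_timeInterval_ofReal.1 ht).2
  have hIcc : ∀ τ ∈ Icc 0 (s + h), τ ∈ timeInterval (ENNReal.ofReal (s + R)) := fun τ hτ =>
    mem_timeInterval_ofReal.2 ⟨hτ.1, by linarith [hτ.2]⟩
  obtain ⟨W, hW, hwW⟩ := exists_measurable_representative (measurableSet_timeInterval _) hwX.1
  obtain ⟨h1, σ, hσ, h2⟩ := hwX.exists_lintegral_rpow_ne_top hα hn hb hbr hadm hp ht
  have hmap : Measurable fun z : ℝ × Sp n => (s + z.1, z.2) := by fun_prop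
  have hWs : Measurable fun z : ℝ × Sp n => W (s + z.1, z.2) := hW.comp hmap
  have hnorm : ∀ ρ, ∀ τ ∈ Icc 0 (s + h), (lnorm ρ volume fun x => ‖W (τ, x)‖ₑ) =
      lnorm ρ volume fun x => ‖w τ x‖ₑ := fun ρ τ hτ => lnorm_congr_ae ρ (by
    filter_upwards [hwW τ (hIcc τ hτ)] with x hx
    rw [hx])
  have h1' : ∫⁻ τ in Ioo 0 (s + h), lnorm r volume (fun x => ‖W (τ, x)‖ₑ) ≠ ∞ := by
    refine ne_top_of_le_ne_top h1 (setLIntegral_mono' measurableSet_Ioo fun τ hτ => ?_)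
    rw [hnorm r τ ⟨hτ.1.le, hτ.2.le⟩, enorm_LSpace hr0]
  have h2' : ∫⁻ τ in Ioo 0 (s + h), lnorm σ volume (fun x => ‖W (τ, x)‖ₑ) ^ (b + 1) ≠ ∞ := by
    refine ne_top_of_le_ne_top h2 (setLIntegral_mono' measurableSet_Ioo fun τ hτ => ?_)
    rw [hnorm σ τ ⟨hτ.1.le, hτ.2.le⟩]
  have hleft : ∀ {g : ℝ → ℝ≥0∞}, ∫⁻ τ in Ioo 0 (s + h), g τ ≠ ∞ → ∫⁻ τ in Ioo 0 s, g τ ≠ ∞ :=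
    fun hg => ne_top_of_le_ne_top hg (lintegral_mono_set (Ioo_subset_Ioo_right (by linarith)))
  have hright : ∀ {g : ℝ → ℝ≥0∞}, ∫⁻ τ in Ioo 0 (s + h), g τ ≠ ∞ →
      ∫⁻ τ in Ioo 0 h, g (s + τ) ≠ ∞ := fun hg => by
    rw [← lintegral_Ioo_shift]
    exact ne_top_of_le_ne_top hg (lintegral_mono_set (Ioo_subset_Ioo_left hs0.le))
  have finS := (duhMaj_source_finite hα hn hb hf hr.le hσ hW (hleft h1') (hleft h2')).2 h hh
  have finH := (duhMaj_source_finite hα hn hb hf hr.le hσ hWs (hright h1') (hright h2')).1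
  have hGm : Measurable fun z => f (W z) := hf.measurable.comp hW
  have hwτ : ∀ τ ∈ Ioo 0 (s + h), ∀ᵐ y, w τ y = W (τ, y) := fun τ hτ =>
    hwW τ (hIcc τ ⟨hτ.1.le, hτ.2.le⟩)
  have huτ : ∀ τ ∈ Ioo 0 s, ∀ᵐ y, u τ y = W (τ, y) := fun τ hτ => by
    rw [← hwu τ hτ.2.le]
    exact hwτ τ ⟨hτ.1, by linarith [hτ.2]⟩
  have hvτ : ∀ τ ∈ Ioo 0 h, ∀ᵐ y, v τ y = W (s + τ, y) := fun τ hτ => by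
    rw [← hwv τ hτ.1]
    exact hwτ (s + τ) ⟨by linarith [hτ.1], by linarith [hτ.2]⟩
  have hus : ∀ᵐ y, u s y = semigroup α s φ y + duhamel n α s (fun z => f (W z)) y := by
    filter_upwards [hu.2 s hs] with y hy
    rw [hy.2.2, integral_eq_duhamel huτ]
  have hφm := measurable_LSpace φ
  have hφr := lnorm_LSpace_ne_top hr0 φ
  have hφs : Measurable (heatMaj n α s fun y => ‖φ y‖ₑ) := measurable_heatMaj hφm.enorm
  filter_upwards [finS, finH, hv.2 h (hIv ⟨hh.le, by linarith⟩),
    ae_heatMaj_lt_top hα hn hr.le hh (measurable_LSpace (u s)).enorm (lnorm_LSpace_ne_top hr0 (u s)),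
    ae_heatMaj_lt_top hα hn hr.le hh hφs
      (lnorm_heatMaj_ne_top hα hn hr.le le_rfl hs0 hφm.enorm hφr)] with x a1 a2 a3 a4 a5
  have hfin : duhMaj n α (s + h) (fun z => ‖f (W z)‖ₑ) x < ∞ :=
    (duhMaj_restart_le hα hn hh hGm.enorm x).trans_lt (ENNReal.add_lt_top.2 ⟨a1, a2⟩)
  obtain ⟨c1, c2⟩ := mild_of_representative hf.measurable hW hwτ hfin
  refine ⟨c1, c2, ?_⟩
  rw [integral_eq_duhamel hwτ, duhamel_restart hα hn hs0.le hh hGm a1 a2, hwv h hh, a3.2.2,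
    integral_eq_duhamel (U := fun z => W (s + z.1, z.2)) hvτ, ← add_assoc]
  congr 1
  -- It remains to see that S(h) maps u(s) - S(s)φ, which is the Duhamel integral up to time s, to
  -- the first part of the split integral.
  have e1 : semigroup α (s + h) φ x = semigroup α h (semigroup α s φ) x := by
    rw [semigroup_semigroup hα hn hh hs0 hφm a5, add_comm]
  have a5' : heatMaj n α h (fun y => ‖semigroup α s φ y‖ₑ) x < ∞ :=
    (heatMaj_mono_ae (ae_of_all _ fun y => enorm_semigroup_le hs0 _ y) x).trans_lt a5
  have e2 := semigroup_sub hh (measurable_LSpace (u s)) (measurable_semigroup (α := α) s hφm) a4 a5'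
  rw [e1, ← sub_eq_iff_eq_add', e2]
  refine semigroup_congr_ae hh ?_ x
  filter_upwards [hus] with y hy
  rw [hy, add_sub_cancel_left]

end Gluing

/-! ### Maximal solutions and blow-up. -/

section Maximal

variable {n : ℕ} {α : ℝ} {𝕜 : Type*} [RCLike 𝕜] {b r p : ℝ} {q : ℝ≥0∞} {f : 𝕜 → 𝕜}
  [Fact (1 ≤ ENNReal.ofReal r)]

/-- A maximal solution, from local existence and uniqueness. -/
theorem exists_isMaximalSolution {φ : LSpace 𝕜 n r}
    (hex : ∃ T : ℝ, 0 < T ∧ ∃ u, IsSolutionX α q p f φ (ENNReal.ofReal T) u)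
    (huniq : ∀ (T : ℝ≥0∞) (u v : ℝ → LSpace 𝕜 n r), IsSolutionX α q p f φ T u →
      IsSolutionX α q p f φ T v → EqOn u v (timeInterval T)) :
    ∃ (Tmax : ℝ≥0∞) (u : ℝ → LSpace 𝕜 n r), IsMaximalSolution α q p f φ Tmax u ∧
      ∀ (T : ℝ≥0∞) (v : ℝ → LSpace 𝕜 n r), IsMaximalSolution α q p f φ T v →
        T = Tmax ∧ EqOn v u (timeInterval Tmax) := by
  classical
  set A : Set ℝ≥0∞ := {T | ∃ u, IsSolutionX α q p f φ T u} with hA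
  have hlt : ∀ T < sSup A, ∃ T', T < T' ∧ ∃ u, IsSolutionX α q p f φ T' u := fun T hT => by
    obtain ⟨T', hT', h⟩ := lt_sSup_iff.1 hT
    exact ⟨T', h, hT'⟩
  -- At each t the value of a solution chosen on some interval containing t; uniqueness makes the
  -- choices consistent.
  set u : ℝ → LSpace 𝕜 n r := fun t => if h : ENNReal.ofReal t < sSup A then
    (hlt _ h).choose_spec.2.choose t else φ with hu
  have hueq : ∀ T, (hT : T ≤ sSup A) → ∀ v, IsSolutionX α q p f φ T v → EqOn u v (timeInterval T) := by
    intro T hT v hv t ht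
    have h : ENNReal.ofReal t < sSup A := ht.2.trans_le hT
    have h1 := (hlt _ h).choose_spec.1
    have h2 := (hlt _ h).choose_spec.2.choose_spec
    have e : u t = (hlt _ h).choose_spec.2.choose t := dif_pos h
    rw [e]
    exact huniq _ _ _ (h2.mono (min_le_left _ T)) (hv.mono (min_le_right _ _))
      ⟨ht.1, lt_min h1 ht.2⟩
  have hmax : IsMaximalSolution α q p f φ (sSup A) u := by
    refine ⟨?_, fun T hT => ?_, fun T v hv => le_sSup ⟨v, hv⟩⟩
    · obtain ⟨T, hT, v, hv⟩ := hex
      exact (ENNReal.ofReal_pos.2 hT).trans_le (le_sSup ⟨v, hv⟩)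
    · obtain ⟨T', hT', v, hv⟩ := hlt T hT
      exact (hv.mono hT'.le).congr (hueq T hT.le v (hv.mono hT'.le))
  refine ⟨sSup A, u, hmax, fun T v hv => ?_⟩
  have hT : T = sSup A := le_antisymm (le_of_forall_lt fun T' hT' => ?_)
    (le_of_forall_lt fun T' hT' => ?_)
  · refine ⟨hT, fun t ht => ?_⟩
    obtain ⟨T', h1, h2⟩ := exists_between ht.2
    exact (hueq T' h2.le v (hv.solution T' (hT ▸ h2)) ⟨ht.1, h1⟩).symm
  · obtain ⟨S, h1, h2⟩ := exists_between hT'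
    exact h1.trans_le (hmax.maximal S v (hv.solution S h2))
  · obtain ⟨S, h1, h2⟩ := exists_between hT'
    exact h1.trans_le (hv.maximal S u (hmax.solution S h2))

/-- The lower bound for the norm of a maximal solution. -/
theorem exists_blowup_bound (hα : 0 < α) (hn : 0 < n) (hb : 0 < b) (hbr : n / (2 * α) * b ≤ r)
    (hadm : IsAdmissible n α q p r) (hp : b + 1 < p) (hf : IsPowerSource b f) (T₀ : ℝ) :
    ∃ C : ℝ, 0 < C ∧ ∀ (φ : LSpace 𝕜 n r) (Tmax : ℝ) (u : ℝ → LSpace 𝕜 n r), Tmax ≤ T₀ →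
      IsMaximalSolution α q p f φ (ENNReal.ofReal Tmax) u → ∀ s : ℝ, 0 ≤ s → s < Tmax →
        C / (Tmax - s) ^ (1 / b - n / (2 * r * α)) ≤ ‖u s‖ := by
  have hr0 : 0 < r := by linarith [hadm.one_lt]
  -- The bound T₀ + 1 leaves room for existence times slightly longer than Tmax - s ≤ T₀.
  obtain ⟨c, hc0, hc⟩ := exists_solution_of_norm_le (𝕜 := 𝕜) hα hn hb hbr hadm hf (T₀ + 1)
  -- Failure of the lower bound with this constant is exactly (Tmax-s)^δ ‖u(s)‖^b < c.
  refine ⟨c ^ (1 / b), by positivity, fun φ Tmax u hT₀ hu s hs hsT => ?_⟩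
  by_contra! hlt
  set e : ℝ := 1 / b - n / (2 * r * α) with he
  set δ : ℝ := 1 - n / (2 * α) * b / r with hδ
  have heb : e * b = δ := by
    rw [he, hδ]
    field_simp
  have hx : 0 < Tmax - s := sub_pos.2 hsT
  have h1 : (Tmax - s) ^ δ * ‖u s‖ ^ b < c := by
    rw [lt_div_iff₀ (by positivity)] at hlt
    have h2 := Real.rpow_lt_rpow (by positivity) hlt hb
    rw [Real.mul_rpow (norm_nonneg _) (by positivity), ← Real.rpow_mul hx.le, heb,
      ← Real.rpow_mul hc0.le, one_div_mul_cancel hb.ne', Real.rpow_one] at h2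
    linarith
  -- The strict inequality persists for some T > Tmax - s, so the restarted solution reaches beyond
  -- Tmax.
  have h2 : ∀ᶠ T in 𝓝[>] (Tmax - s), T ^ δ * ‖u s‖ ^ b < c ∧ T ≤ T₀ + 1 := by
    refine Filter.Eventually.and ?_ ?_
    · have h3 : Tendsto (fun T : ℝ => T ^ δ * ‖u s‖ ^ b) (𝓝 (Tmax - s))
          (𝓝 ((Tmax - s) ^ δ * ‖u s‖ ^ b)) :=
        ((Real.continuousAt_rpow_const _ _ (Or.inl hx.ne')).mul continuousAt_const).tendsto
      exact (h3.eventually_lt_const h1).filter_mono nhdsWithin_le_nhds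
    · exact (eventually_le_nhds (by linarith)).filter_mono nhdsWithin_le_nhds
  obtain ⟨T, ⟨hTc, hTT⟩, hT⟩ := (h2.and self_mem_nhdsWithin).exists
  have hTx : Tmax - s < T := hT
  obtain ⟨v, hv⟩ := hc T (by linarith) hTT (u s) hTc.le
  obtain ⟨R, hR1, hR2⟩ := exists_between hTx
  have hmem : ENNReal.ofReal s < ENNReal.ofReal Tmax :=
    (ENNReal.ofReal_lt_ofReal_iff_of_nonneg hs).2 hsT
  have hbeyond : ∀ (S : ℝ) (w : ℝ → LSpace 𝕜 n r), Tmax < S →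
      ¬ IsSolutionX α q p f φ (ENNReal.ofReal S) w := fun S w hS hw => by
    have h4 := hu.maximal _ w hw
    rw [ENNReal.ofReal_le_ofReal_iff (hs.trans hsT.le)] at h4
    linarith
  obtain ⟨T₁, hT₁, hT₁'⟩ := exists_between hmem
  have hsol := hu.solution T₁ hT₁'
  -- Gluing needs a positive restart time; at s = 0 the new solution itself already contradicts
  -- maximality.
  rcases hs.eq_or_lt with h0 | h0
  · rw [← h0, hsol.2.initial (zero_le.trans_lt hT₁)] at hv
    exact hbeyond T v (by linarith) hv
  · exact hbeyond (s + R) _ (by linarith) (hsol.glue hα hn hb hbr hadm hp hf ⟨hs, hT₁⟩ h0 hv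
      (mem_timeInterval_ofReal.2 ⟨by linarith, hR2⟩))

theorem tendsto_norm_atTop_of_bound {E : Type*} [NormedAddCommGroup E] {u : ℝ → E} {C e T : ℝ}
    (hC : 0 < C) (he : 0 < e) (hT : 0 < T)
    (h : ∀ s, 0 ≤ s → s < T → C / (T - s) ^ e ≤ ‖u s‖) :
    Tendsto (fun t => ‖u t‖) (𝓝[<] T) atTop := by
  have h1 : Tendsto (fun t : ℝ => T - t) (𝓝[<] T) (𝓝[>] 0) := by
    refine tendsto_nhdsWithin_iff.2 ⟨?_, ?_⟩
    · have : Tendsto (fun t : ℝ => T - t) (𝓝 T) (𝓝 (T - T)) := tendsto_const_nhds.sub tendsto_id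
      rw [sub_self] at this
      exact this.mono_left nhdsWithin_le_nhds
    · filter_upwards [self_mem_nhdsWithin] with t ht using mem_Ioi.2 (sub_pos.2 (mem_Iio.1 ht))
  have h2 : Tendsto (fun x : ℝ => C * x ^ (-e)) (𝓝[>] 0) atTop :=
    (tendsto_rpow_neg_nhdsGT_zero (by linarith)).const_mul_atTop hC
  refine tendsto_atTop_mono' _ ?_ (h2.comp h1)
  filter_upwards [self_mem_nhdsWithin, mem_nhdsWithin_of_mem_nhds (Ioi_mem_nhds hT)] with t ht ht0
  have := h t (mem_Ioi.1 ht0).le (mem_Iio.1 ht)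
  rwa [Function.comp_apply, Real.rpow_neg (sub_pos.2 (mem_Iio.1 ht)).le, ← div_eq_mul_inv]

end Maximal

end FracHeat

/-! ### Assembly of the theorem. -/

theorem theorem5p1 {𝕜 : Type*} [RCLike 𝕜] (n : ℕ) (α b₁ b₂ ε₁ ε₂ p r : ℝ) (q : ℝ≥0∞)
    (hα : 0 < α) (hb₂ : 0 < b₂) (hb : b₂ < b₁)
    (hε₁ : ε₁ = 1 ∨ ε₁ = -1) (hε₂ : ε₂ = 1 ∨ ε₂ = -1)
    (hr₀ : 1 < n * b₁ / (2 * α)) (hr : n * b₁ / (2 * α) ≤ r)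
    (hadm : FracHeat.IsAdmissible n α q p r) [Fact (1 ≤ ENNReal.ofReal r)] :
    -- local existence and uniqueness, `T` depending on `φ`
    (∀ φ : FracHeat.LSpace 𝕜 n r, ∃ T : ℝ, 0 < T ∧ ∃ u : ℝ → FracHeat.LSpace 𝕜 n r,
      FracHeat.IsSolutionX α q p (FracHeat.source ε₁ ε₂ b₁ b₂) φ (ENNReal.ofReal T) u ∧
      (b₁ + 1 < p → ∀ v : ℝ → FracHeat.LSpace 𝕜 n r,
        FracHeat.IsSolutionX α q p (FracHeat.source ε₁ ε₂ b₁ b₂) φ (ENNReal.ofReal T) v →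
          EqOn v u (FracHeat.timeInterval (ENNReal.ofReal T)))) ∧
    -- for `r > r₀`, `T` depends on `φ` only through (a bound for) its norm
    (n * b₁ / (2 * α) < r → ∀ M : ℝ, ∃ T : ℝ, 0 < T ∧
      ∀ φ : FracHeat.LSpace 𝕜 n r, ‖φ‖ ≤ M → ∃ u : ℝ → FracHeat.LSpace 𝕜 n r,
        FracHeat.IsSolutionX α q p (FracHeat.source ε₁ ε₂ b₁ b₂) φ (ENNReal.ofReal T) u ∧
        (b₁ + 1 < p → ∀ v : ℝ → FracHeat.LSpace 𝕜 n r,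
          FracHeat.IsSolutionX α q p (FracHeat.source ε₁ ε₂ b₁ b₂) φ (ENNReal.ofReal T) v →
            EqOn v u (FracHeat.timeInterval (ENNReal.ofReal T)))) ∧
    -- for `r > r₀`, the maximal solution, and its blow-up
    (n * b₁ / (2 * α) < r → b₁ + 1 < p →
      (∀ φ : FracHeat.LSpace 𝕜 n r, ∃ (Tmax : ℝ≥0∞) (u : ℝ → FracHeat.LSpace 𝕜 n r),
        FracHeat.IsMaximalSolution α q p (FracHeat.source ε₁ ε₂ b₁ b₂) φ Tmax u ∧
        ∀ (T : ℝ≥0∞) (v : ℝ → FracHeat.LSpace 𝕜 n r),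
          FracHeat.IsMaximalSolution α q p (FracHeat.source ε₁ ε₂ b₁ b₂) φ T v →
            T = Tmax ∧ EqOn v u (FracHeat.timeInterval Tmax)) ∧
      (∀ T₀ : ℝ, ∃ C : ℝ, 0 < C ∧
        ∀ (φ : FracHeat.LSpace 𝕜 n r) (Tmax : ℝ) (u : ℝ → FracHeat.LSpace 𝕜 n r), Tmax ≤ T₀ →
          FracHeat.IsMaximalSolution α q p (FracHeat.source ε₁ ε₂ b₁ b₂) φ
            (ENNReal.ofReal Tmax) u →
          ∀ s : ℝ, 0 ≤ s → s < Tmax →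
            C / (Tmax - s) ^ (1 / b₁ - n / (2 * r * α)) ≤ ‖u s‖) ∧
      (∀ (φ : FracHeat.LSpace 𝕜 n r) (Tmax : ℝ) (u : ℝ → FracHeat.LSpace 𝕜 n r),
        FracHeat.IsMaximalSolution α q p (FracHeat.source ε₁ ε₂ b₁ b₂) φ
          (ENNReal.ofReal Tmax) u →
        Tendsto (fun t => ‖u t‖) (𝓝[<] Tmax) atTop)) := by
  have hb₁ : 0 < b₁ := hb₂.trans hb
  have hn : 0 < n := Nat.pos_of_ne_zero fun h => by
    rw [h] at hr₀
    norm_num at hr₀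
  have hn' : (0 : ℝ) < n := Nat.cast_pos.2 hn
  have hr0 : 0 < r := one_pos.trans hadm.one_lt
  have hcomm : (n : ℝ) * b₁ / (2 * α) = n / (2 * α) * b₁ := by ring
  rw [hcomm] at hr ⊢
  have habs : ∀ {ε : ℝ}, ε = 1 ∨ ε = -1 → |ε| = 1 := by
    rintro ε (rfl | rfl) <;> simp
  have hf := FracHeat.isPowerSource_source (𝕜 := 𝕜) hb₂ hb (habs hε₁) (habs hε₂)
  have huniq : b₁ + 1 < p → ∀ (φ : FracHeat.LSpace 𝕜 n r) (T : ℝ≥0∞)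
      (u v : ℝ → FracHeat.LSpace 𝕜 n r),
      FracHeat.IsSolutionX α q p (FracHeat.source ε₁ ε₂ b₁ b₂) φ T u →
      FracHeat.IsSolutionX α q p (FracHeat.source ε₁ ε₂ b₁ b₂) φ T v →
      EqOn u v (FracHeat.timeInterval T) := fun hp φ T u v hu hv =>
    hu.eqOn hα hn hb₂ hb hr hadm hp hf (K := (2 + b₁).toNNReal)
      (FracHeat.enorm_source_sub_le hb₂ hb (habs hε₁) (habs hε₂)) hv
  have hloc := FracHeat.exists_local_solution (𝕜 := 𝕜) hα hn hb₁ hr hadm hf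
  refine ⟨fun φ => ?_, fun hrr M => ?_, fun hrr hp => ?_⟩
  · obtain ⟨T, hT, u, hu⟩ := hloc φ
    exact ⟨T, hT, u, hu, fun hp v hv => huniq hp φ _ v u hv hu⟩
  · obtain ⟨c, hc, h⟩ :=
      FracHeat.exists_solution_of_norm_le (𝕜 := 𝕜) hα hn hb₁ hr hadm hf 1
    have hδ : 0 < 1 - n / (2 * α) * b₁ / r := sub_pos.2 ((div_lt_one hr0).2 hrr)
    -- For r > r₀ the power of T is positive, so one small T serves all data of norm at most M; `max
    -- M 0` keeps the base of the power nonnegative.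
    have hlim : Tendsto (fun T : ℝ => T ^ (1 - n / (2 * α) * b₁ / r) * max M 0 ^ b₁) (𝓝[>] 0)
        (𝓝 0) := by
      have := ((Real.continuousAt_rpow_const 0 _ (Or.inr hδ.le)).tendsto.mono_left
        (nhdsWithin_le_nhds (s := Ioi 0))).mul_const (max M 0 ^ b₁)
      rwa [Real.zero_rpow hδ.ne', zero_mul] at this
    obtain ⟨T, hTc, hT0, hT1⟩ := ((hlim.eventually (ge_mem_nhds hc)).and
      (Ioc_mem_nhdsGT one_pos)).exists
    refine ⟨T, hT0, fun φ hφ => ?_⟩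
    obtain ⟨u, hu⟩ := h T hT0 hT1 φ <| hTc.trans' <| mul_le_mul_of_nonneg_left
      (Real.rpow_le_rpow (norm_nonneg _) (hφ.trans (le_max_left _ _)) hb₁.le)
      (Real.rpow_nonneg hT0.le _)
    exact ⟨u, hu, fun hp v hv => huniq hp φ _ v u hv hu⟩
  · have hbound := FracHeat.exists_blowup_bound (𝕜 := 𝕜) hα hn hb₁ hr hadm hp hf
    refine ⟨fun φ => FracHeat.exists_isMaximalSolution (hloc φ) (huniq hp φ), hbound,
      fun φ Tmax u hu => ?_⟩
    -- For the limit the solution is fixed, so its own finite maximal time can serve as T₀.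
    obtain ⟨C, hC, h⟩ := hbound Tmax
    refine FracHeat.tendsto_norm_atTop_of_bound hC ?_ (ENNReal.ofReal_pos.1 hu.pos)
      (h φ Tmax u le_rfl hu)
    rw [sub_pos, div_lt_div_iff₀ (by positivity) hb₁]
    rw [div_mul_eq_mul_div, div_lt_iff₀ (by positivity)] at hrr
    linarith
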